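/- Let $d\in\{2,3\}$, $k>0$, $0<R_0<R$, and write $x=(\underline{x},x_d)\in\mathbb{R}^{d-1}\times\mathbb{R}$. Put $\Omega^R=\mathbb{R}^{d-1}\times(0,R)$, $\Omega_0^{R_0}=(-\pi,\pi)^{d-1}\times(0,R_0)$, $\Gamma^s=\mathbb{R}^{d-1}\times\{s\}$, $\Gamma_0^R=(-\pi,\pi)^{d-1}\times\{R\}$. Let $n_p^2\in L^\infty(\mathbb{R}^d_+;\mathbb{C})$ be $2\pi$-periodic in each of $x_1,\dots,x_{d-1}$, with $n_p^2=1$ for $x_d>R_0$, $\operatorname{Im} n_p^2\ge 0$, and $\operatorname{Im} n_p^2>0$ on some nonempty open set. Let $\tilde H^1(\Omega^R)$ be the space of $u\in H^1(\Omega^R)$ with vanishing trace on $\Gamma^0$, and let $\gamma_{\Gamma_0^R}:\tilde H^1(\Omega^R)\to L^2(\Gamma_0^R)$ be the trace on $\Gamma^R$ restricted to $\Gamma_0^R$. Let $T$ be the Dirichlet-to-Neumann map on $\Gamma^R$, that is, the Fourier multiplier in $\underline{x}$ with symbol $\mathrm{i}\sqrt{k^2-|\xi|^2}$ (where $\sqrt{t}=\mathrm{i}\sqrt{|t|}$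 for $t<0$). For $q\in L^2(\Omega_0^{R_0};\mathbb{C})$, extended by zero, set $$a_q(u,v)=\int_{\Omega^R}\nabla u\cdot\nabla\overline v-k^2(n_p^2+q)\,u\,\overline v\,dx-\int_{\Gamma^R}T(u|_{\Gamma^R})\,\overline v\,dS,\qquad u,v\in\tilde H^1(\Omega^R).$$ Call a function $\delta$, which assigns a radius $\delta(q_0)>0$ to every $q_0\in L^\infty(\Omega_0^{R_0})$ with $\operatorname{Im}q_0\ge0$, admissible if for every such $q_0$ and every $q\in L^2(\Omega_0^{R_0})$ with $\|q-q_0\|_{L^2}<\delta(q_0)$ the differential operator of $a_q$ is invertible, i.e. for every bounded antilinear functional $F$ on $\tilde H^1(\Omega^R)$ there is exactly one $u$ with $a_q(u,v)=F(v)$ for all $v$. Then an admissible $\delta$ exists. Moreover, let $\delta$ be any admissible function and let $$Q=\bigcup_{q_0\in L^\infty(\Omega_0^{R_0}),\ \operatorname{Im}q_0\ge 0}B_{\delta(q_0)}(q_0)\subseteq L^2(\Omega_0^{R_0}),$$ which is open. For every $q\in Q$ there is a bounded linear solution operator $\tilde\Lambda_q:L^2(\Omega_0^{R_0})\to\tilde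 H^1(\Omega^R)$, $f\mapsto u_f$, where $a_q(u_f,v)=\int_{\Omega_0^{R_0}} f\,\overline v\,dx$ for all $v\in\tilde H^1(\Omega^R)$, and the measurement operator $$\mathcal S:Q\to\mathcal L\big(L^2(\Omega_0^{R_0}),L^2(\Gamma_0^R)\big),\qquad \mathcal S(q)=\gamma_{\Gamma_0^R}\circ\tilde\Lambda_q,$$ is (complex) Fréchet differentiable at every $q\in Q$. Its derivative $\mathcal S'(q)\in\mathcal L\big(L^2(\Omega_0^{R_0}),\mathcal L(L^2(\Omega_0^{R_0}),L^2(\Gamma_0^R))\big)$ is $h\mapsto\gamma_{\Gamma_0^R}\circ\tilde W_h$, where $\tilde W_h f=w_{h,f}\in\tilde H^1(\Omega^R)$ is the solution of $$a_q(w_{h,f},v)=\int_{\Omega_0^{R_0}}k^2\,h\,u_f\,\overline v\,dx\qquad\text{for all }v\in\tilde H^1(\Omega^R),$$ and $h\mapsto\tilde W_h$ is a bounded linear map from $L^2(\Omega_0^{R_0})$ to $\mathcal L(L^2(\Omega_0^{R_0}),\tilde H^1(\Omega^R))$. -/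

import Mathlib

open MeasureTheory Set

open scoped ContDiff FourierTransform ComplexConjugate

noncomputable section

namespace PerturbedLayer

/-! ### Geometry: `ℝ^d = ℝ^m × ℝ` with `m = d - 1`; a point is `x = (x', x_d)` -/

/-- The horizontal space `ℝ^{d-1}` (Euclidean norm). -/
abbrev Hor (m : ℕ) : Type := EuclideanSpace ℝ (Fin m)

/-- The space `ℝ^d = ℝ^{d-1} × ℝ`. -/
abbrev Pt (m : ℕ) : Type := Hor m × ℝ

/-- The upper half space `ℝ^d_+`. -/
def halfSpace (m : ℕ) : Set (Pt m) := {x | 0 < x.2}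

/-- The layer `Ω^R = ℝ^{d-1} × (0, R)`. -/
def slab (m : ℕ) (R : ℝ) : Set (Pt m) := univ ×ˢ Ioo 0 R

/-- The horizontal periodic cell `(-π, π)^{d-1}`; it is identified with `Γ_0^R`. -/
def cube (m : ℕ) : Set (Hor m) := {x | ∀ i, x i ∈ Ioo (-Real.pi) Real.pi}

/-- One periodic cell `Ω_0^R = (-π, π)^{d-1} × (0, R)` of the layer. -/
def cell (m : ℕ) (R : ℝ) : Set (Pt m) := cube m ×ˢ Ioo 0 R

/-- `L²(Ω^R)`. -/
abbrev L2Slab (m : ℕ) (R : ℝ) : Type := Lp ℂ 2 ((volume : Measure (Pt m)).restrict (slab m R))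

/-- `L²(Ω_0^R)`. -/
abbrev L2Cell (m : ℕ) (R : ℝ) : Type := Lp ℂ 2 ((volume : Measure (Pt m)).restrict (cell m R))

/-- `L²(Γ^s)`, where `Γ^s = ℝ^{d-1} × {s}` is identified with `ℝ^{d-1}`. -/
abbrev L2Hor (m : ℕ) : Type := Lp ℂ 2 (volume : Measure (Hor m))

/-- `L²(Γ_0^R)`, where `Γ_0^R = (-π, π)^{d-1} × {R}` is identified with `(-π, π)^{d-1}`. -/
abbrev L2Cube (m : ℕ) : Type := Lp ℂ 2 ((volume : Measure (Hor m)).restrict (cube m))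

/-- The `d = m + 1` coordinate directions of `ℝ^m × ℝ`. -/
abbrev Dir (m : ℕ) : Type := Fin m ⊕ Unit

/-- The standard basis vectors of `ℝ^m × ℝ`. -/
def dirVec (m : ℕ) : Dir m → Pt m
  | Sum.inl i => (EuclideanSpace.single i 1, 0)
  | Sum.inr _ => (0, 1)

/-! ### The Sobolev space `H¹(Ω^R)` -/

/-- Tuples `(u, (g_j)_j)` of `L²(Ω^R)` functions, with the Hilbert norm
`(‖u‖² + ∑_j ‖g_j‖²)^{1/2}`; the entry `none` is `u` and the entry `some j` is `g_j`. -/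
abbrev Jet (m : ℕ) (R : ℝ) : Type := PiLp 2 (fun _ : Option (Dir m) => L2Slab m R)

/-- `g` is the weak partial derivative of `u` in direction `j` in `Ω^R`. -/
def IsWeakDeriv {m : ℕ} {R : ℝ} (j : Dir m) (u g : L2Slab m R) : Prop :=
  ∀ φ : Pt m → ℂ, ContDiff ℝ ∞ φ → HasCompactSupport φ → tsupport φ ⊆ slab m R →
    ∫ x in slab m R, u x * fderiv ℝ φ x (dirVec m j) = - ∫ x in slab m R, g x * φ x

lemma memLp_test {m : ℕ} (R : ℝ) {φ : Pt m → ℂ} (h : Continuous φ) (hc : HasCompactSupport φ) :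
    MemLp φ 2 ((volume : Measure (Pt m)).restrict (slab m R)) :=
  h.memLp_of_hasCompactSupport hc

lemma memLp_test_deriv {m : ℕ} (R : ℝ) {φ : Pt m → ℂ} (h : ContDiff ℝ ∞ φ)
    (hc : HasCompactSupport φ) (v : Pt m) :
    MemLp (fun x => fderiv ℝ φ x v) 2 ((volume : Measure (Pt m)).restrict (slab m R)) :=
  memLp_test R ((h.continuous_fderiv (by simp)).clm_apply continuous_const)
    (hc.fderiv_apply (𝕜 := ℝ) v)

lemma integral_add_mul {m : ℕ} {R : ℝ} (u v : L2Slab m R) {ψ : Pt m → ℂ}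
    (hψ : MemLp ψ 2 ((volume : Measure (Pt m)).restrict (slab m R))) :
    ∫ x in slab m R, (u + v) x * ψ x
      = (∫ x in slab m R, u x * ψ x) + ∫ x in slab m R, v x * ψ x := by
  have hu : Integrable (fun x => u x * ψ x) (volume.restrict (slab m R)) :=
    (Lp.memLp u).integrable_mul hψ
  have hv : Integrable (fun x => v x * ψ x) (volume.restrict (slab m R)) :=
    (Lp.memLp v).integrable_mul hψ
  rw [← integral_add hu hv]
  refine integral_congr_ae ?_
  filter_upwards [Lp.coeFn_add u v] with x hx
  rw [hx, Pi.add_apply, add_mul]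

lemma integral_smul_mul {m : ℕ} {R : ℝ} (c : ℂ) (u : L2Slab m R) (ψ : Pt m → ℂ) :
    ∫ x in slab m R, (c • u) x * ψ x = c * ∫ x in slab m R, u x * ψ x := by
  rw [← integral_const_mul]
  refine integral_congr_ae ?_
  filter_upwards [Lp.coeFn_smul c u] with x hx
  rw [hx, Pi.smul_apply, smul_eq_mul, mul_assoc]

/-- `H¹(Ω^R)`: an element is a function `u ∈ L²(Ω^R)` together with its weak gradient in
`L²(Ω^R)^d`, so that the norm is the usual `H¹` norm. -/
def H1 (m : ℕ) (R : ℝ) : Submodule ℂ (Jet m R) where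
  carrier := {U | ∀ j, IsWeakDeriv j (U none) (U (some j))}
  zero_mem' := by
    intro j φ _ _ _
    have h : ((0 : L2Slab m R) : Pt m → ℂ) =ᵐ[volume.restrict (slab m R)] 0 := Lp.coeFn_zero _ _ _
    have h1 : ∀ ψ : Pt m → ℂ, ∫ x in slab m R, (0 : L2Slab m R) x * ψ x = 0 := by
      intro ψ
      refine integral_eq_zero_of_ae ?_
      filter_upwards [h] with x hx
      rw [hx, Pi.zero_apply, zero_mul]
    simp only [PiLp.zero_apply]
    rw [h1, h1, neg_zero]
  add_mem' := by
    intro U V hU hV j φ h1 h2 h3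
    simp only [PiLp.add_apply]
    rw [integral_add_mul _ _ (memLp_test_deriv R h1 h2 _),
      integral_add_mul _ _ (memLp_test R h1.continuous h2), hU j φ h1 h2 h3, hV j φ h1 h2 h3]
    ring
  smul_mem' := by
    intro c U hU j φ h1 h2 h3
    simp only [PiLp.smul_apply]
    rw [integral_smul_mul, integral_smul_mul, hU j φ h1 h2 h3]
    ring

/-! ### Traces on the two faces of the layer

For `χ(t) = a + b t` the boundary term `χ(R) u(·, R) - χ(0) u(·, 0)` is the function
`γ ∈ L²(ℝ^{d-1})` given by Green's formula
`∫ γ ψ dx' = ∫_{Ω^R} (χ ∂_d u + χ' u) ψ(x') dx` for all `ψ ∈ L²(ℝ^{d-1})`.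
The choices of `χ` with `χ(R) = 1, χ(0) = 0`, and with `χ(R) = 0, χ(0) = -1`, give the traces on
`Γ^R` and on `Γ^0`. These are bounded operators and, as is proved below, they extend the
restriction of smooth functions to the face. -/

lemma restrict_slab (m : ℕ) (R : ℝ) : (volume : Measure (Pt m)).restrict (slab m R)
    = (volume : Measure (Hor m)).prod ((volume : Measure ℝ).restrict (Ioo 0 R)) := by
  rw [slab, Measure.volume_eq_prod, ← Measure.prod_restrict, Measure.restrict_univ]

lemma lift_bound {m : ℕ} (R a b : ℝ) :
    ∀ᵐ x ∂((volume : Measure (Pt m)).restrict (slab m R)),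
      ‖((a + b * x.2 : ℝ) : ℂ)‖ ≤ |a| + |b| * |R| := by
  have hs : MeasurableSet (slab m R) := MeasurableSet.univ.prod measurableSet_Ioo
  filter_upwards [ae_restrict_mem hs] with x hx
  have h := hx.2
  rw [Complex.norm_real, Real.norm_eq_abs]
  refine (abs_add_le _ _).trans ?_
  rw [abs_mul]
  have : |x.2| ≤ |R| := abs_le_abs_of_nonneg h.1.le h.2.le
  gcongr

lemma memLp_comp_fst {m : ℕ} (R : ℝ) (g : L2Hor m) :
    MemLp (fun x : Pt m => g x.1) 2 ((volume : Measure (Pt m)).restrict (slab m R)) := by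
  rw [restrict_slab]
  exact (Lp.memLp g).comp_fst _

lemma memLp_lift {m : ℕ} (R a b : ℝ) (g : L2Hor m) :
    MemLp (fun x : Pt m => ((a + b * x.2 : ℝ) : ℂ) * g x.1) 2
      ((volume : Measure (Pt m)).restrict (slab m R)) :=
  by
  refine (memLp_comp_fst R g).of_le_mul (c := |a| + |b| * |R|)
    ((by fun_prop : Continuous fun x : Pt m => ((a + b * x.2 : ℝ) : ℂ)).aestronglyMeasurable.mul
      (memLp_comp_fst R g).1) ?_
  filter_upwards [lift_bound R a b] with x hx
  rw [norm_mul]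
  gcongr

lemma ae_comp_fst {m : ℕ} (R : ℝ) {p : Hor m → Prop} (h : ∀ᵐ y, p y) :
    ∀ᵐ x ∂((volume : Measure (Pt m)).restrict (slab m R)), p x.1 := by
  rw [restrict_slab]
  exact Measure.quasiMeasurePreserving_fst.ae h

/-- The bounded operator `ψ ↦ (a + b x_d) ψ(x')` from `L²(ℝ^{d-1})` to `L²(Ω^R)`. -/
def lift (m : ℕ) (R a b : ℝ) : L2Hor m →L[ℂ] L2Slab m R :=
  LinearMap.mkContinuousOfExistsBound
    { toFun := fun g => (memLp_lift R a b g).toLp _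
      map_add' := by
        intro g h
        rw [← MemLp.toLp_add]
        refine MemLp.toLp_congr _ _ ?_
        filter_upwards [ae_comp_fst R (Lp.coeFn_add g h)] with x hx
        rw [hx, Pi.add_apply, Pi.add_apply, mul_add]
      map_smul' := by
        intro c g
        rw [RingHom.id_apply, ← MemLp.toLp_const_smul]
        refine MemLp.toLp_congr _ _ ?_
        filter_upwards [ae_comp_fst R (Lp.coeFn_smul c g)] with x hx
        rw [hx, Pi.smul_apply, Pi.smul_apply, smul_eq_mul, smul_eq_mul, mul_left_comm] }
    ⟨(|a| + |b| * |R|) * ((volume.restrict (Ioo 0 R) univ) ^ (1 / 2 : ℝ)).toReal, by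
      intro g
      have h1 : eLpNorm (fun x : Pt m => ((a + b * x.2 : ℝ) : ℂ) * g x.1) 2
          (volume.restrict (slab m R)) ≤ ENNReal.ofReal (|a| + |b| * |R|) *
          eLpNorm (fun x : Pt m => g x.1) 2 (volume.restrict (slab m R)) := by
        refine eLpNorm_le_mul_eLpNorm_of_ae_le_mul ?_ 2
        filter_upwards [lift_bound R a b] with x hx
        rw [norm_mul]
        gcongr
      have h2 : eLpNorm (fun x : Pt m => g x.1) 2 (volume.restrict (slab m R))
          = (volume.restrict (Ioo 0 R) univ) ^ (1 / 2 : ℝ) * eLpNorm g 2 volume := by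
        rw [restrict_slab]
        have h3 := eLpNorm_map_measure (p := 2) (f := (Prod.fst : Hor m × ℝ → Hor m)) (g := g)
          (μ := (volume : Measure (Hor m)).prod ((volume : Measure ℝ).restrict (Ioo 0 R)))
          (by
            rw [Measure.map_fst_prod]
            exact (Lp.aestronglyMeasurable g).smul_measure _) measurable_fst.aemeasurable
        rw [Measure.map_fst_prod, eLpNorm_smul_measure_of_ne_top (by simp)] at h3
        simpa [Function.comp_def, smul_eq_mul] using h3.symm
      rw [h2] at h1
      rw [LinearMap.coe_mk, AddHom.coe_mk, Lp.norm_toLp, Lp.norm_def]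
      refine (ENNReal.toReal_mono ?_ h1).trans ?_
      · refine ENNReal.mul_ne_top (by simp) (ENNReal.mul_ne_top ?_ (Lp.eLpNorm_ne_top g))
        exact ENNReal.rpow_ne_top_of_nonneg (by norm_num) (measure_ne_top _ _)
      · rw [ENNReal.toReal_mul, ENNReal.toReal_mul, ENNReal.toReal_ofReal (by positivity),
          mul_assoc]⟩

lemma lift_coe {m : ℕ} (R a b : ℝ) (g : L2Hor m) :
    (lift m R a b g : Pt m → ℂ) =ᵐ[volume.restrict (slab m R)]
      fun x => ((a + b * x.2 : ℝ) : ℂ) * g x.1 :=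
  MemLp.coeFn_toLp (memLp_lift R a b g)

/-- The boundary term `χ(R) u(·, R) - χ(0) u(·, 0)`, `χ(t) = a + b t`, defined by Green's
formula. -/
def greenTrace (m : ℕ) (R a b : ℝ) : Jet m R →L[ℂ] L2Hor m :=
  (ContinuousLinearMap.adjoint (lift m R a b)).comp
      (PiLp.proj 2 (fun _ : Option (Dir m) => L2Slab m R) (some (Sum.inr ())))
    + (ContinuousLinearMap.adjoint (lift m R b 0)).comp
      (PiLp.proj 2 (fun _ : Option (Dir m) => L2Slab m R) none)

/-- The trace operator `γ_{Γ^R}` on the upper face, `H¹(Ω^R) → L²(Γ^R)`. -/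
def traceTop (m : ℕ) (R : ℝ) : Jet m R →L[ℂ] L2Hor m := greenTrace m R 0 R⁻¹

/-- The trace operator `γ_{Γ^0}` on the lower face, `H¹(Ω^R) → L²(Γ^0)`. -/
def traceBot (m : ℕ) (R : ℝ) : Jet m R →L[ℂ] L2Hor m := greenTrace m R (-1) R⁻¹

/-- On a smooth function the boundary term is the classical one. -/
theorem greenTrace_smooth {m : ℕ} {R : ℝ} (hR : 0 < R) (a b : ℝ) {φ : Pt m → ℂ}
    (hφ : ContDiff ℝ ∞ φ) (hc : HasCompactSupport φ) (U : Jet m R)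
    (h0 : (U none : Pt m → ℂ) =ᵐ[volume.restrict (slab m R)] φ)
    (h1 : (U (some (Sum.inr ())) : Pt m → ℂ) =ᵐ[volume.restrict (slab m R)]
      fun x => fderiv ℝ φ x (0, 1)) :
    (greenTrace m R a b U : Hor m → ℂ) =ᵐ[volume]
      fun y => ((a + b * R : ℝ) : ℂ) * φ (y, R) - (a : ℂ) * φ (y, 0) := by
  have hs : ∀ s : ℝ, MemLp (fun y : Hor m => φ (y, s)) 2 (volume : Measure (Hor m)) := fun s =>
    (hφ.continuous.comp (by fun_prop : Continuous fun y : Hor m => (y, s)))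
      |>.memLp_of_hasCompactSupport
        (hc.comp_isClosedEmbedding ((Isometry.of_dist_eq (f := fun y : Hor m => (y, s)) (by simp [Prod.dist_eq])).isClosedEmbedding))
  have hg : MemLp (fun y : Hor m => ((a + b * R : ℝ) : ℂ) * φ (y, R) - (a : ℂ) * φ (y, 0)) 2
      (volume : Measure (Hor m)) := ((hs R).const_mul _).sub ((hs 0).const_mul _)
  suffices h : greenTrace m R a b U = hg.toLp _ by
    rw [h]
    exact MemLp.coeFn_toLp hg
  refine ext_inner_left ℂ fun g => ?_
  have e1 : inner ℂ g (greenTrace m R a b U)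
      = inner ℂ (lift m R a b g) (U (some (Sum.inr ()))) + inner ℂ (lift m R b 0 g) (U none) := by
    rw [← ContinuousLinearMap.adjoint_inner_right, ← ContinuousLinearMap.adjoint_inner_right,
      ← inner_add_right]
    rfl
  set F : Pt m → ℂ := fun x => conj (g x.1) *
    (((a + b * x.2 : ℝ) : ℂ) * fderiv ℝ φ x (0, 1) + (b : ℂ) * φ x) with hF
  have hae : (fun x => inner ℂ (lift m R a b g x) (U (some (Sum.inr ())) x)
      + inner ℂ (lift m R b 0 g x) (U none x)) =ᵐ[volume.restrict (slab m R)] F := by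
    filter_upwards [h0, h1, lift_coe R a b g, lift_coe R b 0 g] with x p0 p1 p2 p3
    rw [p0, p1, p2, p3, hF]
    simp only [RCLike.inner_apply, map_mul, Complex.conj_ofReal]
    push_cast
    ring
  have hi1 := L2.integrable_inner (𝕜 := ℂ) (lift m R a b g) (U (some (Sum.inr ())))
  have hi2 := L2.integrable_inner (𝕜 := ℂ) (lift m R b 0 g) (U none)
  have hFi : Integrable F (volume.restrict (slab m R)) := (hi1.add hi2).congr hae
  rw [e1, L2.inner_def, L2.inner_def, ← integral_add hi1 hi2, integral_congr_ae hae]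
  rw [restrict_slab] at hFi ⊢
  rw [integral_prod _ hFi, L2.inner_def]
  refine integral_congr_ae ?_
  filter_upwards [MemLp.coeFn_toLp hg] with y hy
  rw [hy, hF]
  simp only [RCLike.inner_apply]
  rw [integral_const_mul, mul_comm]
  congr 1
  rw [← integral_Ioc_eq_integral_Ioo, ← intervalIntegral.integral_of_le hR.le]
  have hd : ∀ t : ℝ, HasDerivAt (fun t : ℝ => ((a + b * t : ℝ) : ℂ) * φ (y, t))
      (((a + b * t : ℝ) : ℂ) * fderiv ℝ φ (y, t) (0, 1) + (b : ℂ) * φ (y, t)) t := by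
    intro t
    have q1 : HasDerivAt (fun t : ℝ => ((a + b * t : ℝ) : ℂ)) (b : ℂ) t := by
      have := ((hasDerivAt_id t).const_mul b).const_add a
      simpa using this.ofReal_comp
    have q2 : HasDerivAt (fun t : ℝ => φ (y, t)) (fderiv ℝ φ (y, t) (0, 1)) t :=
      ((hφ.differentiable (by simp)) (y, t)).hasFDerivAt.comp_hasDerivAt t
        ((hasDerivAt_const t y).prodMk (hasDerivAt_id t))
    have := q1.mul q2
    rwa [add_comm] at this
  have hcd : Continuous fun x : Pt m => fderiv ℝ φ x (0, 1) :=
    (hφ.continuous_fderiv (by simp)).clm_apply continuous_const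
  have hcφ := hφ.continuous
  rw [intervalIntegral.integral_eq_sub_of_hasDerivAt (fun t _ => hd t)
    (Continuous.intervalIntegrable (by fun_prop) _ _)]
  simp

/-- On a smooth function `traceTop` is the restriction to `Γ^R`. -/
theorem traceTop_smooth {m : ℕ} {R : ℝ} (hR : 0 < R) {φ : Pt m → ℂ}
    (hφ : ContDiff ℝ ∞ φ) (hc : HasCompactSupport φ) (U : Jet m R)
    (h0 : (U none : Pt m → ℂ) =ᵐ[volume.restrict (slab m R)] φ)
    (h1 : (U (some (Sum.inr ())) : Pt m → ℂ) =ᵐ[volume.restrict (slab m R)]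
      fun x => fderiv ℝ φ x (0, 1)) :
    (traceTop m R U : Hor m → ℂ) =ᵐ[volume] fun y => φ (y, R) := by
  filter_upwards [greenTrace_smooth hR 0 R⁻¹ hφ hc U h0 h1] with y hy
  rw [traceTop, hy]
  simp [hR.ne']

/-- On a smooth function `traceBot` is the restriction to `Γ^0`. -/
theorem traceBot_smooth {m : ℕ} {R : ℝ} (hR : 0 < R) {φ : Pt m → ℂ}
    (hφ : ContDiff ℝ ∞ φ) (hc : HasCompactSupport φ) (U : Jet m R)
    (h0 : (U none : Pt m → ℂ) =ᵐ[volume.restrict (slab m R)] φ)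
    (h1 : (U (some (Sum.inr ())) : Pt m → ℂ) =ᵐ[volume.restrict (slab m R)]
      fun x => fderiv ℝ φ x (0, 1)) :
    (traceBot m R U : Hor m → ℂ) =ᵐ[volume] fun y => φ (y, 0) := by
  filter_upwards [greenTrace_smooth hR (-1) R⁻¹ hφ hc U h0 h1] with y hy
  rw [traceBot, hy]
  simp [hR.ne']

/-- `H̃¹(Ω^R)`: the functions in `H¹(Ω^R)` with vanishing trace on `Γ^0`. -/
def HTilde (m : ℕ) (R : ℝ) : Submodule ℂ (Jet m R) := H1 m R ⊓ (traceBot m R).ker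

/-- The trace on one periodic cell of the upper face, `γ_{Γ_0^R} : H̃¹(Ω^R) → L²(Γ_0^R)`. -/
def traceCell (m : ℕ) (R : ℝ) : HTilde m R →L[ℂ] L2Cube m :=
  (LpToLpRestrictCLM (Hor m) ℂ ℂ volume 2 (cube m)).comp
    ((traceTop m R).comp (HTilde m R).subtypeL)

/-! ### The variational problem -/

/-- The square root of a real number `t` with branch cut at the negative imaginary axis:
`√t` for `t ≥ 0` and `i √|t|` for `t < 0`. -/
def branchSqrt (t : ℝ) : ℂ :=
  if 0 ≤ t then (Real.sqrt t : ℂ) else Complex.I * (Real.sqrt (-t) : ℂ)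

/-- The pairing `∫_{Γ^R} T(φ) ψ̄ dS` with the Dirichlet-to-Neumann map `T`, the Fourier
multiplier with symbol `i √(k² - |ξ|²)`; by Parseval's identity it is the integral of
`i √(k² - |ξ|²) φ̂(ξ)` times the conjugate of `ψ̂(ξ)`. Here `𝓕` is the unitary Fourier transform
with kernel `exp(-2 π i x' · η)`, so that `ξ = 2 π η`. -/
def dtnPairing {m : ℕ} (k : ℝ) (φ ψ : L2Hor m) : ℂ :=
  ∫ η : Hor m, Complex.I * branchSqrt (k ^ 2 - ‖(2 * Real.pi) • η‖ ^ 2)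
    * (𝓕 φ : L2Hor m) η * conj ((𝓕 ψ : L2Hor m) η)

/-- The assumptions on the unperturbed refractive index `n_p²` (a function on `ℝ^d_+`): it is in
`L^∞`, `2π`-periodic in `x'`, equal to `1` for `x_d > R₀`, its imaginary part is nonnegative, and
positive on some nonempty open set. -/
structure IsLayerIndex {m : ℕ} (R₀ : ℝ) (np2 : Pt m → ℂ) : Prop where
  bounded : MemLp np2 ⊤ (volume.restrict (halfSpace m))
  periodic : ∀ j : Fin m → ℤ, ∀ᵐ x ∂(volume.restrict (halfSpace m)),
    np2 (x.1 + WithLp.toLp 2 (fun i => 2 * Real.pi * (j i : ℝ)), x.2) = np2 x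
  eq_one : ∀ᵐ x ∂(volume.restrict (halfSpace m)), R₀ < x.2 → np2 x = 1
  im_nonneg : ∀ᵐ x ∂(volume.restrict (halfSpace m)), 0 ≤ (np2 x).im
  absorbing : ∃ V : Set (Pt m), IsOpen V ∧ V.Nonempty ∧ V ⊆ halfSpace m ∧
    ∀ᵐ x ∂(volume.restrict V), 0 < (np2 x).im

/-- The perturbed refractive index `n² = n_p² + q`, where `q ∈ L²(Ω_0^{R₀})` is extended by zero. -/
def perturbedIndex {m : ℕ} {R₀ : ℝ} (np2 : Pt m → ℂ) (q : L2Cell m R₀) (x : Pt m) : ℂ :=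
  np2 x + (cell m R₀).indicator q x

/-- The sesquilinear form
`a_q(u, v) = ∫_{Ω^R} ∇u · ∇v̄ - k² n² u v̄ dx - ∫_{Γ^R} T(u|_{Γ^R}) v̄ dS`. -/
def form {m : ℕ} {R₀ R : ℝ} (k : ℝ) (np2 : Pt m → ℂ) (q : L2Cell m R₀) (u v : HTilde m R) : ℂ :=
  (∫ x in slab m R, ((∑ j : Dir m, u.1 (some j) x * conj (v.1 (some j) x))
      - (k : ℂ) ^ 2 * perturbedIndex np2 q x * u.1 none x * conj (v.1 none x)))
    - dtnPairing k (traceTop m R u.1) (traceTop m R v.1)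

/-- The differential operator of the variational problem is invertible: for every bounded
antilinear functional `F` on `H̃¹(Ω^R)` there is exactly one `u` with `a_q(u, v) = F(v)` for all
`v`. -/
def IsUniquelySolvable {m : ℕ} {R₀ : ℝ} (k R : ℝ) (np2 : Pt m → ℂ) (q : L2Cell m R₀) : Prop :=
  ∀ F : HTilde m R →L⋆[ℂ] ℂ, ∃! u : HTilde m R, ∀ v, form k np2 q u v = F v

/-- `Λ` maps every `f ∈ L²(Ω_0^{R₀})` to a solution `u ∈ H̃¹(Ω^R)` of
`a_q(u, v) = ∫ f v̄ dx` for all `v`. -/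
def IsSolutionOperator {m : ℕ} {R₀ R : ℝ} (k : ℝ) (np2 : Pt m → ℂ) (q : L2Cell m R₀)
    (Λ : L2Cell m R₀ →L[ℂ] HTilde m R) : Prop :=
  ∀ (f : L2Cell m R₀) (v : HTilde m R),
    form k np2 q (Λ f) v = ∫ x in cell m R₀, f x * conj (v.1 none x)

open Classical in
/-- The solution operator `Λ̃_q : L²(Ω_0^{R₀}) → H̃¹(Ω^R)`, `f ↦ u_f` (zero if there is none). -/
def solutionOperator {m : ℕ} {R₀ : ℝ} (k R : ℝ) (np2 : Pt m → ℂ) (q : L2Cell m R₀) :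
    L2Cell m R₀ →L[ℂ] HTilde m R :=
  if h : ∃ Λ : L2Cell m R₀ →L[ℂ] HTilde m R, IsSolutionOperator k np2 q Λ then h.choose else 0

/-- The measurement operator `𝒮(q) = γ_{Γ_0^R} ∘ Λ̃_q`. -/
def measurement {m : ℕ} {R₀ : ℝ} (k R : ℝ) (np2 : Pt m → ℂ) (q : L2Cell m R₀) :
    L2Cell m R₀ →L[ℂ] L2Cube m :=
  (traceCell m R).comp (solutionOperator k R np2 q)

/-- `W h f = w_{h,f}` solves the linearized problem
`a_q(w_{h,f}, v) = ∫ k² h u_f v̄ dx` for all `v`, where `u_f = Λ̃_q f`. -/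
def IsLinearizedOperator {m : ℕ} {R₀ R : ℝ} (k : ℝ) (np2 : Pt m → ℂ) (q : L2Cell m R₀)
    (W : L2Cell m R₀ →L[ℂ] L2Cell m R₀ →L[ℂ] HTilde m R) : Prop :=
  ∀ (h f : L2Cell m R₀) (v : HTilde m R), form k np2 q (W h f) v
    = ∫ x in cell m R₀, (k : ℂ) ^ 2 * h x * (solutionOperator k R np2 q f).1 none x
        * conj (v.1 none x)

/-! ### The parameter set -/

/-- The bounded perturbations `q₀ ∈ L^∞(Ω_0^{R₀})` with `Im q₀ ≥ 0`, as elements of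
`L²(Ω_0^{R₀})`. -/
def boundedPerturbations (m : ℕ) (R₀ : ℝ) : Set (L2Cell m R₀) :=
  {q₀ | MemLp q₀ ⊤ (volume.restrict (cell m R₀)) ∧
    ∀ᵐ x ∂(volume.restrict (cell m R₀)), 0 ≤ (q₀ x).im}

/-- The radii `δ(q₀) > 0` are so small that the problem stays uniquely solvable for every
`q ∈ B_{δ(q₀)}(q₀)`. -/
def IsAdmissibleRadius {m : ℕ} {R₀ : ℝ} (k R : ℝ) (np2 : Pt m → ℂ) (δ : L2Cell m R₀ → ℝ) : Prop :=
  ∀ q₀ ∈ boundedPerturbations m R₀, 0 < δ q₀ ∧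
    ∀ q ∈ Metric.ball q₀ (δ q₀), IsUniquelySolvable k R np2 q

/-- `Q = ⋃ B_{δ(q₀)}(q₀)`, the union over all bounded `q₀` with `Im q₀ ≥ 0`. -/
def parameterSet {m : ℕ} {R₀ : ℝ} (δ : L2Cell m R₀ → ℝ) : Set (L2Cell m R₀) :=
  ⋃ q₀ ∈ boundedPerturbations m R₀, Metric.ball q₀ (δ q₀)

end PerturbedLayer

end

/-!
The form `a_q` is represented on the Hilbert space `H̃¹(Ω^R)` by an operator `A₀ - k² B(q)`
(`exists_form_operator`). The map `B` is bounded and linear in `q ∈ L²`, because in dimension two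
and three the Sobolev embedding `H¹ → L⁴` makes `∫ q u v̄` finite. The boundary term is finite
because traces lie in `H^{1/2}` (`integrable_traceTop`). Traces being defined by Green's formula,
this is shown directly: on the frequency band `n ≤ |η| < n + 1` Green's formula is used with the
lifting function `(t / R)^{n + 1}`, and Bessel's inequality adds up the bands.

Once `A₀ - k² B(q₀)` is invertible for bounded `q₀` with `Im q₀ ≥ 0`, the theorem is a statement about
the inversion of operators. Invertible operators form an open set, which gives the radii `δ(q₀)`
(`exists_isAdmissibleRadius`), and `𝒮(q) = γ (A₀ - k² B(q))⁻¹ J`, where `J f` represents the source,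
is differentiated by the rule for the inverse (`hasFDerivAt_measurement`).

Invertibility (`isUniquelySolvable_of_mem_boundedPerturbations`) follows from an a priori bound
`‖u‖ ≤ C ‖F‖` (`exists_norm_le`) together with injectivity of the adjoint problem
(`eq_zero_of_form_eq_zero`). The layer is unbounded in the horizontal directions, so that there is
no Fredholm alternative; absorption and periodicity replace it. The Dirichlet-to-Neumann term has a
sign in both its real and its imaginary part (`dtn_self`). Hence the real part of `a_q(u, u)` reduces
the a priori bound to a bound of `‖u‖_{L²}`, and the imaginary part controls `∫ Im(n²) |u|²`. That
the second quantity controls the first is a local matter: on a single periodic cell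
`∫ |u|² ≤ C (∫ Im(n²) |u|² + source) + ε ‖u‖²_{H¹}`, the last norm being taken in a neighbourhood
of the cell (`exists_cell_bound`). Otherwise a normalized sequence of solutions with sources and
absorption tending to zero would have a nonzero limit by Rellich's theorem
(`tendsto_cell_of_weakly_null`); the limit solves the homogeneous equation and vanishes on the
absorbing set, against unique continuation (`eq_zero_of_eq_zero_on_open`). The translates of the
local estimate by the periods are summed over all cells (`exists_slab_bound`). The constant does not
depend on the cell: only two potentials occur, that of the base cell, which carries `q₀`, and that
of all other cells.

Unique continuation is proved by a Carleman estimate whose weight is the exponential of an indefinite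
quadratic form, for which the conjugated Laplacian can be computed exactly. It gives continuation
across spheres, which suffices on connected open sets. Rellich's theorem and the Sobolev embedding on
a cell are obtained from those on the whole space by even reflection at the two faces.
-/

set_option linter.unusedSectionVars false
set_option linter.style.haveILetI false

noncomputable section

namespace PerturbedLayer

open Filter Topology

/-! ### Mollification -/

section Mollify

variable {E : Type*} [NormedAddCommGroup E] [NormedSpace ℝ E] [FiniteDimensional ℝ E]
  [MeasurableSpace E] [BorelSpace E] (μ : Measure E) [μ.IsAddHaarMeasure]

/-- The convolution of `w` with the kernel `k`. -/
def smear (k w : E → ℂ) (x : E) : ℂ := ∫ y, w y * k (x - y) ∂μ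

/-- The function `g` is the weak derivative of `u` in the direction `v` in the open set `O`. -/
def HasWeakDerivOn (O : Set E) (v : E) (u g : E → ℂ) : Prop :=
  ∀ φ : E → ℂ, ContDiff ℝ ∞ φ → HasCompactSupport φ → tsupport φ ⊆ O →
    ∫ x, u x * fderiv ℝ φ x v ∂μ = - ∫ x, g x * φ x ∂μ

variable {μ}

lemma smear_eq_convolution (k w : E → ℂ) :
    smear μ k w = convolution k w (ContinuousLinearMap.mul ℝ ℂ) μ := by
  ext x
  rw [convolution_eq_swap, smear]
  simp [mul_comm]

lemma contDiff_smear {k w : E → ℂ} (hk : ContDiff ℝ ∞ k) (hc : HasCompactSupport k)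
    (hw : LocallyIntegrable w μ) : ContDiff ℝ ∞ (smear μ k w) := by
  rw [smear_eq_convolution]
  exact hc.contDiff_convolution_left _ hk hw

lemma fderiv_smear {k w : E → ℂ} (hk : ContDiff ℝ ∞ k) (hc : HasCompactSupport k)
    (hw : LocallyIntegrable w μ) (x v : E) :
    fderiv ℝ (smear μ k w) x v = smear μ (fun y => fderiv ℝ k y v) w x := by
  rw [smear_eq_convolution, smear_eq_convolution,
    (hc.hasFDerivAt_convolution_left _ (hk.of_le (by simp)) hw x).fderiv]
  have h2 : ConvolutionExistsAt (fderiv ℝ k) w x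
      ((ContinuousLinearMap.mul ℝ ℂ).precompL E) μ :=
    (hc.fderiv (𝕜 := ℝ)).convolutionExists_left _ (hk.continuous_fderiv (by simp)) hw x
  rw [convolution, ContinuousLinearMap.integral_apply h2, convolution]
  simp [ContinuousLinearMap.precompL_apply]

lemma contDiff_translate_kernel {k : E → ℂ} (hk : ContDiff ℝ ∞ k) (x : E) :
    ContDiff ℝ ∞ fun y => k (x - y) := hk.comp (contDiff_const.sub contDiff_id)

lemma hasCompactSupport_translate_kernel {k : E → ℂ} (hc : HasCompactSupport k) (x : E) :
    HasCompactSupport fun y => k (x - y) :=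
  hc.comp_homeomorph (Homeomorph.subLeft x)

lemma fderiv_translate_kernel {k : E → ℂ} (hk : ContDiff ℝ ∞ k) (x y v : E) :
    fderiv ℝ (fun y => k (x - y)) y v = - fderiv ℝ k (x - y) v := by
  have h := ((hk.differentiable (by simp)) (x - y)).hasFDerivAt.comp y
    ((hasFDerivAt_id y).const_sub x)
  have h2 : fderiv ℝ (fun y => k (x - y)) y = _ := h.fderiv
  rw [h2]
  simp

lemma HasWeakDerivOn.fderiv_smear {k w g : E → ℂ} (hk : ContDiff ℝ ∞ k)
    (hc : HasCompactSupport k) (hw : LocallyIntegrable w μ) {v : E}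
    (h : HasWeakDerivOn μ univ v w g) (x : E) :
    fderiv ℝ (smear μ k w) x v = smear μ k g x := by
  rw [PerturbedLayer.fderiv_smear hk hc hw]
  have h1 := h (fun y => k (x - y)) (contDiff_translate_kernel hk x)
    (hasCompactSupport_translate_kernel hc x) (subset_univ _)
  simp only [fderiv_translate_kernel hk, mul_neg, integral_neg, neg_inj] at h1
  exact h1

lemma support_smear_subset {k w : E → ℂ} {K : Set E} {δ : ℝ} (hK : ∀ x ∉ K, w x = 0)
    (hk : ∀ x, δ ≤ ‖x‖ → k x = 0) {x : E} (hx : ∀ y ∈ K, δ ≤ dist x y) : smear μ k w x = 0 := by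
  refine integral_eq_zero_of_ae (Eventually.of_forall fun y => ?_)
  by_cases hy : y ∈ K
  · simp [hk (x - y) (by simpa [dist_eq_norm] using hx y hy)]
  · simp [hK y hy]

/-- The mollification kernel attached to a smooth bump function. -/
def molKernel (μ : Measure E) (φ : ContDiffBump (0 : E)) : E → ℂ := fun x => (φ.normed μ x : ℂ)

lemma contDiff_molKernel (φ : ContDiffBump (0 : E)) : ContDiff ℝ ∞ (molKernel μ φ) :=
  Complex.ofRealCLM.contDiff.comp φ.contDiff_normed

lemma hasCompactSupport_molKernel (φ : ContDiffBump (0 : E)) :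
    HasCompactSupport (molKernel μ φ) :=
  (φ.hasCompactSupport_normed (μ := μ)).comp_left (g := fun r : ℝ => (r : ℂ)) rfl

lemma molKernel_eq_zero (φ : ContDiffBump (0 : E)) {x : E} (hx : φ.rOut ≤ ‖x‖) :
    molKernel μ φ x = 0 := by
  have : x ∉ Function.support (φ.normed μ) := by
    rw [φ.support_normed_eq]; simpa using hx
  simp [molKernel, Function.notMem_support.1 this]

/-- The probability measure with density the mollification kernel. -/
def molMeasure (μ : Measure E) (φ : ContDiffBump (0 : E)) : Measure E :=
  μ.withDensity fun y => ENNReal.ofReal (φ.normed μ y)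

lemma isProbabilityMeasure_molMeasure (φ : ContDiffBump (0 : E)) :
    IsProbabilityMeasure (molMeasure μ φ) := by
  refine ⟨?_⟩
  rw [molMeasure, withDensity_apply _ MeasurableSet.univ, Measure.restrict_univ,
    ← ofReal_integral_eq_lintegral_ofReal φ.integrable_normed
      (Eventually.of_forall φ.nonneg_normed), φ.integral_normed, ENNReal.ofReal_one]

lemma smear_molKernel_eq (φ : ContDiffBump (0 : E)) (w : E → ℂ) (x : E) :
    smear μ (molKernel μ φ) w x = ∫ y, w (x - y) ∂(molMeasure μ φ) := by
  rw [molMeasure, integral_withDensity_eq_integral_toReal_smul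
    (φ.continuous_normed.measurable.ennreal_ofReal) (by simp), smear_eq_convolution, convolution]
  refine integral_congr_ae (Eventually.of_forall fun y => ?_)
  simp [molKernel, ENNReal.toReal_ofReal (φ.nonneg_normed y)]

/-- Jensen's inequality: a mollification is as close to `w` as the small translates of `w`. -/
lemma eLpNorm_smear_sub_le (φ : ContDiffBump (0 : E)) {w : E → ℂ} (hw : MemLp w 2 μ) {ε : ENNReal}
    (h : ∀ y, ‖y‖ < φ.rOut → eLpNorm (fun x => w (x - y) - w x) 2 μ ≤ ε) :
    eLpNorm (fun x => smear μ (molKernel μ φ) w x - w x) 2 μ ≤ ε := by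
  haveI := isProbabilityMeasure_molMeasure (μ := μ) φ
  have hac : molMeasure μ φ ≪ μ := withDensity_absolutelyContinuous _ _
  have hq : Measure.QuasiMeasurePreserving (fun p : E × E => p.1 - p.2) (μ.prod (molMeasure μ φ)) μ :=
    (quasiMeasurePreserving_sub μ μ).mono_left (Measure.AbsolutelyContinuous.rfl.prod hac)
  have hli : LocallyIntegrable w μ := hw.locallyIntegrable (by norm_num)
  have hm : AEStronglyMeasurable (fun p : E × E => w (p.1 - p.2) - w p.1)
      (μ.prod (molMeasure μ φ)) :=
    (hw.1.comp_quasiMeasurePreserving hq).sub hw.1.comp_fst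
  -- pointwise bound
  have hpt : ∀ x, ‖smear μ (molKernel μ φ) w x - w x‖ₑ ^ (2 : ℝ)
      ≤ ∫⁻ y, ‖w (x - y) - w x‖ₑ ^ (2 : ℝ) ∂(molMeasure μ φ) := by
    intro x
    have hi : Integrable (fun y => w (x - y)) (molMeasure μ φ) := by
      rw [molMeasure, integrable_withDensity_iff_integrable_smul'
        (φ.continuous_normed.measurable.ennreal_ofReal) (by simp)]
      have := (hasCompactSupport_molKernel (μ := μ) φ).convolutionExists_left
        (ContinuousLinearMap.mul ℝ ℂ) (contDiff_molKernel φ).continuous hli x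
      refine this.congr (Eventually.of_forall fun y => ?_)
      simp [molKernel, ENNReal.toReal_ofReal (φ.nonneg_normed y)]
    have h1 : smear μ (molKernel μ φ) w x - w x = ∫ y, (w (x - y) - w x) ∂(molMeasure μ φ) := by
      rw [integral_sub hi (integrable_const _), smear_molKernel_eq]; simp
    rw [h1]
    have h2 := enorm_integral_le_lintegral_enorm (μ := molMeasure μ φ) (fun y => w (x - y) - w x)
    have h3 := eLpNorm_le_eLpNorm_of_exponent_le (μ := molMeasure μ φ) (p := 1) (q := 2)
      (by norm_num) (hi.sub (integrable_const (w x))).1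
    rw [eLpNorm_one_eq_lintegral_enorm,
      eLpNorm_eq_lintegral_rpow_enorm_toReal (by norm_num) (by norm_num)] at h3
    refine (ENNReal.rpow_le_rpow (h2.trans h3) (by norm_num : (0:ℝ) ≤ 2)).trans ?_
    rw [← ENNReal.rpow_mul]
    simp
  rw [eLpNorm_eq_lintegral_rpow_enorm_toReal (by norm_num) (by norm_num)]
  simp only [ENNReal.toReal_ofNat]
  rw [one_div, ENNReal.rpow_inv_le_iff (by norm_num)]
  calc ∫⁻ x, ‖smear μ (molKernel μ φ) w x - w x‖ₑ ^ (2 : ℝ) ∂μ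
      ≤ ∫⁻ x, ∫⁻ y, ‖w (x - y) - w x‖ₑ ^ (2 : ℝ) ∂(molMeasure μ φ) ∂μ := lintegral_mono hpt
    _ = ∫⁻ y, ∫⁻ x, ‖w (x - y) - w x‖ₑ ^ (2 : ℝ) ∂μ ∂(molMeasure μ φ) :=
        lintegral_lintegral_swap (hm.enorm.pow_const _)
    _ ≤ ∫⁻ y, ε ^ (2 : ℝ) ∂(molMeasure μ φ) := by
        refine lintegral_mono_ae ?_
        have hae : ∀ᵐ y ∂(molMeasure μ φ), ‖y‖ < φ.rOut := by
          rw [molMeasure, ae_withDensity_iff (φ.continuous_normed.measurable.ennreal_ofReal)]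
          refine Eventually.of_forall fun y hy => ?_
          by_contra hlt
          have : y ∉ Function.support (φ.normed μ) := by
            rw [φ.support_normed_eq]; simpa using hlt
          exact hy (by simp [Function.notMem_support.1 this])
        filter_upwards [hae] with y hy
        have := h y hy
        rw [eLpNorm_eq_lintegral_rpow_enorm_toReal (by norm_num) (by norm_num)] at this
        simp only [ENNReal.toReal_ofNat] at this
        rwa [one_div, ENNReal.rpow_inv_le_iff (by norm_num)] at this
    _ = ε ^ (2 : ℝ) := by simp

/-- A sequence of bump functions with radii tending to zero. -/
def bumpSeq (n : ℕ) : ContDiffBump (0 : E) where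
  rIn := 1 / (n + 2)
  rOut := 1 / (n + 1)
  rIn_pos := by positivity
  rIn_lt_rOut := by gcongr; norm_num

variable (μ) in
/-- The `n`-th mollification of a function. -/
def mollify (n : ℕ) (w : E → ℂ) : E → ℂ := smear μ (molKernel μ (bumpSeq n)) w

lemma bumpSeq_rOut (n : ℕ) : (bumpSeq (E := E) n).rOut = 1 / ((n : ℝ) + 1) := rfl

/-- Translations are continuous in `L²`. -/
lemma exists_norm_translate_sub_lt {w : E → ℂ} (hw : MemLp w 2 μ) {ε : ENNReal} (hε : 0 < ε) :
    ∃ δ > 0, ∀ y, ‖y‖ < δ → eLpNorm (fun x => w (x - y) - w x) 2 μ ≤ ε := by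
  set f : Lp ℂ 2 μ := hw.toLp w
  let τ : E → C(E, E) := fun y => ⟨fun x => x - y, by fun_prop⟩
  have hτ : Continuous τ := by
    refine ContinuousMap.continuous_of_continuous_uncurry _ ?_
    exact continuous_snd.sub continuous_fst
  have hmp : ∀ y, MeasurePreserving (τ y) μ μ := fun y => measurePreserving_sub_right μ y
  have hc : Continuous fun y => Lp.compMeasurePreserving (τ y) (hmp y) f :=
    continuous_const.compMeasurePreservingLp hτ hmp (by norm_num)
  have h0 : Tendsto (fun y => Lp.compMeasurePreserving (τ y) (hmp y) f) (𝓝 0)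
      (𝓝 (Lp.compMeasurePreserving (τ 0) (hmp 0) f)) := hc.tendsto 0
  have key : ∀ y, eLpNorm (fun x => w (x - y) - w x) 2 μ
      = edist (Lp.compMeasurePreserving (τ y) (hmp y) f)
        (Lp.compMeasurePreserving (τ 0) (hmp 0) f) := by
    intro y
    rw [Lp.edist_def]
    refine eLpNorm_congr_ae ?_
    have hf : f =ᵐ[μ] w := hw.coeFn_toLp
    filter_upwards [Lp.coeFn_compMeasurePreserving f (hmp y),
      Lp.coeFn_compMeasurePreserving f (hmp 0), hf, (hmp y).quasiMeasurePreserving.ae hf]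
      with x h1 h2 h3 h4
    have h5 : τ 0 x = x := by simp [τ]
    simp only [Pi.sub_apply, h1, h2, Function.comp_apply, h4, h5, h3]
    rfl
  have h1 := EMetric.tendsto_nhds.1 h0 ε hε
  obtain ⟨δ, hδ, h2⟩ := Metric.eventually_nhds_iff.1 h1
  refine ⟨δ, hδ, fun y hy => ?_⟩
  rw [key]
  exact (h2 (by simpa using hy)).le

lemma tendsto_eLpNorm_mollify_sub {w : E → ℂ} (hw : MemLp w 2 μ) :
    Tendsto (fun n => eLpNorm (fun x => mollify μ n w x - w x) 2 μ) atTop (𝓝 0) := by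
  rw [ENNReal.tendsto_nhds_zero]
  intro ε hε
  obtain ⟨δ, hδ, h⟩ := exists_norm_translate_sub_lt hw hε
  obtain ⟨N, hN⟩ := exists_nat_one_div_lt hδ
  filter_upwards [eventually_ge_atTop N] with n hn
  refine eLpNorm_smear_sub_le _ hw fun y hy => h y (hy.trans_le ?_)
  rw [bumpSeq_rOut]
  refine le_trans ?_ hN.le
  gcongr

lemma contDiff_mollify (n : ℕ) {w : E → ℂ} (hw : LocallyIntegrable w μ) :
    ContDiff ℝ ∞ (mollify μ n w) :=
  contDiff_smear (contDiff_molKernel _) (hasCompactSupport_molKernel _) hw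

lemma mollify_eq_zero {n : ℕ} {w : E → ℂ} {K : Set E} (hK : ∀ x ∉ K, w x = 0) {x : E}
    (hx : x ∉ Metric.cthickening 1 K) : mollify μ n w x = 0 := by
  refine support_smear_subset hK (fun x h => molKernel_eq_zero _ h) fun y hy => ?_
  by_contra hlt
  rw [not_le, bumpSeq_rOut] at hlt
  refine hx (Metric.mem_cthickening_of_dist_le x y 1 K hy (hlt.le.trans ?_))
  rw [div_le_one (by positivity)]
  linarith [(Nat.cast_nonneg n : (0:ℝ) ≤ n)]

lemma hasCompactSupport_mollify {n : ℕ} {w : E → ℂ} {K : Set E} (hKc : IsCompact K)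
    (hK : ∀ x ∉ K, w x = 0) : HasCompactSupport (mollify μ n w) :=
  HasCompactSupport.intro hKc.cthickening fun _ hx => mollify_eq_zero hK hx

end Mollify

/-! ### Difference quotients and Rellich's theorem -/

section Rellich

variable {E : Type*} [NormedAddCommGroup E] [NormedSpace ℝ E] [FiniteDimensional ℝ E]
  [MeasurableSpace E] [BorelSpace E] {μ : Measure E} [μ.IsAddHaarMeasure]

lemma eLpNorm_two_le_iff {α : Type*} {m : MeasurableSpace α} {ν : Measure α} {f : α → ℂ}
    {ε : ENNReal} : eLpNorm f 2 ν ≤ ε ↔ ∫⁻ x, ‖f x‖ₑ ^ (2 : ℝ) ∂ν ≤ ε ^ (2 : ℝ) := by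
  rw [eLpNorm_eq_lintegral_rpow_enorm_toReal (by norm_num) (by norm_num)]
  simp only [ENNReal.toReal_ofNat]
  rw [one_div, ENNReal.rpow_inv_le_iff (by norm_num)]

lemma eLpNorm_translate {w : E → ℂ} (hw : AEStronglyMeasurable w μ) (y : E) :
    eLpNorm (fun x => w (x - y)) 2 μ = eLpNorm w 2 μ :=
  eLpNorm_comp_measurePreserving hw (measurePreserving_sub_right μ y)

/-- By the mean value formula and Jensen's inequality. -/
lemma eLpNorm_translate_sub_le_of_contDiff {w : E → ℂ} (hw : ContDiff ℝ ∞ w) (y : E) :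
    eLpNorm (fun x => w (x - y) - w x) 2 μ ≤ eLpNorm (fun x => fderiv ℝ w x y) 2 μ := by
  set ν : Measure ℝ := volume.restrict (Ioc 0 1)
  haveI : IsProbabilityMeasure ν := ⟨by simp [ν]⟩
  have hcont : Continuous fun x => fderiv ℝ w x y :=
    (hw.continuous_fderiv (by simp)).clm_apply continuous_const
  have hc2 : Continuous fun p : E × ℝ => fderiv ℝ w (p.1 - p.2 • y) y :=
    hcont.comp (by fun_prop)
  rw [eLpNorm_two_le_iff]
  have hpt : ∀ x, ‖w (x - y) - w x‖ₑ ^ (2 : ℝ)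
      ≤ ∫⁻ s, ‖fderiv ℝ w (x - s • y) y‖ₑ ^ (2 : ℝ) ∂ν := by
    intro x
    have hci : Continuous fun s : ℝ => fderiv ℝ w (x - s • y) y := hcont.comp (by fun_prop)
    have hd : ∀ s ∈ uIcc (0 : ℝ) 1, HasDerivAt (fun s : ℝ => w (x - s • y))
        (-fderiv ℝ w (x - s • y) y) s := by
      intro s _
      have h1 : HasDerivAt (fun s : ℝ => x - s • y) (-((1 : ℝ) • y)) s :=
        ((hasDerivAt_id s).smul_const y).const_sub x
      have h2 := ((hw.differentiable (by simp)) (x - s • y)).hasFDerivAt.comp_hasDerivAt s h1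
      simpa [Function.comp_def] using h2
    have h1 := intervalIntegral.integral_eq_sub_of_hasDerivAt hd
      (hci.neg.intervalIntegrable 0 1)
    rw [intervalIntegral.integral_of_le zero_le_one] at h1
    simp only [one_smul, zero_smul, sub_zero] at h1
    rw [← h1]
    have hi : Integrable (fun s => -fderiv ℝ w (x - s • y) y) ν :=
      (hci.neg.intervalIntegrable 0 1).1
    have h2 := enorm_integral_le_lintegral_enorm (μ := ν) (fun s => -fderiv ℝ w (x - s • y) y)
    have h3 := eLpNorm_le_eLpNorm_of_exponent_le (μ := ν) (p := 1) (q := 2) (by norm_num) hi.1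
    rw [eLpNorm_one_eq_lintegral_enorm,
      eLpNorm_eq_lintegral_rpow_enorm_toReal (by norm_num) (by norm_num)] at h3
    refine (ENNReal.rpow_le_rpow (h2.trans h3) (by norm_num : (0:ℝ) ≤ 2)).trans ?_
    rw [← ENNReal.rpow_mul]
    simp
  calc ∫⁻ x, ‖w (x - y) - w x‖ₑ ^ (2 : ℝ) ∂μ
      ≤ ∫⁻ x, ∫⁻ s, ‖fderiv ℝ w (x - s • y) y‖ₑ ^ (2 : ℝ) ∂ν ∂μ := lintegral_mono hpt
    _ = ∫⁻ s, ∫⁻ x, ‖fderiv ℝ w (x - s • y) y‖ₑ ^ (2 : ℝ) ∂μ ∂ν :=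
        lintegral_lintegral_swap (hc2.aestronglyMeasurable.enorm.pow_const _)
    _ = ∫⁻ s, (eLpNorm (fun x => fderiv ℝ w x y) 2 μ) ^ (2 : ℝ) ∂ν := by
        refine lintegral_congr fun s => ?_
        rw [lintegral_sub_right_eq_self (fun x => ‖fderiv ℝ w x y‖ₑ ^ (2 : ℝ)) (s • y),
          eLpNorm_eq_lintegral_rpow_enorm_toReal (by norm_num) (by norm_num), ← ENNReal.rpow_mul]
        simp
    _ = _ := by simp

/-- The difference quotients of a function in `L²` are bounded by its weak derivative. -/
lemma HasWeakDerivOn.eLpNorm_translate_sub_le {w g : E → ℂ} {y : E} (hw : MemLp w 2 μ)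
    (hg : MemLp g 2 μ) (h : HasWeakDerivOn μ univ y w g) :
    eLpNorm (fun x => w (x - y) - w x) 2 μ ≤ eLpNorm g 2 μ := by
  have hli : LocallyIntegrable w μ := hw.locallyIntegrable (by norm_num)
  have hms : ∀ n, AEStronglyMeasurable (mollify μ n w) μ := fun n =>
    (contDiff_mollify n hli).continuous.aestronglyMeasurable
  have hgs : ∀ n, AEStronglyMeasurable (mollify μ n g) μ := fun n =>
    (contDiff_mollify n (hg.locallyIntegrable (by norm_num))).continuous.aestronglyMeasurable
  have hbd : ∀ n, eLpNorm (fun x => w (x - y) - w x) 2 μ ≤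
      (eLpNorm (fun x => mollify μ n w x - w x) 2 μ + (eLpNorm g 2 μ
        + eLpNorm (fun x => mollify μ n g x - g x) 2 μ))
        + eLpNorm (fun x => mollify μ n w x - w x) 2 μ := by
    intro n
    have hsub : AEStronglyMeasurable (fun x => mollify μ n w x - w x) μ := (hms n).sub hw.1
    have hmp := (measurePreserving_sub_right μ y)
    have e : (fun x => w (x - y) - w x) = ((fun x => -(mollify μ n w (x - y) - w (x - y)))
        + (fun x => mollify μ n w (x - y) - mollify μ n w x))
        + fun x => mollify μ n w x - w x := by
      ext x; simp only [Pi.add_apply]; ring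
    have hm1 : AEStronglyMeasurable (fun x => -(mollify μ n w (x - y) - w (x - y))) μ :=
      (hsub.comp_measurePreserving hmp).neg
    have hm2 : AEStronglyMeasurable (fun x => mollify μ n w (x - y) - mollify μ n w x) μ :=
      ((hms n).comp_measurePreserving hmp).sub (hms n)
    have t1 : eLpNorm (fun x => -(mollify μ n w (x - y) - w (x - y))) 2 μ
        = eLpNorm (fun x => mollify μ n w x - w x) 2 μ := by
      rw [← eLpNorm_translate hsub y]
      exact eLpNorm_neg _ _ _
    have t2 : eLpNorm (fun x => mollify μ n w (x - y) - mollify μ n w x) 2 μ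
        ≤ eLpNorm g 2 μ + eLpNorm (fun x => mollify μ n g x - g x) 2 μ := by
      refine (eLpNorm_translate_sub_le_of_contDiff (contDiff_mollify n hli) y).trans ?_
      have e2 : (fun x => fderiv ℝ (mollify μ n w) x y)
          = g + fun x => mollify μ n g x - g x := by
        ext x
        rw [mollify, h.fderiv_smear (contDiff_molKernel _) (hasCompactSupport_molKernel _) hli]
        simp [mollify]
      rw [e2]
      exact eLpNorm_add_le hg.1 ((hgs n).sub hg.1) (by norm_num)
    rw [e]
    refine (eLpNorm_add_le (hm1.add hm2) hsub (by norm_num)).trans ?_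
    gcongr
    refine (eLpNorm_add_le hm1 hm2 (by norm_num)).trans ?_
    rw [t1]
    gcongr
  have hlim := ((tendsto_eLpNorm_mollify_sub hw).add
    ((tendsto_const_nhds (x := eLpNorm g 2 μ)).add (tendsto_eLpNorm_mollify_sub hg))).add
    (tendsto_eLpNorm_mollify_sub hw)
  simp only [zero_add, add_zero] at hlim
  exact ge_of_tendsto' hlim hbd

lemma enorm_smear_le {k w : E → ℂ} (hk : Continuous k) (hw : AEStronglyMeasurable w μ) (x : E) :
    ‖smear μ k w x‖ₑ ≤ eLpNorm w 2 μ * eLpNorm k 2 μ := by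
  have hkx : eLpNorm (fun y => k (x - y)) 2 μ = eLpNorm k 2 μ :=
    eLpNorm_comp_measurePreserving hk.aestronglyMeasurable (Measure.measurePreserving_sub_left μ x)
  rw [← hkx]
  refine (enorm_integral_le_lintegral_enorm _).trans ?_
  have := eLpNorm_smul_le_mul_eLpNorm (μ := μ) (p := 2) (q := 2) (r := 1)
    (hf := (hk.comp (by fun_prop : Continuous fun y => x - y)).aestronglyMeasurable) (hφ := hw)
  rw [eLpNorm_one_eq_lintegral_enorm] at this
  simpa [Function.comp_def] using this

/-- Rellich's theorem: a weakly null sequence of functions supported in a fixed compact set, with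
uniformly bounded difference quotients, tends to zero in `L²`. -/
theorem tendsto_eLpNorm_of_weakly_null {z : ℕ → E → ℂ} (hz : ∀ n, MemLp (z n) 2 μ) {K : Set E}
    (hKc : IsCompact K) (hK : ∀ n, ∀ x ∉ K, z n x = 0) {B M : ℝ}
    (hB : ∀ n y, eLpNorm (fun x => z n (x - y) - z n x) 2 μ ≤ ENNReal.ofReal (B * ‖y‖))
    (hM : ∀ n, eLpNorm (z n) 2 μ ≤ ENNReal.ofReal M)
    (h0 : ∀ ψ : E → ℂ, ContDiff ℝ ∞ ψ → HasCompactSupport ψ →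
      Tendsto (fun n => ∫ x, z n x * ψ x ∂μ) atTop (𝓝 0)) :
    Tendsto (fun n => eLpNorm (z n) 2 μ) atTop (𝓝 0) := by
  have hli : ∀ n, LocallyIntegrable (z n) μ := fun n => (hz n).locallyIntegrable (by norm_num)
  have hmol : ∀ k, Tendsto (fun n => eLpNorm (mollify μ k (z n)) 2 μ) atTop (𝓝 0) := by
    intro k
    have hkm : MemLp (molKernel μ (bumpSeq (E := E) k)) 2 μ :=
      (contDiff_molKernel _).continuous.memLp_of_hasCompactSupport (hasCompactSupport_molKernel _)
    set C := ENNReal.ofReal M * eLpNorm (molKernel μ (bumpSeq (E := E) k)) 2 μ with hC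
    have hCt : C ≠ ⊤ := ENNReal.mul_ne_top (by simp) hkm.2.ne
    have hb : ∀ n, ∀ᵐ x ∂μ, ‖mollify μ k (z n) x‖ₑ ^ (2 : ℝ)
        ≤ (Metric.cthickening 1 K).indicator (fun _ => C ^ (2 : ℝ)) x := by
      intro n
      refine Eventually.of_forall fun x => ?_
      by_cases hx : x ∈ Metric.cthickening 1 K
      · rw [indicator_of_mem hx]
        refine ENNReal.rpow_le_rpow ?_ (by norm_num)
        refine (enorm_smear_le (contDiff_molKernel _).continuous (hz n).1 x).trans ?_
        exact mul_le_mul_left (hM n) _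
      · rw [indicator_of_notMem hx, mollify_eq_zero (hK n) hx]; simp
    have hfin : ∫⁻ x, (Metric.cthickening 1 K).indicator (fun _ => C ^ (2 : ℝ)) x ∂μ ≠ ⊤ := by
      rw [lintegral_indicator (Metric.isClosed_cthickening.measurableSet), setLIntegral_const]
      exact ENNReal.mul_ne_top (by simp [hCt]) hKc.cthickening.measure_lt_top.ne
    have hpt : ∀ᵐ x ∂μ, Tendsto (fun n => ‖mollify μ k (z n) x‖ₑ ^ (2 : ℝ)) atTop (𝓝 0) := by
      refine Eventually.of_forall fun x => ?_
      have h1 : Tendsto (fun n => mollify μ k (z n) x) atTop (𝓝 0) :=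
        h0 _ (contDiff_translate_kernel (contDiff_molKernel _) x)
          (hasCompactSupport_translate_kernel (hasCompactSupport_molKernel _) x)
      have h2 := (ENNReal.continuous_rpow_const (y := (2:ℝ))).tendsto 0 |>.comp
        ((continuous_enorm.tendsto (0 : ℂ)).comp h1 |>.trans_eq (by simp))
      simpa [Function.comp_def] using h2
    have hl := tendsto_lintegral_of_dominated_convergence' _
      (fun n => ((contDiff_mollify k (hli n)).continuous.aestronglyMeasurable (μ := μ)).enorm.pow_const
        (2 : ℝ)) hb hfin hpt
    simp only [lintegral_zero] at hl
    have h3 := (ENNReal.continuous_rpow_const (y := (1 / 2:ℝ))).tendsto 0 |>.comp hl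
    simp only [Function.comp_def] at h3
    rw [ENNReal.zero_rpow_of_pos (by norm_num)] at h3
    refine h3.congr fun n => ?_
    rw [eLpNorm_eq_lintegral_rpow_enorm_toReal (by norm_num) (by norm_num)]
    simp
  rw [ENNReal.tendsto_nhds_zero]
  intro ε hε
  have hε2 : 0 < ε / 2 := ENNReal.half_pos hε.ne'
  have hlim : Tendsto (fun k : ℕ => ENNReal.ofReal (|B| * (1 / ((k : ℝ) + 1)))) atTop (𝓝 0) := by
    have := (tendsto_one_div_add_atTop_nhds_zero_nat (𝕜 := ℝ)).const_mul |B|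
    rw [mul_zero] at this
    simpa using ENNReal.tendsto_ofReal this
  obtain ⟨k, hk⟩ := ((ENNReal.tendsto_nhds_zero.1 hlim) (ε / 2) hε2).exists
  filter_upwards [(ENNReal.tendsto_nhds_zero.1 (hmol k)) (ε / 2) hε2] with n hn
  have hs : AEStronglyMeasurable (mollify μ k (z n)) μ :=
    (contDiff_mollify k (hli n)).continuous.aestronglyMeasurable
  have hj : eLpNorm (fun x => mollify μ k (z n) x - z n x) 2 μ ≤ ε / 2 := by
    refine eLpNorm_smear_sub_le _ (hz n) fun y hy => (hB n y).trans (le_trans ?_ hk)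
    rw [bumpSeq_rOut] at hy
    refine ENNReal.ofReal_le_ofReal ?_
    refine (mul_le_mul_of_nonneg_right (le_abs_self B) (norm_nonneg y)).trans ?_
    gcongr
  have e : z n = mollify μ k (z n) - fun x => mollify μ k (z n) x - z n x := by
    ext x; simp
  rw [e]
  refine (eLpNorm_sub_le hs (hs.sub (hz n).1) (by norm_num)).trans ?_
  exact (add_le_add hn hj).trans_eq (ENNReal.add_halves ε)

end Rellich

/-! ### A Carleman estimate -/

section Carleman

variable {m : ℕ}

/-- The partial derivative in the coordinate direction `j`. -/
def pd {F : Type*} [NormedAddCommGroup F] [NormedSpace ℝ F] (j : Dir m) (f : Pt m → F) (x : Pt m) :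
    F := fderiv ℝ f x (dirVec m j)

/-- The Laplacian. -/
def lapl {F : Type*} [NormedAddCommGroup F] [NormedSpace ℝ F] (f : Pt m → F) (x : Pt m) : F :=
  ∑ j, pd j (pd j f) x

/-- The coordinate functions. -/
def coord (m : ℕ) : Dir m → (Pt m →L[ℝ] ℝ)
  | Sum.inl i => (EuclideanSpace.proj i).comp (ContinuousLinearMap.fst ℝ (Hor m) ℝ)
  | Sum.inr _ => ContinuousLinearMap.snd ℝ (Hor m) ℝ

lemma coord_dirVec (j k : Dir m) : coord m j (dirVec m k) = if j = k then 1 else 0 := by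
  rcases j with i | _ <;> rcases k with l | _ <;> simp [coord, dirVec]

lemma sum_coord_smul_dirVec (x : Pt m) : ∑ j, coord m j x • dirVec m j = x := by
  ext1
  · ext i
    simp [coord, dirVec, Prod.fst_sum, Pi.single_apply]
  · simp [coord, dirVec, Prod.snd_sum]

instance : (volume : Measure (Pt m)).IsAddHaarMeasure :=
  inferInstanceAs ((volume : Measure (Hor m)).prod (volume : Measure ℝ)).IsAddHaarMeasure

section smooth

variable {F : Type*} [NormedAddCommGroup F] [NormedSpace ℝ F]

lemma contDiff_pd {f : Pt m → F} (hf : ContDiff ℝ ∞ f) (j : Dir m) : ContDiff ℝ ∞ (pd j f) :=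
  (hf.fderiv_right (m := ∞) (by simp)).clm_apply contDiff_const

lemma hasCompactSupport_pd {f : Pt m → F} (hf : HasCompactSupport f) (j : Dir m) :
    HasCompactSupport (pd j f) := hf.fderiv_apply (𝕜 := ℝ) _

lemma contDiff_lapl {f : Pt m → F} (hf : ContDiff ℝ ∞ f) : ContDiff ℝ ∞ (lapl f) :=
  ContDiff.sum fun j _ => contDiff_pd (contDiff_pd hf j) j

lemma pd_comm {f : Pt m → F} (hf : ContDiff ℝ ∞ f) (j k : Dir m) (x : Pt m) :
    pd j (pd k f) x = pd k (pd j f) x := by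
  have hd : DifferentiableAt ℝ (fderiv ℝ f) x :=
    (hf.fderiv_right (m := ∞) (by simp)).differentiable (by simp) x
  have h : ∀ a b : Dir m, pd a (pd b f) x = fderiv ℝ (fderiv ℝ f) x (dirVec m a) (dirVec m b) := by
    intro a b
    change fderiv ℝ (fun y => fderiv ℝ f y (dirVec m b)) x (dirVec m a) = _
    rw [fderiv_clm_apply hd (by fun_prop)]
    simp
  rw [h, h]
  exact (hf.contDiffAt.isSymmSndFDerivAt (by
    simpa using (show ((2 : ℕ∞) : WithTop ℕ∞) ≤ ((⊤ : ℕ∞) : WithTop ℕ∞) from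
      WithTop.coe_le_coe.2 le_top))).eq _ _

end smooth

lemma pd_add {F : Type*} [NormedAddCommGroup F] [NormedSpace ℝ F] {f g : Pt m → F}
    (hf : ContDiff ℝ ∞ f) (hg : ContDiff ℝ ∞ g) (j : Dir m) (x : Pt m) :
    pd j (fun y => f y + g y) x = pd j f x + pd j g x := by
  have := fderiv_fun_add ((hf.differentiable (by simp)) x) ((hg.differentiable (by simp)) x)
  simp [pd, this]

lemma pd_mul {𝕜 : Type*} [NormedRing 𝕜] [NormedAlgebra ℝ 𝕜] {f g : Pt m → 𝕜}
    (hf : ContDiff ℝ ∞ f) (hg : ContDiff ℝ ∞ g) (j : Dir m) (x : Pt m) :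
    pd j (fun y => f y * g y) x = pd j f x * g x + f x * pd j g x := by
  have := fderiv_mul' ((hf.differentiable (by simp)) x) ((hg.differentiable (by simp)) x)
  have h2 : fderiv ℝ (fun y => f y * g y) x = _ := this
  rw [pd, h2]
  simp [pd, add_comm]

lemma integral_mul_pd {𝕜 : Type*} [NormedField 𝕜] [NormedAlgebra ℝ 𝕜]
    {f g : Pt m → 𝕜} (hf : ContDiff ℝ ∞ f) (hg : ContDiff ℝ ∞ g) (hc : HasCompactSupport g)
    (j : Dir m) : ∫ x, f x * pd j g x = - ∫ x, pd j f x * g x := by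
  refine integral_mul_fderiv_eq_neg_fderiv_mul_of_integrable ?_ ?_ ?_ ?_ ?_
  · exact ((contDiff_pd hf j).continuous.mul hg.continuous).integrable_of_hasCompactSupport hc.mul_left
  · exact (hf.continuous.mul (contDiff_pd hg j).continuous).integrable_of_hasCompactSupport
      (hasCompactSupport_pd hc j).mul_left
  · exact (hf.continuous.mul hg.continuous).integrable_of_hasCompactSupport hc.mul_left
  · exact fun x _ => hf.differentiable (by simp) x
  · exact fun x _ => hg.differentiable (by simp) x

/-- Smooth compactly supported real functions. -/
def IsTest (f : Pt m → ℝ) : Prop := ContDiff ℝ ∞ f ∧ HasCompactSupport f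

lemma IsTest.integrable {f : Pt m → ℝ} (h : IsTest f) : Integrable f :=
  h.1.continuous.integrable_of_hasCompactSupport h.2

lemma IsTest.mul_left {f g : Pt m → ℝ} (h : IsTest f) (hg : ContDiff ℝ ∞ g) :
    IsTest (fun x => g x * f x) := ⟨hg.mul h.1, h.2.mul_left⟩

lemma IsTest.pd {f : Pt m → ℝ} (h : IsTest f) (j : Dir m) : IsTest (pd j f) :=
  ⟨contDiff_pd h.1 j, hasCompactSupport_pd h.2 j⟩

variable {b : Dir m → Pt m → ℝ} {H : Dir m → Dir m → ℝ}

lemma integral_pd_pd_mul_self {v : Pt m → ℝ} (hv : IsTest v) (j : Dir m) :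
    ∫ x, pd j (pd j v) x * v x = - ∫ x, pd j v x ^ 2 := by
  simp_rw [mul_comm _ (v _), pow_two]
  exact integral_mul_pd hv.1 (hv.pd j).1 (hv.pd j).2 j

lemma integral_mul_mul_pd {v p : Pt m → ℝ} (hv : IsTest v) (hp : ContDiff ℝ ∞ p) (k : Dir m) :
    ∫ x, p x * (v x * pd k v x) = - (1 / 2) * ∫ x, pd k p x * v x ^ 2 := by
  have h := integral_mul_pd hp (hv.mul_left hv.1).1 (hv.mul_left hv.1).2 k
  simp_rw [pd_mul hv.1 hv.1] at h
  have e : ∀ x, p x * (pd k v x * v x + v x * pd k v x) = 2 * (p x * (v x * pd k v x)) := by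
    intro x; ring
  simp_rw [e, integral_const_mul, ← pow_two] at h
  linarith

lemma integral_pd_pd_mul_field {v : Pt m → ℝ} (hv : IsTest v) (hb : ∀ k, ContDiff ℝ ∞ (b k))
    (hH : ∀ j k x, pd k (b j) x = H j k) (j k : Dir m) :
    ∫ x, pd j (pd j v) x * (b k x * pd k v x)
      = - H k j * (∫ x, pd j v x * pd k v x) + 1 / 2 * H k k * ∫ x, pd j v x ^ 2 := by
  have h1 := integral_mul_pd (((hv.pd k).mul_left (hb k)).1) (hv.pd j).1 (hv.pd j).2 j
  simp_rw [pd_mul (hb k) (hv.pd k).1, hH, pd_comm hv.1 j k] at h1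
  have h2 := integral_mul_mul_pd (hv.pd j) (hb k) k
  simp_rw [hH, integral_const_mul] at h2
  have e : ∀ x, (H k j * pd k v x + b k x * pd k (pd j v) x) * pd j v x
      = H k j * (pd j v x * pd k v x) + b k x * (pd j v x * pd k (pd j v) x) := by
    intro x; ring
  simp_rw [e] at h1
  rw [integral_add (((hv.pd k).mul_left (hv.pd j).1).integrable.const_mul _)
    ((((hv.pd j).pd k).mul_left (hv.pd j).1).mul_left (hb k)).integrable, integral_const_mul, h2]
    at h1
  simp_rw [mul_comm (pd j (pd j v) _)]
  rw [h1]
  ring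

/-- The positive commutator of the symmetric and the antisymmetric part of the Laplacian conjugated
with the exponential of a quadratic function whose gradient is `b` and whose Hessian is `H`. -/
lemma integral_conjugated_lapl_ge {v : Pt m → ℝ} (hv : IsTest v) (hb : ∀ k, ContDiff ℝ ∞ (b k))
    (hH : ∀ j k x, pd k (b j) x = H j k) (hs : ∀ j k, H j k = H k j) (τ : ℝ) :
    4 * τ * (∑ j, ∑ k, H j k * ∫ x, pd j v x * pd k v x) + 4 * τ * (∑ j, ∫ x, pd j v x ^ 2)
      + ∫ x, (4 * τ ^ 3 * ((∑ j, ∑ k, H j k * b j x * b k x) - ∑ j, b j x ^ 2) - 4 * τ ^ 2) * v x ^ 2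
      ≤ ∫ x, (lapl v x - 2 * τ * (∑ k, b k x * pd k v x)
        + (τ ^ 2 * (∑ j, b j x ^ 2) - τ * ∑ j, H j j) * v x) ^ 2 := by
  set q : Pt m → ℝ := fun x => ∑ j, b j x ^ 2 with hq
  obtain ⟨h, hh⟩ : ∃ h : ℝ, h = ∑ j, H j j := ⟨_, rfl⟩
  rw [← hh]
  have hqs : ContDiff ℝ ∞ q := ContDiff.sum fun j _ => (hb j).pow 2
  have hqd : ∀ k x, pd k q x = 2 * ∑ j, H j k * b j x := by
    intro k x
    have hd : ∀ j, HasFDerivAt (fun y => b j y ^ 2) _ x := fun j =>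
      (((hb j).differentiable (by simp) x).hasFDerivAt).pow 2
    have := HasFDerivAt.fun_sum (u := Finset.univ) fun j _ => hd j
    rw [pd, this.fderiv, sum_apply, Finset.mul_sum]
    refine Finset.sum_congr rfl fun j _ => ?_
    have := hH j k x
    rw [pd] at this
    simp [this]
    ring
  have hvv : IsTest fun x => v x ^ 2 := by
    simp_rw [pow_two]; exact hv.mul_left hv.1
  -- drop the square of the antisymmetric part, and bound the square of the symmetric part below
  have hpt : ∀ x, (∑ j, ∑ k, (-4 * τ) * (pd j (pd j v) x * (b k x * pd k v x)))
      + (∑ j, (-2 * τ * h - 4 * τ) * (pd j (pd j v) x * v x))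
      + (∑ k, (-4 * τ ^ 3) * ((q x * b k x) * (v x * pd k v x)))
      + ((-2 * τ ^ 3 * h - 4 * τ ^ 3) * (q x * v x ^ 2) - 4 * τ ^ 2 * v x ^ 2)
      ≤ (lapl v x - 2 * τ * (∑ k, b k x * pd k v x) + (τ ^ 2 * q x - τ * h) * v x) ^ 2 := by
    intro x
    have e1 : (∑ j, ∑ k, (-4 * τ) * (pd j (pd j v) x * (b k x * pd k v x)))
        = (-4 * τ) * (lapl v x * ∑ k, b k x * pd k v x) := by
      rw [lapl, Finset.sum_mul_sum, Finset.mul_sum]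
      simp_rw [Finset.mul_sum]
    have e2 : (∑ j, (-2 * τ * h - 4 * τ) * (pd j (pd j v) x * v x))
        = (-2 * τ * h - 4 * τ) * (lapl v x * v x) := by
      rw [lapl, Finset.sum_mul, Finset.mul_sum]
    have e3 : (∑ k, (-4 * τ ^ 3) * ((q x * b k x) * (v x * pd k v x)))
        = (-4 * τ ^ 3) * (q x * v x * ∑ k, b k x * pd k v x) := by
      rw [Finset.mul_sum, Finset.mul_sum]
      exact Finset.sum_congr rfl fun k _ => by ring
    rw [e1, e2, e3]
    set L := lapl v x
    set B := ∑ k, b k x * pd k v x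
    nlinarith [sq_nonneg (L + τ ^ 2 * q x * v x + 2 * τ * v x),
      sq_nonneg (-2 * τ * B - τ * h * v x)]
  -- integrate by parts in each of the terms
  have i1 : ∀ j k, Integrable fun x => (-4 * τ) * (pd j (pd j v) x * (b k x * pd k v x)) :=
    fun j k => ((((hv.pd k).mul_left (hb k)).mul_left ((hv.pd j).pd j).1).integrable.const_mul _)
  have i2 : ∀ j, Integrable fun x => (-2 * τ * h - 4 * τ) * (pd j (pd j v) x * v x) :=
    fun j => (hv.mul_left ((hv.pd j).pd j).1).integrable.const_mul _
  have i3 : ∀ k, Integrable fun x => (-4 * τ ^ 3) * ((q x * b k x) * (v x * pd k v x)) :=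
    fun k => (((hv.pd k).mul_left hv.1).mul_left (hqs.mul (hb k))).integrable.const_mul _
  have i4 : Integrable fun x => (-2 * τ ^ 3 * h - 4 * τ ^ 3) * (q x * v x ^ 2) :=
    (hvv.mul_left hqs).integrable.const_mul _
  have i5 : Integrable fun x => 4 * τ ^ 2 * v x ^ 2 := hvv.integrable.const_mul _
  have s1 := integrable_finsetSum Finset.univ fun j _ =>
    integrable_finsetSum Finset.univ fun k _ => i1 j k
  have s2 := integrable_finsetSum Finset.univ fun j _ => i2 j
  have s3 := integrable_finsetSum Finset.univ fun j _ => i3 j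
  have i45 : Integrable fun x => (-2 * τ ^ 3 * h - 4 * τ ^ 3) * (q x * v x ^ 2)
      - 4 * τ ^ 2 * v x ^ 2 := i4.sub i5
  have hSmooth : ContDiff ℝ ∞ fun x => lapl v x - 2 * τ * (∑ k, b k x * pd k v x)
      + (τ ^ 2 * q x - τ * h) * v x := by
    refine ((contDiff_lapl hv.1).sub (contDiff_const.mul (ContDiff.sum fun k _ =>
      (hb k).mul (hv.pd k).1))).add (((contDiff_const.mul hqs).sub contDiff_const).mul hv.1)
  have hsupp : HasCompactSupport fun x => (lapl v x - 2 * τ * (∑ k, b k x * pd k v x)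
      + (τ ^ 2 * q x - τ * h) * v x) ^ 2 := by
    refine HasCompactSupport.intro hv.2 fun x hx => ?_
    have h1 : ∀ k, pd k v x = 0 := fun k => by
      have : x ∉ tsupport (pd k v) := fun hh => hx (tsupport_fderiv_apply_subset ℝ _ hh)
      exact image_eq_zero_of_notMem_tsupport this
    have h2 : ∀ k, pd k (pd k v) x = 0 := fun k => by
      have : x ∉ tsupport (pd k (pd k v)) := fun hh =>
        hx (tsupport_fderiv_apply_subset ℝ _ (tsupport_fderiv_apply_subset ℝ _ hh))
      exact image_eq_zero_of_notMem_tsupport this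
    simp [lapl, h1, h2, image_eq_zero_of_notMem_tsupport hx]
  have hint := integral_mono (((s1.add s2).add s3).add i45)
    ((hSmooth.pow 2).continuous.integrable_of_hasCompactSupport hsupp) hpt
  refine le_trans (le_of_eq ?_) hint
  have hfun : (fun x => (4 * τ ^ 3 * ((∑ j, ∑ k, H j k * b j x * b k x) - q x) - 4 * τ ^ 2)
      * v x ^ 2) = fun x => (∑ k, 2 * τ ^ 3 * (pd k (fun y => q y * b k y) x * v x ^ 2))
        + ((-2 * τ ^ 3 * h - 4 * τ ^ 3) * (q x * v x ^ 2) - 4 * τ ^ 2 * v x ^ 2) := by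
    ext x
    simp_rw [pd_mul hqs (hb _), hqd, hH]
    have e0 : ∑ k, (∑ j, H j k * b j x) * b k x = ∑ j, ∑ k, H j k * b j x * b k x := by
      simp_rw [Finset.sum_mul]
      exact Finset.sum_comm
    have e : ∑ k, 2 * τ ^ 3 * ((2 * (∑ j, H j k * b j x) * b k x + q x * H k k) * v x ^ 2)
        = ∑ k, ((4 * τ ^ 3 * v x ^ 2) * ((∑ j, H j k * b j x) * b k x)
          + (2 * τ ^ 3 * q x * v x ^ 2) * H k k) :=
      Finset.sum_congr rfl fun k _ => by ring
    rw [e, Finset.sum_add_distrib, ← Finset.mul_sum, ← Finset.mul_sum, e0, ← hh]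
    ring
  have i6 : ∀ k, Integrable fun x => 2 * τ ^ 3 * (pd k (fun y => q y * b k y) x * v x ^ 2) :=
    fun k => (hvv.mul_left (contDiff_pd (hqs.mul (hb k)) k)).integrable.const_mul _
  rw [hfun, integral_add (integrable_finsetSum _ fun k _ => i6 k) i45,
    integral_finsetSum _ (fun k _ => i6 k)]
  rw [integral_add' ((s1.add s2).add s3) i45, integral_add' (s1.add s2) s3, integral_add' s1 s2,
    integral_finsetSum _ (fun j _ => integrable_finsetSum Finset.univ fun k _ => i1 j k),
    integral_finsetSum _ (fun j _ => i2 j), integral_finsetSum _ (fun j _ => i3 j)]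
  simp_rw [integral_finsetSum _ (fun k _ => i1 _ k), integral_const_mul,
    integral_pd_pd_mul_self hv, integral_pd_pd_mul_field hv hb hH,
    integral_mul_mul_pd hv (hqs.mul (hb _))]
  have e1 : ∑ j, ∑ k, -4 * τ * (-H k j * (∫ x, pd j v x * pd k v x)
        + 1 / 2 * H k k * ∫ x, pd j v x ^ 2)
      = 4 * τ * (∑ j, ∑ k, H j k * ∫ x, pd j v x * pd k v x)
        - 2 * τ * h * ∑ j, ∫ x, pd j v x ^ 2 := by
    have e : ∀ j, ∑ k, -4 * τ * (-H k j * (∫ x, pd j v x * pd k v x)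
        + 1 / 2 * H k k * ∫ x, pd j v x ^ 2)
        = 4 * τ * (∑ k, H j k * ∫ x, pd j v x * pd k v x)
          + (-2 * τ * h) * ∫ x, pd j v x ^ 2 := by
      intro j
      have e' : ∀ k, -4 * τ * (-H k j * (∫ x, pd j v x * pd k v x)
          + 1 / 2 * H k k * ∫ x, pd j v x ^ 2) = 4 * τ * (H j k * ∫ x, pd j v x * pd k v x)
          + (-2 * τ * ∫ x, pd j v x ^ 2) * H k k := fun k => by rw [hs j k]; ring
      simp_rw [e', Finset.sum_add_distrib, ← Finset.mul_sum, ← hh]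
      ring
    simp_rw [e, Finset.sum_add_distrib, ← Finset.mul_sum]
    ring
  rw [e1, ← Finset.mul_sum, ← Finset.mul_sum, ← Finset.mul_sum, Finset.sum_neg_distrib,
    ← Finset.mul_sum]
  ring

end Carleman

/-! ### The quadratic Carleman weight -/

section CarlemanWeight

variable {m : ℕ}

/-- The coordinate of `x` along the axis `e` through `o`. -/
def axial (e : Dir m → ℝ) (o x : Pt m) : ℝ := ∑ j, e j * coord m j (x - o)

/-- The squared Euclidean distance of `x` and `o` (the norm of the product space `Pt m` is not
Euclidean). -/
def distSq (o x : Pt m) : ℝ := ∑ j, coord m j (x - o) ^ 2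

/-- The quadratic Carleman weight `(2 s² - |x_⊥|²) / 2`, where `s` is the coordinate along the axis
`e` through `o` and `x_⊥` is the component orthogonal to the axis. -/
def carlemanWeight (e : Dir m → ℝ) (o x : Pt m) : ℝ := (3 * axial e o x ^ 2 - distSq o x) / 2

/-- The gradient of `carlemanWeight`. -/
def carlemanGrad (e : Dir m → ℝ) (o : Pt m) (j : Dir m) (x : Pt m) : ℝ :=
  3 * axial e o x * e j - coord m j (x - o)

lemma contDiff_axial (e : Dir m → ℝ) (o : Pt m) : ContDiff ℝ ∞ (axial e o) :=
  ContDiff.sum fun j _ => contDiff_const.mul ((coord m j).contDiff.comp (by fun_prop))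

lemma contDiff_distSq (o : Pt m) : ContDiff ℝ ∞ (distSq o) :=
  ContDiff.sum fun j _ => ((coord m j).contDiff.comp (by fun_prop)).pow 2

lemma contDiff_carlemanWeight (e : Dir m → ℝ) (o : Pt m) : ContDiff ℝ ∞ (carlemanWeight e o) :=
  ((contDiff_const.mul ((contDiff_axial e o).pow 2)).sub (contDiff_distSq o)).div_const _

lemma contDiff_carlemanGrad (e : Dir m → ℝ) (o : Pt m) (j : Dir m) :
    ContDiff ℝ ∞ (carlemanGrad e o j) :=
  ((contDiff_const.mul (contDiff_axial e o)).mul contDiff_const).sub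
    ((coord m j).contDiff.comp (by fun_prop))

lemma hasFDerivAt_coord_sub (o x : Pt m) (j : Dir m) :
    HasFDerivAt (fun y => coord m j (y - o)) (coord m j) x :=
  (coord m j).hasFDerivAt.comp x ((hasFDerivAt_id x).sub_const o)

lemma hasFDerivAt_axial (e : Dir m → ℝ) (o x : Pt m) :
    HasFDerivAt (axial e o) (∑ j, e j • coord m j) x :=
  HasFDerivAt.fun_sum fun j _ => (hasFDerivAt_coord_sub o x j).const_mul (e j)

lemma hasFDerivAt_distSq (o x : Pt m) :
    HasFDerivAt (distSq o) (∑ j, (2 * coord m j (x - o)) • coord m j) x := by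
  refine HasFDerivAt.fun_sum fun j _ => ?_
  have := (hasFDerivAt_coord_sub o x j).pow 2
  simpa using this

lemma pd_carlemanWeight (e : Dir m → ℝ) (o x : Pt m) (k : Dir m) :
    pd k (carlemanWeight e o) x = carlemanGrad e o k x := by
  have h := ((((hasFDerivAt_axial e o x).pow 2).const_mul 3).sub (hasFDerivAt_distSq o x)).mul_const
    (1 / 2 : ℝ)
  have h' : HasFDerivAt (carlemanWeight e o) _ x := h.congr_of_eventuallyEq
    (Eventually.of_forall fun y => by simp [carlemanWeight]; ring)
  rw [pd, h'.fderiv]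
  simp [coord_dirVec, carlemanGrad, -Fintype.sum_sum_type]
  ring

lemma pd_carlemanGrad (e : Dir m → ℝ) (o x : Pt m) (j k : Dir m) :
    pd k (carlemanGrad e o j) x = 3 * e j * e k - if j = k then 1 else 0 := by
  have h : HasFDerivAt (carlemanGrad e o j) _ x :=
    (((hasFDerivAt_axial e o x).const_mul 3).mul_const (e j)).sub (hasFDerivAt_coord_sub o x j)
  rw [pd, h.fderiv]
  simp [coord_dirVec, -Fintype.sum_sum_type]
  ring

/-- The Carleman estimate with a quadratic weight, for real test functions. -/
lemma carleman_real {e : Dir m → ℝ} (he : ∑ j, e j ^ 2 = 1) (o : Pt m) {τ : ℝ} (hτ : 0 ≤ τ)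
    {w : Pt m → ℝ} (hw : IsTest w) :
    ∫ x, ((4 * τ ^ 3 * (6 * axial e o x ^ 2 - 2 * distSq o x) - 4 * τ ^ 2)
        * Real.exp (2 * τ * carlemanWeight e o x)) * w x ^ 2
      ≤ ∫ x, Real.exp (2 * τ * carlemanWeight e o x) * lapl w x ^ 2 := by
  obtain ⟨ex, hex⟩ : ∃ ex : Pt m → ℝ, ex = fun x => Real.exp (τ * carlemanWeight e o x) := ⟨_, rfl⟩
  have hexs : ContDiff ℝ ∞ ex := hex ▸ Real.contDiff_exp.comp (contDiff_const.mul (contDiff_carlemanWeight e o))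
  have hexd : ∀ k x, pd k ex x = ex x * (τ * carlemanGrad e o k x) := by
    intro k x
    have hd := ((contDiff_carlemanWeight e o).differentiable (by simp) x).hasFDerivAt
    have h := (hd.const_mul τ).exp
    rw [pd, hex, h.fderiv, ← pd_carlemanWeight, pd]
    simp
  have hb := contDiff_carlemanGrad e o
  -- apply the commutator estimate to `v = exp (τ φ) w`; the Hessian of the weight is `3 e ⊗ e - 1`
  have hv : IsTest fun x => ex x * w x := hw.mul_left hexs
  obtain ⟨H, hHd⟩ : ∃ H : Dir m → Dir m → ℝ, ∀ j k, H j k = 3 * e j * e k - if j = k then 1 else 0 :=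
    ⟨_, fun _ _ => rfl⟩
  have hH : ∀ j k x, pd k (carlemanGrad e o j) x = H j k :=
    fun j k x => by rw [pd_carlemanGrad, hHd]
  have key := integral_conjugated_lapl_ge hv hb hH
    (by intro j k; simp only [hHd, eq_comm (a := j)]; ring) τ
  have hpv : ∀ j, pd j (fun x => ex x * w x)
      = fun x => ex x * (pd j w x + τ * (carlemanGrad e o j x * w x)) := by
    intro j; ext x
    rw [pd_mul hexs hw.1, hexd]; ring
  have hppv : ∀ j x, pd j (pd j (fun x => ex x * w x)) x
      = ex x * (pd j (pd j w) x + 2 * τ * (carlemanGrad e o j x * pd j w x)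
        + τ * (H j j * w x)
        + τ ^ 2 * carlemanGrad e o j x ^ 2 * w x) := by
    intro j x
    have h1 : ContDiff ℝ ∞ fun x => carlemanGrad e o j x * w x := (hb j).mul hw.1
    have h2 : ContDiff ℝ ∞ fun x => τ * (carlemanGrad e o j x * w x) := contDiff_const.mul h1
    have h3 : pd j (fun x => τ * (carlemanGrad e o j x * w x)) x
        = τ * pd j (fun x => carlemanGrad e o j x * w x) x := by
      have := pd_mul (f := fun _ => τ) contDiff_const h1 j x
      rw [this]; simp [pd]
    rw [hpv, pd_mul hexs ((hw.pd j).1.add h2), hexd, pd_add (hw.pd j).1 h2, h3, pd_mul (hb j) hw.1, hH]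
    ring
  have hP : ∀ x, lapl (fun x => ex x * w x) x
      - 2 * τ * (∑ k, carlemanGrad e o k x * pd k (fun x => ex x * w x) x)
      + (τ ^ 2 * (∑ j, carlemanGrad e o j x ^ 2)
        - τ * ∑ j, H j j) * (ex x * w x) = ex x * lapl w x := by
    intro x
    have hB : ∑ k, carlemanGrad e o k x * pd k (fun x => ex x * w x) x
        = ∑ k, carlemanGrad e o k x * (ex x * (pd k w x + τ * (carlemanGrad e o k x * w x))) :=
      Finset.sum_congr rfl fun k _ => by rw [hpv k]
    rw [lapl, lapl]
    rw [Finset.sum_congr rfl fun j _ => hppv j x, hB]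
    rw [Finset.mul_sum, Finset.mul_sum, Finset.mul_sum, Finset.mul_sum, ← Finset.sum_sub_distrib,
      ← Finset.sum_sub_distrib, Finset.sum_mul, ← Finset.sum_add_distrib]
    refine Finset.sum_congr rfl fun j _ => by ring
  simp_rw [hP] at key
  have hsq : ∀ x, Real.exp (2 * τ * carlemanWeight e o x) = ex x ^ 2 := by
    intro x; rw [hex, ← Real.exp_nat_mul]; congr 1; push_cast; ring
  have hbe : ∀ x, ∑ j, e j * carlemanGrad e o j x = 2 * axial e o x := by
    intro x
    simp only [carlemanGrad, mul_sub, Finset.sum_sub_distrib]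
    have : ∑ j, e j * (3 * axial e o x * e j) = 3 * axial e o x * ∑ j, e j ^ 2 := by
      rw [Finset.mul_sum]
      exact Finset.sum_congr rfl fun j _ => by ring
    rw [he] at this
    rw [this, axial]; ring
  have hbb : ∀ x, ∑ j, carlemanGrad e o j x ^ 2 = 3 * axial e o x ^ 2 + distSq o x := by
    intro x
    have : ∀ j, carlemanGrad e o j x ^ 2 = 9 * axial e o x ^ 2 * e j ^ 2
      + (-6 * axial e o x) * (e j * coord m j (x - o)) + coord m j (x - o) ^ 2 := by
      intro j; rw [carlemanGrad]; ring
    simp_rw [this, Finset.sum_add_distrib, ← Finset.mul_sum, he]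
    rw [← axial, ← distSq]
    ring
  have hHbb : ∀ f : Dir m → ℝ, ∑ j, ∑ k, H j k * f j * f k
      = 3 * (∑ j, e j * f j) ^ 2 - ∑ j, f j ^ 2 := by
    intro f
    have : ∀ j k, H j k * f j * f k
        = 3 * ((e j * f j) * (e k * f k)) - if j = k then f j * f k else 0 := by
      intro j k; rw [hHd]; split_ifs <;> ring
    simp_rw [this, Finset.sum_sub_distrib]
    rw [pow_two, Finset.sum_mul_sum, Finset.mul_sum]
    simp [Finset.mul_sum, pow_two, -Fintype.sum_sum_type]
  have hcc : ∀ x, (4 * τ ^ 3 * ((∑ j, ∑ k, H j k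
        * carlemanGrad e o j x * carlemanGrad e o k x) - ∑ j, carlemanGrad e o j x ^ 2) - 4 * τ ^ 2)
        * (ex x * w x) ^ 2
      = ((4 * τ ^ 3 * (6 * axial e o x ^ 2 - 2 * distSq o x) - 4 * τ ^ 2)
        * Real.exp (2 * τ * carlemanWeight e o x)) * w x ^ 2 := by
    intro x
    rw [hHbb fun j => carlemanGrad e o j x, hbe, hbb, hsq]
    ring
  simp_rw [hcc] at key
  -- the Hessian is bounded below by `-1`, so that the gradient terms may be dropped
  have hgrad : 0 ≤ 4 * τ * (∑ j, ∑ k, H j k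
        * ∫ x, pd j (fun x => ex x * w x) x * pd k (fun x => ex x * w x) x)
      + 4 * τ * (∑ j, ∫ x, pd j (fun x => ex x * w x) x ^ 2) := by
    rw [← mul_add]
    refine mul_nonneg (by positivity) ?_
    have hi : ∀ j k, Integrable fun x =>
        pd j (fun x => ex x * w x) x * pd k (fun x => ex x * w x) x :=
      fun j k => ((hv.pd k).mul_left (hv.pd j).1).integrable
    have e1 : (∑ j, ∑ k, H j k
        * ∫ x, pd j (fun x => ex x * w x) x * pd k (fun x => ex x * w x) x)
        = ∫ x, ∑ j, ∑ k, H j k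
        * pd j (fun x => ex x * w x) x * pd k (fun x => ex x * w x) x := by
      rw [integral_finsetSum _ fun j _ => integrable_finsetSum _ fun k _ => by
        simpa only [mul_assoc] using (hi j k).const_mul _]
      refine Finset.sum_congr rfl fun j _ => ?_
      rw [integral_finsetSum _ fun k _ => by simpa only [mul_assoc] using (hi j k).const_mul _]
      refine Finset.sum_congr rfl fun k _ => ?_
      simp_rw [mul_assoc _ (pd j _ _), integral_const_mul]
    have hi2 : Integrable fun x => ∑ j, pd j (fun x => ex x * w x) x ^ 2 :=
      integrable_finsetSum _ fun j _ => by simpa only [pow_two] using hi j j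
    have hi3 : Integrable fun x => ∑ j, ∑ k, H j k
        * pd j (fun x => ex x * w x) x * pd k (fun x => ex x * w x) x :=
      integrable_finsetSum _ fun j _ => integrable_finsetSum _ fun k _ => by
        simpa only [mul_assoc] using (hi j k).const_mul _
    rw [e1, ← integral_finsetSum _ fun j _ => by simpa only [pow_two] using hi j j,
      ← integral_add hi3 hi2]
    refine integral_nonneg fun x => ?_
    change 0 ≤ (∑ j, ∑ k, H j k
        * pd j (fun x => ex x * w x) x * pd k (fun x => ex x * w x) x)
        + ∑ j, pd j (fun x => ex x * w x) x ^ 2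
    rw [hHbb fun j => pd j (fun x => ex x * w x) x]
    have := sq_nonneg (∑ j, e j * pd j (fun x => ex x * w x) x)
    linarith
  have hr : ∀ x, (ex x * lapl w x) ^ 2 = Real.exp (2 * τ * carlemanWeight e o x) * lapl w x ^ 2 := by
    intro x; rw [hsq]; ring
  simp_rw [hr] at key
  linarith

lemma pd_re {w : Pt m → ℂ} (hw : ContDiff ℝ ∞ w) (j : Dir m) :
    pd j (fun x => (w x).re) = fun x => (pd j w x).re := by
  ext x
  have h := (Complex.reCLM.hasFDerivAt (x := w x)).comp x (hw.differentiable (by simp) x).hasFDerivAt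
  have h' : HasFDerivAt (fun x => (w x).re) _ x := h
  rw [pd, h'.fderiv]; rfl

lemma pd_im {w : Pt m → ℂ} (hw : ContDiff ℝ ∞ w) (j : Dir m) :
    pd j (fun x => (w x).im) = fun x => (pd j w x).im := by
  ext x
  have h := (Complex.imCLM.hasFDerivAt (x := w x)).comp x (hw.differentiable (by simp) x).hasFDerivAt
  have h' : HasFDerivAt (fun x => (w x).im) _ x := h
  rw [pd, h'.fderiv]; rfl

lemma continuous_carleman_weights (e : Dir m → ℝ) (o : Pt m) (τ : ℝ) :
    Continuous (fun x => (4 * τ ^ 3 * (6 * axial e o x ^ 2 - 2 * distSq o x) - 4 * τ ^ 2)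
        * Real.exp (2 * τ * carlemanWeight e o x)) ∧
    Continuous (fun x => Real.exp (2 * τ * carlemanWeight e o x)) := by
  have h1 := (contDiff_axial e o).continuous
  have h2 := (contDiff_distSq o).continuous
  have h3 := (contDiff_carlemanWeight e o).continuous
  constructor <;> fun_prop

/-- The Carleman estimate for complex test functions, by adding it for the real and the imaginary
part. -/
lemma carleman_smooth {e : Dir m → ℝ} (he : ∑ j, e j ^ 2 = 1) (o : Pt m) {τ : ℝ} (hτ : 0 ≤ τ)
    {w : Pt m → ℂ} (hw : ContDiff ℝ ∞ w) (hc : HasCompactSupport w) :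
    ∫ x, ((4 * τ ^ 3 * (6 * axial e o x ^ 2 - 2 * distSq o x) - 4 * τ ^ 2)
        * Real.exp (2 * τ * carlemanWeight e o x)) * ‖w x‖ ^ 2
      ≤ ∫ x, Real.exp (2 * τ * carlemanWeight e o x) * ‖lapl w x‖ ^ 2 := by
  have hre : IsTest fun x => (w x).re :=
    ⟨Complex.reCLM.contDiff.comp hw, hc.comp_left (g := Complex.re) rfl⟩
  have him : IsTest fun x => (w x).im :=
    ⟨Complex.imCLM.contDiff.comp hw, hc.comp_left (g := Complex.im) rfl⟩
  have h1 := carleman_real he o hτ hre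
  have h2 := carleman_real he o hτ him
  obtain ⟨c1, c2⟩ := continuous_carleman_weights e o τ
  have hl1 : ∀ x, lapl (fun x => (w x).re) x = (lapl w x).re := by
    intro x
    simp only [lapl, Complex.re_sum]
    exact Finset.sum_congr rfl fun j _ => by rw [pd_re hw, pd_re (contDiff_pd hw j)]
  have hl2 : ∀ x, lapl (fun x => (w x).im) x = (lapl w x).im := by
    intro x
    simp only [lapl, Complex.im_sum]
    exact Finset.sum_congr rfl fun j _ => by rw [pd_im hw, pd_im (contDiff_pd hw j)]
  have hlt : ∀ {f : Pt m → ℝ}, IsTest f → IsTest (lapl f) := by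
    intro f hf
    refine ⟨contDiff_lapl hf.1, HasCompactSupport.intro hf.2 fun x hx => ?_⟩
    refine Finset.sum_eq_zero fun k _ => ?_
    have : x ∉ tsupport (pd k (pd k f)) := fun hh =>
      hx (tsupport_fderiv_apply_subset ℝ _ (tsupport_fderiv_apply_subset ℝ _ hh))
    exact image_eq_zero_of_notMem_tsupport this
  have hint : ∀ {a : Pt m → ℝ} {f : Pt m → ℝ}, Continuous a → IsTest f →
      Integrable fun x => a x * f x ^ 2 := by
    intro a f ha hf
    refine (ha.mul (hf.1.continuous.pow 2)).integrable_of_hasCompactSupport ?_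
    refine HasCompactSupport.intro hf.2 fun x hx => ?_
    simp [image_eq_zero_of_notMem_tsupport hx]
  have h3 := add_le_add h1 h2
  rw [← integral_add (hint c1 hre) (hint c1 him),
    ← integral_add (hint c2 (hlt hre)) (hint c2 (hlt him))] at h3
  have hn : ∀ z : ℂ, ‖z‖ ^ 2 = z.re ^ 2 + z.im ^ 2 := fun z => by
    rw [Complex.sq_norm, Complex.normSq_apply]; ring
  simp_rw [hn, mul_add, ← hl1, ← hl2]
  exact h3

end CarlemanWeight

/-! ### Unique continuation -/

lemma tendsto_integral_mul_norm_sq {α : Type*} {mα : MeasurableSpace α} {μ : Measure α}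
    {a : α → ℝ} (ha : AEStronglyMeasurable a μ) {A : ℝ} (hA : ∀ᵐ x ∂μ, |a x| ≤ A)
    {g : ℕ → α → ℂ} {g₀ : α → ℂ} (hg : ∀ n, MemLp (g n) 2 μ) (hg₀ : MemLp g₀ 2 μ)
    (h : Tendsto (fun n => eLpNorm (fun x => g n x - g₀ x) 2 μ) atTop (𝓝 0)) :
    Tendsto (fun n => ∫ x, a x * ‖g n x‖ ^ 2 ∂μ) atTop (𝓝 (∫ x, a x * ‖g₀ x‖ ^ 2 ∂μ)) := by
  have hmul : ∀ {f : α → ℂ}, MemLp f 2 μ → MemLp (fun x => (a x : ℂ) * f x) 2 μ := by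
    intro f hf
    refine hf.of_le_mul (c := A) ((Complex.continuous_ofReal.comp_aestronglyMeasurable ha).mul hf.1) ?_
    filter_upwards [hA] with x hx
    rw [norm_mul, Complex.norm_real]
    exact mul_le_mul_of_nonneg_right hx (norm_nonneg _)
  have hin : ∀ {f : α → ℂ} (hf : MemLp f 2 μ),
      (inner ℂ (hf.toLp f) ((hmul hf).toLp _)).re = ∫ x, a x * ‖f x‖ ^ 2 ∂μ := by
    intro f hf
    have : inner ℂ (hf.toLp f) ((hmul hf).toLp _) = ((∫ x, a x * ‖f x‖ ^ 2 ∂μ : ℝ) : ℂ) := by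
      rw [L2.inner_def, ← integral_complex_ofReal]
      refine integral_congr_ae ?_
      filter_upwards [hf.coeFn_toLp, (hmul hf).coeFn_toLp] with x h1 h2
      rw [h1, h2, RCLike.inner_apply, mul_assoc, Complex.mul_conj, Complex.normSq_eq_norm_sq]
      push_cast; rfl
    rw [this, Complex.ofReal_re]
  have h1 : Tendsto (fun n => (hg n).toLp (g n)) atTop (𝓝 (hg₀.toLp g₀)) :=
    (Lp.tendsto_Lp_iff_tendsto_eLpNorm'' _ hg _ hg₀).2 h
  have h2 : Tendsto (fun n => (hmul (hg n)).toLp _) atTop (𝓝 ((hmul hg₀).toLp _)) := by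
    refine (Lp.tendsto_Lp_iff_tendsto_eLpNorm'' _ (fun n => hmul (hg n)) _ (hmul hg₀)).2 ?_
    have h3 : Tendsto (fun n => ENNReal.ofReal A * eLpNorm (fun x => g n x - g₀ x) 2 μ) atTop (𝓝 0) := by
      simpa using ENNReal.Tendsto.const_mul h (Or.inr (ENNReal.ofReal_ne_top (r := A)))
    refine tendsto_of_tendsto_of_tendsto_of_le_of_le tendsto_const_nhds h3 (fun _ => zero_le)
      fun n => ?_
    refine eLpNorm_le_mul_eLpNorm_of_ae_le_mul ?_ 2
    filter_upwards [hA] with x hx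
    simp only [Pi.sub_apply]
    rw [← mul_sub, norm_mul, Complex.norm_real]
    exact mul_le_mul_of_nonneg_right hx (norm_nonneg _)
  have h3 := (Complex.continuous_re.tendsto _).comp (h1.inner h2 (𝕜 := ℂ))
  rw [hin] at h3
  refine h3.congr fun n => ?_
  exact hin (hg n)

section UniqueContinuation

variable {m : ℕ}

lemma tendsto_integral_weight_mul_norm_sq {a : Pt m → ℝ} (ha : Continuous a) {K : Set (Pt m)}
    (hK : IsCompact K)
    {g : ℕ → Pt m → ℂ} {g₀ : Pt m → ℂ} (hg : ∀ n, MemLp (g n) 2 volume) (hg₀ : MemLp g₀ 2 volume)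
    (hz : ∀ n, ∀ x ∉ K, g n x = 0) (hz₀ : ∀ x ∉ K, g₀ x = 0)
    (h : Tendsto (fun n => eLpNorm (fun x => g n x - g₀ x) 2 volume) atTop (𝓝 0)) :
    Tendsto (fun n => ∫ x, a x * ‖g n x‖ ^ 2) atTop (𝓝 (∫ x, a x * ‖g₀ x‖ ^ 2)) := by
  obtain ⟨A, hA⟩ := hK.exists_bound_of_continuousOn ha.continuousOn
  have e : ∀ {f : Pt m → ℂ}, (∀ x ∉ K, f x = 0) →
      ∫ x, a x * ‖f x‖ ^ 2 = ∫ x, K.indicator a x * ‖f x‖ ^ 2 := by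
    intro f hf
    refine integral_congr_ae (Eventually.of_forall fun x => ?_)
    by_cases hx : x ∈ K
    · simp [hx]
    · simp [hx, hf x hx]
  rw [e hz₀]
  simp_rw [e (hz _)]
  refine tendsto_integral_mul_norm_sq (A := max A 0)
    (ha.aestronglyMeasurable.indicator hK.measurableSet) (Eventually.of_forall fun x => ?_) hg hg₀ h
  by_cases hx : x ∈ K
  · rw [indicator_of_mem hx]; exact le_max_of_le_left (hA x hx)
  · rw [indicator_of_notMem hx]; simp

lemma lapl_smear {k w f : Pt m → ℂ} (hk : ContDiff ℝ ∞ k) (hc : HasCompactSupport k)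
    (hw : LocallyIntegrable w)
    (h : ∀ ψ : Pt m → ℂ, ContDiff ℝ ∞ ψ → HasCompactSupport ψ →
      ∫ x, w x * lapl ψ x = ∫ x, f x * ψ x) (x : Pt m) :
    lapl (smear volume k w) x = smear volume k f x := by
  have h1 : ∀ j, pd j (smear volume k w) = smear volume (pd j k) w := by
    intro j; ext y; exact fderiv_smear hk hc hw y _
  have h2 : ∀ j, pd j (pd j (smear volume k w)) x = smear volume (pd j (pd j k)) w x := by
    intro j; rw [h1]; exact fderiv_smear (contDiff_pd hk j) (hasCompactSupport_pd hc j) hw x _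
  have h3 : ∀ j, pd j (pd j fun y => k (x - y)) = fun y => pd j (pd j k) (x - y) := by
    intro j
    have e1 : (pd j fun y => k (x - y)) = fun y => (-pd j k) (x - y) := by
      ext y; exact fderiv_translate_kernel hk x y _
    ext y
    rw [e1]
    have e2 := fderiv_translate_kernel (contDiff_pd hk j).neg x y (dirVec m j)
    change fderiv ℝ (fun y => -(pd j k) (x - y)) y (dirVec m j) = _
    rw [e2]
    have e3 : fderiv ℝ (fun y => -(pd j k) y) (x - y) = - fderiv ℝ (pd j k) (x - y) := fderiv_neg
    rw [e3]; simp [pd]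
  have h4 := h _ (contDiff_translate_kernel hk x) (hasCompactSupport_translate_kernel hc x)
  rw [smear, ← h4]
  simp only [lapl, h2, h3, smear]
  simp_rw [Finset.mul_sum]
  rw [integral_finsetSum]
  intro j _
  have hcc := (hasCompactSupport_translate_kernel (hasCompactSupport_pd (hasCompactSupport_pd hc j) j) x)
  have hcn := (contDiff_translate_kernel (contDiff_pd (contDiff_pd hk j) j) x).continuous
  simpa [mul_comm] using hw.integrable_smul_left_of_hasCompactSupport hcn hcc

/-- The Carleman estimate for compactly supported functions with Laplacian in `L²`. -/
lemma carleman_weak {e : Dir m → ℝ} (he : ∑ j, e j ^ 2 = 1) (o : Pt m) {τ : ℝ} (hτ : 0 ≤ τ)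
    {w f : Pt m → ℂ} (hw : MemLp w 2 volume) (hf : MemLp f 2 volume) {K : Set (Pt m)}
    (hK : IsCompact K) (hwK : ∀ x ∉ K, w x = 0) (hfK : ∀ x ∉ K, f x = 0)
    (h : ∀ ψ : Pt m → ℂ, ContDiff ℝ ∞ ψ → HasCompactSupport ψ →
      ∫ x, w x * lapl ψ x = ∫ x, f x * ψ x) :
    ∫ x, ((4 * τ ^ 3 * (6 * axial e o x ^ 2 - 2 * distSq o x) - 4 * τ ^ 2)
        * Real.exp (2 * τ * carlemanWeight e o x)) * ‖w x‖ ^ 2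
      ≤ ∫ x, Real.exp (2 * τ * carlemanWeight e o x) * ‖f x‖ ^ 2 := by
  have hwl : LocallyIntegrable w := hw.locallyIntegrable (by norm_num)
  have hfl : LocallyIntegrable f := hf.locallyIntegrable (by norm_num)
  obtain ⟨c1, c2⟩ := continuous_carleman_weights e o τ
  have hmem : ∀ {g : Pt m → ℂ} (n : ℕ), LocallyIntegrable g → (∀ x ∉ K, g x = 0) →
      MemLp (mollify volume n g) 2 volume := fun n hg hgK =>
    (contDiff_mollify n hg).continuous.memLp_of_hasCompactSupport
      (hasCompactSupport_mollify hK hgK)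
  have hsub := Metric.self_subset_cthickening (δ := 1) K
  have h1 := tendsto_integral_weight_mul_norm_sq c1 hK.cthickening (fun n => hmem n hwl hwK) hw
    (fun n x hx => mollify_eq_zero hwK hx) (fun x hx => hwK x fun hh => hx (hsub hh))
    (tendsto_eLpNorm_mollify_sub hw)
  have h2 := tendsto_integral_weight_mul_norm_sq c2 hK.cthickening (fun n => hmem n hfl hfK) hf
    (fun n x hx => mollify_eq_zero hfK hx) (fun x hx => hfK x fun hh => hx (hsub hh))
    (tendsto_eLpNorm_mollify_sub hf)
  refine le_of_tendsto_of_tendsto' h1 h2 fun n => ?_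
  have h3 := carleman_smooth he o hτ (contDiff_mollify n hwl) (hasCompactSupport_mollify hK hwK)
  have h4 : ∀ x, lapl (mollify volume n w) x = mollify volume n f x :=
    lapl_smear (contDiff_molKernel _) (hasCompactSupport_molKernel _) hwl h
  simpa only [h4] using h3

/-- The pair `(u, g)` solves `-div g = P u` weakly in `O`. -/
def SolvesOn (O : Set (Pt m)) (u : Pt m → ℂ) (g : Dir m → Pt m → ℂ) (P : Pt m → ℂ) : Prop :=
  ∀ φ : Pt m → ℂ, ContDiff ℝ ∞ φ → HasCompactSupport φ → tsupport φ ⊆ O →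
    ∫ x, ∑ j, g j x * pd j φ x = ∫ x, P x * u x * φ x

/-- Weak differentiation is local. -/
lemma HasWeakDerivOn.eq_zero_of_eq_zero {O B : Set (Pt m)} {v : Pt m} {u g : Pt m → ℂ}
    (h : HasWeakDerivOn volume O v u g) (hg : LocallyIntegrable g) (hB : IsOpen B)
    (hBO : B ⊆ O) (hu : ∀ᵐ x, x ∈ B → u x = 0) : ∀ᵐ x, x ∈ B → g x = 0 := by
  refine hB.ae_eq_zero_of_integral_contDiff_smul_eq_zero (hg.locallyIntegrableOn _)
    fun ψ h1 h2 h3 => ?_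
  have hψ : ContDiff ℝ ∞ fun x => (ψ x : ℂ) := Complex.ofRealCLM.contDiff.comp h1
  have hψc : HasCompactSupport fun x => (ψ x : ℂ) := h2.comp_left (g := fun r : ℝ => (r : ℂ)) rfl
  have hψs : tsupport (fun x => (ψ x : ℂ)) ⊆ tsupport ψ :=
    closure_mono fun x hx => by simpa using hx
  have := h _ hψ hψc (hψs.trans (h3.trans hBO))
  have h0 : ∫ x, u x * fderiv ℝ (fun x => (ψ x : ℂ)) x v = 0 := by
    refine integral_eq_zero_of_ae ?_
    filter_upwards [hu] with x hx
    by_cases hxB : x ∈ B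
    · simp [hx hxB]
    · have hx2 : x ∉ tsupport (fun x => fderiv ℝ (fun x => (ψ x : ℂ)) x v) := fun hh =>
        hxB (h3 (hψs (tsupport_fderiv_apply_subset ℝ _ hh)))
      have hx3 := image_eq_zero_of_notMem_tsupport hx2
      simp [hx3]
  rw [h0] at this
  have h5 : ∫ x, g x * (ψ x : ℂ) = 0 := by linear_combination this
  rw [← h5]
  exact integral_congr_ae (Eventually.of_forall fun x => by simp [mul_comm])

lemma isCompact_distSq_le (z : Pt m) (s : ℝ) : IsCompact {x | distSq z x ≤ s} := by
  refine Metric.isCompact_of_isClosed_isBounded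
    (isClosed_le (contDiff_distSq z).continuous continuous_const) ?_
  refine (Metric.isBounded_iff_subset_closedBall z).2
    ⟨∑ j, (Real.sqrt s * ‖dirVec m j‖), fun x hx => ?_⟩
  rw [Metric.mem_closedBall, dist_eq_norm, ← sum_coord_smul_dirVec (x - z)]
  refine norm_sum_le_of_le _ fun j _ => ?_
  rw [norm_smul]
  refine mul_le_mul_of_nonneg_right (Real.abs_le_sqrt (le_trans ?_ hx)) (norm_nonneg _)
  exact Finset.single_le_sum (f := fun j => coord m j (x - z) ^ 2) (fun _ _ => sq_nonneg _)
    (Finset.mem_univ j)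

lemma distSq_self (z : Pt m) : distSq z z = 0 := by simp [distSq, -Fintype.sum_sum_type]

lemma distSq_nonneg (z x : Pt m) : 0 ≤ distSq z x := Finset.sum_nonneg fun _ _ => sq_nonneg _

lemma distSq_comm (z x : Pt m) : distSq z x = distSq x z :=
  Finset.sum_congr rfl fun j _ => by rw [map_sub, map_sub]; ring

lemma eq_of_distSq_eq_zero {z x : Pt m} (h : distSq z x = 0) : x = z := by
  rw [distSq, Finset.sum_eq_zero_iff_of_nonneg fun _ _ => sq_nonneg _] at h
  rw [← sub_eq_zero, ← sum_coord_smul_dirVec (x - z)]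
  refine Finset.sum_eq_zero fun j hj => ?_
  rw [pow_eq_zero_iff two_ne_zero |>.1 (h j hj), zero_smul]

lemma distSq_le_two (a b c : Pt m) : distSq a c ≤ 2 * distSq b a + 2 * distSq b c := by
  simp only [distSq, Finset.mul_sum, ← Finset.sum_add_distrib]
  refine Finset.sum_le_sum fun j _ => ?_
  simp only [map_sub]
  nlinarith [sq_nonneg (coord m j a - coord m j b + (coord m j c - coord m j b))]

lemma exists_distSq_le_subset {O : Set (Pt m)} (hO : IsOpen O) {z : Pt m} (hz : z ∈ O) :
    ∃ δ > 0, {x | distSq z x ≤ δ ^ 2} ⊆ O := by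
  obtain ⟨ε, hε, hb⟩ := Metric.isOpen_iff.1 hO z hz
  set B := ∑ j, ‖dirVec m j‖ with hB
  have hB0 : 0 ≤ B := Finset.sum_nonneg fun _ _ => norm_nonneg _
  refine ⟨ε / (B + 1), by positivity, fun x hx => hb ?_⟩
  rw [Metric.mem_ball, dist_eq_norm, ← sum_coord_smul_dirVec (x - z)]
  have hle : ‖∑ j, coord m j (x - z) • dirVec m j‖ ≤ ∑ j, (ε / (B + 1)) * ‖dirVec m j‖ := by
    refine norm_sum_le_of_le _ fun j _ => ?_
    rw [norm_smul]
    refine mul_le_mul_of_nonneg_right (abs_le_of_sq_le_sq (le_trans ?_ hx) (by positivity))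
      (norm_nonneg _)
    exact Finset.single_le_sum (f := fun j => coord m j (x - z) ^ 2) (fun _ _ => sq_nonneg _)
      (Finset.mem_univ j)
  refine hle.trans_lt ?_
  rw [← Finset.mul_sum, ← hB, div_mul_eq_mul_div, div_lt_iff₀ (by positivity)]
  nlinarith

end UniqueContinuation

/-! ### Continuation across spheres -/

section Cutoff

variable {m : ℕ}

/-- Multiplying a weak solution by a cutoff function: the Laplacian of the product. -/
lemma SolvesOn.integral_mul_lapl {O : Set (Pt m)} {u P : Pt m → ℂ} {g : Dir m → Pt m → ℂ}
    (hs : SolvesOn O u g P) (hw : ∀ j, HasWeakDerivOn volume O (dirVec m j) u (g j))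
    (hu : LocallyIntegrable u) (hg : ∀ j, LocallyIntegrable (g j))
    {χ : Pt m → ℂ} (hχ : ContDiff ℝ ∞ χ) (hχc : HasCompactSupport χ) (hχO : tsupport χ ⊆ O)
    (hPu : LocallyIntegrable fun x => P x * u x) {ψ : Pt m → ℂ} (hψ : ContDiff ℝ ∞ ψ) :
    ∫ x, (χ x * u x) * lapl ψ x
      = ∫ x, (-(χ x * (P x * u x)) + (2 * (∑ j, g j x * pd j χ x) + u x * lapl χ x)) * ψ x := by
  have hi : ∀ {f : Pt m → ℂ} {η : Pt m → ℂ}, LocallyIntegrable f → ContDiff ℝ ∞ η →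
      HasCompactSupport η → Integrable fun x => f x * η x := by
    intro f η hf hη hηc
    simpa [mul_comm] using hf.integrable_smul_left_of_hasCompactSupport hη.continuous hηc
  have hsub : ∀ {η : Pt m → ℂ}, tsupport (fun x => χ x * η x) ⊆ O := fun {η} =>
    (tsupport_mul_subset_left (f := χ) (g := η)).trans hχO
  have hsub' : ∀ {η : Pt m → ℂ} j, tsupport (fun x => pd j χ x * η x) ⊆ O := fun {η} j =>
    ((tsupport_mul_subset_left (f := pd j χ) (g := η)).trans
      (tsupport_fderiv_apply_subset ℝ _)).trans hχO
  have c1 : ∀ j, ContDiff ℝ ∞ (pd j χ) := fun j => contDiff_pd hχ j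
  have c2 : ∀ j, ContDiff ℝ ∞ (pd j (pd j χ)) := fun j => contDiff_pd (c1 j) j
  have d1 : ∀ j, ContDiff ℝ ∞ (pd j ψ) := fun j => contDiff_pd hψ j
  have k1 : ∀ j, HasCompactSupport (pd j χ) := fun j => hasCompactSupport_pd hχc j
  have k2 : ∀ j, HasCompactSupport (pd j (pd j χ)) := fun j => hasCompactSupport_pd (k1 j) j
  -- the termwise identity
  have hj : ∀ j, ∫ x, u x * (χ x * pd j (pd j ψ) x)
      = -(∫ x, g j x * pd j (fun y => χ y * ψ y) x) + 2 * (∫ x, g j x * (pd j χ x * ψ x))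
        + ∫ x, u x * (pd j (pd j χ) x * ψ x) := by
    intro j
    have e1 := hw j (fun x => χ x * pd j ψ x) (hχ.mul (d1 j)) hχc.mul_right hsub
    have e2 := hw j (fun x => pd j χ x * ψ x) ((c1 j).mul hψ) (k1 j).mul_right (hsub' j)
    change ∫ x, u x * pd j (fun x => χ x * pd j ψ x) x = _ at e1
    change ∫ x, u x * pd j (fun x => pd j χ x * ψ x) x = _ at e2
    simp_rw [pd_mul hχ (d1 j), mul_add] at e1
    simp_rw [pd_mul (c1 j) hψ, mul_add] at e2
    rw [integral_add (hi hu ((c1 j).mul (d1 j)) (k1 j).mul_right)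
      (hi hu (hχ.mul (contDiff_pd (d1 j) j)) hχc.mul_right)] at e1
    rw [integral_add (hi hu ((c2 j).mul hψ) (k2 j).mul_right)
      (hi hu ((c1 j).mul (d1 j)) (k1 j).mul_right)] at e2
    have e3 : ∫ x, g j x * pd j (fun y => χ y * ψ y) x
        = (∫ x, g j x * (pd j χ x * ψ x)) + ∫ x, g j x * (χ x * pd j ψ x) := by
      simp_rw [pd_mul hχ hψ, mul_add]
      exact integral_add (hi (hg j) ((c1 j).mul hψ) (k1 j).mul_right)
        (hi (hg j) (hχ.mul (d1 j)) hχc.mul_right)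
    rw [e3]
    linear_combination e1 - e2
  have hsol := hs (fun x => χ x * ψ x) (hχ.mul hψ) hχc.mul_right hsub
  have hcs : ∀ j, HasCompactSupport (pd j fun y => χ y * ψ y) := fun j =>
    hasCompactSupport_pd (f := fun y => χ y * ψ y) hχc.mul_right j
  rw [integral_finsetSum _ fun j _ => hi (hg j) (contDiff_pd (hχ.mul hψ) j) (hcs j)] at hsol
  have l1 : ∀ x, (χ x * u x) * lapl ψ x = ∑ j, u x * (χ x * pd j (pd j ψ) x) := by
    intro x; rw [lapl, Finset.mul_sum]; exact Finset.sum_congr rfl fun j _ => by ring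
  have l2 : ∀ x, (-(χ x * (P x * u x)) + (2 * (∑ j, g j x * pd j χ x) + u x * lapl χ x)) * ψ x
      = -(P x * u x * (χ x * ψ x)) + ((∑ j, 2 * (g j x * (pd j χ x * ψ x)))
        + ∑ j, u x * (pd j (pd j χ) x * ψ x)) := by
    intro x
    rw [← Finset.mul_sum, lapl, add_mul, add_mul, Finset.mul_sum (a := u x), Finset.sum_mul,
      mul_assoc 2, Finset.sum_mul]
    simp_rw [mul_assoc]
    ring
  simp_rw [l1, l2]
  have n1 : ∀ j, Integrable fun x => 2 * (g j x * (pd j χ x * ψ x)) := fun j =>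
    (hi (hg j) ((c1 j).mul hψ) (k1 j).mul_right).const_mul 2
  have n2 : ∀ j, Integrable fun x => u x * (pd j (pd j χ) x * ψ x) := fun j =>
    hi hu ((c2 j).mul hψ) (k2 j).mul_right
  have n3 : Integrable fun x => -(P x * u x * (χ x * ψ x)) :=
    (hi hPu (hχ.mul hψ) hχc.mul_right).neg
  have n12 : Integrable fun x => (∑ j, 2 * (g j x * (pd j χ x * ψ x)))
      + ∑ j, u x * (pd j (pd j χ) x * ψ x) :=
    (integrable_finsetSum _ fun j _ => n1 j).add (integrable_finsetSum _ fun j _ => n2 j)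
  rw [integral_finsetSum _ fun j _ => hi hu (hχ.mul (contDiff_pd (d1 j) j)) hχc.mul_right,
    integral_add n3 n12,
    integral_add (integrable_finsetSum _ fun j _ => n1 j) (integrable_finsetSum _ fun j _ => n2 j),
    integral_finsetSum _ fun j _ => n1 j, integral_finsetSum _ fun j _ => n2 j, integral_neg,
    ← hsol, Finset.sum_congr rfl fun j _ => hj j, Finset.sum_add_distrib, Finset.sum_add_distrib,
    Finset.sum_neg_distrib]
  simp_rw [integral_const_mul]
  ring

lemma integrable_weight_mul_sq_of_memLp {a : Pt m → ℝ} (ha : Continuous a) {K : Set (Pt m)}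
    (hK : IsCompact K) {w : Pt m → ℂ} (hw : MemLp w 2 volume) (h0 : ∀ x ∉ K, w x = 0) :
    Integrable fun x => a x * ‖w x‖ ^ 2 := by
  obtain ⟨A, hA⟩ := hK.exists_bound_of_continuousOn ha.continuousOn
  refine (hw.norm.integrable_sq.const_mul A).mono'
    (ha.aestronglyMeasurable.mul (hw.1.norm.pow 2)) (Eventually.of_forall fun x => ?_)
  by_cases hx : x ∈ K
  · rw [norm_mul, norm_pow, norm_norm]
    exact mul_le_mul_of_nonneg_right (hA x hx) (by positivity)
  · simp [h0 x hx]

/-- A smooth cutoff function around `z`, which is radial in the Euclidean sense. -/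
def ballCutoff (z : Pt m) (δ : ℝ) (x : Pt m) : ℂ :=
  (Real.smoothTransition (2 - 4 * distSq z x / δ ^ 2) : ℝ)

lemma contDiff_ballCutoff (z : Pt m) (δ : ℝ) : ContDiff ℝ ∞ (ballCutoff z δ) :=
  Complex.ofRealCLM.contDiff.comp (Real.smoothTransition.contDiff.comp
    (contDiff_const.sub ((contDiff_const.mul (contDiff_distSq z)).div_const _)))

lemma ballCutoff_eq_one {z x : Pt m} {δ : ℝ} (hδ : 0 < δ) (h : distSq z x ≤ δ ^ 2 / 4) :
    ballCutoff z δ x = 1 := by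
  rw [ballCutoff, Real.smoothTransition.one_of_one_le, Complex.ofReal_one]
  have : 4 * distSq z x / δ ^ 2 ≤ 1 := by
    rw [div_le_one (by positivity)]; linarith
  linarith

lemma ballCutoff_eq_zero {z x : Pt m} {δ : ℝ} (hδ : 0 < δ) (h : δ ^ 2 / 2 ≤ distSq z x) :
    ballCutoff z δ x = 0 := by
  rw [ballCutoff, Real.smoothTransition.zero_of_nonpos, Complex.ofReal_zero]
  have : 2 ≤ 4 * distSq z x / δ ^ 2 := by
    rw [le_div_iff₀ (by positivity)]; linarith
  linarith

lemma tsupport_ballCutoff_subset (z : Pt m) {δ : ℝ} (hδ : 0 < δ) :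
    tsupport (ballCutoff z δ) ⊆ {x | distSq z x ≤ δ ^ 2} := by
  refine closure_minimal (fun x hx => ?_)
    (isClosed_le (contDiff_distSq z).continuous continuous_const)
  by_contra h
  rw [mem_ofPred_eq, not_le] at h
  exact hx (ballCutoff_eq_zero hδ (by nlinarith))

lemma pd_ballCutoff_eq_zero {z x : Pt m} {δ : ℝ} (hδ : 0 < δ) (h : distSq z x < δ ^ 2 / 4)
    (j : Dir m) : pd j (ballCutoff z δ) x = 0 := by
  have h1 : ballCutoff z δ =ᶠ[𝓝 x] fun _ => (1 : ℂ) := by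
    filter_upwards [(isOpen_lt (contDiff_distSq z).continuous continuous_const).mem_nhds h] with y hy
    exact ballCutoff_eq_one hδ (le_of_lt hy)
  rw [pd, h1.fderiv_eq]; simp

lemma lapl_ballCutoff_eq_zero {z x : Pt m} {δ : ℝ} (hδ : 0 < δ) (h : distSq z x < δ ^ 2 / 4) :
    lapl (ballCutoff z δ) x = 0 := by
  refine Finset.sum_eq_zero fun j _ => ?_
  have h1 : pd j (ballCutoff z δ) =ᶠ[𝓝 x] fun _ => (0 : ℂ) := by
    filter_upwards [(isOpen_lt (contDiff_distSq z).continuous continuous_const).mem_nhds h] with y hy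
    exact pd_ballCutoff_eq_zero hδ hy j
  rw [pd, h1.fderiv_eq]; simp

/-- The geometry of the Carleman weight centred at distance `r / 8` behind a point `z` of the sphere
of radius `r` about `c`, with axis pointing from `z` to `c`. The first estimate makes the weight
convex enough near `z`; the second says that outside the ball the weight is below its value
at `z`. -/
lemma carlemanWeight_geometry {c z : Pt m} {r δ : ℝ} (hr : 0 < r) (hc : distSq c z = r ^ 2)
    (hδ : 0 < δ) (hδr : δ ≤ r / 100) :
    ∃ (e : Dir m → ℝ) (o : Pt m), ∑ j, e j ^ 2 = 1 ∧
      ∀ x, distSq z x ≤ δ ^ 2 → r ^ 2 / 32 ≤ 6 * axial e o x ^ 2 - 2 * distSq o x ∧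
        (r ^ 2 ≤ distSq c x →
          carlemanWeight e o x ≤ carlemanWeight e o z - distSq z x / 4) := by
  set e : Dir m → ℝ := fun j => coord m j (c - z) / r with he
  have he1 : ∑ j, e j ^ 2 = 1 := by
    have : ∑ j, e j ^ 2 = distSq c z / r ^ 2 := by
      rw [distSq, Finset.sum_div]
      refine Finset.sum_congr rfl fun j _ => ?_
      rw [he]; simp only [map_sub]; ring
    rw [this, hc, div_self (by positivity)]
  set o : Pt m := z - (r / 8) • ∑ j, e j • dirVec m j with ho
  have hco : ∀ x j, coord m j (x - o) = coord m j (x - z) + r / 8 * e j := by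
    intro x j
    have : x - o = (x - z) + (r / 8) • ∑ j, e j • dirVec m j := by rw [ho]; abel
    rw [this, map_add, map_smul, map_sum]
    simp [coord_dirVec, -Fintype.sum_sum_type]
  have hcc : ∀ x j, coord m j (x - c) = coord m j (x - z) - r * e j := by
    intro x j
    rw [he]
    simp only [map_sub]
    field_simp
    ring
  have hax : ∀ x, axial e o x = axial e z x + r / 8 := by
    intro x
    simp only [axial, hco, mul_add, Finset.sum_add_distrib]
    have : ∑ j, e j * (r / 8 * e j) = r / 8 * ∑ j, e j ^ 2 := by
      rw [Finset.mul_sum]; exact Finset.sum_congr rfl fun j _ => by ring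
    rw [this, he1, mul_one]
  have hexp : ∀ (x : Pt m) (s : ℝ), ∑ j, (coord m j (x - z) + s * e j) ^ 2
      = distSq z x + 2 * s * axial e z x + s ^ 2 := by
    intro x s
    have : ∀ j, (coord m j (x - z) + s * e j) ^ 2 = coord m j (x - z) ^ 2
        + 2 * s * (e j * coord m j (x - z)) + s ^ 2 * e j ^ 2 := fun j => by ring
    simp_rw [this, Finset.sum_add_distrib, ← Finset.mul_sum, he1, mul_one]
    rfl
  have hdo : ∀ x, distSq o x = distSq z x + 2 * (r / 8) * axial e z x + (r / 8) ^ 2 := by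
    intro x
    rw [← hexp, distSq]; simp_rw [hco]
  have hdc : ∀ x, distSq c x = distSq z x + 2 * (-r) * axial e z x + (-r) ^ 2 := by
    intro x
    rw [← hexp, distSq]; simp_rw [hcc]
    exact Finset.sum_congr rfl fun j _ => by ring
  have haz : axial e z z = 0 := by simp [axial, -Fintype.sum_sum_type]
  refine ⟨e, o, he1, fun x hx => ?_⟩
  have hY : axial e z x ^ 2 ≤ distSq z x := by
    have := Finset.sum_mul_sq_le_sq_mul_sq Finset.univ e fun j => coord m j (x - z)
    rwa [he1, one_mul] at this
  have hD := distSq_nonneg z x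
  simp only [carlemanWeight, hax, hdo, haz, distSq_self, hdc]
  set Y := axial e z x
  set D := distSq z x
  have hYδ : |Y| ≤ δ := abs_le_of_sq_le_sq (hY.trans hx) hδ.le
  obtain ⟨hY1, hY2⟩ := abs_le.1 hYδ
  have hD2 : D ≤ (r / 100) ^ 2 := hx.trans (by gcongr)
  constructor
  · nlinarith [mul_nonneg (sub_nonneg.2 (hY1.trans' (neg_le_neg hδr))) hr.le, sq_nonneg Y]
  · intro hb
    have hb' : 2 * r * Y ≤ D := by nlinarith
    rcases le_or_gt 0 Y with h | h
    · nlinarith [mul_nonneg h (sub_nonneg.2 (hY2.trans hδr))]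
    · nlinarith [mul_nonneg (neg_nonneg.2 h.le) (by linarith : 0 ≤ Y + r / 100)]

lemma pd_eq_zero_of_notMem {χ : Pt m → ℂ} {K : Set (Pt m)} (hχK : tsupport χ ⊆ K) {x : Pt m}
    (hx : x ∉ K) (j : Dir m) : pd j χ x = 0 := by
  have h : x ∉ tsupport (pd j χ) := fun h => hx (hχK (tsupport_fderiv_apply_subset ℝ _ h))
  exact image_eq_zero_of_notMem_tsupport h

lemma lapl_eq_zero_of_notMem {χ : Pt m → ℂ} {K : Set (Pt m)} (hχK : tsupport χ ⊆ K) {x : Pt m}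
    (hx : x ∉ K) : lapl χ x = 0 :=
  Finset.sum_eq_zero fun j _ =>
    pd_eq_zero_of_notMem (χ := pd j χ)
      (((tsupport_fderiv_apply_subset ℝ (dirVec m j) :
        tsupport (pd j χ) ⊆ tsupport χ)).trans hχK) hx j

set_option maxHeartbeats 800000 in
/-- Unique continuation across a sphere: a weak solution which vanishes in a ball vanishes near every
point of the bounding sphere. -/
lemma eventually_eq_zero_of_ball {O : Set (Pt m)} (hO : IsOpen O) {u P : Pt m → ℂ}
    {g : Dir m → Pt m → ℂ} (hs : SolvesOn O u g P)
    (hw : ∀ j, HasWeakDerivOn volume O (dirVec m j) u (g j))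
    (hu : MemLp u 2 volume) (hg : ∀ j, MemLp (g j) 2 volume)
    (hP : AEStronglyMeasurable P volume) {M : ℝ} (hPM : ∀ᵐ x, ‖P x‖ ≤ M)
    {c z : Pt m} {r : ℝ} (hr : 0 < r) (hc : distSq c z = r ^ 2) (hz : z ∈ O)
    (hball : ∀ᵐ x, x ∈ O → distSq c x < r ^ 2 → u x = 0) :
    ∃ W ∈ 𝓝 z, ∀ᵐ x, x ∈ W → u x = 0 := by
  obtain ⟨δ₀, hδ₀, hδO⟩ := exists_distSq_le_subset hO hz
  set δ := min δ₀ (r / 100) with hδd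
  have hδ : 0 < δ := lt_min hδ₀ (by positivity)
  have hδO' : {x | distSq z x ≤ δ ^ 2} ⊆ O := fun x hx =>
    hδO (le_trans (mem_ofPred_eq ▸ hx) (by gcongr; exact min_le_left _ _))
  obtain ⟨e, o, he, hgeo⟩ := carlemanWeight_geometry hr hc hδ (min_le_right _ _)
  obtain ⟨χ, hχd⟩ : ∃ χ, χ = ballCutoff z δ := ⟨_, rfl⟩
  have hχ : ContDiff ℝ ∞ χ := hχd ▸ contDiff_ballCutoff z δ
  obtain ⟨K, hKd⟩ : ∃ K, K = {x | distSq z x ≤ δ ^ 2} := ⟨_, rfl⟩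
  rw [← hKd] at hδO'
  replace hgeo : ∀ x ∈ K, _ := fun x hx => hgeo x (by rw [hKd] at hx; exact hx)
  have hK : IsCompact K := hKd ▸ isCompact_distSq_le z _
  have hχK : tsupport χ ⊆ K := by rw [hχd, hKd]; exact tsupport_ballCutoff_subset z hδ
  have hχc : HasCompactSupport χ := hK.of_isClosed_subset (isClosed_tsupport _) hχK
  have hχ0 : ∀ x ∉ K, χ x = 0 := fun x hx => image_eq_zero_of_notMem_tsupport fun h => hx (hχK h)
  have hdχ0 : ∀ j, ∀ x ∉ K, pd j χ x = 0 := fun j x hx => pd_eq_zero_of_notMem hχK hx j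
  have hlχ0 : ∀ x ∉ K, lapl χ x = 0 := fun x hx => lapl_eq_zero_of_notMem hχK hx
  have hbd : ∀ {η f : Pt m → ℂ}, Continuous η → HasCompactSupport η → MemLp f 2 volume →
      MemLp (fun x => η x * f x) 2 volume := by
    intro η f hη hηc hf
    obtain ⟨C, hC⟩ := hη.bounded_above_of_compact_support hηc
    refine hf.of_le_mul (c := C) (hη.aestronglyMeasurable.mul hf.1)
      (Eventually.of_forall fun x => ?_)
    rw [norm_mul]
    exact mul_le_mul_of_nonneg_right (hC x) (norm_nonneg _)
  have hM0 : 0 ≤ M := by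
    obtain ⟨x, hx⟩ := hPM.exists
    exact (norm_nonneg _).trans hx
  have hPu : MemLp (fun x => P x * u x) 2 volume := by
    refine hu.of_le_mul (c := M) (hP.mul hu.1) ?_
    filter_upwards [hPM] with x hx
    rw [norm_mul]
    exact mul_le_mul_of_nonneg_right hx (norm_nonneg _)
  have hli : ∀ {f : Pt m → ℂ}, MemLp f 2 volume → LocallyIntegrable f := fun hf =>
    hf.locallyIntegrable (by norm_num)
  set w : Pt m → ℂ := fun x => χ x * u x with hwd
  set f₂ : Pt m → ℂ := fun x => 2 * (∑ j, g j x * pd j χ x) + u x * lapl χ x with hf₂d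
  set f : Pt m → ℂ := fun x => -(χ x * (P x * u x)) + f₂ x with hfd
  have hw2 : MemLp w 2 volume := hbd hχ.continuous hχc hu
  have hf₂2 : MemLp f₂ 2 volume := by
    have a1 : ∀ j, MemLp (fun x => g j x * pd j χ x) 2 volume := fun j =>
      (hbd (contDiff_pd hχ j).continuous (hasCompactSupport_pd hχc j) (hg j)).congr_norm
        ((hg j).1.mul (contDiff_pd hχ j).continuous.aestronglyMeasurable)
        (Eventually.of_forall fun x => by rw [mul_comm])
    have a2 : MemLp (fun x => u x * lapl χ x) 2 volume :=
      (hbd (contDiff_lapl hχ).continuous (HasCompactSupport.intro hK hlχ0) hu).congr_norm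
        (hu.1.mul (contDiff_lapl hχ).continuous.aestronglyMeasurable)
        (Eventually.of_forall fun x => by rw [mul_comm])
    have a3 : MemLp (fun x => ∑ j, g j x * pd j χ x) 2 volume :=
      memLp_finsetSum _ fun j _ => a1 j
    exact (a3.const_mul 2).add a2
  have hf2 : MemLp f 2 volume := (hbd hχ.continuous hχc hPu).neg.add hf₂2
  have hwK : ∀ x ∉ K, w x = 0 := fun x hx => by simp [hwd, hχ0 x hx]
  have hf₂K : ∀ x ∉ K, f₂ x = 0 := fun x hx => by simp [hf₂d, hdχ0 _ x hx, hlχ0 x hx]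
  have hfK : ∀ x ∉ K, f x = 0 := fun x hx => by simp [hfd, hχ0 x hx, hf₂K x hx]
  have hlap : ∀ ψ : Pt m → ℂ, ContDiff ℝ ∞ ψ → HasCompactSupport ψ →
      ∫ x, w x * lapl ψ x = ∫ x, f x * ψ x := fun ψ hψ _ =>
    hs.integral_mul_lapl hw (hli hu) (fun j => hli (hg j)) hχ hχc (hχK.trans hδO') (hli hPu) hψ
  -- the remainder `f₂` lives where the weight is small
  have hBopen : IsOpen (O ∩ {x | distSq c x < r ^ 2}) :=
    hO.inter (isOpen_lt (contDiff_distSq c).continuous continuous_const)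
  have hgball : ∀ j, ∀ᵐ x, x ∈ O ∩ {x | distSq c x < r ^ 2} → g j x = 0 := fun j =>
    (hw j).eq_zero_of_eq_zero (hli (hg j)) hBopen inter_subset_left
      (by filter_upwards [hball] with x hx h using hx h.1 h.2)
  set φz := carlemanWeight e o z with hφz
  set η := δ ^ 2 / 16 with hη
  have hηpos : 0 < η := by positivity
  have hf₂small : ∀ᵐ x, f₂ x ≠ 0 → carlemanWeight e o x ≤ φz - η := by
    filter_upwards [hball, ae_all_iff.2 hgball] with x h1 h2 h3
    by_cases hxK : x ∈ K
    · by_cases hxb : distSq c x < r ^ 2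
      · refine absurd ?_ h3
        simp [hf₂d, h1 (hδO' hxK) hxb, fun j => h2 j ⟨hδO' hxK, hxb⟩]
      · by_cases hxδ : distSq z x < δ ^ 2 / 4
        · refine absurd ?_ h3
          simp [hf₂d, hχd, pd_ballCutoff_eq_zero hδ hxδ, lapl_ballCutoff_eq_zero hδ hxδ]
        · have := (hgeo x hxK).2 (not_lt.1 hxb)
          rw [hη]; linarith
    · exact absurd (hf₂K x hxK) h3
  -- a neighbourhood of `z` on which the weight is large
  set W := {x | distSq z x < δ ^ 2 / 4} ∩ {x | φz - η / 2 < carlemanWeight e o x} with hWd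
  have hWo : IsOpen W := (isOpen_lt (contDiff_distSq z).continuous continuous_const).inter
    (isOpen_lt continuous_const (contDiff_carlemanWeight e o).continuous)
  have hWz : z ∈ W := ⟨by rw [mem_ofPred_eq, distSq_self]; positivity,
    by rw [mem_ofPred_eq]; linarith⟩
  refine ⟨W, hWo.mem_nhds hWz, ?_⟩
  set E : ℝ → Pt m → ℝ := fun τ x => Real.exp (2 * τ * carlemanWeight e o x) with hE
  have hEc : ∀ τ, Continuous (E τ) := fun τ => (continuous_carleman_weights e o τ).2
  have hwint : ∀ τ, Integrable fun x => E τ x * ‖w x‖ ^ 2 := fun τ =>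
    integrable_weight_mul_sq_of_memLp (hEc τ) hK hw2 hwK
  have hfint : ∀ τ, Integrable fun x => E τ x * ‖f x‖ ^ 2 := fun τ =>
    integrable_weight_mul_sq_of_memLp (hEc τ) hK hf2 hfK
  have hf₂int : ∀ τ, Integrable fun x => E τ x * ‖f₂ x‖ ^ 2 := fun τ =>
    integrable_weight_mul_sq_of_memLp (hEc τ) hK hf₂2 hf₂K
  -- for a large parameter the term with the potential is absorbed in the left hand side
  have hcarl : ∀ τ : ℝ, 0 ≤ τ → 2 * M ^ 2 + 1 ≤ τ ^ 3 * r ^ 2 / 8 - 4 * τ ^ 2 →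
      ∫ x, E τ x * ‖w x‖ ^ 2 ≤ 2 * ∫ x, E τ x * ‖f₂ x‖ ^ 2 := by
    intro τ hτ hbig
    have h1 := carleman_weak he o hτ hw2 hf2 hK hwK hfK hlap
    have h2 : (2 * M ^ 2 + 1) * ∫ x, E τ x * ‖w x‖ ^ 2
        ≤ ∫ x, ((4 * τ ^ 3 * (6 * axial e o x ^ 2 - 2 * distSq o x) - 4 * τ ^ 2)
        * Real.exp (2 * τ * carlemanWeight e o x)) * ‖w x‖ ^ 2 := by
      rw [← integral_const_mul]
      refine integral_mono ((hwint τ).const_mul _) (integrable_weight_mul_sq_of_memLp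
        (continuous_carleman_weights e o τ).1 hK hw2 hwK) fun x => ?_
      by_cases hx : x ∈ K
      · have h3 := (hgeo x hx).1
        have h4 : 2 * M ^ 2 + 1
            ≤ 4 * τ ^ 3 * (6 * axial e o x ^ 2 - 2 * distSq o x) - 4 * τ ^ 2 := by
          have := mul_le_mul_of_nonneg_left h3 (by positivity : 0 ≤ 4 * τ ^ 3)
          linarith
        simp only [hE]
        rw [← mul_assoc]
        gcongr
      · simp [hwK x hx]
    have h3 : ∫ x, E τ x * ‖f x‖ ^ 2
        ≤ ∫ x, (2 * M ^ 2 * (E τ x * ‖w x‖ ^ 2) + 2 * (E τ x * ‖f₂ x‖ ^ 2)) := by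
      refine integral_mono_ae (hfint τ) (((hwint τ).const_mul _).add ((hf₂int τ).const_mul _)) ?_
      filter_upwards [hPM] with x hx
      have h4 : ‖f x‖ ≤ M * ‖w x‖ + ‖f₂ x‖ := by
        refine (norm_add_le _ _).trans (add_le_add_left ?_ _)
        rw [norm_neg, hwd, norm_mul, norm_mul, norm_mul]
        have := mul_le_mul_of_nonneg_left hx (mul_nonneg (norm_nonneg (χ x)) (norm_nonneg (u x)))
        nlinarith
      have h5 : ‖f x‖ ^ 2 ≤ 2 * M ^ 2 * ‖w x‖ ^ 2 + 2 * ‖f₂ x‖ ^ 2 := by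
        have := pow_le_pow_left₀ (norm_nonneg _) h4 2
        nlinarith [sq_nonneg (M * ‖w x‖ - ‖f₂ x‖)]
      have hEp : 0 ≤ E τ x := (Real.exp_pos _).le
      nlinarith [mul_le_mul_of_nonneg_left h5 hEp]
    rw [integral_add ((hwint τ).const_mul _) ((hf₂int τ).const_mul _), integral_const_mul,
      integral_const_mul] at h3
    have h6 := h2.trans (h1.trans h3)
    linarith
  -- let the parameter of the weight tend to infinity
  have hfin : ∀ τ : ℝ, 0 ≤ τ → 2 * M ^ 2 + 1 ≤ τ ^ 3 * r ^ 2 / 8 - 4 * τ ^ 2 →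
      ∫ x in W, ‖u x‖ ^ 2 ≤ 2 * Real.exp (-(τ * η)) * ∫ x, ‖f₂ x‖ ^ 2 := by
    intro τ hτ hbig
    have h1 := hcarl τ hτ hbig
    have h2 : ∫ x, E τ x * ‖f₂ x‖ ^ 2
        ≤ Real.exp (2 * τ * (φz - η)) * ∫ x, ‖f₂ x‖ ^ 2 := by
      rw [← integral_const_mul]
      refine integral_mono_ae (hf₂int τ) (hf₂2.norm.integrable_sq.const_mul _) ?_
      filter_upwards [hf₂small] with x hx
      by_cases h0 : f₂ x = 0
      · simp [h0]
      · simp only [hE]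
        have := hx h0
        gcongr
    have h3 : Real.exp (2 * τ * (φz - η / 2)) * ∫ x in W, ‖u x‖ ^ 2
        ≤ ∫ x, E τ x * ‖w x‖ ^ 2 := by
      rw [← integral_const_mul]
      refine le_trans (setIntegral_mono_on ((hu.norm.integrable_sq.const_mul _).integrableOn)
        (hwint τ).integrableOn hWo.measurableSet fun x hx => ?_)
        (setIntegral_le_integral (hwint τ) (Eventually.of_forall fun x => by positivity))
      have h4 : w x = u x := by
        simp only [hwd, hχd]
        rw [ballCutoff_eq_one hδ (le_of_lt hx.1), one_mul]
      rw [h4]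
      simp only [hE]
      have hx2 : φz - η / 2 < carlemanWeight e o x := hx.2
      have := hx2.le
      gcongr
    have h5 : Real.exp (2 * τ * (φz - η)) = Real.exp (2 * τ * (φz - η / 2)) * Real.exp (-(τ * η)) := by
      rw [← Real.exp_add]; congr 1; ring
    have h6 : Real.exp (2 * τ * (φz - η / 2)) * ∫ x in W, ‖u x‖ ^ 2
        ≤ Real.exp (2 * τ * (φz - η / 2)) * (2 * Real.exp (-(τ * η)) * ∫ x, ‖f₂ x‖ ^ 2) := by
      rw [h5] at h2
      linarith
    exact le_of_mul_le_mul_left h6 (Real.exp_pos _)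
  have hlim : Tendsto (fun τ : ℝ => 2 * Real.exp (-(τ * η)) * ∫ x, ‖f₂ x‖ ^ 2) atTop (𝓝 0) := by
    have h1 : Tendsto (fun τ : ℝ => Real.exp (-(τ * η))) atTop (𝓝 0) :=
      Real.tendsto_exp_neg_atTop_nhds_zero.comp (tendsto_id.atTop_mul_const hηpos)
    simpa using (h1.const_mul 2).mul_const (∫ x, ‖f₂ x‖ ^ 2)
  have hev : ∀ᶠ τ : ℝ in atTop, 0 ≤ τ ∧ 2 * M ^ 2 + 1 ≤ τ ^ 3 * r ^ 2 / 8 - 4 * τ ^ 2 := by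
    filter_upwards [eventually_ge_atTop (max 1 ((2 * M ^ 2 + 5) * 8 / r ^ 2))] with τ hτ
    have h1 : 1 ≤ τ := (le_max_left _ _).trans hτ
    have h2 : (2 * M ^ 2 + 5) * 8 / r ^ 2 ≤ τ := (le_max_right _ _).trans hτ
    rw [div_le_iff₀ (by positivity)] at h2
    refine ⟨by linarith, ?_⟩
    have h3 : τ ^ 2 * (2 * M ^ 2 + 5) ≤ τ ^ 3 * r ^ 2 / 8 := by
      have := mul_le_mul_of_nonneg_left h2 (sq_nonneg τ)
      linarith
    nlinarith [sq_nonneg M, mul_nonneg (sub_nonneg.2 (one_le_pow₀ h1 : 1 ≤ τ ^ 2)) (sq_nonneg M)]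
  have hzero : ∫ x in W, ‖u x‖ ^ 2 ≤ 0 :=
    ge_of_tendsto hlim (hev.mono fun τ h => hfin τ h.1 h.2)
  have hzero' : ∫ x in W, ‖u x‖ ^ 2 = 0 :=
    le_antisymm hzero (integral_nonneg fun x => by positivity)
  rw [integral_eq_zero_iff_of_nonneg (fun x => by positivity) hu.norm.integrable_sq.integrableOn]
    at hzero'
  have := (ae_restrict_iff' hWo.measurableSet).1 hzero'
  filter_upwards [this] with x hx hxW
  simpa using hx hxW

/-- **Unique continuation**: a weak solution in a connected open set which vanishes on a nonempty
open subset vanishes identically. -/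
theorem eq_zero_of_eq_zero_on_open {O V : Set (Pt m)} (hO : IsOpen O) (hOc : IsPreconnected O)
    (hV : IsOpen V) (hVn : V.Nonempty) (hVO : V ⊆ O) {u P : Pt m → ℂ}
    {g : Dir m → Pt m → ℂ} (hs : SolvesOn O u g P)
    (hw : ∀ j, HasWeakDerivOn volume O (dirVec m j) u (g j))
    (hu : MemLp u 2 volume) (hg : ∀ j, MemLp (g j) 2 volume)
    (hP : AEStronglyMeasurable P volume) {M : ℝ} (hPM : ∀ᵐ x, ‖P x‖ ≤ M)
    (hu0 : ∀ᵐ x, x ∈ V → u x = 0) : ∀ᵐ x, x ∈ O → u x = 0 := by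
  set Z : Set (Pt m) := {x | ∃ W ∈ 𝓝 x, ∀ᵐ y, y ∈ W → u y = 0} with hZ
  have hZo : IsOpen Z := by
    rw [isOpen_iff_mem_nhds]
    rintro x ⟨W, hW, h⟩
    obtain ⟨W', hW'W, hW'o, hxW'⟩ := mem_nhds_iff.1 hW
    exact mem_of_superset (hW'o.mem_nhds hxW') fun y hy =>
      ⟨W', hW'o.mem_nhds hy, h.mono fun a ha hh => ha (hW'W hh)⟩
  have hZae : ∀ᵐ x, x ∈ Z → u x = 0 := by
    rw [ae_iff]
    refine measure_null_of_locally_null _ fun x hx => ?_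
    simp only [mem_ofPred_eq, Classical.not_imp] at hx
    obtain ⟨W, hW, h⟩ := hx.1
    refine ⟨W ∩ {a | ¬ (a ∈ Z → u a = 0)}, inter_mem (mem_nhdsWithin_of_mem_nhds hW)
      self_mem_nhdsWithin, ?_⟩
    refine measure_mono_null (fun a ha => ?_) (ae_iff.1 h)
    simp only [mem_inter_iff, mem_ofPred_eq, Classical.not_imp] at ha ⊢
    exact ⟨ha.1, ha.2.2⟩
  have hVZ : V ⊆ Z := fun x hx => ⟨V, hV.mem_nhds hx, hu0⟩
  have hsub : O ⊆ Z := by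
    refine hOc.subset_of_closure_inter_subset hZo ?_ ?_
    · obtain ⟨x, hx⟩ := hVn
      exact ⟨x, hVO hx, hVZ hx⟩
    rintro z₀ ⟨hz₀c, hz₀O⟩
    by_contra hz₀Z
    obtain ⟨δ, hδ, hδO⟩ := exists_distSq_le_subset hO hz₀O
    have hnb : {x | distSq z₀ x < δ ^ 2 / 4} ∈ 𝓝 z₀ :=
      (isOpen_lt (contDiff_distSq z₀).continuous continuous_const).mem_nhds
        (by rw [mem_ofPred_eq, distSq_self]; positivity)
    obtain ⟨c, hcn, hcZ⟩ := mem_closure_iff_nhds.1 hz₀c _ hnb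
    rw [mem_ofPred_eq, distSq_comm] at hcn
    -- a point of the complement of `Z` nearest to `c`
    have hSc : IsCompact ({x | distSq c x ≤ distSq c z₀} \ Z) :=
      (isCompact_distSq_le c _).diff hZo
    obtain ⟨z, hz, hmin⟩ := hSc.exists_isMinOn ⟨z₀, ⟨show distSq c z₀ ≤ distSq c z₀ from le_rfl, hz₀Z⟩⟩
      (contDiff_distSq c).continuous.continuousOn
    have hzc : distSq c z ≤ distSq c z₀ := hz.1
    have hzO : z ∈ O := hδO (by
      have := distSq_le_two z₀ c z
      rw [mem_ofPred_eq]
      linarith)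
    have hpos : 0 < distSq c z := by
      refine (distSq_nonneg c z).lt_of_ne fun h => hz.2 ?_
      rw [eq_of_distSq_eq_zero h.symm]; exact hcZ
    refine hz.2 (eventually_eq_zero_of_ball hO hs hw hu hg hP hPM (Real.sqrt_pos.2 hpos)
      (Real.sq_sqrt hpos.le).symm hzO ?_)
    rw [Real.sq_sqrt hpos.le]
    filter_upwards [hZae] with x hx _ hlt
    refine hx (by_contra fun hxZ => ?_)
    exact absurd (isMinOn_iff.1 hmin x ⟨(hlt.le.trans hzc), hxZ⟩) (not_le.2 hlt)
  filter_upwards [hZae] with x hx hxO using hx (hsub hxO)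

end Cutoff

/-! ### Integration by parts in the layer -/

section Green

variable {m : ℕ} {R : ℝ}

/-- Extension by zero of an element of `L²(Ω^R)`. -/
def zext (f : L2Slab m R) : Pt m → ℂ := (slab m R).indicator f

lemma measurableSet_slab : MeasurableSet (slab m R) := MeasurableSet.univ.prod measurableSet_Ioo

lemma isOpen_slab : IsOpen (slab m R) := isOpen_univ.prod isOpen_Ioo

lemma eLpNorm_zext (f : L2Slab m R) (p : ENNReal) :
    eLpNorm (zext f) p volume = eLpNorm f p (volume.restrict (slab m R)) :=
  eLpNorm_indicator_eq_eLpNorm_restrict measurableSet_slab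

lemma memLp_zext (f : L2Slab m R) : MemLp (zext f) 2 volume :=
  (memLp_indicator_iff_restrict measurableSet_slab).2 (Lp.memLp f)

lemma eLpNorm_zext_two (f : L2Slab m R) :
    eLpNorm (zext f) 2 volume = ENNReal.ofReal ‖f‖ := by
  rw [eLpNorm_zext, Lp.norm_def, ENNReal.ofReal_toReal (Lp.eLpNorm_ne_top f)]

lemma integral_zext_mul (f : L2Slab m R) (ψ : Pt m → ℂ) :
    ∫ x, zext f x * ψ x = ∫ x in slab m R, f x * ψ x := by
  rw [← integral_indicator measurableSet_slab]
  refine integral_congr_ae (Eventually.of_forall fun x => ?_)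
  simp only [zext]
  by_cases h : x ∈ slab m R <;> simp [h]

lemma zext_eq_zero (f : L2Slab m R) {x : Pt m} (hx : x ∉ slab m R) : zext f x = 0 :=
  indicator_of_notMem hx _

lemma isWeakDeriv_iff {j : Dir m} {u g : L2Slab m R} :
    IsWeakDeriv j u g ↔ HasWeakDerivOn volume (slab m R) (dirVec m j) (zext u) (zext g) := by
  constructor
  · intro h φ h1 h2 h3
    rw [integral_zext_mul, integral_zext_mul]
    exact h φ h1 h2 h3
  · intro h φ h1 h2 h3
    have := h φ h1 h2 h3
    rwa [integral_zext_mul, integral_zext_mul] at this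

lemma HasWeakDerivOn.mul_cutoff {O : Set (Pt m)} {v : Pt m} {u g χ : Pt m → ℂ}
    (h : HasWeakDerivOn volume O v u g) (hu : LocallyIntegrable u) (hg : LocallyIntegrable g)
    (hχ : ContDiff ℝ ∞ χ) {A : Set (Pt m)} (hχO : tsupport χ ∩ A ⊆ O) :
    HasWeakDerivOn volume A v (fun x => χ x * u x) (fun x => χ x * g x + fderiv ℝ χ x v * u x) := by
  intro φ hφ hφc hφA
  have hsub : tsupport (fun x => χ x * φ x) ⊆ O := fun x hx =>
    hχO ⟨tsupport_mul_subset_left (f := χ) (g := φ) hx,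
      hφA (tsupport_mul_subset_right (f := χ) (g := φ) hx)⟩
  have hfd : ∀ {f : Pt m → ℂ}, ContDiff ℝ ∞ f → Continuous fun x => fderiv ℝ f x v :=
    fun hf => (hf.continuous_fderiv (by simp)).clm_apply continuous_const
  have hi : ∀ {f η : Pt m → ℂ}, LocallyIntegrable f → Continuous η →
      HasCompactSupport η → Integrable fun x => f x * η x := by
    intro f η hf hη hηc
    simpa [mul_comm] using hf.integrable_smul_left_of_hasCompactSupport hη hηc
  have h0 := h (fun x => χ x * φ x) (hχ.mul hφ) hφc.mul_left hsub
  have hd : ∀ x, fderiv ℝ (fun x => χ x * φ x) x v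
      = χ x * fderiv ℝ φ x v + fderiv ℝ χ x v * φ x := by
    intro x
    rw [fderiv_fun_mul (hχ.differentiable (by simp) x) (hφ.differentiable (by simp) x)]
    simp [mul_comm]
  simp_rw [hd, mul_add] at h0
  have k1 : HasCompactSupport fun x => fderiv ℝ φ x v := hφc.fderiv_apply (𝕜 := ℝ) v
  have i1 : Integrable fun x => u x * (χ x * fderiv ℝ φ x v) :=
    hi hu (hχ.continuous.mul (hfd hφ)) k1.mul_left
  have i2 : Integrable fun x => u x * (fderiv ℝ χ x v * φ x) :=
    hi hu ((hfd hχ).mul hφ.continuous) hφc.mul_left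
  have i3 : Integrable fun x => g x * (χ x * φ x) :=
    hi hg (hχ.continuous.mul hφ.continuous) hφc.mul_left
  rw [integral_add i1 i2] at h0
  have e1 : ∀ x, χ x * u x * fderiv ℝ φ x v = u x * (χ x * fderiv ℝ φ x v) := fun x => by ring
  have e2 : ∀ x, (χ x * g x + fderiv ℝ χ x v * u x) * φ x
      = g x * (χ x * φ x) + u x * (fderiv ℝ χ x v * φ x) := fun x => by ring
  simp_rw [e1, e2]
  rw [integral_add i3 i2]
  linear_combination h0

/-- The derivative is continuous and supported in `[0, 1]`. -/
lemma exists_bound_deriv_smoothTransition :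
    ∃ C : ℝ, ∀ s, |deriv Real.smoothTransition s| ≤ C := by
  have hc : Continuous (deriv Real.smoothTransition) :=
    (Real.smoothTransition.contDiff (n := 1)).continuous_deriv le_rfl
  have hs : HasCompactSupport (deriv Real.smoothTransition) := by
    refine HasCompactSupport.intro (isCompact_Icc (a := (0 : ℝ)) (b := 1)) fun s hs => ?_
    rw [mem_Icc, not_and_or, not_le, not_le] at hs
    rcases hs with h | h
    · have : Real.smoothTransition =ᶠ[𝓝 s] fun _ => 0 := by
        filter_upwards [Iio_mem_nhds h] with t ht
        exact Real.smoothTransition.zero_of_nonpos (le_of_lt ht)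
      rw [this.deriv_eq, deriv_const]
    · have : Real.smoothTransition =ᶠ[𝓝 s] fun _ => 1 := by
        filter_upwards [Ioi_mem_nhds h] with t ht
        exact Real.smoothTransition.one_of_one_le (le_of_lt ht)
      rw [this.deriv_eq, deriv_const]
  exact hs.exists_bound_of_continuous hc

lemma deriv_smoothTransition_eq_zero {s : ℝ} (h : 1 < s) : deriv Real.smoothTransition s = 0 := by
  have : Real.smoothTransition =ᶠ[𝓝 s] fun _ => 1 := by
    filter_upwards [Ioi_mem_nhds h] with t ht
    exact Real.smoothTransition.one_of_one_le (le_of_lt ht)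
  rw [this.deriv_eq, deriv_const]

/-- A cutoff function of the vertical variable, which vanishes near the two faces of the layer and
tends to `1` inside. -/
def verticalCutoff (R : ℝ) (n : ℕ) (t : ℝ) : ℝ :=
  Real.smoothTransition (n * t - 1) * Real.smoothTransition (n * (R - t) - 1)

lemma contDiff_verticalCutoff (R : ℝ) (n : ℕ) : ContDiff ℝ ∞ (verticalCutoff R n) :=
  (Real.smoothTransition.contDiff.comp (by fun_prop)).mul
    (Real.smoothTransition.contDiff.comp (by fun_prop))

lemma abs_verticalCutoff_le (R : ℝ) (n : ℕ) (t : ℝ) : |verticalCutoff R n t| ≤ 1 := by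
  rw [verticalCutoff, abs_mul, abs_of_nonneg (Real.smoothTransition.nonneg _),
    abs_of_nonneg (Real.smoothTransition.nonneg _)]
  exact mul_le_one₀ (Real.smoothTransition.le_one _) (Real.smoothTransition.nonneg _)
    (Real.smoothTransition.le_one _)

lemma verticalCutoff_eventually_eq_one {t : ℝ} (ht : t ∈ Ioo 0 R) :
    ∀ᶠ n : ℕ in atTop, verticalCutoff R n t = 1 := by
  have h1 : Tendsto (fun n : ℕ => (n : ℝ) * t) atTop atTop :=
    tendsto_natCast_atTop_atTop.atTop_mul_const ht.1
  have h2 : Tendsto (fun n : ℕ => (n : ℝ) * (R - t)) atTop atTop :=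
    tendsto_natCast_atTop_atTop.atTop_mul_const (sub_pos.2 ht.2)
  filter_upwards [h1.eventually_ge_atTop 2, h2.eventually_ge_atTop 2] with n a b
  rw [verticalCutoff, Real.smoothTransition.one_of_one_le (by linarith),
    Real.smoothTransition.one_of_one_le (by linarith), mul_one]

lemma hasDerivAt_verticalCutoff (R : ℝ) (n : ℕ) (t : ℝ) :
    HasDerivAt (verticalCutoff R n)
      (n * deriv Real.smoothTransition (n * t - 1) * Real.smoothTransition (n * (R - t) - 1)
        - n * (Real.smoothTransition (n * t - 1) * deriv Real.smoothTransition (n * (R - t) - 1)))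
      t := by
  have hS : ∀ s, HasDerivAt Real.smoothTransition (deriv Real.smoothTransition s) s := fun s =>
    ((Real.smoothTransition.contDiff (n := 1)).differentiable (by simp) s).hasDerivAt
  have h1 : HasDerivAt (fun t : ℝ => (n : ℝ) * t - 1) n t := by
    simpa using ((hasDerivAt_id t).const_mul (n : ℝ)).sub_const 1
  have h2 : HasDerivAt (fun t : ℝ => (n : ℝ) * (R - t) - 1) (-n) t := by
    simpa using (((hasDerivAt_id t).const_sub R).const_mul (n : ℝ)).sub_const 1
  have := ((hS _).comp t h1).mul ((hS _).comp t h2)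
  refine HasDerivAt.congr_deriv (f := verticalCutoff R n) this ?_
  simp only [Function.comp]
  ring

lemma verticalCutoff_deriv_eventually {t : ℝ} (ht : t ∈ Ioo 0 R) :
    ∀ᶠ n : ℕ in atTop, deriv (verticalCutoff R n) t = 0 := by
  have h1 : Tendsto (fun n : ℕ => (n : ℝ) * t) atTop atTop :=
    tendsto_natCast_atTop_atTop.atTop_mul_const ht.1
  have h2 : Tendsto (fun n : ℕ => (n : ℝ) * (R - t)) atTop atTop :=
    tendsto_natCast_atTop_atTop.atTop_mul_const (sub_pos.2 ht.2)
  filter_upwards [h1.eventually_gt_atTop 2, h2.eventually_gt_atTop 2] with n a b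
  rw [(hasDerivAt_verticalCutoff R n t).deriv, deriv_smoothTransition_eq_zero (by linarith),
    deriv_smoothTransition_eq_zero (by linarith)]
  simp

/-- The derivative of the cutoff grows like the inverse distance to the faces. -/
lemma exists_verticalCutoff_deriv_bound :
    ∃ C : ℝ, 0 ≤ C ∧ ∀ (n : ℕ) (t a L : ℝ), t ∈ Ioo 0 R → 0 ≤ a → 0 ≤ L → a ≤ L * t →
      a ≤ L * (R - t) → |deriv (verticalCutoff R n) t| * a ≤ C * L := by
  obtain ⟨C, hC⟩ := exists_bound_deriv_smoothTransition
  have hC0 : 0 ≤ C := (abs_nonneg _).trans (hC 0)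
  refine ⟨4 * C, by positivity, fun n t a L ht ha hL h1 h2 => ?_⟩
  -- only `s` with `n s ≤ 2` contributes
  have key : ∀ s : ℝ, 0 ≤ s → a ≤ L * s →
      n * |deriv Real.smoothTransition (n * s - 1)| * a ≤ 2 * C * L := by
    intro s hs has
    rcases lt_or_ge 1 ((n : ℝ) * s - 1) with h | h
    · rw [deriv_smoothTransition_eq_zero h]
      simp only [abs_zero, mul_zero, zero_mul]
      positivity
    · calc n * |deriv Real.smoothTransition (n * s - 1)| * a
          ≤ n * C * (L * s) := by gcongr; exact hC _
        _ = C * L * (n * s) := by ring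
        _ ≤ C * L * 2 := by gcongr; linarith
        _ = 2 * C * L := by ring
  rw [(hasDerivAt_verticalCutoff R n t).deriv]
  have hS : ∀ s, |Real.smoothTransition s| ≤ 1 := fun s => by
    rw [abs_of_nonneg (Real.smoothTransition.nonneg _)]; exact Real.smoothTransition.le_one _
  have b1 : |n * deriv Real.smoothTransition (n * t - 1) * Real.smoothTransition (n * (R - t) - 1)|
      ≤ n * |deriv Real.smoothTransition (n * t - 1)| := by
    rw [abs_mul, abs_mul, Nat.abs_cast]
    exact mul_le_of_le_one_right (by positivity) (hS _)
  have b2 : |n * (Real.smoothTransition (n * t - 1) * deriv Real.smoothTransition (n * (R - t) - 1))|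
      ≤ n * |deriv Real.smoothTransition (n * (R - t) - 1)| := by
    rw [abs_mul, abs_mul, Nat.abs_cast]
    exact mul_le_mul_of_nonneg_left (mul_le_of_le_one_left (abs_nonneg _) (hS _)) (by positivity)
  calc _ ≤ (n * |deriv Real.smoothTransition (n * t - 1)|
        + n * |deriv Real.smoothTransition (n * (R - t) - 1)|) * a := by
        gcongr
        exact (abs_sub _ _).trans (add_le_add b1 b2)
    _ ≤ 2 * C * L + 2 * C * L := by
        rw [add_mul]
        exact add_le_add (key t ht.1.le h1) (key (R - t) (sub_nonneg.2 ht.2.le) h2)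
    _ = 4 * C * L := by ring

lemma contDiff_verticalCutoff_snd (n : ℕ) :
    ContDiff ℝ ∞ fun x : Pt m => (verticalCutoff R n x.2 : ℂ) :=
  Complex.ofRealCLM.contDiff.comp ((contDiff_verticalCutoff R n).comp contDiff_snd)

lemma tsupport_verticalCutoff_mul_subset {Φ : Pt m → ℂ} (n : ℕ) :
    tsupport (fun x : Pt m => (verticalCutoff R n x.2 : ℂ) * Φ x) ⊆ slab m R := by
  have hsub : Function.support (fun x : Pt m => (verticalCutoff R n x.2 : ℂ) * Φ x)
      ⊆ {x | 1 ≤ (n : ℝ) * x.2} ∩ {x | 1 ≤ (n : ℝ) * (R - x.2)} := by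
    intro x hx
    by_contra hcon
    rw [mem_inter_iff, not_and_or] at hcon
    refine hx ?_
    have h0 : verticalCutoff R n x.2 = 0 := by
      rw [verticalCutoff]
      rcases hcon with h | h
      · rw [Real.smoothTransition.zero_of_nonpos, zero_mul]
        have : ¬ (1 ≤ (n : ℝ) * x.2) := h
        linarith
      · rw [Real.smoothTransition.zero_of_nonpos (x := n * (R - x.2) - 1), mul_zero]
        have : ¬ (1 ≤ (n : ℝ) * (R - x.2)) := h
        linarith
    simp [h0]
  refine (closure_minimal hsub ((isClosed_le (by fun_prop) (by fun_prop)).inter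
    (isClosed_le (by fun_prop) (by fun_prop)))).trans ?_
  rintro x ⟨h1, h2⟩
  have h1' : 1 ≤ (n : ℝ) * x.2 := h1
  have h2' : 1 ≤ (n : ℝ) * (R - x.2) := h2
  have hn : (0 : ℝ) ≤ n := Nat.cast_nonneg n
  refine ⟨mem_univ _, ?_, ?_⟩
  · by_contra h
    nlinarith [mul_nonneg hn (neg_nonneg.2 (not_lt.1 h))]
  · by_contra h
    nlinarith [mul_nonneg hn (sub_nonneg.2 (not_lt.1 h))]

lemma fderiv_verticalCutoff_snd (n : ℕ) (x : Pt m) (j : Dir m) :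
    pd j (fun x : Pt m => (verticalCutoff R n x.2 : ℂ)) x
      = (deriv (verticalCutoff R n) x.2 * (dirVec m j).2 : ℝ) := by
  have h1 : HasFDerivAt (fun x : Pt m => (verticalCutoff R n x.2 : ℂ)) (Complex.ofRealCLM.comp
      ((ContinuousLinearMap.toSpanSingleton ℝ (deriv (verticalCutoff R n) x.2)).comp
        (ContinuousLinearMap.snd ℝ (Hor m) ℝ))) x := by
    have h2 : HasDerivAt (verticalCutoff R n) (deriv (verticalCutoff R n) x.2) x.2 :=
      ((contDiff_verticalCutoff R n).differentiable (by simp) x.2).hasDerivAt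
    exact Complex.ofRealCLM.hasFDerivAt.comp x (h2.hasFDerivAt.comp x hasFDerivAt_snd)
  rw [pd, h1.fderiv]
  simp [mul_comm]

/-- A Lipschitz function which vanishes on a face is bounded by the distance to the face. -/
lemma norm_le_mul_of_apply_zero {Φ : Pt m → ℂ} (hΦ : ContDiff ℝ ∞ Φ) {L : ℝ}
    (hL : ∀ x, ‖fderiv ℝ Φ x‖ ≤ L) {y : Hor m} {s t : ℝ} (h0 : Φ (y, s) = 0) :
    ‖Φ (y, t)‖ ≤ L * |t - s| := by
  have := (convex_univ : Convex ℝ (univ : Set (Pt m))).norm_image_sub_le_of_norm_fderiv_le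
    (𝕜 := ℝ) (f := Φ) (C := L) (fun x _ => hΦ.differentiable (by simp) x) (fun x _ => hL x)
    (mem_univ (y, s)) (mem_univ (y, t))
  rw [h0, sub_zero] at this
  refine this.trans_eq ?_
  simp [Prod.norm_def]

/-- Integration by parts in the layer against a test function of the whole space: there are no
boundary terms in a horizontal direction, nor in the vertical direction when the test function
vanishes on the two faces. -/
lemma green {U : Jet m R} (hU : U ∈ H1 m R) (j : Dir m) {Φ : Pt m → ℂ} (hΦ : ContDiff ℝ ∞ Φ)
    (hc : HasCompactSupport Φ) (h0 : (dirVec m j).2 ≠ 0 → ∀ y, Φ (y, 0) = 0 ∧ Φ (y, R) = 0) :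
    ∫ x, zext (U none) x * pd j Φ x = -∫ x, zext (U (some j)) x * Φ x := by
  have hwd := isWeakDeriv_iff.1 (hU j)
  have hli : ∀ f : L2Slab m R, LocallyIntegrable (zext f) := fun f =>
    (memLp_zext f).locallyIntegrable (by norm_num)
  have hi : ∀ {f η : Pt m → ℂ}, LocallyIntegrable f → Continuous η →
      HasCompactSupport η → Integrable fun x => f x * η x := by
    intro f η hf hη hηc
    simpa [mul_comm] using hf.integrable_smul_left_of_hasCompactSupport hη hηc
  obtain ⟨L, hL⟩ := (hc.fderiv (𝕜 := ℝ)).exists_bound_of_continuous (hΦ.continuous_fderiv (by simp))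
  have hL0 : 0 ≤ L := (norm_nonneg _).trans (hL 0)
  obtain ⟨C, hC0, hC⟩ := exists_verticalCutoff_deriv_bound (R := R)
  set κ : ℕ → Pt m → ℂ := fun n x => (verticalCutoff R n x.2 : ℂ) with hκ
  have hκs : ∀ n, ContDiff ℝ ∞ (κ n) := fun n => contDiff_verticalCutoff_snd n
  have hκ1 : ∀ n x, ‖κ n x‖ ≤ 1 := fun n x => by
    rw [hκ, Complex.norm_real]; exact abs_verticalCutoff_le R n x.2
  have hbase : ∀ n, (∫ x, zext (U none) x * (κ n x * pd j Φ x))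
      + (∫ x, zext (U none) x * (pd j (κ n) x * Φ x))
      = -∫ x, zext (U (some j)) x * (κ n x * Φ x) := by
    intro n
    have h := hwd (fun x => κ n x * Φ x) ((hκs n).mul hΦ) hc.mul_left
      (tsupport_verticalCutoff_mul_subset n)
    have i1 : Integrable fun x => zext (U none) x * (κ n x * pd j Φ x) :=
      hi (hli _) ((hκs n).continuous.mul (contDiff_pd hΦ j).continuous)
        (hasCompactSupport_pd hc j).mul_left
    have i2 : Integrable fun x => zext (U none) x * (pd j (κ n) x * Φ x) :=
      hi (hli _) ((contDiff_pd (hκs n) j).continuous.mul hΦ.continuous) hc.mul_left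
    rw [← h, ← integral_add i1 i2]
    refine integral_congr_ae (Eventually.of_forall fun x => ?_)
    change _ = zext (U none) x * pd j (fun x => κ n x * Φ x) x
    rw [pd_mul (hκs n) hΦ]
    ring
  have hlim : ∀ (f : L2Slab m R) {η : Pt m → ℂ}, Continuous η → HasCompactSupport η →
      Tendsto (fun n => ∫ x, zext f x * (κ n x * η x)) atTop (𝓝 (∫ x, zext f x * η x)) := by
    intro f η hη hηc
    refine tendsto_integral_of_dominated_convergence (fun x => ‖zext f x * η x‖)
      (fun n => (hi (hli f) ((hκs n).continuous.mul hη) hηc.mul_left).1)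
      (hi (hli f) hη hηc).norm (fun n => Eventually.of_forall fun x => ?_)
      (Eventually.of_forall fun x => ?_)
    · rw [norm_mul, norm_mul, norm_mul]
      exact mul_le_mul_of_nonneg_left (mul_le_of_le_one_left (norm_nonneg _) (hκ1 n x))
        (norm_nonneg _)
    · by_cases hx : x ∈ slab m R
      · refine tendsto_const_nhds.congr' ?_
        filter_upwards [verticalCutoff_eventually_eq_one hx.2] with n hn
        simp [hκ, hn]
      · simp [zext_eq_zero f hx]
  -- the derivative of the cutoff function grows like the inverse distance to the faces, which is
  -- compensated by the vanishing of `Φ` on the faces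
  have hlim2 : Tendsto (fun n => ∫ x, zext (U none) x * (pd j (κ n) x * Φ x)) atTop (𝓝 0) := by
    have hb := ((memLp_zext (U none)).integrable_mul
      (q := 2) ((memLp_indicator_const 2 hc.isCompact.measurableSet (C * L : ℂ)
        (Or.inr hc.isCompact.measure_lt_top.ne)))).norm
    rw [← integral_zero (Pt m) ℂ (μ := volume)]
    refine tendsto_integral_of_dominated_convergence _
      (fun n => (hi (hli (U none)) ((contDiff_pd (hκs n) j).continuous.mul hΦ.continuous)
        hc.mul_left).1) hb (fun n => Eventually.of_forall fun x => ?_)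
      (Eventually.of_forall fun x => ?_)
    · rw [norm_mul, Pi.mul_apply, norm_mul, norm_mul]
      by_cases hx : x ∈ slab m R
      · refine mul_le_mul_of_nonneg_left ?_ (norm_nonneg _)
        by_cases hxs : x ∈ tsupport Φ
        · rw [indicator_of_mem hxs]
          have hCL : ‖(C * L : ℂ)‖ = C * L := by
            rw [← Complex.ofReal_mul, Complex.norm_real, Real.norm_of_nonneg (by positivity)]
          rw [hCL, fderiv_verticalCutoff_snd, Complex.norm_real, norm_mul]
          by_cases hj : (dirVec m j).2 = 0
          · rw [hj]; simp only [norm_zero, mul_zero, zero_mul]; positivity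
          · have hj1 : ‖(dirVec m j).2‖ = 1 := by
              rcases j with l | l
              · exact absurd rfl hj
              · simp [dirVec]
            rw [hj1, mul_one]
            have a1 := norm_le_mul_of_apply_zero hΦ hL (y := x.1) (t := x.2) (h0 hj x.1).1
            have a2 := norm_le_mul_of_apply_zero hΦ hL (y := x.1) (t := x.2) (h0 hj x.1).2
            rw [sub_zero, abs_of_pos hx.2.1] at a1
            rw [abs_of_neg (sub_neg.2 hx.2.2), neg_sub] at a2
            exact hC n x.2 ‖Φ x‖ L hx.2 (norm_nonneg _) hL0 a1 a2
        · rw [image_eq_zero_of_notMem_tsupport hxs]; simp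
      · simp [zext_eq_zero _ hx]
    · by_cases hx : x ∈ slab m R
      · refine tendsto_const_nhds.congr' ?_
        filter_upwards [verticalCutoff_deriv_eventually hx.2] with n hn
        rw [fderiv_verticalCutoff_snd, hn]
        simp
      · simp [zext_eq_zero _ hx]
  have hl := (hlim (U none) (contDiff_pd hΦ j).continuous (hasCompactSupport_pd hc j)).add hlim2
  have hr := (hlim (U (some j)) hΦ.continuous hc).neg
  rw [add_zero] at hl
  exact tendsto_nhds_unique hl (hr.congr fun n => (hbase n).symm)

end Green

/-! ### Extension by reflection -/

section Reflection

variable {m : ℕ} {R : ℝ}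

/-- The reflection `(x', x_d) ↦ (x', a - x_d)`. -/
def refl (a : ℝ) (x : Pt m) : Pt m := (x.1, a - x.2)

lemma refl_refl (a : ℝ) (x : Pt m) : refl a (refl a x) = x := by simp [refl]

lemma contDiff_refl (a : ℝ) : ContDiff ℝ ∞ (refl a : Pt m → Pt m) := by
  unfold refl; fun_prop

lemma measurePreserving_refl (a : ℝ) :
    MeasurePreserving (refl a : Pt m → Pt m) volume volume := by
  have h := (MeasurePreserving.id (volume : Measure (Hor m))).prod
    (Measure.measurePreserving_sub_left (volume : Measure ℝ) a)
  rw [← Measure.volume_eq_prod] at h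
  exact h

/-- The homeomorphism given by a reflection. -/
def reflHomeo (a : ℝ) : Pt m ≃ₜ Pt m where
  toFun := refl a
  invFun := refl a
  left_inv := refl_refl a
  right_inv := refl_refl a
  continuous_toFun := (contDiff_refl a).continuous
  continuous_invFun := (contDiff_refl a).continuous

lemma integral_comp_refl (a : ℝ) (f : Pt m → ℂ) : ∫ x, f (refl a x) = ∫ x, f x :=
  (measurePreserving_refl a).integral_comp (reflHomeo a).measurableEmbedding f

/-- The sign of a coordinate direction under vertical reflection. -/
def reflSign : Dir m → ℂ
  | Sum.inl _ => 1
  | Sum.inr _ => -1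

lemma norm_reflSign (j : Dir m) : ‖(reflSign j : ℂ)‖ = 1 := by
  rcases j with i | i <;> simp [reflSign]

lemma pd_comp_refl (a : ℝ) {Ψ : Pt m → ℂ} (hΨ : ContDiff ℝ ∞ Ψ) (j : Dir m) (x : Pt m) :
    pd j (fun y => Ψ (refl a y)) x = reflSign j * pd j Ψ (refl a x) := by
  have h1 : HasFDerivAt (refl a : Pt m → Pt m) ((ContinuousLinearMap.fst ℝ (Hor m) ℝ).prod
      (-ContinuousLinearMap.snd ℝ (Hor m) ℝ)) x :=
    (hasFDerivAt_fst.prodMk (hasFDerivAt_snd.const_sub a))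
  have h2 := (hΨ.differentiable (by simp) (refl a x)).hasFDerivAt.comp x h1
  have h3 : HasFDerivAt (fun y => Ψ (refl a y)) _ x := h2
  rw [pd, h3.fderiv, pd]
  rcases j with i | i
  · simp [reflSign, dirVec]
  · simp only [reflSign, dirVec, ContinuousLinearMap.comp_apply, ContinuousLinearMap.prod_apply,
      _root_.neg_apply, ContinuousLinearMap.coe_fst', ContinuousLinearMap.coe_snd']
    rw [neg_one_mul, ← map_neg]
    simp

/-- The sum of `f` and its reflections at the two faces of the layer, with a sign. For a function
supported in `Ω^R` it is the extension by even or odd reflection. -/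
def foldExt (R : ℝ) (s : ℂ) (f : Pt m → ℂ) (x : Pt m) : ℂ :=
  f x + s * (f (refl 0 x) + f (refl (2 * R) x))

lemma memLp_comp_refl (a : ℝ) {f : Pt m → ℂ} (hf : MemLp f 2 volume) :
    MemLp (fun x => f (refl a x)) 2 volume :=
  hf.comp_measurePreserving (measurePreserving_refl a)

lemma memLp_foldExt (s : ℂ) {f : Pt m → ℂ} (hf : MemLp f 2 volume) :
    MemLp (foldExt R s f) 2 volume :=
  hf.add (((memLp_comp_refl 0 hf).add (memLp_comp_refl (2 * R) hf)).const_mul s)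

lemma eLpNorm_foldExt_le {s : ℂ} (hs : ‖s‖ = 1) {f : Pt m → ℂ} (hf : MemLp f 2 volume) :
    eLpNorm (foldExt R s f) 2 volume ≤ 3 * eLpNorm f 2 volume := by
  have h1 : ∀ a, eLpNorm (fun x => f (refl a x)) 2 volume = eLpNorm f 2 volume := fun a =>
    eLpNorm_comp_measurePreserving hf.1 (measurePreserving_refl a)
  have h2 : eLpNorm (fun x => s * (f (refl 0 x) + f (refl (2 * R) x))) 2 volume
      ≤ eLpNorm f 2 volume + eLpNorm f 2 volume := by
    have e1 : eLpNorm (fun x => s * (f (refl 0 x) + f (refl (2 * R) x))) 2 volume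
        = eLpNorm (fun x => f (refl 0 x) + f (refl (2 * R) x)) 2 volume := by
      refine eLpNorm_congr_norm_ae (Eventually.of_forall fun x => ?_)
      rw [norm_mul, hs, one_mul]
    rw [e1]
    refine (eLpNorm_add_le (memLp_comp_refl 0 hf).1 (memLp_comp_refl (2 * R) hf).1
      (by norm_num)).trans ?_
    rw [h1, h1]
  refine (eLpNorm_add_le hf.1 ((((memLp_comp_refl 0 hf).add
    (memLp_comp_refl (2 * R) hf)).const_mul s)).1 (by norm_num)).trans ?_
  calc _ ≤ eLpNorm f 2 volume + (eLpNorm f 2 volume + eLpNorm f 2 volume) := add_le_add le_rfl h2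
    _ = 3 * eLpNorm f 2 volume := by ring

lemma contDiff_foldExt (s : ℂ) {Ψ : Pt m → ℂ} (hΨ : ContDiff ℝ ∞ Ψ) :
    ContDiff ℝ ∞ (foldExt R s Ψ) :=
  hΨ.add (contDiff_const.mul ((hΨ.comp (contDiff_refl 0)).add (hΨ.comp (contDiff_refl (2 * R)))))

lemma hasCompactSupport_foldExt (s : ℂ) {Ψ : Pt m → ℂ} (hΨ : HasCompactSupport Ψ) :
    HasCompactSupport (foldExt R s Ψ) := by
  have h : ∀ a, HasCompactSupport fun x => Ψ (refl a x) := fun a => hΨ.comp_homeomorph (reflHomeo a)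
  exact hΨ.add (((h 0).add (h (2 * R))).mul_left (f := fun _ => s))

lemma integral_foldExt_mul (s : ℂ) {f Ψ : Pt m → ℂ} (hf : MemLp f 2 volume)
    (hΨ : MemLp Ψ 2 volume) :
    ∫ x, foldExt R s f x * Ψ x = ∫ x, f x * foldExt R s Ψ x := by
  have hr : ∀ a, ∫ x, f (refl a x) * Ψ x = ∫ x, f x * Ψ (refl a x) := fun a => by
    rw [← integral_comp_refl a fun x => f (refl a x) * Ψ x]
    simp_rw [refl_refl]
  have i0 : Integrable fun x => f x * Ψ x := hf.integrable_mul hΨ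
  have i1 : ∀ a, Integrable fun x => f (refl a x) * Ψ x := fun a =>
    (memLp_comp_refl a hf).integrable_mul hΨ
  have i2 : ∀ a, Integrable fun x => f x * Ψ (refl a x) := fun a =>
    hf.integrable_mul (memLp_comp_refl a hΨ)
  have e1 : ∀ x, foldExt R s f x * Ψ x
      = f x * Ψ x + s * (f (refl 0 x) * Ψ x + f (refl (2 * R) x) * Ψ x) := fun x => by
    rw [foldExt]; ring
  have e2 : ∀ x, f x * foldExt R s Ψ x
      = f x * Ψ x + s * (f x * Ψ (refl 0 x) + f x * Ψ (refl (2 * R) x)) := fun x => by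
    rw [foldExt]; ring
  have j1 : Integrable fun x => s * (f (refl 0 x) * Ψ x + f (refl (2 * R) x) * Ψ x) :=
    ((i1 0).add (i1 (2 * R))).const_mul s
  have j2 : Integrable fun x => s * (f x * Ψ (refl 0 x) + f x * Ψ (refl (2 * R) x)) :=
    ((i2 0).add (i2 (2 * R))).const_mul s
  simp_rw [e1, e2]
  rw [integral_add i0 j1, integral_add i0 j2, integral_const_mul, integral_const_mul,
    integral_add (i1 0) (i1 _), integral_add (i2 0) (i2 _), hr, hr]

lemma pd_foldExt (s : ℂ) {Ψ : Pt m → ℂ} (hΨ : ContDiff ℝ ∞ Ψ) (j : Dir m) (x : Pt m) :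
    pd j (foldExt R s Ψ) x = foldExt R (s * reflSign j) (pd j Ψ) x := by
  have h0 : ContDiff ℝ ∞ fun y => Ψ (refl 0 y) := hΨ.comp (contDiff_refl (m := m) 0)
  have hR : ContDiff ℝ ∞ fun y => Ψ (refl (2 * R) y) := hΨ.comp (contDiff_refl (m := m) (2 * R))
  have e : (foldExt R s Ψ)
      = fun y => Ψ y + (fun _ => s) y * (fun y => Ψ (refl 0 y) + Ψ (refl (2 * R) y)) y := rfl
  have hc : pd j (fun _ : Pt m => s) x = 0 := by simp [pd]
  rw [e, pd_add hΨ (contDiff_const.mul (h0.add hR)), pd_mul contDiff_const (h0.add hR), hc,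
    pd_add h0 hR, pd_comp_refl 0 hΨ, pd_comp_refl _ hΨ, foldExt]
  ring

/-- Even reflection of `u` (and odd reflection of the vertical derivative) preserves weak
derivatives across the faces. -/
lemma hasWeakDerivOn_foldExt {U : Jet m R} (hU : U ∈ H1 m R) (j : Dir m) :
    HasWeakDerivOn volume (univ ×ˢ Ioo (-R) (2 * R)) (dirVec m j)
      (foldExt R 1 (zext (U none))) (foldExt R (reflSign j) (zext (U (some j)))) := by
  intro Ψ hΨ hc hs
  have hm : ∀ {η : Pt m → ℂ}, ContDiff ℝ ∞ η → HasCompactSupport η → MemLp η 2 volume :=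
    fun h hc => h.continuous.memLp_of_hasCompactSupport hc
  have hs2 : (reflSign j : ℂ) * reflSign j = 1 := by rcases j with i | i <;> simp [reflSign]
  change ∫ x, foldExt R 1 (zext (U none)) x * pd j Ψ x = _
  rw [integral_foldExt_mul _ (memLp_zext _) (hm (contDiff_pd hΨ j) (hasCompactSupport_pd hc j)),
    integral_foldExt_mul _ (memLp_zext _) (hm hΨ hc),
    ← green hU j (contDiff_foldExt _ hΨ) (hasCompactSupport_foldExt _ hc)]
  · simp_rw [pd_foldExt _ hΨ, hs2]
  · intro hj y
    rcases j with i | i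
    · exact absurd rfl hj
    have hz : ∀ t, t ∉ Ioo (-R) (2 * R) → Ψ (y, t) = 0 := fun t ht =>
      image_eq_zero_of_notMem_tsupport fun h => ht (hs h).2
    have z1 : Ψ (y, 2 * R) = 0 := hz _ (by simp)
    have z2 : Ψ (y, -R) = 0 := hz _ (by simp)
    constructor
    · simp [foldExt, refl, reflSign, z1]
    · have : 2 * R - R = R := by ring
      simp [foldExt, refl, reflSign, z2, this]

/-- An extension of `u` to the whole space, cut off by `χ`. -/
def extFun (χ : Pt m → ℂ) (U : Jet m R) (x : Pt m) : ℂ :=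
  χ x * foldExt R 1 (zext (U none)) x

/-- The gradient of the extension `extFun χ U`. -/
def extGrad (χ : Pt m → ℂ) (U : Jet m R) (j : Dir m) (x : Pt m) : ℂ :=
  χ x * foldExt R (reflSign j) (zext (U (some j))) x + pd j χ x * foldExt R 1 (zext (U none)) x

variable {χ : Pt m → ℂ}

lemma hasWeakDerivOn_extFun (hχ : ContDiff ℝ ∞ χ) (hχR : tsupport χ ⊆ univ ×ˢ Ioo (-R) (2 * R))
    {U : Jet m R} (hU : U ∈ H1 m R) (j : Dir m) :
    HasWeakDerivOn volume univ (dirVec m j) (extFun χ U) (extGrad χ U j) :=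
  (hasWeakDerivOn_foldExt hU j).mul_cutoff ((memLp_foldExt _ (memLp_zext _)).locallyIntegrable
    (by norm_num)) ((memLp_foldExt _ (memLp_zext _)).locallyIntegrable (by norm_num)) hχ
    (inter_subset_left.trans hχR)

lemma extFun_eq_zero (U : Jet m R) {x : Pt m} (hx : x ∉ tsupport χ) : extFun χ U x = 0 := by
  rw [extFun, image_eq_zero_of_notMem_tsupport hx, zero_mul]

lemma extFun_eq (U : Jet m R) {x : Pt m} (hx : x ∈ slab m R) (h1 : χ x = 1) :
    extFun χ U x = U none x := by
  have h2 : refl 0 x ∉ slab m R := fun h => by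
    have := h.2.1; simp only [refl] at this; linarith [hx.2.1]
  have h3 : refl (2 * R) x ∉ slab m R := fun h => by
    have := h.2.2; simp only [refl] at this; linarith [hx.2.2]
  rw [extFun, h1, foldExt, zext_eq_zero _ h2, zext_eq_zero _ h3, zext, indicator_of_mem hx]
  ring

lemma memLp_mul_of_continuous {η f : Pt m → ℂ} (hη : Continuous η) (hc : HasCompactSupport η)
    (hf : MemLp f 2 volume) : MemLp (fun x => η x * f x) 2 volume := by
  obtain ⟨C, hC⟩ := hη.bounded_above_of_compact_support hc
  refine hf.of_le_mul (c := C) (hη.aestronglyMeasurable.mul hf.1)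
    (Eventually.of_forall fun x => ?_)
  rw [norm_mul]
  exact mul_le_mul_of_nonneg_right (hC x) (norm_nonneg _)

lemma memLp_extFun (hχ : ContDiff ℝ ∞ χ) (hχc : HasCompactSupport χ) (U : Jet m R) :
    MemLp (extFun χ U) 2 volume :=
  memLp_mul_of_continuous hχ.continuous hχc (memLp_foldExt _ (memLp_zext _))

lemma memLp_extGrad (hχ : ContDiff ℝ ∞ χ) (hχc : HasCompactSupport χ) (U : Jet m R) (j : Dir m) :
    MemLp (extGrad χ U j) 2 volume :=
  (memLp_mul_of_continuous hχ.continuous hχc (memLp_foldExt _ (memLp_zext _))).add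
    (memLp_mul_of_continuous (contDiff_pd hχ j).continuous (hasCompactSupport_pd hχc j)
      (memLp_foldExt _ (memLp_zext _)))

/-- The extension is bounded from `H¹(Ω^R)` to `H¹(ℝ^d)`. -/
lemma exists_eLpNorm_ext_le (hχ : ContDiff ℝ ∞ χ) (hχc : HasCompactSupport χ) :
    ∃ C : ℝ, 0 < C ∧ ∀ U : Jet m R, eLpNorm (extFun χ U) 2 volume ≤ ENNReal.ofReal (C * ‖U‖) ∧
      ∀ j, eLpNorm (extGrad χ U j) 2 volume ≤ ENNReal.ofReal (C * ‖U‖) := by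
  obtain ⟨C₀, hC₀⟩ := hχ.continuous.bounded_above_of_compact_support hχc
  choose D hD using fun j : Dir m =>
    (contDiff_pd hχ j).continuous.bounded_above_of_compact_support (hasCompactSupport_pd hχc j)
  have hC0 : 0 ≤ C₀ := (norm_nonneg _).trans (hC₀ 0)
  have hD0 : ∀ j, 0 ≤ D j := fun j => (norm_nonneg _).trans (hD j 0)
  set A := C₀ + ∑ j, D j with hA
  have hA0 : 0 ≤ A := add_nonneg hC0 (Finset.sum_nonneg fun j _ => hD0 j)
  have hCA : C₀ ≤ A := le_add_of_nonneg_right (Finset.sum_nonneg fun j _ => hD0 j)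
  have hDA : ∀ j, D j ≤ A := fun j => (Finset.single_le_sum (fun j _ => hD0 j)
    (Finset.mem_univ j)).trans (le_add_of_nonneg_left hC0)
  have key : ∀ (U : Jet m R) (o : Option (Dir m)) (s : ℂ) (η : Pt m → ℂ), ‖s‖ = 1 →
      (∀ x, ‖η x‖ ≤ A) → eLpNorm (fun x => η x * foldExt R s (zext (U o)) x) 2 volume
        ≤ ENNReal.ofReal (3 * A * ‖U‖) := by
    intro U o s η hs hη
    have h1 : eLpNorm (fun x => η x * foldExt R s (zext (U o)) x) 2 volume
        ≤ ENNReal.ofReal A * eLpNorm (foldExt R s (zext (U o))) 2 volume :=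
      eLpNorm_le_mul_eLpNorm_of_ae_le_mul (Eventually.of_forall fun x => by
        rw [norm_mul]; exact mul_le_mul_of_nonneg_right (hη x) (norm_nonneg _)) 2
    refine h1.trans ?_
    calc _ ≤ ENNReal.ofReal A * (3 * ENNReal.ofReal ‖U‖) := by
          gcongr
          refine (eLpNorm_foldExt_le hs (memLp_zext _)).trans ?_
          rw [eLpNorm_zext_two]
          gcongr
          exact PiLp.norm_apply_le U o
      _ = ENNReal.ofReal (3 * A * ‖U‖) := by
          rw [ENNReal.ofReal_mul (by positivity), ENNReal.ofReal_mul (by norm_num)]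
          simp; ring
  refine ⟨6 * A + 1, by positivity, fun U => ⟨?_, fun j => ?_⟩⟩
  · refine (key U none 1 χ (by simp) fun x => (hC₀ x).trans hCA).trans ?_
    gcongr
    linarith
  · refine (eLpNorm_add_le (memLp_mul_of_continuous hχ.continuous hχc
      (memLp_foldExt _ (memLp_zext _))).1
      (memLp_mul_of_continuous (contDiff_pd hχ j).continuous (hasCompactSupport_pd hχc j)
      (memLp_foldExt _ (memLp_zext _))).1 (by norm_num)).trans ?_
    refine (add_le_add (key U (some j) (reflSign j) χ (norm_reflSign j) fun x => (hC₀ x).trans hCA)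
      (key U none 1 (pd j χ) (by simp) fun x => (hD j x).trans (hDA j))).trans ?_
    rw [← ENNReal.ofReal_add (by positivity) (by positivity)]
    gcongr
    linarith [norm_nonneg U]

/-- A cutoff function which is `1` on the cell and vanishes before the reflections of the faces. -/
lemma exists_cellCutoff (hR : 0 < R) : ∃ χ : Pt m → ℂ, ContDiff ℝ ∞ χ ∧ HasCompactSupport χ ∧
    tsupport χ ⊆ univ ×ˢ Ioo (-R) (2 * R) ∧ ∀ x ∈ cell m R, χ x = 1 := by
  let a : ContDiffBump (0 : Hor m) := ⟨Real.pi * (m + 1), Real.pi * (m + 1) + 1,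
    by have := Real.pi_pos; positivity, by linarith⟩
  let b : ContDiffBump (R / 2) := ⟨R / 2, R, by positivity, by linarith⟩
  have hsub : Function.support (fun x : Pt m => ((a x.1 * b x.2 : ℝ) : ℂ))
      ⊆ Metric.closedBall 0 a.rOut ×ˢ Metric.closedBall (R / 2) R := by
    intro x hx
    have hx' : a x.1 * b x.2 ≠ 0 := by simpa using hx
    refine ⟨?_, ?_⟩
    · by_contra h
      exact hx' (by rw [a.zero_of_le_dist (le_of_lt (not_le.1 h)), zero_mul])
    · by_contra h
      exact hx' (by rw [b.zero_of_le_dist (le_of_lt (not_le.1 h)), mul_zero])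
  have hcomp := (isCompact_closedBall (0 : Hor m) a.rOut).prod (isCompact_closedBall (R / 2) R)
  have hts := closure_minimal hsub hcomp.isClosed
  refine ⟨fun x => ((a x.1 * b x.2 : ℝ) : ℂ), ?_, hcomp.of_isClosed_subset (isClosed_tsupport _) hts,
    ?_, ?_⟩
  · exact Complex.ofRealCLM.contDiff.comp ((a.contDiff.comp contDiff_fst).mul
      (b.contDiff.comp contDiff_snd))
  · intro x hx
    have := (hts hx).2
    rw [Metric.mem_closedBall, Real.dist_eq, abs_le] at this
    exact ⟨mem_univ _, by constructor <;> linarith⟩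
  · intro x hx
    have h1 : a x.1 = 1 := a.one_of_mem_closedBall (by
      rw [mem_closedBall_zero_iff, EuclideanSpace.norm_eq]
      refine Real.sqrt_le_iff.2 ⟨a.rIn_pos.le, ?_⟩
      calc ∑ i, ‖x.1 i‖ ^ 2 ≤ ∑ i : Fin m, Real.pi ^ 2 := by
            refine Finset.sum_le_sum fun i _ => ?_
            gcongr
            have := hx.1 i
            exact abs_le.2 ⟨this.1.le, this.2.le⟩
        _ = m * Real.pi ^ 2 := by simp
        _ ≤ (Real.pi * (m + 1)) ^ 2 := by
            have : (0 : ℝ) ≤ m := Nat.cast_nonneg m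
            nlinarith [mul_nonneg (sq_nonneg Real.pi) this, mul_nonneg (mul_nonneg
              (sq_nonneg Real.pi) this) this, sq_nonneg Real.pi])
    have h2 : b x.2 = 1 := b.one_of_mem_closedBall (by
      change dist x.2 (R / 2) ≤ R / 2
      rw [Real.dist_eq, abs_le]
      constructor <;> linarith [hx.2.1, hx.2.2])
    simp [h1, h2]

end Reflection

/-! ### Compactness and the Sobolev embedding on a cell -/

section Embedding

variable {m : ℕ} {R : ℝ}

lemma HasWeakDerivOn.of_dirVec {w : Pt m → ℂ} {g : Dir m → Pt m → ℂ}
    (h : ∀ j, HasWeakDerivOn volume univ (dirVec m j) w (g j)) (hw : LocallyIntegrable w)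
    (hg : ∀ j, LocallyIntegrable (g j)) (y : Pt m) :
    HasWeakDerivOn volume univ y w fun x => ∑ j, (coord m j y : ℂ) * g j x := by
  intro φ hφ hc hs
  have hi : ∀ {f η : Pt m → ℂ}, LocallyIntegrable f → Continuous η →
      HasCompactSupport η → Integrable fun x => f x * η x := by
    intro f η hf hη hηc
    simpa [mul_comm] using hf.integrable_smul_left_of_hasCompactSupport hη hηc
  have e1 : ∀ x, w x * fderiv ℝ φ x y = ∑ j, (coord m j y : ℂ) * (w x * pd j φ x) := by
    intro x
    conv_lhs => rw [← sum_coord_smul_dirVec y]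
    rw [map_sum, Finset.mul_sum]
    refine Finset.sum_congr rfl fun j _ => ?_
    rw [map_smul, pd, Complex.real_smul]; ring
  have e2 : ∀ x, (∑ j, (coord m j y : ℂ) * g j x) * φ x
      = ∑ j, (coord m j y : ℂ) * (g j x * φ x) := by
    intro x
    rw [Finset.sum_mul]
    exact Finset.sum_congr rfl fun j _ => by ring
  have i1 : ∀ j, Integrable fun x => (coord m j y : ℂ) * (w x * pd j φ x) := fun j =>
    (hi hw (contDiff_pd hφ j).continuous (hasCompactSupport_pd hc j)).const_mul _
  have i2 : ∀ j, Integrable fun x => (coord m j y : ℂ) * (g j x * φ x) := fun j =>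
    (hi (hg j) hφ.continuous hc).const_mul _
  simp_rw [e1, e2]
  rw [integral_finsetSum _ fun j _ => i1 j, integral_finsetSum _ fun j _ => i2 j,
    ← Finset.sum_neg_distrib]
  refine Finset.sum_congr rfl fun j _ => ?_
  rw [integral_const_mul, integral_const_mul, ← mul_neg]
  congr 1
  exact h j φ hφ hc hs

lemma eLpNorm_sum_const_mul_le {ι : Type*} [Fintype ι] (c : ι → ℂ) {g : ι → Pt m → ℂ}
    (hg : ∀ j, AEStronglyMeasurable (g j)) {D : ℝ} (hD : ∀ j, ‖c j‖ ≤ D) {B : ℝ}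
    (hB : ∀ j, eLpNorm (g j) 2 volume ≤ ENNReal.ofReal B) :
    eLpNorm (fun x => ∑ j, c j * g j x) 2 volume
      ≤ ENNReal.ofReal (Fintype.card ι * D * B) := by
  rcases isEmpty_or_nonempty ι with hι | ⟨⟨j₀⟩⟩
  · simp
  have hD0 : 0 ≤ D := (norm_nonneg _).trans (hD j₀)
  have h1 : (fun x => ∑ j, c j * g j x) = ∑ j, fun x => c j * g j x := by
    ext x; simp
  rw [h1]
  refine (eLpNorm_sum_le (fun j _ => (hg j).const_mul (c j)) (by norm_num)).trans ?_
  have h2 : ∀ j, eLpNorm (fun x => c j * g j x) 2 volume ≤ ENNReal.ofReal (D * B) := by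
    intro j
    rw [ENNReal.ofReal_mul hD0]
    refine (eLpNorm_le_mul_eLpNorm_of_ae_le_mul (c := D) (g := g j)
      (Eventually.of_forall fun x => ?_) 2).trans (by gcongr; exact hB j)
    rw [norm_mul]
    exact mul_le_mul_of_nonneg_right (hD j) (norm_nonneg _)
  refine (Finset.sum_le_sum fun j _ => h2 j).trans ?_
  rw [Finset.sum_const, nsmul_eq_mul, mul_assoc, ENNReal.ofReal_mul (p := (Fintype.card ι : ℝ))
    (Nat.cast_nonneg _), ENNReal.ofReal_natCast, Finset.card_univ]

lemma exists_norm_coord_le : ∃ D : ℝ, 0 ≤ D ∧ ∀ (j : Dir m) (y : Pt m),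
    ‖(coord m j y : ℂ)‖ ≤ D * ‖y‖ := by
  refine ⟨∑ j, ‖coord m j‖, Finset.sum_nonneg fun _ _ => norm_nonneg _, fun j y => ?_⟩
  rw [Complex.norm_real]
  refine ((coord m j).le_opNorm y).trans ?_
  gcongr
  exact Finset.single_le_sum (f := fun j => ‖coord m j‖) (fun _ _ => norm_nonneg _)
    (Finset.mem_univ j)

lemma cell_subset_slab : cell m R ⊆ slab m R := fun _ hx => ⟨mem_univ _, hx.2⟩

lemma measurableSet_cube : MeasurableSet (cube m) := by
  have : cube m = ⋂ i, {x : Hor m | x i ∈ Ioo (-Real.pi) Real.pi} := by ext; simp [cube]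
  rw [this]
  exact MeasurableSet.iInter fun i => measurableSet_Ioo.preimage (by fun_prop)

lemma measurableSet_cell : MeasurableSet (cell m R) := measurableSet_cube.prod measurableSet_Ioo

lemma coeFn_ae_cell {p : Pt m → Prop} (h : ∀ᵐ x ∂(volume.restrict (slab m R)), p x) :
    ∀ᵐ x ∂(volume.restrict (cell m R)), p x :=
  ae_restrict_of_ae_restrict_of_subset cell_subset_slab h

/-- The compact embedding of `H¹` of the layer into `L²` of a cell: a bounded sequence in `H¹` which
tends weakly to zero tends to zero in `L²` of the cell. -/
theorem tendsto_cell_of_weakly_null (hR : 0 < R) {U : ℕ → Jet m R} (hU : ∀ n, U n ∈ H1 m R)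
    {M : ℝ} (hM : ∀ n, ‖U n‖ ≤ M) (h0 : ∀ f : L2Slab m R,
      Tendsto (fun n => inner ℂ f (U n none)) atTop (𝓝 0)) :
    Tendsto (fun n => eLpNorm (U n none) 2 (volume.restrict (cell m R))) atTop (𝓝 0) := by
  obtain ⟨χ, hχ, hχc, hχR, hχ1⟩ := exists_cellCutoff (m := m) hR
  obtain ⟨C, hC0, hC⟩ := exists_eLpNorm_ext_le (R := R) hχ hχc
  obtain ⟨D, hD0, hD⟩ := exists_norm_coord_le (m := m)
  have hmain : Tendsto (fun n => eLpNorm (extFun χ (U n)) 2 volume) atTop (𝓝 0) := by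
    refine tendsto_eLpNorm_of_weakly_null (K := tsupport χ)
      (B := Fintype.card (Dir m) * D * (C * M)) (M := C * M)
      (fun n => memLp_extFun hχ hχc (U n)) hχc (fun n x hx => extFun_eq_zero _ hx) ?_ ?_ ?_
    · intro n y
      have hd := HasWeakDerivOn.of_dirVec (fun j => hasWeakDerivOn_extFun hχ hχR (hU n) j)
        ((memLp_extFun hχ hχc (U n)).locallyIntegrable (by norm_num))
        (fun j => (memLp_extGrad hχ hχc (U n) j).locallyIntegrable (by norm_num)) y
      have hm : MemLp (fun x => ∑ j, (coord m j y : ℂ) * extGrad χ (U n) j x) 2 volume :=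
        memLp_finsetSum _ fun j _ => (memLp_extGrad hχ hχc (U n) j).const_mul _
      refine (hd.eLpNorm_translate_sub_le (memLp_extFun hχ hχc (U n)) hm).trans ?_
      refine (eLpNorm_sum_const_mul_le (D := D * ‖y‖) (B := C * M) _
        (fun j => (memLp_extGrad hχ hχc (U n) j).1) (fun j => hD j y)
        fun j => ((hC (U n)).2 j).trans ?_).trans (le_of_eq ?_)
      · gcongr; exact hM n
      · ring_nf
    · intro n
      refine (hC (U n)).1.trans ?_
      gcongr
      exact hM n
    · intro ψ hψ hψc
      have hψ' : ContDiff ℝ ∞ (foldExt R 1 fun x => χ x * ψ x) := contDiff_foldExt _ (hχ.mul hψ)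
      have hψc' : HasCompactSupport (foldExt R 1 fun x => χ x * ψ x) :=
        hasCompactSupport_foldExt _ hψc.mul_left
      have hm : MemLp (fun x => conj (foldExt R 1 (fun x => χ x * ψ x) x)) 2
          ((volume : Measure (Pt m)).restrict (slab m R)) :=
        memLp_test R (Complex.continuous_conj.comp hψ'.continuous)
          (hψc'.comp_left (g := conj) (map_zero _))
      refine (h0 (hm.toLp _)).congr fun n => ?_
      have e1 : ∀ x, extFun χ (U n) x * ψ x = foldExt R 1 (zext (U n none)) x * (χ x * ψ x) :=
        fun x => by rw [extFun]; ring
      simp_rw [e1]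
      rw [integral_foldExt_mul _ (memLp_zext _)
        ((hχ.mul hψ).continuous.memLp_of_hasCompactSupport hψc.mul_left), integral_zext_mul,
        L2.inner_def]
      refine integral_congr_ae ?_
      filter_upwards [MemLp.coeFn_toLp hm] with x hx
      rw [hx]
      simp
  refine tendsto_of_tendsto_of_tendsto_of_le_of_le tendsto_const_nhds hmain
    (fun _ => zero_le) fun n => ?_
  have : eLpNorm (U n none) 2 (volume.restrict (cell m R))
      = eLpNorm (extFun χ (U n)) 2 (volume.restrict (cell m R)) := by
    refine eLpNorm_congr_ae ?_
    filter_upwards [ae_restrict_mem measurableSet_cell] with x hx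
    rw [extFun_eq _ (cell_subset_slab hx) (hχ1 x hx)]
  rw [this]
  exact eLpNorm_restrict_le _ _ _ _

lemma norm_fderiv_le_sum_pd (f : Pt m → ℂ) (x : Pt m) {D : ℝ} (hD0 : 0 ≤ D)
    (hD : ∀ (j : Dir m) (y : Pt m), ‖(coord m j y : ℂ)‖ ≤ D * ‖y‖) :
    ‖fderiv ℝ f x‖ ≤ ‖∑ j, (D : ℂ) * (‖pd j f x‖ : ℂ)‖ := by
  have e : ‖∑ j, (D : ℂ) * (‖pd j f x‖ : ℂ)‖ = ∑ j, D * ‖pd j f x‖ := by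
    have : ∑ j, (D : ℂ) * (‖pd j f x‖ : ℂ) = ((∑ j, D * ‖pd j f x‖ : ℝ) : ℂ) := by push_cast; rfl
    rw [this, Complex.norm_real, Real.norm_of_nonneg]
    exact Finset.sum_nonneg fun j _ => by positivity
  rw [e]
  refine ContinuousLinearMap.opNorm_le_bound _
    (Finset.sum_nonneg fun j _ => by positivity) fun y => ?_
  conv_lhs => rw [← sum_coord_smul_dirVec y]
  rw [map_sum, Finset.sum_mul]
  refine norm_sum_le_of_le _ fun j _ => ?_
  rw [map_smul, norm_smul, mul_right_comm]
  have := hD j y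
  rw [Complex.norm_real] at this
  exact mul_le_mul_of_nonneg_right this (norm_nonneg _)

/-- The Sobolev inequality `‖f‖_{L⁴} ≤ C ‖∇f‖_{L²}` for smooth functions with support in a fixed
compact set, in dimension two and three. -/
lemma exists_eLpNorm_four_le_fderiv (hm : m = 1 ∨ m = 2) {K : Set (Pt m)} (hK : IsCompact K) :
    ∃ C : ENNReal, C ≠ ⊤ ∧ ∀ f : Pt m → ℂ, ContDiff ℝ 1 f → (∀ x ∉ K, f x = 0) →
      eLpNorm f 4 volume ≤ C * eLpNorm (fderiv ℝ f) 2 volume := by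
  have hfin : Module.finrank ℝ (Pt m) = m + 1 := by
    rw [Module.finrank_prod]; simp
  obtain ⟨p, hp1, hp2, hpm, hpq⟩ : ∃ p : NNReal, 1 ≤ p ∧ p ≤ 2 ∧ p < (Module.finrank ℝ (Pt m) : NNReal) ∧
      (p : ℝ)⁻¹ - (Module.finrank ℝ (Pt m) : ℝ)⁻¹ ≤ ((4 : NNReal) : ℝ)⁻¹ := by
    rw [hfin]
    rcases hm with rfl | rfl
    · refine ⟨4 / 3, ?_, ?_, ?_, ?_⟩
      · rw [← NNReal.coe_le_coe]; norm_num
      · rw [← NNReal.coe_le_coe]; norm_num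
      · rw [← NNReal.coe_lt_coe]; norm_num
      · norm_num
    · refine ⟨12 / 7, ?_, ?_, ?_, ?_⟩
      · rw [← NNReal.coe_le_coe]; norm_num
      · rw [← NNReal.coe_le_coe]; norm_num
      · rw [← NNReal.coe_lt_coe]; norm_num
      · norm_num
  set θ : ℝ := 1 / (p : ENNReal).toReal - 1 / (2 : ENNReal).toReal with hθ
  have hθ0 : 0 ≤ θ := by
    have h1 : (1 : ℝ) ≤ p := by exact_mod_cast hp1
    have h2 : (p : ℝ) ≤ 2 := by exact_mod_cast hp2
    simp only [hθ, ENNReal.coe_toReal, ENNReal.toReal_ofNat, sub_nonneg]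
    exact one_div_le_one_div_of_le (by linarith) h2
  refine ⟨eLpNormLESNormFDerivOfLeConst ℂ (volume : Measure (Pt m)) K p 4 * volume K ^ θ,
    ENNReal.mul_ne_top ENNReal.coe_ne_top
      (ENNReal.rpow_ne_top_of_nonneg hθ0 hK.measure_lt_top.ne), fun f hf hfK => ?_⟩
  have h1 := eLpNorm_le_eLpNorm_fderiv_of_le (volume : Measure (Pt m)) (u := f) (s := K) hf
    (fun x hx => by_contra fun h => hx (hfK x h)) hp1 hpm hpq hK.isBounded
  have hfd : ∀ x ∉ K, fderiv ℝ f x = 0 := by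
    intro x hx
    have : f =ᶠ[𝓝 x] fun _ => 0 := by
      filter_upwards [hK.isClosed.isOpen_compl.mem_nhds hx] with y hy using hfK y hy
    rw [this.fderiv_eq]; simp
  have h2 : eLpNorm (fderiv ℝ f) p volume ≤ eLpNorm (fderiv ℝ f) 2 volume * volume K ^ θ := by
    have hsupp : Function.support (fun x => ‖fderiv ℝ f x‖) ⊆ K := fun x hx =>
      by_contra fun h => hx (by simp [hfd x h])
    rw [← eLpNorm_norm (fderiv ℝ f), ← eLpNorm_norm (fderiv ℝ f),
      ← eLpNorm_restrict_eq_of_support_subset hsupp,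
      ← eLpNorm_restrict_eq_of_support_subset (p := 2) hsupp]
    have := eLpNorm_le_eLpNorm_mul_rpow_measure_univ (μ := (volume : Measure (Pt m)).restrict K)
      (p := (p : ENNReal)) (q := 2) (f := fun x => ‖fderiv ℝ f x‖) (by exact_mod_cast hp2)
      (hf.continuous_fderiv (by simp)).norm.aestronglyMeasurable
    rwa [Measure.restrict_apply_univ] at this
  calc eLpNorm f 4 volume ≤ _ := h1
    _ ≤ _ := by
      rw [mul_assoc, mul_comm (volume K ^ θ)]
      gcongr

/-- The Sobolev inequality for weakly differentiable functions with support in a fixed compact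
set. -/
lemma exists_eLpNorm_four_le (hm : m = 1 ∨ m = 2) {K : Set (Pt m)} (hK : IsCompact K) :
    ∃ C : ℝ, 0 ≤ C ∧ ∀ (w : Pt m → ℂ) (g : Dir m → Pt m → ℂ) (B : ℝ), MemLp w 2 volume →
      (∀ j, MemLp (g j) 2 volume) → (∀ x ∉ K, w x = 0) →
      (∀ j, HasWeakDerivOn volume univ (dirVec m j) w (g j)) → 0 < B →
      (∀ j, eLpNorm (g j) 2 volume ≤ ENNReal.ofReal B) →
      eLpNorm w 4 volume ≤ ENNReal.ofReal (C * B) := by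
  obtain ⟨C, hC, hCf⟩ := exists_eLpNorm_four_le_fderiv hm (hK.cthickening (r := 1))
  obtain ⟨D, hD0, hD⟩ := exists_norm_coord_le (m := m)
  refine ⟨C.toReal * (Fintype.card (Dir m) * D * 2), by positivity,
    fun w g B hw hg hwK hwd hB hgB => ?_⟩
  have hli : LocallyIntegrable w := hw.locallyIntegrable (by norm_num)
  have hsm : ∀ n, ContDiff ℝ ∞ (mollify volume n w) := fun n => contDiff_mollify n hli
  have hpd : ∀ n j, pd j (mollify volume n w) = mollify volume n (g j) := by
    intro n j
    ext x
    exact (hwd j).fderiv_smear (contDiff_molKernel _) (hasCompactSupport_molKernel _) hli x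
  have hgms : ∀ n j, AEStronglyMeasurable (mollify volume n (g j)) := fun n j =>
    (contDiff_mollify n ((hg j).locallyIntegrable (by norm_num))).continuous.aestronglyMeasurable
  have hbd : ∀ᶠ n in atTop, eLpNorm (mollify volume n w) 4 volume
      ≤ ENNReal.ofReal (C.toReal * (Fintype.card (Dir m) * D * 2) * B) := by
    have hev : ∀ᶠ n in atTop, ∀ j, eLpNorm (fun x => mollify volume n (g j) x - g j x) 2 volume
        ≤ ENNReal.ofReal B := by
      rw [eventually_all]
      intro j
      exact (tendsto_eLpNorm_mollify_sub (hg j)).eventually_le_const (by simpa using hB)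
    filter_upwards [hev] with n hn
    have hgn : ∀ j, eLpNorm (pd j (mollify volume n w)) 2 volume ≤ ENNReal.ofReal (2 * B) := by
      intro j
      rw [hpd n j]
      have e : mollify volume n (g j) = (fun x => mollify volume n (g j) x - g j x) + g j := by
        ext x; simp
      rw [e]
      refine (eLpNorm_add_le ((hgms n j).sub (hg j).1) (hg j).1 (by norm_num)).trans ?_
      rw [two_mul, ENNReal.ofReal_add hB.le hB.le]
      exact add_le_add (hn j) (hgB j)
    have h1 := hCf (mollify volume n w) ((hsm n).of_le (by simp))
      fun x hx => mollify_eq_zero hwK hx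
    refine h1.trans ?_
    have h2 : eLpNorm (fderiv ℝ (mollify volume n w)) 2 volume
        ≤ ENNReal.ofReal (Fintype.card (Dir m) * D * (2 * B)) := by
      refine (eLpNorm_mono fun x => norm_fderiv_le_sum_pd _ x hD0 hD).trans ?_
      refine eLpNorm_sum_const_mul_le (D := D) (B := 2 * B) (fun _ => (D : ℂ))
        (g := fun j x => (‖pd j (mollify volume n w) x‖ : ℂ)) (fun j => ?_) (fun j => ?_) fun j => ?_
      · exact (Complex.continuous_ofReal.comp
          (contDiff_pd (hsm n) j).continuous.norm).aestronglyMeasurable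
      · rw [Complex.norm_real, Real.norm_of_nonneg hD0]
      · refine le_trans (le_of_eq ?_) (hgn j)
        exact eLpNorm_congr_norm_ae (Eventually.of_forall fun x => by simp)
    calc C * _ ≤ C * ENNReal.ofReal (Fintype.card (Dir m) * D * (2 * B)) := by gcongr
      _ = _ := by
        conv_lhs => rw [← ENNReal.ofReal_toReal hC]
        rw [← ENNReal.ofReal_mul (by positivity)]
        congr 1; ring
  refine eLpNorm_le_of_tendstoInMeasure hbd ?_ fun n => (hsm n).continuous.aestronglyMeasurable
  exact tendstoInMeasure_of_tendsto_eLpNorm (p := 2) (by norm_num)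
    (fun n => (hsm n).continuous.aestronglyMeasurable) hw.1 (tendsto_eLpNorm_mollify_sub hw)

/-- The Sobolev embedding `H¹(Ω^R) → L⁴` of a cell. -/
theorem exists_eLpNorm_cell_four_le (hm : m = 1 ∨ m = 2) (hR : 0 < R) :
    ∃ C : ℝ, 0 ≤ C ∧ ∀ U ∈ H1 m R,
      eLpNorm (U none) 4 (volume.restrict (cell m R)) ≤ ENNReal.ofReal (C * ‖U‖) := by
  obtain ⟨χ, hχ, hχc, hχR, hχ1⟩ := exists_cellCutoff (m := m) hR
  obtain ⟨C, hC0, hC⟩ := exists_eLpNorm_ext_le (R := R) hχ hχc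
  obtain ⟨C', hC'0, hC'⟩ := exists_eLpNorm_four_le hm (K := tsupport χ) hχc
  refine ⟨C' * C, by positivity, fun U hU => ?_⟩
  rcases eq_or_ne U 0 with rfl | hU0
  · have h : ((0 : L2Slab m R) : Pt m → ℂ) =ᵐ[volume.restrict (cell m R)] 0 :=
      coeFn_ae_cell (Lp.coeFn_zero _ _ _)
    simp only [PiLp.zero_apply]
    rw [eLpNorm_congr_ae h]
    simp
  have hpos : 0 < ‖U‖ := norm_pos_iff.2 hU0
  have h1 := hC' (extFun χ U) (extGrad χ U) (C * ‖U‖) (memLp_extFun hχ hχc U)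
    (memLp_extGrad hχ hχc U) (fun x hx => extFun_eq_zero U hx)
    (hasWeakDerivOn_extFun hχ hχR hU) (by positivity) (hC U).2
  have : eLpNorm (U none) 4 (volume.restrict (cell m R))
      = eLpNorm (extFun χ U) 4 (volume.restrict (cell m R)) := by
    refine eLpNorm_congr_ae ?_
    filter_upwards [ae_restrict_mem measurableSet_cell] with x hx
    rw [extFun_eq _ (cell_subset_slab hx) (hχ1 x hx)]
  rw [this, mul_assoc]
  exact (eLpNorm_restrict_le _ _ _ _).trans h1

end Embedding

/-! ### Weak derivatives and the Fourier transform -/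

section FourierWeak

variable {V : Type*} [NormedAddCommGroup V] [InnerProductSpace ℝ V] [FiniteDimensional ℝ V]
  [MeasurableSpace V] [BorelSpace V]

open SchwartzMap LineDeriv in
/-- A weak derivative in `L²` may be tested with Schwartz functions. -/
lemma HasWeakDerivOn.integral_schwartz {f h : Lp ℂ 2 (volume : Measure V)} {v : V}
    (hd : HasWeakDerivOn volume univ v (f : V → ℂ) h) (ψ : 𝓢(V, ℂ)) :
    ∫ x, f x * fderiv ℝ ψ x v = -∫ x, h x * ψ x := by
  let b : ContDiffBump (0 : V) := ⟨1, 2, one_pos, one_lt_two⟩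
  set s : ℕ → V → V := fun n x => ((n : ℝ) + 1)⁻¹ • x with hs
  have hbs : ContDiff ℝ ∞ fun x => (b x : ℂ) := Complex.ofRealCLM.contDiff.comp b.contDiff
  have hbc : HasCompactSupport fun x => (b x : ℂ) :=
    b.hasCompactSupport.comp_left (g := fun r : ℝ => (r : ℂ)) rfl
  obtain ⟨C, hC⟩ := ((hbs.continuous_fderiv (by simp)).clm_apply
    continuous_const).bounded_above_of_compact_support (hbc.fderiv_apply (𝕜 := ℝ) v)
  have hφs : ∀ n, ContDiff ℝ ∞ fun x => (b (s n x) : ℂ) := fun n =>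
    hbs.comp (contDiff_const.smul contDiff_id)
  have hφc : ∀ n, HasCompactSupport fun x => (b (s n x) : ℂ) := fun n =>
    hbc.comp_smul (by positivity : ((n : ℝ) + 1)⁻¹ ≠ 0)
  have hφd : ∀ n x, fderiv ℝ (fun x => (b (s n x) : ℂ)) x v
      = (((n : ℝ) + 1)⁻¹ : ℝ) * fderiv ℝ (fun x => (b x : ℂ)) (s n x) v := by
    intro n x
    have h1 : HasFDerivAt (s n) (((n : ℝ) + 1)⁻¹ • ContinuousLinearMap.id ℝ V) x :=
      (hasFDerivAt_id x).const_smul _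
    have h2 := (hbs.differentiable (by simp) (s n x)).hasFDerivAt.comp x h1
    have h3 : HasFDerivAt (fun x => (b (s n x) : ℂ)) _ x := h2
    rw [h3.fderiv]
    simp
  have hψs : ContDiff ℝ ∞ ψ := ψ.smooth ⊤
  have hψm : MemLp ψ 2 volume := ψ.memLp 2 volume
  have hdm : MemLp (fun x => fderiv ℝ ψ x v) 2 volume := (∂_{v} ψ).memLp 2 volume
  have i1 : Integrable fun x => f x * fderiv ℝ ψ x v := (Lp.memLp f).integrable_mul hdm
  have i2 : Integrable fun x => h x * ψ x := (Lp.memLp h).integrable_mul hψm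
  have i3 : Integrable fun x => f x * ψ x := (Lp.memLp f).integrable_mul hψm
  have hb1 : ∀ n x, ‖(b (s n x) : ℂ)‖ ≤ 1 := fun n x => by
    rw [Complex.norm_real, Real.norm_of_nonneg b.nonneg]; exact b.le_one
  have hbev : ∀ x, ∀ᶠ n : ℕ in atTop, b (s n x) = 1 := by
    intro x
    have : Tendsto (fun n : ℕ => (n : ℝ) + 1) atTop atTop :=
      tendsto_atTop_add_const_right _ _ tendsto_natCast_atTop_atTop
    filter_upwards [this.eventually_ge_atTop ‖x‖] with n hn
    refine b.one_of_mem_closedBall ?_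
    rw [mem_closedBall_zero_iff, hs]
    change ‖((n : ℝ) + 1)⁻¹ • x‖ ≤ 1
    rw [norm_smul, norm_inv, Real.norm_of_nonneg (by positivity), inv_mul_le_one₀ (by positivity)]
    exact hn
  have hlim : ∀ {g : V → ℂ}, Integrable g →
      Tendsto (fun n => ∫ x, (b (s n x) : ℂ) * g x) atTop (𝓝 (∫ x, g x)) := by
    intro g hg
    refine tendsto_integral_of_dominated_convergence (fun x => ‖g x‖)
      (fun n => (hφs n).continuous.aestronglyMeasurable.mul hg.1) hg.norm
      (fun n => Eventually.of_forall fun x => ?_) (Eventually.of_forall fun x => ?_)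
    · rw [norm_mul]
      exact mul_le_of_le_one_left (norm_nonneg _) (hb1 n x)
    · refine tendsto_const_nhds.congr' ?_
      filter_upwards [hbev x] with n hn
      simp [hn]
  have hlim0 : Tendsto (fun n => ∫ x, fderiv ℝ (fun x => (b (s n x) : ℂ)) x v * (f x * ψ x)) atTop
      (𝓝 0) := by
    have hinv : Tendsto (fun n : ℕ => ((n : ℝ) + 1)⁻¹) atTop (𝓝 0) :=
      tendsto_inv_atTop_zero.comp
        (tendsto_atTop_add_const_right _ _ tendsto_natCast_atTop_atTop)
    have hbound : Tendsto (fun n : ℕ => ((n : ℝ) + 1)⁻¹ * (C * ∫ x, ‖f x * ψ x‖)) atTop (𝓝 0) := by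
      simpa using hinv.mul_const (C * ∫ x, ‖f x * ψ x‖)
    refine squeeze_zero_norm (fun n => ?_) hbound
    rw [← mul_assoc, ← integral_const_mul]
    refine norm_integral_le_of_norm_le (i3.norm.const_mul _) (Eventually.of_forall fun x => ?_)
    rw [norm_mul, hφd, norm_mul, Complex.norm_real, Real.norm_of_nonneg (by positivity)]
    gcongr
    exact hC (s n x)
  have heq : ∀ n, (∫ x, (b (s n x) : ℂ) * (f x * fderiv ℝ ψ x v))
      + (∫ x, fderiv ℝ (fun x => (b (s n x) : ℂ)) x v * (f x * ψ x))
      = -∫ x, (b (s n x) : ℂ) * (h x * ψ x) := by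
    intro n
    have h1 := hd (fun x => (b (s n x) : ℂ) * ψ x) ((hφs n).mul hψs) (hφc n).mul_right
      (subset_univ _)
    have e1 : ∀ x, f x * fderiv ℝ (fun x => (b (s n x) : ℂ) * ψ x) x v
        = (b (s n x) : ℂ) * (f x * fderiv ℝ ψ x v)
          + fderiv ℝ (fun x => (b (s n x) : ℂ)) x v * (f x * ψ x) := by
      intro x
      rw [fderiv_fun_mul ((hφs n).differentiable (by simp) x) (hψs.differentiable (by simp) x)]
      simp only [_root_.add_apply, _root_.smul_apply, smul_eq_mul]
      ring
    have e2 : ∀ x, h x * ((b (s n x) : ℂ) * ψ x) = (b (s n x) : ℂ) * (h x * ψ x) := fun x => by ring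
    simp_rw [e1, e2] at h1
    have j1 : Integrable fun x => (b (s n x) : ℂ) * (f x * fderiv ℝ ψ x v) :=
      i1.bdd_mul (hφs n).continuous.aestronglyMeasurable (Eventually.of_forall (hb1 n))
    have j2 : Integrable fun x => fderiv ℝ (fun x => (b (s n x) : ℂ)) x v * (f x * ψ x) := by
      refine i3.bdd_mul (c := ((n : ℝ) + 1)⁻¹ * C) (((hφs n).continuous_fderiv (by simp)).clm_apply
        continuous_const).aestronglyMeasurable (Eventually.of_forall fun x => ?_)
      rw [hφd, norm_mul, Complex.norm_real, Real.norm_of_nonneg (by positivity)]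
      gcongr
      exact hC (s n x)
    rwa [integral_add j1 j2] at h1
  have hl := (hlim i1).add hlim0
  rw [add_zero] at hl
  exact tendsto_nhds_unique hl ((hlim i2).neg.congr fun n => (heq n).symm)

open SchwartzMap LineDeriv in
/-- The Fourier transform turns a weak derivative into a multiplication. -/
theorem HasWeakDerivOn.fourier_eq {f h : Lp ℂ 2 (volume : Measure V)} {v : V}
    (hd : HasWeakDerivOn volume univ v (f : V → ℂ) h) :
    ((𝓕 h : Lp ℂ 2 (volume : Measure V)) : V → ℂ) =ᵐ[volume]
      fun η => 2 * Real.pi * Complex.I * (inner ℝ η v : ℝ) * (𝓕 f : Lp ℂ 2 (volume : Measure V)) η := by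
  have h1 : ∂_{v} (f : 𝓢'(V, ℂ)) = (h : 𝓢'(V, ℂ)) := by
    ext ψ
    rw [TemperedDistribution.lineDerivOp_apply_apply, map_neg,
      Lp.toTemperedDistribution_apply, Lp.toTemperedDistribution_apply]
    have := hd.integral_schwartz ψ
    simp only [smul_eq_mul, lineDerivOp_apply_eq_fderiv]
    simp_rw [mul_comm _ (f _), mul_comm _ (h _), this, neg_neg]
  have h2 := TemperedDistribution.fourier_lineDerivOp_eq (f : 𝓢'(V, ℂ)) v
  rw [h1, Lp.fourier_toTemperedDistribution_eq, Lp.fourier_toTemperedDistribution_eq] at h2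
  have hsm : ContDiff ℝ ∞ fun η : V =>
      (2 * Real.pi * Complex.I * (inner ℝ η v : ℝ) : ℂ) :=
    contDiff_const.mul (Complex.ofRealCLM.contDiff.comp (contDiff_id.inner ℝ contDiff_const))
  have hl1 : LocallyIntegrable ((𝓕 h : Lp ℂ 2 (volume : Measure V)) : V → ℂ) :=
    (Lp.memLp _).locallyIntegrable (by norm_num)
  have hl2 : LocallyIntegrable ((𝓕 f : Lp ℂ 2 (volume : Measure V)) : V → ℂ) :=
    (Lp.memLp _).locallyIntegrable (by norm_num)
  have hl3 : LocallyIntegrable fun η => (2 * Real.pi * Complex.I * (inner ℝ η v : ℝ) : ℂ)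
      * (𝓕 f : Lp ℂ 2 (volume : Measure V)) η := by
    rw [← locallyIntegrableOn_univ] at hl2 ⊢
    exact hl2.continuousOn_mul hsm.continuous.continuousOn isClosed_univ.isLocallyClosed
  refine ae_eq_of_integral_contDiff_smul_eq hl1 hl3 fun g hg hgc => ?_
  have hgs : ContDiff ℝ ∞ fun x => (g x : ℂ) := Complex.ofRealCLM.contDiff.comp hg
  have hgcc : HasCompactSupport fun x => (g x : ℂ) :=
    hgc.comp_left (g := fun r : ℝ => (r : ℂ)) rfl
  have h3 := congrArg (fun T : 𝓢'(V, ℂ) => T (hgcc.toSchwartzMap hgs)) h2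
  have htg : (fun x : V => ((inner ℝ x v : ℝ) : ℂ)).HasTemperateGrowth := by fun_prop
  simp only [Lp.toTemperedDistribution_apply, _root_.smul_apply,
    TemperedDistribution.smulLeftCLM_apply_apply, SchwartzMap.smulLeftCLM_apply_apply htg,
    HasCompactSupport.toSchwartzMap_toFun, smul_eq_mul] at h3
  simp_rw [Complex.real_smul]
  refine h3.trans ?_
  rw [← integral_const_mul]
  refine integral_congr_ae (Eventually.of_forall fun x => ?_)
  change _ * (_ * (g x : ℂ) * _) = _
  ring

end FourierWeak

/-! ### Vertical averages and the trace -/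

section Tensor

variable {m : ℕ} {R : ℝ}

lemma memLp_tensor (R : ℝ) (θ : C(ℝ, ℝ)) {g : Hor m → ℂ} (hg : MemLp g 2 volume) :
    MemLp (fun x : Pt m => (θ x.2 : ℂ) * g x.1) 2
      ((volume : Measure (Pt m)).restrict (slab m R)) := by
  have h1 : MemLp (fun x : Pt m => g x.1) 2 ((volume : Measure (Pt m)).restrict (slab m R)) := by
    rw [restrict_slab]
    exact hg.comp_fst _
  obtain ⟨C, hC⟩ := (isCompact_Icc (a := 0) (b := R)).exists_bound_of_continuousOn
    θ.continuous.continuousOn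
  have hc : Continuous fun x : Pt m => (θ x.2 : ℂ) :=
    Complex.continuous_ofReal.comp (θ.continuous.comp continuous_snd)
  refine h1.of_le_mul (c := C) (hc.aestronglyMeasurable.mul h1.1) ?_
  filter_upwards [ae_restrict_mem measurableSet_slab] with x hx
  rw [norm_mul, Complex.norm_real]
  exact mul_le_mul_of_nonneg_right (hC _ ⟨hx.2.1.le, hx.2.2.le⟩) (norm_nonneg _)

/-- The `L²(0, R)` inner product of two continuous functions. -/
def segInner (R : ℝ) (θ ρ : C(ℝ, ℝ)) : ℝ := ∫ t in Ioo 0 R, θ t * ρ t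

lemma segInner_self_nonneg (R : ℝ) (θ : C(ℝ, ℝ)) : 0 ≤ segInner R θ θ :=
  integral_nonneg fun _ => mul_self_nonneg _

lemma integral_tensor (R : ℝ) (θ ρ : C(ℝ, ℝ)) (g h : Hor m → ℂ) :
    ∫ x in slab m R, conj ((θ x.2 : ℂ) * g x.1) * ((ρ x.2 : ℂ) * h x.1)
      = (segInner R θ ρ : ℂ) * ∫ y, conj (g y) * h y := by
  rw [restrict_slab]
  have e : ∀ x : Pt m, conj ((θ x.2 : ℂ) * g x.1) * ((ρ x.2 : ℂ) * h x.1)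
      = (conj (g x.1) * h x.1) * ((θ x.2 * ρ x.2 : ℝ) : ℂ) := by
    intro x
    rw [map_mul, Complex.conj_ofReal]
    push_cast
    ring
  simp_rw [e]
  rw [integral_prod_mul (fun y => conj (g y) * h y) (fun t => ((θ t * ρ t : ℝ) : ℂ)), mul_comm,
    segInner, ← integral_complex_ofReal]

/-- The operator `ψ ↦ ψ(x') θ(x_d)` from `L²(ℝ^{d-1})` to `L²(Ω^R)`. -/
def tensor (m : ℕ) (R : ℝ) (θ : C(ℝ, ℝ)) : L2Hor m →L[ℂ] L2Slab m R :=
  LinearMap.mkContinuous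
    { toFun := fun g => (memLp_tensor R θ (Lp.memLp g)).toLp _
      map_add' := by
        intro g h
        rw [← MemLp.toLp_add]
        refine MemLp.toLp_congr _ _ ?_
        filter_upwards [ae_comp_fst R (Lp.coeFn_add g h)] with x hx
        rw [hx, Pi.add_apply, Pi.add_apply, mul_add]
      map_smul' := by
        intro c g
        rw [RingHom.id_apply, ← MemLp.toLp_const_smul]
        refine MemLp.toLp_congr _ _ ?_
        filter_upwards [ae_comp_fst R (Lp.coeFn_smul c g)] with x hx
        rw [hx, Pi.smul_apply, Pi.smul_apply, smul_eq_mul, smul_eq_mul, mul_left_comm] }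
    (Real.sqrt (segInner R θ θ)) (by
      intro g
      rw [← Real.sqrt_sq (norm_nonneg g), ← Real.sqrt_mul (segInner_self_nonneg R θ)]
      refine Real.le_sqrt_of_sq_le (le_of_eq ?_)
      rw [← Complex.ofReal_inj]
      have h1 := inner_self_eq_norm_sq_to_K (𝕜 := ℂ) ((memLp_tensor R θ (Lp.memLp g)).toLp _)
      have h2 := inner_self_eq_norm_sq_to_K (𝕜 := ℂ) g
      rw [L2.inner_def] at h1 h2
      simp only [LinearMap.coe_mk, AddHom.coe_mk, Complex.ofReal_pow, Complex.ofReal_mul]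
      refine h1.symm.trans ?_
      refine Eq.trans ?_ (congrArg (fun z => (segInner R θ θ : ℂ) * z) h2)
      refine Eq.trans ?_ ((integral_tensor R θ θ g g).trans ?_)
      · refine integral_congr_ae ?_
        filter_upwards [MemLp.coeFn_toLp (memLp_tensor R θ (Lp.memLp g))] with x hx
        rw [hx, RCLike.inner_apply, mul_comm]
      · simp only [RCLike.inner_apply, mul_comm])

lemma tensor_coe (θ : C(ℝ, ℝ)) (g : L2Hor m) :
    (tensor m R θ g : Pt m → ℂ) =ᵐ[volume.restrict (slab m R)] fun x => (θ x.2 : ℂ) * g x.1 :=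
  MemLp.coeFn_toLp (memLp_tensor R θ (Lp.memLp g))

lemma inner_tensor_tensor (θ ρ : C(ℝ, ℝ)) (g h : L2Hor m) :
    inner ℂ (tensor m R θ g) (tensor m R ρ h) = (segInner R θ ρ : ℂ) * inner ℂ g h := by
  rw [L2.inner_def, L2.inner_def]
  refine Eq.trans ?_ ((integral_tensor R θ ρ g h).trans ?_)
  · refine integral_congr_ae ?_
    filter_upwards [tensor_coe θ g, tensor_coe ρ h] with x h1 h2
    rw [h1, h2, RCLike.inner_apply, mul_comm]
  · simp only [RCLike.inner_apply, mul_comm]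

/-- The weighted vertical average `∫ θ(t) f(x', t) dt` of a function in the layer. -/
def slice (θ : C(ℝ, ℝ)) (f : L2Slab m R) : L2Hor m :=
  ContinuousLinearMap.adjoint (tensor m R θ) f

lemma inner_slice (θ : C(ℝ, ℝ)) (g : L2Hor m) (f : L2Slab m R) :
    inner ℂ g (slice θ f) = inner ℂ (tensor m R θ g) f :=
  ContinuousLinearMap.adjoint_inner_right _ _ _

lemma integral_slice_mul (θ : C(ℝ, ℝ)) (f : L2Slab m R) {ψ : Hor m → ℂ} (hψ : MemLp ψ 2 volume) :
    ∫ y, slice θ f y * ψ y = ∫ x, zext f x * ((θ x.2 : ℂ) * ψ x.1) := by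
  have hc : MemLp (fun y => conj (ψ y)) 2 volume := hψ.star
  have h := inner_slice θ (hc.toLp _) f
  rw [L2.inner_def, L2.inner_def] at h
  rw [integral_zext_mul]
  refine Eq.trans ?_ (h.trans ?_)
  · refine integral_congr_ae ?_
    filter_upwards [MemLp.coeFn_toLp hc] with y hy
    rw [hy, RCLike.inner_apply, Complex.conj_conj]
  · refine integral_congr_ae ?_
    filter_upwards [tensor_coe θ (hc.toLp _), ae_comp_fst R (MemLp.coeFn_toLp hc)] with x hx hy
    rw [hx, hy, RCLike.inner_apply, map_mul, Complex.conj_conj, Complex.conj_ofReal]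

/-- A cutoff function in one variable, equal to `1` near `[0, R]`. -/
lemma exists_segCutoff (hR : 0 < R) : ∃ ρ : ℝ → ℂ, ContDiff ℝ ∞ ρ ∧ HasCompactSupport ρ ∧
    ∀ t ∈ Icc 0 R, ρ =ᶠ[𝓝 t] fun _ => 1 := by
  let b : ContDiffBump (R / 2) := ⟨R, 2 * R, hR, by linarith⟩
  refine ⟨fun t => (b t : ℂ), Complex.ofRealCLM.contDiff.comp b.contDiff,
    b.hasCompactSupport.comp_left (g := fun r : ℝ => (r : ℂ)) rfl, fun t ht => ?_⟩
  filter_upwards [Metric.isOpen_ball.mem_nhds (show t ∈ Metric.ball (R / 2) R by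
    rw [Metric.mem_ball, Real.dist_eq, abs_lt]; constructor <;> linarith [ht.1, ht.2])] with s hs
  rw [b.one_of_mem_closedBall (Metric.ball_subset_closedBall hs), Complex.ofReal_one]

/-- Integration by parts against a product `θ(x_d) ψ(x')`. -/
lemma green_tensor (hR : 0 < R) {U : Jet m R} (hU : U ∈ H1 m R) (j : Dir m) {θ : ℝ → ℝ}
    (hθ : ContDiff ℝ ∞ θ) {ψ : Hor m → ℂ} (hψ : ContDiff ℝ ∞ ψ) (hψc : HasCompactSupport ψ)
    (h0 : (dirVec m j).2 ≠ 0 → θ 0 = 0 ∧ θ R = 0) :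
    ∫ x, zext (U none) x * ((deriv θ x.2 * (dirVec m j).2 : ℝ) * ψ x.1
        + (θ x.2 : ℂ) * fderiv ℝ ψ x.1 (dirVec m j).1)
      = -∫ x, zext (U (some j)) x * ((θ x.2 : ℂ) * ψ x.1) := by
  obtain ⟨ρ, hρ, hρc, hρ1⟩ := exists_segCutoff hR
  set Φ : Pt m → ℂ := fun x => ρ x.2 * ((θ x.2 : ℂ) * ψ x.1) with hΦd
  have hθc : ContDiff ℝ ∞ fun x : Pt m => (θ x.2 : ℂ) :=
    Complex.ofRealCLM.contDiff.comp (hθ.comp contDiff_snd)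
  have hψ1 : ContDiff ℝ ∞ fun x : Pt m => ψ x.1 := hψ.comp contDiff_fst
  have hΦ : ContDiff ℝ ∞ Φ := (hρ.comp contDiff_snd).mul (hθc.mul hψ1)
  have hΦc : HasCompactSupport Φ := by
    refine HasCompactSupport.intro (hψc.isCompact.prod hρc.isCompact) fun x hx => ?_
    rw [mem_prod, not_and_or] at hx
    rcases hx with h | h
    · simp [hΦd, image_eq_zero_of_notMem_tsupport h]
    · simp [hΦd, image_eq_zero_of_notMem_tsupport h]
  have hg := green hU j hΦ hΦc (fun hj y => by simp [hΦd, (h0 hj).1, (h0 hj).2])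
  have hpd : ∀ x ∈ slab m R, pd j Φ x = (deriv θ x.2 * (dirVec m j).2 : ℝ) * ψ x.1
        + (θ x.2 : ℂ) * fderiv ℝ ψ x.1 (dirVec m j).1 := by
    intro x hx
    have hev : Φ =ᶠ[𝓝 x] fun x => (θ x.2 : ℂ) * ψ x.1 := by
      have := (hρ1 x.2 ⟨hx.2.1.le, hx.2.2.le⟩)
      filter_upwards [continuous_snd.continuousAt.eventually this] with z hz
      simp [hΦd, hz]
    have h1 : HasFDerivAt (fun x : Pt m => (θ x.2 : ℂ)) (Complex.ofRealCLM.comp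
        ((ContinuousLinearMap.toSpanSingleton ℝ (deriv θ x.2)).comp
          (ContinuousLinearMap.snd ℝ (Hor m) ℝ))) x := by
      have h2 : HasDerivAt θ (deriv θ x.2) x.2 := (hθ.differentiable (by simp) x.2).hasDerivAt
      exact Complex.ofRealCLM.hasFDerivAt.comp x (h2.hasFDerivAt.comp x hasFDerivAt_snd)
    have h3 : HasFDerivAt (fun x : Pt m => ψ x.1)
        ((fderiv ℝ ψ x.1).comp (ContinuousLinearMap.fst ℝ (Hor m) ℝ)) x :=
      (hψ.differentiable (by simp) x.1).hasFDerivAt.comp x hasFDerivAt_fst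
    have h4 : HasFDerivAt (fun x : Pt m => (θ x.2 : ℂ) * ψ x.1) _ x := h1.mul h3
    rw [pd, hev.fderiv_eq, h4.fderiv]
    simp only [_root_.add_apply, _root_.smul_apply, smul_eq_mul, ContinuousLinearMap.comp_apply,
      ContinuousLinearMap.coe_fst', ContinuousLinearMap.coe_snd', Complex.ofRealCLM_apply,
      ContinuousLinearMap.toSpanSingleton_apply]
    push_cast
    ring
  refine Eq.trans ?_ (hg.trans ?_)
  · refine integral_congr_ae (Eventually.of_forall fun x => ?_)
    by_cases hx : x ∈ slab m R
    · simp only [hpd x hx]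
    · simp [zext_eq_zero _ hx]
  · congr 1
    refine integral_congr_ae (Eventually.of_forall fun x => ?_)
    by_cases hx : x ∈ slab m R
    · simp [hΦd, (hρ1 x.2 ⟨hx.2.1.le, hx.2.2.le⟩).self_of_nhds]
    · simp [zext_eq_zero _ hx]

/-- Vertical averages commute with horizontal weak derivatives. -/
lemma hasWeakDerivOn_slice (hR : 0 < R) {U : Jet m R} (hU : U ∈ H1 m R) (θ : C(ℝ, ℝ))
    (hθ : ContDiff ℝ ∞ θ) (i : Fin m) :
    HasWeakDerivOn volume univ (EuclideanSpace.single i (1 : ℝ)) (slice θ (U none) : Hor m → ℂ)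
      (slice θ (U (some (Sum.inl i)))) := by
  intro ψ hψ hψc _
  have h := green_tensor hR hU (Sum.inl i) hθ hψ hψc fun h => absurd rfl h
  rw [integral_slice_mul θ _ (hψ.continuous.memLp_of_hasCompactSupport hψc),
    integral_slice_mul θ _ (((hψ.continuous_fderiv (by simp)).clm_apply
      continuous_const).memLp_of_hasCompactSupport (hψc.fderiv_apply (𝕜 := ℝ) _)), ← h]
  simp [dirVec]

/-- The monomials `(t / R)^n`. -/
def mono (R : ℝ) (n : ℕ) : C(ℝ, ℝ) := ⟨fun t => (t / R) ^ n, by fun_prop⟩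

/-- The derivatives of the monomials `(t / R)^n`. -/
def monoDeriv (R : ℝ) (n : ℕ) : C(ℝ, ℝ) := ⟨fun t => n * (t / R) ^ (n - 1) / R, by fun_prop⟩

lemma contDiff_mono (R : ℝ) (n : ℕ) : ContDiff ℝ ∞ (mono R n) := by
  change ContDiff ℝ ∞ fun t => (t / R) ^ n
  fun_prop

lemma contDiff_monoDeriv (R : ℝ) (n : ℕ) : ContDiff ℝ ∞ (monoDeriv R n) := by
  change ContDiff ℝ ∞ fun t => n * (t / R) ^ (n - 1) / R
  fun_prop

lemma hasDerivAt_mono (R : ℝ) (n : ℕ) (t : ℝ) : HasDerivAt (mono R n) (monoDeriv R n t) t := by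
  have := ((hasDerivAt_id t).div_const R).pow n
  refine HasDerivAt.congr_deriv (f := mono R n) this ?_
  simp only [id, monoDeriv, ContinuousMap.coe_mk]
  ring

lemma tensor_eq_lift {a b : ℝ} {θ : C(ℝ, ℝ)} (h : ∀ t, θ t = a + b * t) :
    tensor m R θ = PerturbedLayer.lift m R a b := by
  ext1 g
  refine Lp.ext ?_
  filter_upwards [tensor_coe θ g, lift_coe R a b g] with x h1 h2
  rw [h1, h2, h]

/-- The trace on the upper face by Green's formula with the lifting function `(t / R)^n`. -/
lemma traceTop_eq_slice (hR : 0 < R) {U : Jet m R} (hU : U ∈ H1 m R) {n : ℕ} (hn : 1 ≤ n) :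
    traceTop m R U = slice (mono R n) (U (some (Sum.inr ()))) + slice (monoDeriv R n) (U none) := by
  have hbase : traceTop m R U
      = slice (mono R 1) (U (some (Sum.inr ()))) + slice (monoDeriv R 1) (U none) := by
    rw [slice, slice, tensor_eq_lift (a := 0) (b := R⁻¹) (θ := mono R 1),
      tensor_eq_lift (a := R⁻¹) (b := 0) (θ := monoDeriv R 1)]
    · rfl
    · intro t; simp [monoDeriv]
    · intro t; simp [mono, div_eq_inv_mul]
  rw [hbase]
  have hli : ∀ f : L2Hor m, LocallyIntegrable f := fun f =>
    (Lp.memLp f).locallyIntegrable (by norm_num)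
  refine Lp.ext ?_
  refine ae_eq_of_integral_contDiff_smul_eq (hli _) (hli _) fun ψ hψ hψc => ?_
  have hψs : ContDiff ℝ ∞ fun x => (ψ x : ℂ) := Complex.ofRealCLM.contDiff.comp hψ
  have hψcc : HasCompactSupport fun x => (ψ x : ℂ) :=
    hψc.comp_left (g := fun r : ℝ => (r : ℂ)) rfl
  have hψm : MemLp (fun x => (ψ x : ℂ)) 2 volume :=
    hψs.continuous.memLp_of_hasCompactSupport hψcc
  have hsplit : ∀ k, ∫ y, ψ y • (slice (mono R k) (U (some (Sum.inr ())))
      + slice (monoDeriv R k) (U none) : L2Hor m) y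
      = (∫ x, zext (U (some (Sum.inr ()))) x * ((mono R k x.2 : ℂ) * (ψ x.1 : ℂ)))
        + ∫ x, zext (U none) x * ((monoDeriv R k x.2 : ℂ) * (ψ x.1 : ℂ)) := by
    intro k
    have hi : ∀ f : L2Hor m, Integrable fun y => f y * (ψ y : ℂ) := fun f =>
      (Lp.memLp f).integrable_mul hψm
    rw [← integral_slice_mul _ _ hψm, ← integral_slice_mul _ _ hψm, ← integral_add (hi _) (hi _)]
    refine integral_congr_ae ?_
    filter_upwards [Lp.coeFn_add (slice (mono R k) (U (some (Sum.inr ()))))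
      (slice (monoDeriv R k) (U none))] with y hy
    rw [hy, Pi.add_apply, Complex.real_smul]
    ring
  rw [hsplit 1, hsplit n]
  have hz : ∀ (f : L2Slab m R) (θ : C(ℝ, ℝ)),
      Integrable fun x => zext f x * ((θ x.2 : ℂ) * (ψ x.1 : ℂ)) := by
    intro f θ
    have h1 : Integrable (fun x => f x * ((θ x.2 : ℂ) * (ψ x.1 : ℂ)))
        ((volume : Measure (Pt m)).restrict (slab m R)) :=
      (Lp.memLp f).integrable_mul (memLp_tensor R θ hψm)
    have h2 := (integrable_indicator_iff measurableSet_slab).2 h1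
    refine h2.congr (Eventually.of_forall fun x => ?_)
    by_cases hx : x ∈ slab m R
    · simp [zext, hx]
    · simp [zext, hx]
  have hθ : ContDiff ℝ ∞ fun t => mono R n t - mono R 1 t :=
    (contDiff_mono R n).sub (contDiff_mono R 1)
  have hd : ∀ t, deriv (fun t => mono R n t - mono R 1 t) t = monoDeriv R n t - monoDeriv R 1 t :=
    fun t => ((hasDerivAt_mono R n t).sub (hasDerivAt_mono R 1 t)).deriv
  have h := green_tensor hR hU (Sum.inr ()) hθ hψs hψcc fun _ => by
    constructor
    · simp [mono, show n ≠ 0 by omega]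
    · simp [mono, hR.ne']
  have e1 : ∀ x : Pt m, zext (U none) x * ((deriv (fun t => mono R n t - mono R 1 t) x.2
      * (dirVec m (Sum.inr ())).2 : ℝ) * (ψ x.1 : ℂ) + ((mono R n x.2 - mono R 1 x.2 : ℝ) : ℂ)
        * fderiv ℝ (fun y => (ψ y : ℂ)) x.1 (dirVec m (Sum.inr ())).1)
      = zext (U none) x * ((monoDeriv R n x.2 : ℂ) * (ψ x.1 : ℂ))
        - zext (U none) x * ((monoDeriv R 1 x.2 : ℂ) * (ψ x.1 : ℂ)) := by
    intro x
    rw [hd]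
    simp only [dirVec, map_zero, mul_one, mul_zero, add_zero]
    push_cast
    ring
  have e2 : ∀ x : Pt m, zext (U (some (Sum.inr ()))) x
      * (((mono R n x.2 - mono R 1 x.2 : ℝ) : ℂ) * (ψ x.1 : ℂ))
      = zext (U (some (Sum.inr ()))) x * ((mono R n x.2 : ℂ) * (ψ x.1 : ℂ))
        - zext (U (some (Sum.inr ()))) x * ((mono R 1 x.2 : ℂ) * (ψ x.1 : ℂ)) := by
    intro x
    push_cast
    ring
  simp_rw [e1, e2] at h
  rw [integral_sub (hz _ _) (hz _ _), integral_sub (hz _ _) (hz _ _)] at h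
  linear_combination -h

end Tensor

/-! ### The trace in `H^{1/2}` -/

section TraceBound

variable {m : ℕ} {R : ℝ}

/-- Bessel's inequality for the weighted vertical averages, when the weight depends on the frequency
band. The operators `v ↦ 𝓕 (slice (θ n) v)`, restricted to disjoint bands `E n` and normalized, have
mutually orthogonal adjoints. -/
lemma sum_band_slice_le (s : Finset ℕ) {θ : ℕ → C(ℝ, ℝ)}
    (hθ : ∀ n, 0 < segInner R (θ n) (θ n)) {E : ℕ → Set (Hor m)}
    (hE : ∀ n, MeasurableSet (E n)) (hd : Pairwise fun n k => Disjoint (E n) (E k))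
    (v : L2Slab m R) :
    ∑ n ∈ s, (segInner R (θ n) (θ n))⁻¹ * ∫ η in E n, ‖(𝓕 (slice (θ n) v) : L2Hor m) η‖ ^ 2
      ≤ ‖v‖ ^ 2 := by
  set A : ℕ → ℝ := fun n => ∫ η in E n, ‖(𝓕 (slice (θ n) v) : L2Hor m) η‖ ^ 2 with hA
  have hmem : ∀ n, MemLp ((E n).indicator (𝓕 (slice (θ n) v) : L2Hor m)) 2 volume := fun n =>
    (Lp.memLp _).indicator (hE n)
  set a : ℕ → L2Hor m := fun n => (hmem n).toLp _ with ha
  set b : ℕ → L2Hor m := fun n => 𝓕⁻ (a n) with hb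
  have hFb : ∀ n, 𝓕 (b n) = a n := fun n => FourierTransform.fourier_fourierInv_eq (a n)
  have hin1 : ∀ n, inner ℂ (a n) (𝓕 (slice (θ n) v) : L2Hor m) = (A n : ℂ) := by
    intro n
    rw [L2.inner_def, hA, ← integral_complex_ofReal, ← integral_indicator (hE n)]
    refine integral_congr_ae ?_
    filter_upwards [MemLp.coeFn_toLp (hmem n)] with η hη
    rw [ha, hη, RCLike.inner_apply]
    by_cases h : η ∈ E n
    · rw [indicator_of_mem h, indicator_of_mem h, Complex.mul_conj, Complex.normSq_eq_norm_sq]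
    · rw [indicator_of_notMem h, indicator_of_notMem h, map_zero, mul_zero]
  have hin2 : ∀ n k, inner ℂ (a n) (a k) = if n = k then (A n : ℂ) else 0 := by
    intro n k
    split_ifs with hnk
    · subst hnk
      rw [← hin1, L2.inner_def, L2.inner_def]
      refine integral_congr_ae ?_
      filter_upwards [MemLp.coeFn_toLp (hmem n)] with η hη
      rw [ha, hη, RCLike.inner_apply, RCLike.inner_apply]
      by_cases h : η ∈ E n
      · rw [indicator_of_mem h]
      · rw [indicator_of_notMem h, map_zero, mul_zero, mul_zero]
    · rw [L2.inner_def]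
      refine integral_eq_zero_of_ae ?_
      filter_upwards [MemLp.coeFn_toLp (hmem n), MemLp.coeFn_toLp (hmem k)] with η h1 h2
      rw [ha, h1, h2, RCLike.inner_apply, Pi.zero_apply]
      by_cases h : η ∈ E n
      · rw [indicator_of_notMem (disjoint_left.1 (hd hnk) h), zero_mul]
      · rw [indicator_of_notMem h, map_zero, mul_zero]
  set c : ℕ → ℝ := fun n => (segInner R (θ n) (θ n))⁻¹ with hc
  set w : L2Slab m R := ∑ n ∈ s, (c n : ℂ) • tensor m R (θ n) (b n) with hw
  set S : ℝ := ∑ n ∈ s, c n * A n with hS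
  have hwv : inner ℂ w v = (S : ℂ) := by
    rw [hw, sum_inner, hS]
    push_cast
    refine Finset.sum_congr rfl fun n _ => ?_
    rw [inner_smul_left, Complex.conj_ofReal, ← inner_slice, ← Lp.inner_fourier_eq, hFb, hin1]
  have hww : inner ℂ w w = (S : ℂ) := by
    conv_lhs => rw [hw]
    rw [sum_inner, hS]
    push_cast
    refine Finset.sum_congr rfl fun n hn => ?_
    rw [inner_smul_left, Complex.conj_ofReal, inner_sum]
    congr 1
    rw [Finset.sum_eq_single n]
    · rw [inner_smul_right, inner_tensor_tensor, ← Lp.inner_fourier_eq, hFb, hin2, if_pos rfl,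
        ← mul_assoc, hc, ← Complex.ofReal_mul, inv_mul_cancel₀ (hθ n).ne', Complex.ofReal_one,
        one_mul]
    · intro k _ hk
      rw [inner_smul_right, inner_tensor_tensor, ← Lp.inner_fourier_eq, hFb, hFb, hin2,
        if_neg (Ne.symm hk), mul_zero, mul_zero]
    · exact fun h => absurd hn h
  have hnorm : ‖w‖ ^ 2 = S := by
    have := inner_self_eq_norm_sq_to_K (𝕜 := ℂ) w
    rw [hww] at this
    apply Complex.ofReal_injective
    rw [Complex.ofReal_pow]
    exact this.symm
  have hle : S ≤ ‖w‖ * ‖v‖ := by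
    have := norm_inner_le_norm (𝕜 := ℂ) w v
    rw [hwv, Complex.norm_real] at this
    exact (le_abs_self S).trans this
  change S ≤ ‖v‖ ^ 2
  nlinarith [sq_nonneg (‖w‖ - ‖v‖), norm_nonneg w, norm_nonneg v]

lemma segInner_mono (hR : 0 < R) (n : ℕ) :
    segInner R (mono R (n + 1)) (mono R (n + 1)) = R / (2 * n + 3) := by
  rw [segInner, ← integral_Ioc_eq_integral_Ioo, ← intervalIntegral.integral_of_le hR.le]
  have e : ∀ t : ℝ, mono R (n + 1) t * mono R (n + 1) t = R⁻¹ ^ (2 * n + 2) * t ^ (2 * n + 2) := by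
    intro t
    simp only [mono, ContinuousMap.coe_mk]
    rw [← pow_add, div_eq_inv_mul, mul_pow]
    congr 2 <;> ring
  simp_rw [e]
  rw [intervalIntegral.integral_const_mul, integral_pow]
  simp only [inv_pow, zero_pow (Nat.succ_ne_zero _), sub_zero]
  push_cast
  field_simp
  ring

lemma segInner_monoDeriv (hR : 0 < R) (n : ℕ) :
    segInner R (monoDeriv R (n + 1)) (monoDeriv R (n + 1)) = (n + 1) ^ 2 / (R * (2 * n + 1)) := by
  rw [segInner, ← integral_Ioc_eq_integral_Ioo, ← intervalIntegral.integral_of_le hR.le]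
  have e : ∀ t : ℝ, monoDeriv R (n + 1) t * monoDeriv R (n + 1) t
      = ((n + 1) ^ 2 / R ^ 2 * R⁻¹ ^ (2 * n)) * t ^ (2 * n) := by
    intro t
    simp only [monoDeriv, ContinuousMap.coe_mk, Nat.add_sub_cancel]
    rw [div_eq_inv_mul t, mul_pow, pow_mul', pow_mul']
    push_cast
    ring
  simp_rw [e]
  rw [intervalIntegral.integral_const_mul, integral_pow]
  simp only [inv_pow, zero_pow (Nat.succ_ne_zero _), sub_zero]
  push_cast
  field_simp
  ring

lemma Jet.norm_sq_eq (U : Jet m R) :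
    ‖U‖ ^ 2 = ‖U none‖ ^ 2 + ((∑ i, ‖U (some (Sum.inl i))‖ ^ 2) + ‖U (some (Sum.inr ()))‖ ^ 2) := by
  rw [PiLp.norm_sq_eq_of_L2, Fintype.sum_option, Fintype.sum_sum_type]
  simp

/-- The trace of an `H¹` function on the upper face belongs to `H^{1/2}`. On the frequency band
`n ≤ |η| < n + 1` the trace is computed by Green's formula with the lifting function
`(t / R)^{n + 1}`, and the bands are added by Bessel's inequality. -/
theorem integrable_traceTop (hR : 0 < R) {U : Jet m R} (hU : U ∈ H1 m R) :
    Integrable (fun η => (1 + ‖η‖) * ‖(𝓕 (traceTop m R U) : L2Hor m) η‖ ^ 2) ∧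
      ∫ η, (1 + ‖η‖) * ‖(𝓕 (traceTop m R U) : L2Hor m) η‖ ^ 2 ≤ (2 * R + 8 / R) * ‖U‖ ^ 2 := by
  -- the frequency bands, and the transforms of the two terms in Green's formula with the lifting
  -- function of each band; `D` is the horizontal gradient of `B`, which supplies decay in `η`
  set E : ℕ → Set (Hor m) := fun n => {η | (n : ℝ) ≤ ‖η‖ ∧ ‖η‖ < n + 1} with hE
  have hEm : ∀ n, MeasurableSet (E n) := fun n =>
    (measurableSet_le measurable_const measurable_norm).inter
      (measurableSet_lt measurable_norm measurable_const)
  have hEd : Pairwise fun n k => Disjoint (E n) (E k) := by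
    intro n k hnk
    rw [disjoint_left]
    rintro η ⟨h1, h2⟩ ⟨h3, h4⟩
    have a1 : (n : ℝ) < k + 1 := h1.trans_lt h4
    have a2 : (k : ℝ) < n + 1 := h3.trans_lt h2
    norm_cast at a1 a2
    omega
  have hEU : ⋃ n, E n = univ := by
    refine eq_univ_of_forall fun η => mem_iUnion.2 ⟨⌊‖η‖⌋₊, Nat.floor_le (norm_nonneg _),
      Nat.lt_floor_add_one _⟩
  set T : L2Hor m := 𝓕 (traceTop m R U) with hT
  set A : ℕ → L2Hor m := fun n => 𝓕 (slice (mono R (n + 1)) (U (some (Sum.inr ())))) with hA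
  set B : ℕ → L2Hor m := fun n => 𝓕 (slice (monoDeriv R (n + 1)) (U none)) with hB
  set D : ℕ → Fin m → L2Hor m := fun n i =>
    𝓕 (slice (monoDeriv R (n + 1)) (U (some (Sum.inl i)))) with hD
  have hsq : ∀ f : L2Hor m, Integrable fun η => ‖f η‖ ^ 2 := fun f =>
    (Lp.memLp f).norm.integrable_sq
  have hTAB : ∀ n, ∀ᵐ η, T η = A n η + B n η := by
    intro n
    have h1 := traceTop_eq_slice hR hU (n := n + 1) (by omega)
    have h2 : T = A n + B n := by
      rw [hT, h1, FourierTransform.fourier_add]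
    filter_upwards [Lp.coeFn_add (A n) (B n)] with η hη
    rw [h2, hη, Pi.add_apply]
  have hDB : ∀ n i, ∀ᵐ η : Hor m, ‖D n i η‖ ^ 2 = 4 * Real.pi ^ 2 * η i ^ 2 * ‖B n η‖ ^ 2 := by
    intro n i
    have h1 := (hasWeakDerivOn_slice hR hU (monoDeriv R (n + 1)) (contDiff_monoDeriv R _) i).fourier_eq
    filter_upwards [h1] with η hη
    have hin : inner ℝ η (EuclideanSpace.single i (1 : ℝ)) = η i := by
      simp [EuclideanSpace.inner_single_right]
    rw [hD, hη, hin]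
    simp only [norm_mul, Complex.norm_real, Complex.norm_I, Complex.norm_ofNat, mul_pow,
      Real.norm_eq_abs, sq_abs]
    ring
  set cA : ℕ → ℝ := fun n => (segInner R (mono R (n + 1)) (mono R (n + 1)))⁻¹ with hcA
  set cB : ℕ → ℝ := fun n => (segInner R (monoDeriv R (n + 1)) (monoDeriv R (n + 1)))⁻¹ with hcB
  -- `cA n` is of order `n / R`, and `cB n` of order `R / n`: on the band `n` this pays for the weight
  -- `1 + |η|` in front of `A n`, and with the factor `1 + |η|²` coming from `D n` in front of `B n`
  have hpt : ∀ n, ∀ᵐ η, η ∈ E n → (1 + ‖η‖) * ‖T η‖ ^ 2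
      ≤ 2 * R * (cA n * ‖A n η‖ ^ 2)
        + 8 / R * (cB n * ‖B n η‖ ^ 2 + ∑ i, cB n * ‖D n i η‖ ^ 2) := by
    intro n
    filter_upwards [hTAB n, ae_all_iff.2 (hDB n)] with η h1 h2 h3
    have hn : (0 : ℝ) ≤ n := Nat.cast_nonneg n
    have hcA' : R * cA n = 2 * n + 3 := by
      rw [hcA]; simp only [segInner_mono hR]; field_simp
    have hcB' : cB n = R * (2 * n + 1) / (n + 1) ^ 2 := by
      rw [hcB]; simp only [segInner_monoDeriv hR]; rw [inv_div]
    have hsumD : ∑ i, cB n * ‖D n i η‖ ^ 2 = cB n * (4 * Real.pi ^ 2 * ‖η‖ ^ 2) * ‖B n η‖ ^ 2 := by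
      simp_rw [h2]
      rw [EuclideanSpace.real_norm_sq_eq, Finset.mul_sum, Finset.mul_sum, Finset.sum_mul]
      exact Finset.sum_congr rfl fun i _ => by ring
    rw [hsumD, h1]
    have hadd : ‖A n η + B n η‖ ^ 2 ≤ 2 * ‖A n η‖ ^ 2 + 2 * ‖B n η‖ ^ 2 := by
      have := pow_le_pow_left₀ (norm_nonneg _) (norm_add_le (A n η) (B n η)) 2
      nlinarith [sq_nonneg (‖A n η‖ - ‖B n η‖)]
    have hη2 : 1 + ‖η‖ ≤ n + 2 := by linarith [h3.2]
    have hη1 : (n : ℝ) ^ 2 ≤ ‖η‖ ^ 2 := pow_le_pow_left₀ hn h3.1 2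
    have hpi : 1 ≤ 4 * Real.pi ^ 2 := by nlinarith [Real.pi_gt_three]
    have k2 : (n + 2 : ℝ) ≤ 4 / R * (cB n * (1 + 4 * Real.pi ^ 2 * ‖η‖ ^ 2)) := by
      have e : 4 / R * (cB n * (1 + 4 * Real.pi ^ 2 * ‖η‖ ^ 2))
          = 4 * (2 * n + 1) * (1 + 4 * Real.pi ^ 2 * ‖η‖ ^ 2) / (n + 1) ^ 2 := by
        rw [hcB']; field_simp
      rw [e, le_div_iff₀ (by positivity)]
      have h5 : (n : ℝ) ^ 2 ≤ 4 * Real.pi ^ 2 * ‖η‖ ^ 2 :=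
        hη1.trans (le_mul_of_one_le_left (sq_nonneg _) hpi)
      calc ((n : ℝ) + 2) * (n + 1) ^ 2 ≤ 4 * (2 * n + 1) * (1 + n ^ 2) := by
            nlinarith [mul_nonneg hn (sq_nonneg ((n : ℝ) - 1)), sq_nonneg ((n : ℝ) - 1),
              mul_nonneg hn hn, pow_nonneg hn 3]
        _ ≤ _ := by gcongr
    calc (1 + ‖η‖) * ‖A n η + B n η‖ ^ 2
        ≤ (n + 2) * (2 * ‖A n η‖ ^ 2 + 2 * ‖B n η‖ ^ 2) := by gcongr
      _ = 2 * ((n + 2) * ‖A n η‖ ^ 2) + 2 * ((n + 2) * ‖B n η‖ ^ 2) := by ring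
      _ ≤ 2 * ((R * cA n) * ‖A n η‖ ^ 2)
          + 2 * ((4 / R * (cB n * (1 + 4 * Real.pi ^ 2 * ‖η‖ ^ 2))) * ‖B n η‖ ^ 2) := by
          gcongr
          rw [hcA']; linarith
      _ = _ := by ring
  have hint : ∀ n, IntegrableOn (fun η => (1 + ‖η‖) * ‖T η‖ ^ 2) (E n) := by
    intro n
    refine ((hsq T).integrableOn.const_mul ((n : ℝ) + 2)).mono'
      ((continuous_const.add continuous_norm).aestronglyMeasurable.mul
        ((Lp.aestronglyMeasurable T).norm.pow 2).restrict) ?_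
    filter_upwards [ae_restrict_mem (hEm n)] with η hη
    rw [norm_mul, norm_pow, norm_norm, Real.norm_of_nonneg (by positivity)]
    refine mul_le_mul_of_nonneg_right ?_ (sq_nonneg _)
    linarith [hη.2]
  have hband : ∀ n, ∫ η in E n, (1 + ‖η‖) * ‖T η‖ ^ 2
      ≤ 2 * R * (cA n * ∫ η in E n, ‖A n η‖ ^ 2)
        + 8 / R * (cB n * (∫ η in E n, ‖B n η‖ ^ 2)
          + ∑ i, cB n * ∫ η in E n, ‖D n i η‖ ^ 2) := by
    intro n
    have i1 : ∀ (c : ℝ) (f : L2Hor m), IntegrableOn (fun η => c * ‖f η‖ ^ 2) (E n) := fun c f =>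
      ((hsq f).const_mul c).integrableOn
    have i2 : IntegrableOn (fun η => ∑ i, cB n * ‖D n i η‖ ^ 2) (E n) :=
      integrable_finsetSum _ fun i _ => i1 _ _
    have i3 : IntegrableOn (fun η => 2 * R * (cA n * ‖A n η‖ ^ 2)) (E n) := (i1 _ _).const_mul _
    have i5 : IntegrableOn (fun η => cB n * ‖B n η‖ ^ 2 + ∑ i, cB n * ‖D n i η‖ ^ 2) (E n) :=
      (i1 _ _).add i2
    have i4 : IntegrableOn (fun η => 8 / R * (cB n * ‖B n η‖ ^ 2 + ∑ i, cB n * ‖D n i η‖ ^ 2))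
      (E n) := i5.const_mul _
    refine (setIntegral_mono_on_ae (hint n) (i3.add i4) (hEm n) (hpt n)).trans (le_of_eq ?_)
    simp only [Pi.add_apply]
    rw [integral_add i3 i4, integral_const_mul, integral_const_mul, integral_const_mul,
      integral_add (i1 _ _) i2, integral_const_mul, integral_finsetSum _ fun i _ => i1 _ _]
    simp_rw [integral_const_mul]
  have hpA : ∀ n, 0 < segInner R (mono R (n + 1)) (mono R (n + 1)) := fun n => by
    rw [segInner_mono hR]; positivity
  have hpB : ∀ n, 0 < segInner R (monoDeriv R (n + 1)) (monoDeriv R (n + 1)) := fun n => by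
    rw [segInner_monoDeriv hR]; positivity
  -- Bessel's inequality for each of the three families
  have hsum : ∀ N, ∑ n ∈ Finset.range N, ∫ η in E n, (1 + ‖η‖) * ‖T η‖ ^ 2
      ≤ (2 * R + 8 / R) * ‖U‖ ^ 2 := by
    intro N
    have bA := sum_band_slice_le (Finset.range N) hpA hEm hEd (U (some (Sum.inr ())))
    have bB := sum_band_slice_le (Finset.range N) hpB hEm hEd (U none)
    have bD := fun i => sum_band_slice_le (Finset.range N) hpB hEm hEd (U (some (Sum.inl i)))
    refine (Finset.sum_le_sum fun n _ => hband n).trans ?_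
    rw [Finset.sum_add_distrib, ← Finset.mul_sum, ← Finset.mul_sum, Finset.sum_add_distrib,
      Finset.sum_comm]
    have hn := Jet.norm_sq_eq U
    have hDsum := Finset.sum_le_sum fun i (_ : i ∈ Finset.univ) => bD i
    have p1 : 0 ≤ ‖U none‖ ^ 2 := sq_nonneg _
    have p2 : 0 ≤ ∑ i, ‖U (some (Sum.inl i))‖ ^ 2 := Finset.sum_nonneg fun _ _ => sq_nonneg _
    have p3 : 0 ≤ ‖U (some (Sum.inr ()))‖ ^ 2 := sq_nonneg _
    rw [add_mul]
    refine add_le_add ?_ ?_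
    · refine mul_le_mul_of_nonneg_left (bA.trans ?_) (by positivity)
      linarith
    · refine mul_le_mul_of_nonneg_left ((add_le_add bB hDsum).trans ?_) (by positivity)
      linarith
  have hnn : ∀ η, 0 ≤ (1 + ‖η‖) * ‖T η‖ ^ 2 := fun η => by positivity
  have hlin : ∫⁻ η, ENNReal.ofReal ((1 + ‖η‖) * ‖T η‖ ^ 2)
      ≤ ENNReal.ofReal ((2 * R + 8 / R) * ‖U‖ ^ 2) := by
    rw [← setLIntegral_univ, ← hEU, lintegral_iUnion hEm hEd]
    refine ENNReal.tsum_le_of_sum_range_le fun N => ?_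
    have : ∀ n, ∫⁻ η in E n, ENNReal.ofReal ((1 + ‖η‖) * ‖T η‖ ^ 2)
        = ENNReal.ofReal (∫ η in E n, (1 + ‖η‖) * ‖T η‖ ^ 2) := fun n =>
      (ofReal_integral_eq_lintegral_ofReal (hint n) (Eventually.of_forall hnn)).symm
    simp_rw [this]
    rw [← ENNReal.ofReal_sum_of_nonneg fun n _ => integral_nonneg hnn]
    exact ENNReal.ofReal_le_ofReal (hsum N)
  have hms : AEStronglyMeasurable (fun η : Hor m => (1 + ‖η‖) * ‖T η‖ ^ 2) volume :=
    (continuous_const.add continuous_norm).aestronglyMeasurable.mul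
      ((Lp.aestronglyMeasurable T).norm.pow 2)
  refine ⟨⟨hms, ?_⟩, ?_⟩
  · rw [hasFiniteIntegral_iff_ofReal (Eventually.of_forall hnn)]
    exact hlin.trans_lt ENNReal.ofReal_lt_top
  · rw [integral_eq_lintegral_of_nonneg_ae (Eventually.of_forall hnn) hms]
    exact ENNReal.toReal_le_of_le_ofReal (by positivity) hlin

end TraceBound

/-! ### Bounded sesquilinear forms and the terms of `a_q` -/

section BddForm

variable {H : Type*} [NormedAddCommGroup H] [InnerProductSpace ℂ H]

/-- A bounded sesquilinear form, linear in the first and antilinear in the second variable. -/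
structure IsBddForm (b : H → H → ℂ) (C : ℝ) : Prop where
  add_left : ∀ u u' v, b (u + u') v = b u v + b u' v
  smul_left : ∀ (c : ℂ) u v, b (c • u) v = c * b u v
  add_right : ∀ u v v', b u (v + v') = b u v + b u v'
  smul_right : ∀ (c : ℂ) u v, b u (c • v) = conj c * b u v
  bound : ∀ u v, ‖b u v‖ ≤ C * ‖u‖ * ‖v‖

variable [CompleteSpace H]

/-- The operator of a bounded sesquilinear form. -/
def IsBddForm.op {b : H → H → ℂ} {C : ℝ} (h : IsBddForm b C) : H →L[ℂ] H :=
  InnerProductSpace.continuousLinearMapOfBilin (𝕜 := ℂ) (E := H)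
    (LinearMap.mkContinuous₂ (LinearMap.mk₂'ₛₗ (starRingEnd ℂ) (RingHom.id ℂ)
      (fun u v => conj (b u v))
      (fun u u' v => by rw [h.add_left, map_add])
      (fun c u v => by rw [h.smul_left, map_mul, smul_eq_mul])
      (fun u v v' => by rw [h.add_right, map_add])
      (fun c u v => by rw [h.smul_right, map_mul, Complex.conj_conj, RingHom.id_apply, smul_eq_mul]))
      C (fun u v => by
        rw [LinearMap.mk₂'ₛₗ_apply, RCLike.norm_conj]; exact h.bound u v))

lemma IsBddForm.inner_op {b : H → H → ℂ} {C : ℝ} (h : IsBddForm b C) (u v : H) :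
    inner ℂ v (h.op u) = b u v := by
  rw [← inner_conj_symm, IsBddForm.op, InnerProductSpace.continuousLinearMapOfBilin_apply]
  simp

lemma IsBddForm.norm_op_le {b : H → H → ℂ} {C : ℝ} (h : IsBddForm b C) (hC : 0 ≤ C) :
    ‖h.op‖ ≤ C := by
  refine ContinuousLinearMap.opNorm_le_bound _ hC fun u => ?_
  rcases eq_or_ne (h.op u) 0 with h0 | h0
  · rw [h0, norm_zero]; positivity
  · have h1 := h.bound u (h.op u)
    rw [← h.inner_op, inner_self_eq_norm_sq_to_K, norm_pow, RCLike.norm_ofReal, abs_norm,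
      pow_two] at h1
    exact le_of_mul_le_mul_right h1 (norm_pos_iff.2 h0)

end BddForm

section Forms

variable {m : ℕ} {R₀ R : ℝ}

lemma integral_mul_eq_inner {α : Type*} {mα : MeasurableSpace α} {μ : Measure α}
    (f : Lp ℂ 2 μ) {ψ : α → ℂ} (hψ : MemLp ψ 2 μ) :
    ∫ x, f x * ψ x ∂μ = inner ℂ (hψ.star.toLp _) f := by
  rw [L2.inner_def]
  refine integral_congr_ae ?_
  filter_upwards [MemLp.coeFn_toLp hψ.star] with x hx
  rw [hx, RCLike.inner_apply]
  simp

lemma norm_integral_mul_le {α : Type*} {mα : MeasurableSpace α} {μ : Measure α}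
    (f : Lp ℂ 2 μ) {ψ : α → ℂ} (hψ : MemLp ψ 2 μ) {B : ℝ} (hB : 0 ≤ B)
    (h : eLpNorm ψ 2 μ ≤ ENNReal.ofReal B) : ‖∫ x, f x * ψ x ∂μ‖ ≤ ‖f‖ * B := by
  rw [integral_mul_eq_inner f hψ, mul_comm]
  refine (norm_inner_le_norm _ _).trans ?_
  gcongr
  rw [Lp.norm_toLp, eLpNorm_star]
  exact ENNReal.toReal_le_of_le_ofReal hB h

lemma isClosed_H1 : IsClosed (H1 m R : Set (Jet m R)) := by
  have hc : ∀ {ψ : Pt m → ℂ} (o : Option (Dir m)),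
      MemLp ψ 2 ((volume : Measure (Pt m)).restrict (slab m R)) →
      Continuous fun U : Jet m R => ∫ x in slab m R, U o x * ψ x := by
    intro ψ o hψ
    simp_rw [fun f : L2Slab m R => integral_mul_eq_inner f hψ]
    exact continuous_const.inner (PiLp.continuous_apply 2 _ o)
  have : (H1 m R : Set (Jet m R)) = ⋂ (j : Dir m) (φ : Pt m → ℂ) (_ : ContDiff ℝ ∞ φ)
      (_ : HasCompactSupport φ) (_ : tsupport φ ⊆ slab m R), {U : Jet m R |
        ∫ x in slab m R, U none x * fderiv ℝ φ x (dirVec m j)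
          = - ∫ x in slab m R, U (some j) x * φ x} := by
    ext U
    simp only [mem_iInter]
    exact Iff.rfl
  rw [this]
  refine isClosed_iInter fun j => isClosed_iInter fun φ => isClosed_iInter fun h1 =>
    isClosed_iInter fun h2 => isClosed_iInter fun _ => ?_
  exact isClosed_eq (hc none (memLp_test_deriv R h1 h2 _))
    (hc (some j) (memLp_test R h1.continuous h2)).neg

instance completeSpace_HTilde : CompleteSpace (HTilde m R) := by
  have h : IsClosed (HTilde m R : Set (Jet m R)) := by
    have : (HTilde m R : Set (Jet m R)) = (H1 m R : Set (Jet m R)) ∩ (traceBot m R) ⁻¹' {0} := by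
      ext U
      simp [HTilde]
    rw [this]
    exact isClosed_H1.inter (isClosed_singleton.preimage (traceBot m R).continuous)
  exact h.completeSpace_coe

lemma HTilde.mem_H1 (u : HTilde m R) : u.1 ∈ H1 m R := u.2.1

lemma HTilde.norm_apply_le (u : HTilde m R) (o : Option (Dir m)) : ‖u.1 o‖ ≤ ‖u‖ :=
  PiLp.norm_apply_le u.1 o

/-- The form `∫ ∇u · ∇v̄`. -/
def gradForm (u v : HTilde m R) : ℂ := ∑ j, inner ℂ (v.1 (some j)) (u.1 (some j))

lemma isBddForm_gradForm : IsBddForm (gradForm (m := m) (R := R)) (Fintype.card (Dir m)) where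
  add_left u u' v := by
    simp only [gradForm, Submodule.coe_add, PiLp.add_apply, inner_add_right,
      Finset.sum_add_distrib]
  smul_left c u v := by
    simp only [gradForm, Submodule.coe_smul, PiLp.smul_apply, inner_smul_right, Finset.mul_sum]
  add_right u v v' := by
    simp only [gradForm, Submodule.coe_add, PiLp.add_apply, inner_add_left,
      Finset.sum_add_distrib]
  smul_right c u v := by
    simp only [gradForm, Submodule.coe_smul, PiLp.smul_apply, inner_smul_left, Finset.mul_sum]
  bound u v := by
    rw [gradForm]
    refine (norm_sum_le_of_le _ (f := fun j => inner ℂ (v.1 (some j)) (u.1 (some j)))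
      (n := fun _ => ‖u‖ * ‖v‖) fun j _ => (norm_inner_le_norm _ _).trans ?_).trans
      (le_of_eq ?_)
    · rw [mul_comm]
      exact mul_le_mul (HTilde.norm_apply_le u _) (HTilde.norm_apply_le v _) (norm_nonneg _) (norm_nonneg _)
    · simp [mul_assoc]

/-- The form `∫ w u v̄`. -/
def weightForm (w : Pt m → ℂ) (u v : HTilde m R) : ℂ :=
  ∫ x in slab m R, w x * u.1 none x * conj (v.1 none x)

lemma isBddForm_weightForm {w : Pt m → ℂ} {C : ℝ}
    (hi : ∀ u v : HTilde m R, IntegrableOn (fun x => w x * u.1 none x * conj (v.1 none x))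
      (slab m R))
    (hC : ∀ u v : HTilde m R, ‖weightForm w u v‖ ≤ C * ‖u‖ * ‖v‖) :
    IsBddForm (weightForm (R := R) w) C where
  add_left u u' v := by
    rw [weightForm, weightForm, weightForm, ← integral_add (hi u v) (hi u' v)]
    refine integral_congr_ae ?_
    filter_upwards [Lp.coeFn_add (u.1 none) (u'.1 none)] with x hx
    simp only [Submodule.coe_add, PiLp.add_apply]
    rw [hx, Pi.add_apply]; ring
  smul_left c u v := by
    rw [weightForm, weightForm, ← integral_const_mul]
    refine integral_congr_ae ?_
    filter_upwards [Lp.coeFn_smul c (u.1 none)] with x hx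
    simp only [Submodule.coe_smul, PiLp.smul_apply]
    rw [hx, Pi.smul_apply, smul_eq_mul]; ring
  add_right u v v' := by
    rw [weightForm, weightForm, weightForm, ← integral_add (hi u v) (hi u v')]
    refine integral_congr_ae ?_
    filter_upwards [Lp.coeFn_add (v.1 none) (v'.1 none)] with x hx
    simp only [Submodule.coe_add, PiLp.add_apply]
    rw [hx, Pi.add_apply, map_add]; ring
  smul_right c u v := by
    rw [weightForm, weightForm, ← integral_const_mul]
    refine integral_congr_ae ?_
    filter_upwards [Lp.coeFn_smul c (v.1 none)] with x hx
    simp only [Submodule.coe_smul, PiLp.smul_apply]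
    rw [hx, Pi.smul_apply, smul_eq_mul, map_mul]; ring
  bound := hC

lemma memLp_mul_of_bdd {N : Pt m → ℂ} {M : ℝ}
    (hN : AEStronglyMeasurable N (volume.restrict (slab m R)))
    (hM : ∀ᵐ x ∂(volume.restrict (slab m R)), ‖N x‖ ≤ M) (f : L2Slab m R) :
    MemLp (fun x => N x * f x) 2 (volume.restrict (slab m R)) := by
  refine (Lp.memLp f).of_le_mul (c := M) (hN.mul (Lp.aestronglyMeasurable f)) ?_
  filter_upwards [hM] with x hx
  rw [norm_mul]
  exact mul_le_mul_of_nonneg_right hx (norm_nonneg _)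

lemma memLp_conj (f : L2Slab m R) :
    MemLp (fun x => conj (f x)) 2 (volume.restrict (slab m R)) := (Lp.memLp f).star

lemma integrableOn_weight_of_bdd {N : Pt m → ℂ} {M : ℝ}
    (hN : AEStronglyMeasurable N (volume.restrict (slab m R)))
    (hM : ∀ᵐ x ∂(volume.restrict (slab m R)), ‖N x‖ ≤ M) (f g : L2Slab m R) :
    IntegrableOn (fun x => N x * f x * conj (g x)) (slab m R) :=
  (memLp_mul_of_bdd hN hM f).integrable_mul (memLp_conj g)

lemma isBddForm_weightForm_of_bdd {N : Pt m → ℂ} {M : ℝ} (hM0 : 0 ≤ M)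
    (hN : AEStronglyMeasurable N (volume.restrict (slab m R)))
    (hM : ∀ᵐ x ∂(volume.restrict (slab m R)), ‖N x‖ ≤ M) :
    IsBddForm (weightForm (R := R) N) M := by
  refine isBddForm_weightForm (fun u v => integrableOn_weight_of_bdd hN hM _ _) fun u v => ?_
  have hmem := memLp_mul_of_bdd hN hM (u.1 none)
  have e : weightForm N u v = inner ℂ (v.1 none) (hmem.toLp _) := by
    rw [weightForm, L2.inner_def]
    refine integral_congr_ae ?_
    filter_upwards [MemLp.coeFn_toLp hmem] with x hx
    rw [hx, RCLike.inner_apply]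
  have h2 : ‖hmem.toLp _‖ ≤ M * ‖u.1 none‖ := by
    refine Lp.norm_le_mul_norm_of_ae_le_mul ?_
    filter_upwards [MemLp.coeFn_toLp hmem, hM] with x hx hx2
    rw [hx, norm_mul]
    exact mul_le_mul_of_nonneg_right hx2 (norm_nonneg _)
  rw [e]
  refine (norm_inner_le_norm _ _).trans ?_
  rw [mul_comm]
  refine mul_le_mul (h2.trans ?_) (HTilde.norm_apply_le v _) (norm_nonneg _) (by positivity)
  gcongr
  exact HTilde.norm_apply_le u _

lemma cell_subset_cell (h : R₀ ≤ R) : cell m R₀ ⊆ cell m R :=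
  fun _ hx => ⟨hx.1, hx.2.1, hx.2.2.trans_le h⟩

/-- The product of two functions of `H̃¹` is in `L²` of the cell, by Hölder's inequality and the Sobolev
embedding `H¹ → L⁴`. -/
lemma exists_memLp_mul_conj (hm : m = 1 ∨ m = 2) (hR₀ : R₀ ≤ R) (hR : 0 < R) :
    ∃ C : ℝ, 0 ≤ C ∧ ∀ u v : HTilde m R,
      MemLp (fun x => u.1 none x * conj (v.1 none x)) 2 (volume.restrict (cell m R₀)) ∧
      eLpNorm (fun x => u.1 none x * conj (v.1 none x)) 2 (volume.restrict (cell m R₀))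
        ≤ ENNReal.ofReal (C * ‖u‖ * ‖v‖) := by
  obtain ⟨C, hC0, hC⟩ := exists_eLpNorm_cell_four_le hm hR
  have hms : ∀ u : HTilde m R,
      AEStronglyMeasurable (u.1 none) (volume.restrict (cell m R₀)) := fun u =>
    (Lp.aestronglyMeasurable (u.1 none)).mono_measure
      (Measure.restrict_mono ((cell_subset_cell hR₀).trans cell_subset_slab) le_rfl)
  have hb : ∀ u : HTilde m R, eLpNorm (u.1 none) 4 (volume.restrict (cell m R₀))
      ≤ ENNReal.ofReal (C * ‖u‖) := fun u =>
    (eLpNorm_mono_measure _ (Measure.restrict_mono (cell_subset_cell hR₀) le_rfl)).trans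
      (hC u.1 (HTilde.mem_H1 u))
  have : ENNReal.HolderTriple 4 4 2 := ⟨by
    rw [← two_mul, show (4 : ENNReal) = 2 * 2 by norm_num,
      ENNReal.mul_inv (by simp) (by simp), ← mul_assoc,
      ENNReal.mul_inv_cancel (by simp) (by simp), one_mul]⟩
  refine ⟨C * C, by positivity, fun u v => ?_⟩
  have hcm : AEStronglyMeasurable (fun x => conj (v.1 none x)) (volume.restrict (cell m R₀)) :=
    (hms v).star
  have key : eLpNorm (fun x => u.1 none x * conj (v.1 none x)) 2 (volume.restrict (cell m R₀))
        ≤ ENNReal.ofReal (C * C * ‖u‖ * ‖v‖) := by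
    refine (eLpNorm_smul_le_mul_eLpNorm (p := 4) (q := 4) hcm (hms u)).trans ?_
    have e : eLpNorm (fun x => conj (v.1 none x)) 4 (volume.restrict (cell m R₀))
        = eLpNorm (v.1 none) 4 (volume.restrict (cell m R₀)) :=
      eLpNorm_congr_norm_ae (Eventually.of_forall fun x => RCLike.norm_conj _)
    rw [e, show C * C * ‖u‖ * ‖v‖ = (C * ‖u‖) * (C * ‖v‖) by ring,
      ENNReal.ofReal_mul (by positivity)]
    exact mul_le_mul' (hb u) (hb v)
  exact ⟨⟨(hms u).mul hcm, key.trans_lt ENNReal.ofReal_lt_top⟩, key⟩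

lemma weightForm_indicator (hR₀ : R₀ ≤ R) (q : Pt m → ℂ) (u v : HTilde m R) :
    weightForm ((cell m R₀).indicator q) u v
      = ∫ x in cell m R₀, q x * (u.1 none x * conj (v.1 none x)) := by
  have hsub : cell m R₀ ⊆ slab m R := (cell_subset_cell hR₀).trans cell_subset_slab
  rw [weightForm, ← integral_indicator measurableSet_slab, ← integral_indicator measurableSet_cell]
  refine integral_congr_ae (Eventually.of_forall fun x => ?_)
  by_cases hx : x ∈ cell m R₀
  · simp [hx, hsub hx, mul_assoc]
  · by_cases hx2 : x ∈ slab m R <;> simp [hx, hx2]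

lemma integrableOn_indicator_weight (hm : m = 1 ∨ m = 2) (hR₀ : R₀ ≤ R) (hR : 0 < R)
    (q : L2Cell m R₀) (u v : HTilde m R) :
    IntegrableOn (fun x => (cell m R₀).indicator q x * u.1 none x * conj (v.1 none x))
      (slab m R) := by
  obtain ⟨C, _, hC⟩ := exists_memLp_mul_conj hm hR₀ hR
  have h1 : IntegrableOn (fun x => q x * (u.1 none x * conj (v.1 none x))) (cell m R₀) :=
    (Lp.memLp q).integrable_mul (hC u v).1
  refine (((integrable_indicator_iff measurableSet_cell).2 h1).congr
    (Eventually.of_forall fun x => ?_)).integrableOn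
  by_cases hx : x ∈ cell m R₀ <;> simp [hx, mul_assoc]

/-- By the Sobolev embedding, the form `∫ q u v̄` is bounded, uniformly in `q ∈ L²`. -/
lemma exists_isBddForm_indicator (hm : m = 1 ∨ m = 2) (hR₀ : R₀ ≤ R) (hR : 0 < R) :
    ∃ C : ℝ, 0 ≤ C ∧ ∀ q : L2Cell m R₀,
      IsBddForm (weightForm (R := R) ((cell m R₀).indicator q)) (C * ‖q‖) := by
  obtain ⟨C, hC0, hC⟩ := exists_memLp_mul_conj hm hR₀ hR
  refine ⟨C, hC0, fun q => isBddForm_weightForm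
    (fun u v => integrableOn_indicator_weight hm hR₀ hR q u v) fun u v => ?_⟩
  rw [weightForm_indicator hR₀]
  refine (norm_integral_mul_le q (hC u v).1 (by positivity) (hC u v).2).trans (le_of_eq ?_)
  ring

lemma norm_branchSqrt_le {k : ℝ} (hk : 0 < k) (η : Hor m) :
    ‖Complex.I * branchSqrt (k ^ 2 - ‖(2 * Real.pi) • η‖ ^ 2)‖
      ≤ (k + 2 * Real.pi) * (1 + ‖η‖) := by
  have hpi := Real.pi_pos
  rw [norm_mul, Complex.norm_I, one_mul, norm_smul, Real.norm_of_nonneg (by positivity)]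
  have h1 : k ≤ (k + 2 * Real.pi) * (1 + ‖η‖) := by nlinarith [norm_nonneg η]
  have h2 : 2 * Real.pi * ‖η‖ ≤ (k + 2 * Real.pi) * (1 + ‖η‖) := by nlinarith [norm_nonneg η]
  rw [branchSqrt]
  split_ifs
  · rw [Complex.norm_real, Real.norm_of_nonneg (Real.sqrt_nonneg _)]
    refine le_trans (Real.sqrt_le_iff.2 ⟨hk.le, ?_⟩) h1
    nlinarith [sq_nonneg (2 * Real.pi * ‖η‖)]
  · rw [norm_mul, Complex.norm_I, one_mul, Complex.norm_real,
      Real.norm_of_nonneg (Real.sqrt_nonneg _)]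
    refine le_trans (Real.sqrt_le_iff.2 ⟨by positivity, ?_⟩) h2
    nlinarith [sq_nonneg k]

lemma measurable_branchSqrt : Measurable branchSqrt := by
  unfold branchSqrt
  refine Measurable.ite measurableSet_Ici ?_ ?_
  · exact Complex.measurable_ofReal.comp (Real.continuous_sqrt.measurable)
  · exact (Complex.measurable_ofReal.comp
      (Real.continuous_sqrt.measurable.comp measurable_neg)).const_mul _

/-- The symbol of the Dirichlet-to-Neumann map grows linearly, so that the pairing converges by the
`H^{1/2}` bound for the traces. -/
lemma integrable_dtn (hR : 0 < R) {k : ℝ} (hk : 0 < k) (u v : HTilde m R) :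
    Integrable (fun η : Hor m => Complex.I * branchSqrt (k ^ 2 - ‖(2 * Real.pi) • η‖ ^ 2)
      * (𝓕 (traceTop m R u.1) : L2Hor m) η * conj ((𝓕 (traceTop m R v.1) : L2Hor m) η)) ∧
    ‖dtnPairing k (traceTop m R u.1) (traceTop m R v.1)‖
      ≤ (k + 2 * Real.pi) / 2 * (2 * R + 8 / R) * (‖u‖ ^ 2 + ‖v‖ ^ 2) := by
  obtain ⟨i1, b1⟩ := integrable_traceTop hR (HTilde.mem_H1 u)
  obtain ⟨i2, b2⟩ := integrable_traceTop hR (HTilde.mem_H1 v)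
  set φ : L2Hor m := 𝓕 (traceTop m R u.1)
  set ψ : L2Hor m := 𝓕 (traceTop m R v.1)
  have hpi := Real.pi_pos
  have hsym : Measurable fun η : Hor m =>
      Complex.I * branchSqrt (k ^ 2 - ‖(2 * Real.pi) • η‖ ^ 2) :=
    (measurable_branchSqrt.comp (by fun_prop : Continuous fun η : Hor m =>
      k ^ 2 - ‖(2 * Real.pi) • η‖ ^ 2).measurable).const_mul _
  have hb : ∀ η : Hor m, ‖Complex.I * branchSqrt (k ^ 2 - ‖(2 * Real.pi) • η‖ ^ 2)
      * φ η * conj (ψ η)‖ ≤ (k + 2 * Real.pi) / 2 *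
        ((1 + ‖η‖) * ‖φ η‖ ^ 2 + (1 + ‖η‖) * ‖ψ η‖ ^ 2) := by
    intro η
    rw [norm_mul, norm_mul, RCLike.norm_conj]
    calc _ ≤ (k + 2 * Real.pi) * (1 + ‖η‖) * ‖φ η‖ * ‖ψ η‖ := by
          gcongr; exact norm_branchSqrt_le hk η
      _ = (k + 2 * Real.pi) / 2 * (1 + ‖η‖) * (2 * ‖φ η‖ * ‖ψ η‖) := by ring
      _ ≤ (k + 2 * Real.pi) / 2 * (1 + ‖η‖) * (‖φ η‖ ^ 2 + ‖ψ η‖ ^ 2) := by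
          gcongr; exact two_mul_le_add_sq _ _
      _ = _ := by ring
  have hbi := (i1.add i2).const_mul ((k + 2 * Real.pi) / 2)
  have hi : Integrable (fun η : Hor m => Complex.I * branchSqrt (k ^ 2 - ‖(2 * Real.pi) • η‖ ^ 2)
      * φ η * conj (ψ η)) :=
    hbi.mono' ((hsym.aestronglyMeasurable.mul (Lp.aestronglyMeasurable φ)).mul
      (Lp.aestronglyMeasurable ψ).star) (Eventually.of_forall hb)
  refine ⟨hi, ?_⟩
  refine (norm_integral_le_of_norm_le hbi (Eventually.of_forall hb)).trans ?_
  simp only [Pi.add_apply]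
  rw [integral_const_mul, integral_add i1 i2, mul_assoc]
  refine mul_le_mul_of_nonneg_left ?_ (by positivity)
  rw [mul_add]
  exact add_le_add b1 b2

lemma isBddForm_dtn (hR : 0 < R) {k : ℝ} (hk : 0 < k) :
    IsBddForm (fun u v : HTilde m R => dtnPairing k (traceTop m R u.1) (traceTop m R v.1))
      ((k + 2 * Real.pi) * (2 * R + 8 / R)) := by
  have hpi := Real.pi_pos
  have add_left : ∀ u u' v : HTilde m R, dtnPairing k (traceTop m R (u + u').1) (traceTop m R v.1)
      = dtnPairing k (traceTop m R u.1) (traceTop m R v.1)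
        + dtnPairing k (traceTop m R u'.1) (traceTop m R v.1) := by
    intro u u' v
    simp only [dtnPairing, Submodule.coe_add, map_add, FourierTransform.fourier_add]
    rw [← integral_add (integrable_dtn hR hk u v).1 (integrable_dtn hR hk u' v).1]
    refine integral_congr_ae ?_
    filter_upwards [Lp.coeFn_add (𝓕 (traceTop m R u.1) : L2Hor m)
      (𝓕 (traceTop m R u'.1) : L2Hor m)] with η hη
    rw [hη, Pi.add_apply]; ring
  have add_right : ∀ u v v' : HTilde m R, dtnPairing k (traceTop m R u.1) (traceTop m R (v + v').1)
      = dtnPairing k (traceTop m R u.1) (traceTop m R v.1)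
        + dtnPairing k (traceTop m R u.1) (traceTop m R v'.1) := by
    intro u v v'
    simp only [dtnPairing, Submodule.coe_add, map_add, FourierTransform.fourier_add]
    rw [← integral_add (integrable_dtn hR hk u v).1 (integrable_dtn hR hk u v').1]
    refine integral_congr_ae ?_
    filter_upwards [Lp.coeFn_add (𝓕 (traceTop m R v.1) : L2Hor m)
      (𝓕 (traceTop m R v'.1) : L2Hor m)] with η hη
    rw [hη, Pi.add_apply, map_add]; ring
  have smul_left : ∀ (c : ℂ) (u v : HTilde m R),
      dtnPairing k (traceTop m R (c • u).1) (traceTop m R v.1)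
      = c * dtnPairing k (traceTop m R u.1) (traceTop m R v.1) := by
    intro c u v
    simp only [dtnPairing, Submodule.coe_smul, map_smul, FourierTransform.fourier_smul]
    rw [← integral_const_mul]
    refine integral_congr_ae ?_
    filter_upwards [Lp.coeFn_smul c (𝓕 (traceTop m R u.1) : L2Hor m)] with η hη
    rw [hη, Pi.smul_apply, smul_eq_mul]; ring
  have smul_right : ∀ (c : ℂ) (u v : HTilde m R),
      dtnPairing k (traceTop m R u.1) (traceTop m R (c • v).1)
      = conj c * dtnPairing k (traceTop m R u.1) (traceTop m R v.1) := by
    intro c u v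
    simp only [dtnPairing, Submodule.coe_smul, map_smul, FourierTransform.fourier_smul]
    rw [← integral_const_mul]
    refine integral_congr_ae ?_
    filter_upwards [Lp.coeFn_smul c (𝓕 (traceTop m R v.1) : L2Hor m)] with η hη
    rw [hη, Pi.smul_apply, smul_eq_mul, map_mul]; ring
  refine ⟨add_left, smul_left, add_right, smul_right, fun u v => ?_⟩
  -- scale both arguments to norm one
  rcases eq_or_ne u 0 with rfl | hu
  · have := smul_left 0 0 v
    rw [zero_smul, zero_mul] at this
    rw [this, norm_zero]; positivity
  rcases eq_or_ne v 0 with rfl | hv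
  · have := smul_right 0 u 0
    rw [zero_smul, map_zero, zero_mul] at this
    rw [this, norm_zero]; positivity
  have hu' : ‖u‖ ≠ 0 := norm_ne_zero_iff.2 hu
  have hv' : ‖v‖ ≠ 0 := norm_ne_zero_iff.2 hv
  have h1 := (integrable_dtn hR hk (((‖u‖⁻¹ : ℝ) : ℂ) • u) (((‖v‖⁻¹ : ℝ) : ℂ) • v)).2
  rw [smul_left, smul_right, norm_mul, norm_mul, RCLike.norm_conj, norm_smul, norm_smul,
    Complex.norm_real, Complex.norm_real, Real.norm_of_nonneg (by positivity),
    Real.norm_of_nonneg (by positivity), inv_mul_cancel₀ hu', inv_mul_cancel₀ hv'] at h1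
  have hpu : 0 < ‖u‖ := norm_pos_iff.2 hu
  have hpv : 0 < ‖v‖ := norm_pos_iff.2 hv
  have h2 := mul_le_mul_of_nonneg_left h1 (by positivity : 0 ≤ ‖u‖ * ‖v‖)
  have e : ‖u‖ * ‖v‖ * (‖u‖⁻¹ * (‖v‖⁻¹ * ‖dtnPairing k (traceTop m R u.1) (traceTop m R v.1)‖))
      = ‖dtnPairing k (traceTop m R u.1) (traceTop m R v.1)‖ := by
    field_simp
  rw [e] at h2
  refine h2.trans (le_of_eq ?_)
  ring

end Forms

/-! ### The operator of the form -/

section FormOperator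

variable {m : ℕ} {R₀ R : ℝ}

lemma slab_subset_halfSpace : slab m R ⊆ halfSpace m := fun _ hx => hx.2.1

lemma restrict_slab_le_halfSpace :
    (volume : Measure (Pt m)).restrict (slab m R) ≤ volume.restrict (halfSpace m) :=
  Measure.restrict_mono slab_subset_halfSpace le_rfl

lemma IsLayerIndex.exists_bound {np2 : Pt m → ℂ} (hn : IsLayerIndex R₀ np2) :
    ∃ M : ℝ, 0 ≤ M ∧ ∀ᵐ x ∂((volume : Measure (Pt m)).restrict (halfSpace m)), ‖np2 x‖ ≤ M := by
  refine ⟨(eLpNorm np2 ⊤ (volume.restrict (halfSpace m))).toReal, ENNReal.toReal_nonneg, ?_⟩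
  have h := enorm_ae_le_eLpNormEssSup np2 ((volume : Measure (Pt m)).restrict (halfSpace m))
  filter_upwards [h] with x hx
  rw [← eLpNorm_exponent_top] at hx
  have := ENNReal.toReal_mono hn.bounded.2.ne hx
  simpa using this

/-- All integrals in `a_q` converge, so that the form is the sum of its terms. -/
lemma form_eq (hm : m = 1 ∨ m = 2) (hR₀ : 0 < R₀) (hR : R₀ < R) {k : ℝ}
    {np2 : Pt m → ℂ} (hn : IsLayerIndex R₀ np2) (q : L2Cell m R₀) (u v : HTilde m R) :
    form k np2 q u v = gradForm u v - (k : ℂ) ^ 2 * weightForm np2 u v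
      - (k : ℂ) ^ 2 * weightForm ((cell m R₀).indicator q) u v
      - dtnPairing k (traceTop m R u.1) (traceTop m R v.1) := by
  obtain ⟨M, hM0, hM⟩ := hn.exists_bound
  have hp : 0 < R := hR₀.trans hR
  have i1 : ∀ j : Dir m, Integrable (fun x => u.1 (some j) x * conj (v.1 (some j) x))
      (volume.restrict (slab m R)) := fun j =>
    (Lp.memLp (u.1 (some j))).integrable_mul (memLp_conj (v.1 (some j)))
  have i2 : Integrable (fun x => np2 x * u.1 none x * conj (v.1 none x))
      (volume.restrict (slab m R)) :=
    integrableOn_weight_of_bdd (hn.bounded.1.mono_measure restrict_slab_le_halfSpace)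
      (ae_mono restrict_slab_le_halfSpace hM) _ _
  have i3 : Integrable (fun x => (cell m R₀).indicator q x * u.1 none x * conj (v.1 none x))
      (volume.restrict (slab m R)) := integrableOn_indicator_weight hm hR.le hp q u v
  have e : (fun x => (∑ j : Dir m, u.1 (some j) x * conj (v.1 (some j) x))
      - (k : ℂ) ^ 2 * perturbedIndex np2 q x * u.1 none x * conj (v.1 none x))
      = fun x => ((∑ j : Dir m, u.1 (some j) x * conj (v.1 (some j) x))
        - (k : ℂ) ^ 2 * (np2 x * u.1 none x * conj (v.1 none x)))
        - (k : ℂ) ^ 2 * ((cell m R₀).indicator q x * u.1 none x * conj (v.1 none x)) := by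
    funext x
    rw [perturbedIndex]; ring
  have i4 : Integrable (fun x => ∑ j : Dir m, u.1 (some j) x * conj (v.1 (some j) x))
      (volume.restrict (slab m R)) := integrable_finsetSum _ fun j _ => i1 j
  have i5 : Integrable (fun x => (∑ j : Dir m, u.1 (some j) x * conj (v.1 (some j) x))
        - (k : ℂ) ^ 2 * (np2 x * u.1 none x * conj (v.1 none x))) (volume.restrict (slab m R)) :=
    i4.sub (i2.const_mul _)
  rw [form, e, integral_sub i5 (i3.const_mul _), integral_sub i4 (i2.const_mul _),
    integral_const_mul, integral_const_mul, integral_finsetSum _ fun j _ => i1 j]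
  have e2 : gradForm u v = ∑ j : Dir m,
      ∫ x in slab m R, u.1 (some j) x * conj (v.1 (some j) x) := by
    refine Finset.sum_congr rfl fun j _ => ?_
    rw [L2.inner_def]
    rfl
  rw [e2, weightForm, weightForm]

/-- The form `a_q` is represented by the operator `A₀ - k² B(q)`, in which the potential `q ∈ L²`
enters through a bounded linear map `B`. -/
theorem exists_form_operator (hm : m = 1 ∨ m = 2) (hR₀ : 0 < R₀) (hR : R₀ < R) {k : ℝ} (hk : 0 < k)
    {np2 : Pt m → ℂ} (hn : IsLayerIndex R₀ np2) :
    ∃ (A : HTilde m R →L[ℂ] HTilde m R) (B : L2Cell m R₀ →L[ℂ] HTilde m R →L[ℂ] HTilde m R),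
      (∀ q u v, inner ℂ v ((A - (k : ℂ) ^ 2 • B q) u) = form k np2 q u v) ∧
      ∀ q u v, inner ℂ v (B q u) = ∫ x in cell m R₀, q x * (u.1 none x * conj (v.1 none x)) := by
  obtain ⟨M, hM0, hM⟩ := hn.exists_bound
  have hp : 0 < R := hR₀.trans hR
  have h1 := isBddForm_gradForm (m := m) (R := R)
  have h2 := isBddForm_weightForm_of_bdd (R := R) hM0
    (hn.bounded.1.mono_measure restrict_slab_le_halfSpace) (ae_mono restrict_slab_le_halfSpace hM)
  have h3 := isBddForm_dtn (m := m) hp hk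
  obtain ⟨C, hC0, h4⟩ := exists_isBddForm_indicator hm hR.le hp
  have hB : ∀ q u v, inner ℂ v ((h4 q).op u)
      = ∫ x in cell m R₀, q x * (u.1 none x * conj (v.1 none x)) := fun q u v => by
    rw [(h4 q).inner_op, weightForm_indicator hR.le]
  have hint : ∀ (q : L2Cell m R₀) (u v : HTilde m R),
      Integrable (fun x => q x * (u.1 none x * conj (v.1 none x)))
        (volume.restrict (cell m R₀)) := by
    obtain ⟨C, _, hC⟩ := exists_memLp_mul_conj hm hR.le hp
    exact fun q u v => (Lp.memLp q).integrable_mul (hC u v).1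
  let B : L2Cell m R₀ →L[ℂ] HTilde m R →L[ℂ] HTilde m R :=
    LinearMap.mkContinuous
      { toFun := fun q => (h4 q).op
        map_add' := by
          intro p q
          ext1 u
          refine ext_inner_left ℂ fun v => ?_
          rw [_root_.add_apply, inner_add_right, hB, hB, hB,
            ← integral_add (hint p u v) (hint q u v)]
          refine integral_congr_ae ?_
          filter_upwards [Lp.coeFn_add p q] with x hx
          rw [hx, Pi.add_apply, add_mul]
        map_smul' := by
          intro c q
          ext1 u
          refine ext_inner_left ℂ fun v => ?_
          rw [RingHom.id_apply, _root_.smul_apply, inner_smul_right, hB, hB, ← integral_const_mul]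
          refine integral_congr_ae ?_
          filter_upwards [Lp.coeFn_smul c q] with x hx
          rw [hx, Pi.smul_apply, smul_eq_mul, mul_assoc] }
      C fun q => (h4 q).norm_op_le (by positivity)
  refine ⟨h1.op - (k : ℂ) ^ 2 • h2.op - h3.op, B, fun q u v => ?_, hB⟩
  have e : B q = (h4 q).op := rfl
  rw [e, form_eq hm hR₀ hR hn, _root_.sub_apply, _root_.sub_apply, _root_.sub_apply,
    _root_.smul_apply, _root_.smul_apply, inner_sub_right, inner_sub_right, inner_sub_right,
    inner_smul_right, inner_smul_right, h1.inner_op, h2.inner_op, h3.inner_op, (h4 q).inner_op]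
  ring

end FormOperator

/-! ### Compactness of solutions with small absorption -/

section Compactness

/-- Bounded sequences in a separable Hilbert space have weakly convergent subsequences. -/
lemma exists_subseq_weakly_convergent {H : Type*} [NormedAddCommGroup H] [InnerProductSpace ℂ H]
    [CompleteSpace H] [SecondCountableTopology H] {x : ℕ → H} {M : ℝ} (hM : ∀ n, ‖x n‖ ≤ M) :
    ∃ (y : H) (ns : ℕ → ℕ), StrictMono ns ∧
      ∀ f : H, Tendsto (fun n => inner ℂ f (x (ns n))) atTop (𝓝 (inner ℂ f y)) := by
  obtain ⟨y, -, ns, hns, hy⟩ := WeakDual.isSeqCompact_closedBall ℂ H 0 M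
    (x := fun n => StrongDual.toWeakDual (InnerProductSpace.toDual ℂ H (x n)))
    (fun n => by simpa using hM n)
  refine ⟨(InnerProductSpace.toDual ℂ H).symm (WeakDual.toStrongDual y), ns, hns, fun f => ?_⟩
  have h1 : Tendsto (fun n => inner ℂ (x (ns n)) f) atTop (𝓝 (y f)) :=
    (((WeakDual.eval_continuous f).tendsto y).comp hy)
  have h2 := (Complex.continuous_conj.tendsto _).comp h1
  have e : inner ℂ f ((InnerProductSpace.toDual ℂ H).symm (WeakDual.toStrongDual y))
      = conj (y f) := by
    rw [← inner_conj_symm, InnerProductSpace.toDual_symm_apply]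
    rfl
  rw [e]
  refine h2.congr fun n => ?_
  exact inner_conj_symm _ _

/-- Closed subspaces are weakly closed. -/
lemma mem_of_weak_limit {H : Type*} [NormedAddCommGroup H] [InnerProductSpace ℂ H]
    [CompleteSpace H] {K : Submodule ℂ H} (hK : IsClosed (K : Set H)) {x : ℕ → H} (hx : ∀ n, x n ∈ K)
    {y : H} (hy : ∀ f : H, Tendsto (fun n => inner ℂ f (x n)) atTop (𝓝 (inner ℂ f y))) : y ∈ K := by
  have := hK.completeSpace_coe
  rw [← Submodule.orthogonal_orthogonal K, Submodule.mem_orthogonal]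
  intro f hf
  refine tendsto_nhds_unique (hy f) ?_
  have : ∀ n, inner ℂ f (x n) = 0 := fun n => (Submodule.mem_orthogonal' _ _).1 hf _ (hx n)
  simp [this]

variable {m : ℕ} {R : ℝ}

instance secondCountableTopology_jet : SecondCountableTopology (Jet m R) := by
  have : Fact ((2 : ENNReal) ≠ ⊤) := ⟨by simp⟩
  have h : SecondCountableTopology (L2Slab m R) := Lp.SecondCountableTopology
  infer_instance

/-- `u`, with gradient `g`, is a weak solution of `-Δu - P u = F none - ∑ ∂_j F_j` in `O`. -/
def SolvesSourceOn (O : Set (Pt m)) (u : Pt m → ℂ) (g : Dir m → Pt m → ℂ) (P : Pt m → ℂ)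
    (F : Option (Dir m) → Pt m → ℂ) : Prop :=
  ∀ φ : Pt m → ℂ, ContDiff ℝ ∞ φ → HasCompactSupport φ → tsupport φ ⊆ O →
    (∑ j, ∫ x, g j x * pd j φ x) - ∫ x, P x * u x * φ x
      = (∫ x, F none x * φ x) + ∑ j, ∫ x, F (some j) x * pd j φ x

lemma isOpen_cell : IsOpen (cell m R) := by
  refine IsOpen.prod ?_ isOpen_Ioo
  have : cube m = ⋂ i, (fun x : Hor m => x i) ⁻¹' Ioo (-Real.pi) Real.pi := by
    ext x; simp [cube]
  rw [this]
  exact isOpen_iInter_of_finite fun i => isOpen_Ioo.preimage (by fun_prop)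

lemma convex_cell : Convex ℝ (cell m R) := by
  refine Convex.prod ?_ (convex_Ioo _ _)
  have : cube m = ⋂ i, (EuclideanSpace.proj i : Hor m →L[ℝ] ℝ) ⁻¹' Ioo (-Real.pi) Real.pi := by
    ext x; simp [cube]
  rw [this]
  exact convex_iInter fun i => (convex_Ioo _ _).linear_preimage _

lemma tendsto_integral_mul_of_eLpNorm {α : Type*} {mα : MeasurableSpace α} {μ : Measure α}
    {F : ℕ → α → ℂ} {ψ : α → ℂ} {K : Set α} (hK : MeasurableSet K)
    (hF : ∀ n, MemLp (F n) 2 μ) (hψ : MemLp ψ 2 μ) (hψK : ∀ x, x ∉ K → ψ x = 0)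
    (h : Tendsto (fun n => eLpNorm (F n) 2 (μ.restrict K)) atTop (𝓝 0)) :
    Tendsto (fun n => ∫ x, F n x * ψ x ∂μ) atTop (𝓝 0) := by
  rw [tendsto_zero_iff_norm_tendsto_zero]
  have hb : ∀ n, ‖∫ x, F n x * ψ x ∂μ‖
      ≤ (eLpNorm (F n) 2 (μ.restrict K)).toReal * (eLpNorm ψ 2 (μ.restrict K)).toReal := by
    intro n
    have e : ∫ x, F n x * ψ x ∂μ = ∫ x in K, F n x * ψ x ∂μ := by
      rw [← integral_indicator hK]
      refine integral_congr_ae (Eventually.of_forall fun x => ?_)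
      by_cases hx : x ∈ K
      · simp [hx]
      · simp [hx, hψK x hx]
    have e2 : ∫ x in K, F n x * ψ x ∂μ
        = ∫ x in K, ((hF n).restrict K).toLp (F n) x * ψ x ∂μ := by
      refine integral_congr_ae ?_
      filter_upwards [((hF n).restrict K).coeFn_toLp] with x hx
      rw [hx]
    rw [e, e2]
    refine (norm_integral_mul_le _ (hψ.restrict K) ENNReal.toReal_nonneg
      (ENNReal.ofReal_toReal (hψ.restrict K).2.ne).ge).trans (le_of_eq ?_)
    rw [Lp.norm_toLp]
  refine squeeze_zero (fun n => norm_nonneg _) hb ?_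
  have := ((ENNReal.tendsto_toReal ENNReal.zero_ne_top).comp h).mul_const
    (eLpNorm ψ 2 (μ.restrict K)).toReal
  simpa using this

/-- There is no bounded sequence of normalized functions in `H¹` which solve the equation in the
cell with sources tending to zero and whose absorption tends to zero: by compactness it would have
a normalized limit that solves the homogeneous equation and vanishes in the absorbing set, against
unique continuation. -/
lemma not_absorption_tendsto_zero (hR : 0 < R) {P : Pt m → ℂ} {M : ℝ}
    (hP : AEStronglyMeasurable P volume) (hPM : ∀ᵐ x, ‖P x‖ ≤ M)
    (hIm : ∀ᵐ x ∂(volume.restrict (cell m R)), 0 ≤ (P x).im) {V : Set (Pt m)} (hV : IsOpen V)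
    (hVn : V.Nonempty) (hVc : V ⊆ cell m R) (hVP : ∀ᵐ x, x ∈ V → 0 < (P x).im)
    {W : ℕ → Jet m R} (hW : ∀ n, W n ∈ H1 m R) {B : ℝ} (hB : ∀ n, ‖W n‖ ≤ B)
    {F : ℕ → Option (Dir m) → Pt m → ℂ} (hF : ∀ n o, MemLp (F n o) 2 volume)
    (hF0 : ∀ o, Tendsto (fun n => eLpNorm (F n o) 2 (volume.restrict (cell m R))) atTop (𝓝 0))
    (hs : ∀ n, SolvesSourceOn (cell m R) (zext (W n none)) (fun j => zext (W n (some j))) P (F n))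
    (ha : Tendsto (fun n => ∫ x in cell m R, (P x).im * ‖zext (W n none) x‖ ^ 2) atTop (𝓝 0))
    (h1 : ∀ n, eLpNorm (zext (W n none)) 2 (volume.restrict (cell m R)) = 1) : False := by
  obtain ⟨Y, ns, hns, hY⟩ := exists_subseq_weakly_convergent hB
  -- the weak limit is in `H¹`
  have hYH : Y ∈ H1 m R := mem_of_weak_limit isClosed_H1 (fun n => hW (ns n)) hY
  have hcomp : ∀ (o : Option (Dir m)) (f : L2Slab m R),
      Tendsto (fun n => inner ℂ f (W (ns n) o)) atTop (𝓝 (inner ℂ f (Y o))) := by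
    intro o f
    have := hY (ContinuousLinearMap.adjoint
      (PiLp.proj (𝕜 := ℂ) 2 (fun _ : Option (Dir m) => L2Slab m R) o) f)
    simp only [ContinuousLinearMap.adjoint_inner_left] at this
    exact this
  have htest : ∀ (o : Option (Dir m)) {ψ : Pt m → ℂ}, MemLp ψ 2 volume →
      Tendsto (fun n => ∫ x, zext (W (ns n) o) x * ψ x) atTop (𝓝 (∫ x, zext (Y o) x * ψ x)) := by
    intro o ψ hψ
    simp only [integral_zext_mul]
    simp_rw [fun f : L2Slab m R => integral_mul_eq_inner f (hψ.restrict (slab m R))]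
    exact hcomp o _
  have hstrong : Tendsto (fun n => eLpNorm (fun x => zext (W (ns n) none) x - zext (Y none) x) 2
      (volume.restrict (cell m R))) atTop (𝓝 0) := by
    have := tendsto_cell_of_weakly_null (U := fun n => W (ns n) - Y) hR
      (fun n => (H1 m R).sub_mem (hW _) hYH) (M := B + ‖Y‖)
      (fun n => (norm_sub_le _ _).trans (by gcongr; exact hB _)) (fun f => by
        have := (hcomp none f).sub_const (inner ℂ f (Y none))
        simpa only [sub_self, PiLp.sub_apply, inner_sub_right] using this)
    refine this.congr fun n => eLpNorm_congr_ae ?_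
    have h := coeFn_ae_cell (Lp.coeFn_sub (W (ns n) none) (Y none))
    filter_upwards [h, ae_restrict_mem measurableSet_cell] with x hx hxc
    have hxs := cell_subset_slab hxc
    rw [PiLp.sub_apply, hx, Pi.sub_apply, zext, zext, indicator_of_mem hxs, indicator_of_mem hxs]
  have hmemc : ∀ U : Jet m R, MemLp (zext (U none)) 2 (volume.restrict (cell m R)) := fun U =>
    (memLp_zext _).restrict _
  -- the limit has no absorption
  have hPim : AEStronglyMeasurable (fun x => (P x).im) (volume.restrict (cell m R)) :=
    (Complex.continuous_im.comp_aestronglyMeasurable hP).restrict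
  have hPimM : ∀ᵐ x ∂(volume.restrict (cell m R)), |(P x).im| ≤ M :=
    ae_restrict_of_ae (hPM.mono fun x hx => (Complex.abs_im_le_norm _).trans hx)
  have hzero : ∫ x in cell m R, (P x).im * ‖zext (Y none) x‖ ^ 2 = 0 :=
    tendsto_nhds_unique (tendsto_integral_mul_norm_sq hPim hPimM
      (fun n => hmemc (W (ns n))) (hmemc Y) hstrong) (ha.comp hns.tendsto_atTop)
  have hint : Integrable (fun x => (P x).im * ‖zext (Y none) x‖ ^ 2)
      (volume.restrict (cell m R)) :=
    (hmemc Y).integrable_norm_pow (by norm_num) |>.bdd_mul hPim hPimM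
  have hY0 : ∀ᵐ x, x ∈ V → zext (Y none) x = 0 := by
    rw [integral_eq_zero_iff_of_nonneg_ae (hIm.mono fun x hx => by positivity) hint] at hzero
    filter_upwards [(ae_restrict_iff' measurableSet_cell).1 hzero, hVP] with x hx hp hxV
    have := hx (hVc hxV)
    have hp' := (hp hxV).ne'
    simpa [hp'] using this
  -- the limit solves the homogeneous equation
  have hsol : SolvesOn (cell m R) (zext (Y none)) (fun j => zext (Y (some j))) P := by
    intro φ hφ hφc hφs
    have hpd : ∀ j, MemLp (pd j φ) 2 volume := fun j =>
      (contDiff_pd hφ j).continuous.memLp_of_hasCompactSupport (hasCompactSupport_pd hφc j)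
    have hφm : MemLp φ 2 volume := hφ.continuous.memLp_of_hasCompactSupport hφc
    have hPφ : MemLp (fun x => P x * φ x) 2 volume := by
      refine hφm.of_le_mul (c := M) (hP.mul hφm.1) ?_
      filter_upwards [hPM] with x hx
      rw [norm_mul]
      exact mul_le_mul_of_nonneg_right hx (norm_nonneg _)
    have e : ∀ u : Pt m → ℂ, ∫ x, P x * u x * φ x = ∫ x, u x * (P x * φ x) := fun u => by
      congr 1; ext x; ring
    have l1 := (tendsto_finsetSum Finset.univ fun j _ => htest (some j) (hpd j)).sub
      (htest none hPφ)
    have l2 : Tendsto (fun n => (∫ x, F (ns n) none x * φ x)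
        + ∑ j, ∫ x, F (ns n) (some j) x * pd j φ x) atTop (𝓝 (0 + ∑ _j : Dir m, 0)) :=
      (tendsto_integral_mul_of_eLpNorm measurableSet_cell (fun n => hF _ _) hφm
        (fun x hx => image_eq_zero_of_notMem_tsupport fun h => hx (hφs h))
        ((hF0 none).comp hns.tendsto_atTop)).add
      (tendsto_finsetSum Finset.univ fun j _ =>
        tendsto_integral_mul_of_eLpNorm measurableSet_cell (fun n => hF _ _) (hpd j)
        (fun x hx => pd_eq_zero_of_notMem subset_rfl (fun h => hx (hφs h)) j)
        ((hF0 (some j)).comp hns.tendsto_atTop))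
    have l3 := tendsto_nhds_unique l1 (l2.congr fun n => by
      rw [← hs (ns n) φ hφ hφc hφs, e])
    have hi : ∀ j ∈ Finset.univ, Integrable fun x => zext (Y (some j)) x * pd j φ x :=
      fun j _ => (memLp_zext _).integrable_mul (hpd j)
    rw [e, integral_finsetSum _ hi]
    simpa [sub_eq_zero, -Fintype.sum_sum_type] using l3
  have hall := eq_zero_of_eq_zero_on_open isOpen_cell convex_cell.isPreconnected hV hVn hVc hsol
    (fun j φ h1 h2 h3 => isWeakDeriv_iff.1 (hYH j) φ h1 h2 (h3.trans cell_subset_slab))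
    (memLp_zext _) (fun j => memLp_zext _) hP hPM hY0
  have : ∀ n, eLpNorm (fun x => zext (W (ns n) none) x - zext (Y none) x) 2
      (volume.restrict (cell m R)) = 1 := by
    intro n
    rw [← h1 (ns n)]
    refine eLpNorm_congr_ae ?_
    filter_upwards [(ae_restrict_iff' measurableSet_cell).2 hall] with x hx
    rw [hx, sub_zero]
  simp only [this] at hstrong
  exact one_ne_zero (tendsto_nhds_unique tendsto_const_nhds hstrong)

end Compactness

/-! ### The local observability estimate -/

section LocalBound

variable {m : ℕ} {R : ℝ}

lemma eLpNorm_two_eq_sqrt {α : Type*} {mα : MeasurableSpace α} {μ : Measure α} {f : α → ℂ}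
    (hf : MemLp f 2 μ) : eLpNorm f 2 μ = ENNReal.ofReal (√(∫ x, ‖f x‖ ^ 2 ∂μ)) := by
  rw [hf.eLpNorm_eq_integral_rpow_norm (by simp) (by simp), Real.sqrt_eq_rpow]
  simp

lemma norm_sq_toLp_eq {α : Type*} {mα : MeasurableSpace α} {μ : Measure α} {f : α → ℂ}
    (hf : MemLp f 2 μ) : ‖hf.toLp f‖ ^ 2 = ∫ x, ‖f x‖ ^ 2 ∂μ := by
  rw [Lp.norm_toLp, eLpNorm_two_eq_sqrt hf, ENNReal.toReal_ofReal (Real.sqrt_nonneg _),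
    Real.sq_sqrt (integral_nonneg fun x => by positivity)]

/-- Cutting off a function of `H¹(Ω^R)` and scaling gives a function of `H¹` whose norm is
controlled by the function and its gradient on the support of the cutoff function. -/
lemma exists_cutoff_jet {χ : Pt m → ℂ} (hχ : ContDiff ℝ ∞ χ) (hχc : HasCompactSupport χ)
    (hχ1 : ∀ x ∈ cell m R, χ x = 1) :
    ∃ C : ℝ, 0 ≤ C ∧ ∀ (s : ℝ) (u : Pt m → ℂ) (g : Dir m → Pt m → ℂ), MemLp u 2 volume →
      (∀ j, MemLp (g j) 2 volume) → (∀ j, HasWeakDerivOn volume (slab m R) (dirVec m j) u (g j)) →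
      ∃ W ∈ H1 m R, (∀ᵐ x, x ∈ cell m R → zext (W none) x = s * u x) ∧
        (∀ j, ∀ᵐ x, x ∈ cell m R → zext (W (some j)) x = s * g j x) ∧
        ‖W‖ ^ 2 ≤ C * s ^ 2 * ((∫ x in tsupport χ, ‖u x‖ ^ 2)
          + ∑ j, ∫ x in tsupport χ, ‖g j x‖ ^ 2) := by
  have hpdc : ∀ j, HasCompactSupport (pd j χ) := fun j => hasCompactSupport_pd hχc j
  obtain ⟨c, hc0, hc, hcd⟩ : ∃ c : ℝ, 0 ≤ c ∧ (∀ x, ‖χ x‖ ≤ c) ∧ ∀ j x, ‖pd j χ x‖ ≤ c := by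
    obtain ⟨a, ha⟩ := hχc.exists_bound_of_continuous hχ.continuous
    have h : ∀ j : Dir m, ∃ b, ∀ x, ‖pd j χ x‖ ≤ b := fun j =>
      (hpdc j).exists_bound_of_continuous (contDiff_pd hχ j).continuous
    choose b hb using h
    have hb0 : ∀ j, 0 ≤ b j := fun j => (norm_nonneg _).trans (hb j 0)
    have ha0 : 0 ≤ a := (norm_nonneg _).trans (ha 0)
    have hs0 : 0 ≤ ∑ j, b j := Finset.sum_nonneg fun j _ => hb0 j
    refine ⟨a + ∑ j, b j, by positivity, fun x => (ha x).trans (by linarith), fun j x =>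
      (hb j x).trans ?_⟩
    have := Finset.single_le_sum (f := b) (fun i _ => hb0 i) (Finset.mem_univ j)
    linarith
  refine ⟨(2 * Fintype.card (Dir m) + 2) * c ^ 2, by positivity, fun s u g hu hg hw => ?_⟩
  have hKm : MeasurableSet (tsupport χ) := (isClosed_tsupport χ).measurableSet
  have hmul : ∀ {η f : Pt m → ℂ}, Continuous η → (∀ x, ‖η x‖ ≤ c) → MemLp f 2 volume →
      MemLp (fun x => η x * f x) 2 volume := by
    intro η f hη hηc hf
    refine hf.of_le_mul (c := c) (hη.aestronglyMeasurable.mul hf.1) (Eventually.of_forall fun x => ?_)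
    rw [norm_mul]
    exact mul_le_mul_of_nonneg_right (hηc x) (norm_nonneg _)
  have hpdcont : ∀ j, Continuous (pd j χ) := fun j => (contDiff_pd hχ j).continuous
  have hW0 : MemLp (fun x => (s : ℂ) * (χ x * u x)) 2 (volume.restrict (slab m R)) :=
    ((hmul hχ.continuous hc hu).const_mul _).restrict _
  have hWj : ∀ j, MemLp (fun x => (s : ℂ) * (χ x * g j x + pd j χ x * u x)) 2
      (volume.restrict (slab m R)) := fun j =>
    (((hmul hχ.continuous hc (hg j)).add (hmul (hpdcont j) (hcd j) hu)).const_mul _).restrict _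
  let W : Jet m R := WithLp.toLp 2 fun o => match o with
    | none => hW0.toLp _
    | some j => (hWj j).toLp _
  have e0 : W none = hW0.toLp _ := rfl
  have ej : ∀ j, W (some j) = (hWj j).toLp _ := fun j => rfl
  have iu : ∀ {f : Pt m → ℂ}, MemLp f 2 volume → Integrable fun x => ‖f x‖ ^ 2 := fun hf =>
    hf.integrable_norm_pow (by norm_num)
  have hle : ∀ {F G : Pt m → ℝ}, (∀ x, 0 ≤ F x) → (∀ x, F x ≤ (tsupport χ).indicator G x) →
      IntegrableOn G (tsupport χ) → (∀ x, 0 ≤ (tsupport χ).indicator G x) →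
      ∫ x in slab m R, F x ≤ ∫ x in tsupport χ, G x := by
    intro F G hF hFG hG hG0
    rw [← integral_indicator hKm]
    refine (integral_mono_of_nonneg (Eventually.of_forall hF)
      ((integrable_indicator_iff hKm).2 hG).restrict (Eventually.of_forall hFG)).trans ?_
    exact setIntegral_le_integral ((integrable_indicator_iff hKm).2 hG) (Eventually.of_forall hG0)
  refine ⟨W, fun j φ h1 h2 h3 => ?_, ?_, fun j => ?_, ?_⟩
  · have hset : ∀ f ψ : Pt m → ℂ, (∀ x, x ∉ slab m R → ψ x = 0) →
        ∫ x in slab m R, f x * ψ x = ∫ x, f x * ψ x := fun f ψ hψ =>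
      setIntegral_eq_integral_of_forall_compl_eq_zero fun x hx => by rw [hψ x hx, mul_zero]
    have hcong : ∀ (f : L2Slab m R) (f' ψ : Pt m → ℂ), f =ᵐ[volume.restrict (slab m R)] f' →
        (∀ x, x ∉ slab m R → ψ x = 0) → ∫ x in slab m R, f x * ψ x = ∫ x, f' x * ψ x := by
      intro f f' ψ hf hψ
      rw [← hset f' ψ hψ]
      refine integral_congr_ae ?_
      filter_upwards [hf] with x hx
      rw [hx]
    change ∫ x in slab m R, W none x * pd j φ x = _
    rw [e0, ej, hcong _ _ _ hW0.coeFn_toLp (fun x hx => pd_eq_zero_of_notMem h3 hx j),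
      hcong _ _ _ (hWj j).coeFn_toLp
        (fun x hx => image_eq_zero_of_notMem_tsupport fun h => hx (h3 h))]
    have := (hw j).mul_cutoff (hu.locallyIntegrable (by norm_num))
      ((hg j).locallyIntegrable (by norm_num)) hχ (A := slab m R) inter_subset_right φ h1 h2 h3
    simp_rw [mul_assoc (s : ℂ)]
    rw [integral_const_mul, integral_const_mul, ← mul_neg]
    exact congrArg (fun z => (s : ℂ) * z) this
  · filter_upwards [(ae_restrict_iff' measurableSet_slab).1 hW0.coeFn_toLp] with x hx hxc
    have hxs := cell_subset_slab hxc
    rw [e0, zext, indicator_of_mem hxs, hx hxs, hχ1 x hxc, one_mul]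
  · filter_upwards [(ae_restrict_iff' measurableSet_slab).1 (hWj j).coeFn_toLp] with x hx hxc
    have hxs := cell_subset_slab hxc
    have hd : pd j χ x = 0 := by
      have : χ =ᶠ[𝓝 x] fun _ => 1 := by
        filter_upwards [isOpen_cell.mem_nhds hxc] with y hy using hχ1 y hy
      rw [pd, this.fderiv_eq]; simp
    rw [ej, zext, indicator_of_mem hxs, hx hxs, hχ1 x hxc, hd, one_mul, zero_mul, add_zero]
  · have hA : ‖W none‖ ^ 2 ≤ c ^ 2 * s ^ 2 * ∫ x in tsupport χ, ‖u x‖ ^ 2 := by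
      rw [e0, norm_sq_toLp_eq, ← integral_const_mul]
      refine hle (fun x => by positivity) (fun x => ?_) ((iu hu).const_mul _).integrableOn
        fun x => indicator_nonneg (fun x _ => by positivity) x
      by_cases hx : x ∈ tsupport χ
      · rw [indicator_of_mem hx, norm_mul, norm_mul, Complex.norm_real, mul_pow, mul_pow,
          Real.norm_eq_abs, sq_abs]
        have := hc x
        calc s ^ 2 * (‖χ x‖ ^ 2 * ‖u x‖ ^ 2) ≤ s ^ 2 * (c ^ 2 * ‖u x‖ ^ 2) := by gcongr
          _ = _ := by ring
      · rw [indicator_of_notMem hx, image_eq_zero_of_notMem_tsupport hx]; simp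
    have hB : ∀ j, ‖W (some j)‖ ^ 2 ≤ 2 * c ^ 2 * s ^ 2 * (∫ x in tsupport χ, ‖g j x‖ ^ 2)
        + 2 * c ^ 2 * s ^ 2 * ∫ x in tsupport χ, ‖u x‖ ^ 2 := by
      intro j
      rw [ej, norm_sq_toLp_eq, ← integral_const_mul, ← integral_const_mul,
        ← integral_add ((iu (hg j)).const_mul _).integrableOn ((iu hu).const_mul _).integrableOn]
      refine hle (fun x => by positivity) (fun x => ?_)
        (((iu (hg j)).const_mul _).add ((iu hu).const_mul _)).integrableOn
        fun x => indicator_nonneg (fun x _ => by positivity) x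
      by_cases hx : x ∈ tsupport χ
      · rw [indicator_of_mem hx, norm_mul, Complex.norm_real, mul_pow, Real.norm_eq_abs, sq_abs]
        have h1 : ‖χ x * g j x + pd j χ x * u x‖ ≤ c * ‖g j x‖ + c * ‖u x‖ := by
          refine (norm_add_le _ _).trans ?_
          rw [norm_mul, norm_mul]
          gcongr
          · exact hc x
          · exact hcd j x
        calc s ^ 2 * ‖χ x * g j x + pd j χ x * u x‖ ^ 2
            ≤ s ^ 2 * (c * ‖g j x‖ + c * ‖u x‖) ^ 2 := by gcongr
          _ ≤ s ^ 2 * (2 * ((c * ‖g j x‖) ^ 2 + (c * ‖u x‖) ^ 2)) := by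
            gcongr; exact add_sq_le
          _ = _ := by ring
      · rw [indicator_of_notMem hx, image_eq_zero_of_notMem_tsupport hx,
          pd_eq_zero_of_notMem subset_rfl hx]; simp
    have hsum := Finset.sum_le_sum fun j (_ : j ∈ Finset.univ) => hB j
    rw [PiLp.norm_sq_eq_of_L2, Fintype.sum_option]
    rw [Finset.sum_add_distrib, ← Finset.mul_sum, Finset.sum_const, Finset.card_univ,
      nsmul_eq_mul] at hsum
    have hu0 : 0 ≤ ∫ x in tsupport χ, ‖u x‖ ^ 2 := integral_nonneg fun x => by positivity
    have hg0 : 0 ≤ ∑ j, ∫ x in tsupport χ, ‖g j x‖ ^ 2 :=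
      Finset.sum_nonneg fun j _ => integral_nonneg fun x => by positivity
    have hn0 : (0 : ℝ) ≤ Fintype.card (Dir m) := Nat.cast_nonneg _
    have t1 : 0 ≤ c ^ 2 * s ^ 2 * ∫ x in tsupport χ, ‖u x‖ ^ 2 := by positivity
    have t2 : 0 ≤ Fintype.card (Dir m) * (c ^ 2 * s ^ 2 * ∑ j, ∫ x in tsupport χ, ‖g j x‖ ^ 2) := by
      positivity
    linarith

/-- The local observability estimate: in a cell the absorbed energy and the source control a
solution, up to a small multiple of its norm in a neighbourhood of the cell. -/
lemma exists_cell_bound (hR : 0 < R) {χ : Pt m → ℂ} (hχ : ContDiff ℝ ∞ χ)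
    (hχc : HasCompactSupport χ) (hχ1 : ∀ x ∈ cell m R, χ x = 1) {P : Pt m → ℂ} {M : ℝ}
    (hP : AEStronglyMeasurable P volume) (hPM : ∀ᵐ x, ‖P x‖ ≤ M)
    (hIm : ∀ᵐ x ∂(volume.restrict (cell m R)), 0 ≤ (P x).im) {V : Set (Pt m)} (hV : IsOpen V)
    (hVn : V.Nonempty) (hVc : V ⊆ cell m R) (hVP : ∀ᵐ x, x ∈ V → 0 < (P x).im)
    {ε : ℝ} (hε : 0 < ε) :
    ∃ C : ℝ, 0 ≤ C ∧ ∀ (u : Pt m → ℂ) (g : Dir m → Pt m → ℂ) (F : Option (Dir m) → Pt m → ℂ),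
      MemLp u 2 volume → (∀ j, MemLp (g j) 2 volume) → (∀ o, MemLp (F o) 2 volume) →
      (∀ j, HasWeakDerivOn volume (slab m R) (dirVec m j) u (g j)) →
      SolvesSourceOn (cell m R) u g P F →
      ∫ x in cell m R, ‖u x‖ ^ 2 ≤
        C * ((∫ x in cell m R, (P x).im * ‖u x‖ ^ 2) + ∑ o, ∫ x in cell m R, ‖F o x‖ ^ 2)
        + ε * ((∫ x in tsupport χ, ‖u x‖ ^ 2) + ∑ j, ∫ x in tsupport χ, ‖g j x‖ ^ 2) := by
  by_contra! hcon
  obtain ⟨Cχ, hCχ0, hCχ⟩ := exists_cutoff_jet (R := R) hχ hχc hχ1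
  -- a sequence which violates the estimate with the constant `n + 1`
  choose u g F hu hg hF hw hs hlt using fun n : ℕ => hcon (n + 1) (by positivity)
  set A : ℕ → ℝ := fun n => ∫ x in cell m R, ‖u n x‖ ^ 2 with hA
  set b : ℕ → ℝ := fun n => ∫ x in cell m R, (P x).im * ‖u n x‖ ^ 2 with hb
  set c : ℕ → ℝ := fun n => ∑ o, ∫ x in cell m R, ‖F n o x‖ ^ 2 with hc
  set D : ℕ → ℝ := fun n => (∫ x in tsupport χ, ‖u n x‖ ^ 2)
    + ∑ j, ∫ x in tsupport χ, ‖g n j x‖ ^ 2 with hD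
  have hb0 : ∀ n, 0 ≤ b n := fun n =>
    integral_nonneg_of_ae (hIm.mono fun x hx => by positivity)
  have hFo0 : ∀ n o, 0 ≤ ∫ x in cell m R, ‖F n o x‖ ^ 2 := fun n o =>
    integral_nonneg fun x => by positivity
  have hc0 : ∀ n, 0 ≤ c n := fun n => Finset.sum_nonneg fun o _ => hFo0 n o
  have hD0 : ∀ n, 0 ≤ D n := fun n => add_nonneg (integral_nonneg fun x => by positivity)
    (Finset.sum_nonneg fun j _ => integral_nonneg fun x => by positivity)
  have hlt' : ∀ n : ℕ, ((n : ℝ) + 1) * (b n + c n) + ε * D n < A n := hlt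
  have hA0 : ∀ n, 0 < A n := fun n => lt_of_le_of_lt (by
    have := hb0 n; have := hc0 n; have := hD0 n; positivity) (hlt' n)
  have hbA : ∀ n : ℕ, b n + c n ≤ A n * (1 / ((n : ℝ) + 1)) := by
    intro n
    rw [mul_one_div, le_div_iff₀ (by positivity), mul_comm]
    have := hD0 n
    have : 0 ≤ ε * D n := by positivity
    linarith [hlt' n]
  have hDA : ∀ n, D n ≤ A n / ε := by
    intro n
    rw [le_div_iff₀ hε, mul_comm]
    have := add_nonneg (hb0 n) (hc0 n)
    have : 0 ≤ ((n : ℝ) + 1) * (b n + c n) := by positivity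
    linarith [hlt' n]
  -- normalize to `∫ |u|² = 1` on the cell
  obtain ⟨s, hs2⟩ : ∃ s : ℕ → ℝ, ∀ n, s n ^ 2 = (A n)⁻¹ := ⟨fun n => √((A n)⁻¹), fun n =>
    Real.sq_sqrt (inv_nonneg.2 (hA0 n).le)⟩
  choose W hWH hW0 hWj hWn using fun n => hCχ (s n) (u n) (g n) (hu n) (hg n) (hw n)
  have hsq : ∀ n (f : Pt m → ℂ) (x : Pt m), ‖(s n : ℂ) * f x‖ ^ 2 = (A n)⁻¹ * ‖f x‖ ^ 2 := by
    intro n f x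
    rw [norm_mul, mul_pow, Complex.norm_real, Real.norm_eq_abs, sq_abs, hs2]
  have hW0c : ∀ n, ∀ᵐ x ∂(volume.restrict (cell m R)), zext (W n none) x = s n * u n x := fun n =>
    (ae_restrict_iff' measurableSet_cell).2 (hW0 n)
  have hlim : Tendsto (fun n : ℕ => 1 / ((n : ℝ) + 1)) atTop (𝓝 0) :=
    tendsto_one_div_add_atTop_nhds_zero_nat
  refine not_absorption_tendsto_zero hR hP hPM hIm hV hVn hVc hVP hWH (B := √(Cχ / ε))
    (F := fun n o x => (s n : ℂ) * F n o x) (fun n => ?_) (fun n o => (hF n o).const_mul _)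
    (fun o => ?_) (fun n φ h1 h2 h3 => ?_) ?_ fun n => ?_
  · refine Real.le_sqrt_of_sq_le ((hWn n).trans ?_)
    rw [hs2]
    calc Cχ * (A n)⁻¹ * D n ≤ Cχ * (A n)⁻¹ * (A n / ε) := by
          have := (hA0 n).le
          gcongr; exact hDA n
      _ = Cχ / ε := by have := (hA0 n).ne'; field_simp
  · have e : ∀ n, eLpNorm (fun x => (s n : ℂ) * F n o x) 2 (volume.restrict (cell m R))
        = ENNReal.ofReal (√((A n)⁻¹ * ∫ x in cell m R, ‖F n o x‖ ^ 2)) := by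
      intro n
      rw [eLpNorm_two_eq_sqrt (((hF n o).const_mul _).restrict _), ← integral_const_mul]
      simp_rw [hsq]
    simp_rw [e]
    have l1 : Tendsto (fun n => (A n)⁻¹ * ∫ x in cell m R, ‖F n o x‖ ^ 2) atTop (𝓝 0) := by
      refine squeeze_zero (fun n => mul_nonneg (inv_nonneg.2 (hA0 n).le) (hFo0 n o)) (fun n => ?_)
        hlim
      rw [inv_mul_le_iff₀ (hA0 n)]
      refine le_trans ?_ (hbA n)
      have := Finset.single_le_sum (f := fun o => ∫ x in cell m R, ‖F n o x‖ ^ 2)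
        (fun o _ => hFo0 n o) (Finset.mem_univ o)
      have h0 := hb0 n
      have : ∫ x in cell m R, ‖F n o x‖ ^ 2 ≤ c n := this
      linarith
    have := ENNReal.tendsto_ofReal ((Real.continuous_sqrt.tendsto 0).comp l1)
    simpa using this
  · have hvan : ∀ {ψ : Pt m → ℂ}, (∀ x, x ∉ cell m R → ψ x = 0) → ∀ {f f' Q : Pt m → ℂ},
        (∀ᵐ x, x ∈ cell m R → f x = s n * f' x) →
        ∫ x, Q x * f x * ψ x = s n * ∫ x, Q x * f' x * ψ x := by
      intro ψ hψ f f' Q hf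
      rw [← integral_const_mul]
      refine integral_congr_ae ?_
      filter_upwards [hf] with x hx
      by_cases hxc : x ∈ cell m R
      · rw [hx hxc]; ring
      · rw [hψ x hxc]; ring
    have hφ0 : ∀ x, x ∉ cell m R → φ x = 0 := fun x hx =>
      image_eq_zero_of_notMem_tsupport fun h => hx (h3 h)
    have hpd0 : ∀ j, ∀ x, x ∉ cell m R → pd j φ x = 0 := fun j x hx =>
      pd_eq_zero_of_notMem h3 hx j
    have h := hs n φ h1 h2 h3
    have k1 : ∀ j, ∫ x, zext (W n (some j)) x * pd j φ x = s n * ∫ x, g n j x * pd j φ x :=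
      fun j => by
        have := hvan (hpd0 j) (Q := fun _ => 1) (hWj n j)
        simpa only [one_mul] using this
    rw [hvan hφ0 (hW0 n)]
    simp_rw [k1, mul_assoc (s n : ℂ), integral_const_mul, ← Finset.mul_sum]
    rw [← mul_sub, ← mul_add, h]
  · refine squeeze_zero (fun n => ?_) (fun n => ?_) hlim
    · exact integral_nonneg_of_ae (hIm.mono fun x hx => by positivity)
    · have e : ∫ x in cell m R, (P x).im * ‖zext (W n none) x‖ ^ 2 = (A n)⁻¹ * b n := by
        rw [hb, ← integral_const_mul]
        refine integral_congr_ae ?_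
        filter_upwards [hW0c n] with x hx
        rw [hx, hsq]; ring
      rw [e, inv_mul_le_iff₀ (hA0 n)]
      linarith [hbA n, hc0 n]
  · have e : eLpNorm (zext (W n none)) 2 (volume.restrict (cell m R))
        = eLpNorm (fun x => (s n : ℂ) * u n x) 2 (volume.restrict (cell m R)) :=
      eLpNorm_congr_ae (hW0c n)
    rw [e, eLpNorm_two_eq_sqrt (((hu n).const_mul _).restrict _)]
    simp_rw [hsq]
    rw [integral_const_mul, inv_mul_cancel₀ (hA0 n).ne']
    simp

end LocalBound

/-! ### Periodic translations -/

section Periods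

variable {m : ℕ} {R : ℝ}

/-- The horizontal translation vectors `(2π l, 0)`, `l ∈ ℤ^{d-1}`. -/
def period (l : Fin m → ℤ) : Pt m := (WithLp.toLp 2 fun i => 2 * Real.pi * (l i : ℝ), 0)

lemma add_period_mem_slab {x : Pt m} {l : Fin m → ℤ} : x + period l ∈ slab m R ↔ x ∈ slab m R := by
  simp [slab, period]

lemma sub_mem_cell_iff {x : Pt m} {l : Fin m → ℤ} : x - period l ∈ cell m R ↔
    (∀ i, x.1 i - 2 * Real.pi * (l i : ℝ) ∈ Ioo (-Real.pi) Real.pi) ∧ x.2 ∈ Ioo 0 R := by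
  have h2 : (x - period l).2 = x.2 := by simp [period]
  constructor
  · intro h
    exact ⟨fun i => h.1 i, h2 ▸ h.2⟩
  · intro h
    exact ⟨fun i => h.1 i, h2.symm ▸ h.2⟩

lemma translate_test {O O' : Set (Pt m)} {c : Pt m} (hO : ∀ x ∈ O', x + c ∈ O) {φ : Pt m → ℂ}
    (hφ : ContDiff ℝ ∞ φ) (hφc : HasCompactSupport φ) (hφs : tsupport φ ⊆ O') :
    ContDiff ℝ ∞ (fun x => φ (x - c)) ∧ HasCompactSupport (fun x => φ (x - c)) ∧
      tsupport (fun x => φ (x - c)) ⊆ O ∧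
      ∀ x v, fderiv ℝ (fun x => φ (x - c)) x v = fderiv ℝ φ (x - c) v := by
  have e : (fun x => φ (x - c)) = φ ∘ (Homeomorph.subRight c) := rfl
  refine ⟨hφ.comp (by fun_prop), hφc.comp_homeomorph (Homeomorph.subRight c), ?_, fun x v => ?_⟩
  · intro x hx
    rw [e, tsupport_comp_eq_preimage] at hx
    have := hO _ (hφs hx)
    simpa using this
  · rw [fderiv_comp_sub]

lemma HasWeakDerivOn.translate {O O' : Set (Pt m)} {c v : Pt m} (hO : ∀ x ∈ O', x + c ∈ O)
    {u g : Pt m → ℂ} (h : HasWeakDerivOn volume O v u g) :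
    HasWeakDerivOn volume O' v (fun x => u (x + c)) (fun x => g (x + c)) := by
  intro φ h1 h2 h3
  obtain ⟨k1, k2, k3, k4⟩ := translate_test hO h1 h2 h3
  have := h _ k1 k2 k3
  simp only [k4] at this
  rw [← integral_add_right_eq_self (fun x => u x * fderiv ℝ φ (x - c) v) c,
    ← integral_add_right_eq_self (fun x => g x * φ (x - c)) c] at this
  simpa only [add_sub_cancel_right] using this

lemma SolvesSourceOn.translate {O O' : Set (Pt m)} {c : Pt m} (hO : ∀ x ∈ O', x + c ∈ O)
    {u P : Pt m → ℂ} {g : Dir m → Pt m → ℂ} {F : Option (Dir m) → Pt m → ℂ}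
    (h : SolvesSourceOn O u g P F) {P' : Pt m → ℂ} (hP : ∀ᵐ x, x ∈ O' → P (x + c) = P' x) :
    SolvesSourceOn O' (fun x => u (x + c)) (fun j x => g j (x + c)) P'
      (fun o x => F o (x + c)) := by
  intro φ h1 h2 h3
  obtain ⟨k1, k2, k3, k4⟩ := translate_test hO h1 h2 h3
  have h0 := h _ k1 k2 k3
  have k5 : ∀ j x, pd j (fun x => φ (x - c)) x = pd j φ (x - c) := fun j x => k4 x _
  simp only [k5] at h0
  have ht : ∀ (f ψ : Pt m → ℂ), ∫ x, f x * ψ (x - c) = ∫ x, f (x + c) * ψ x := fun f ψ => by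
    rw [← integral_add_right_eq_self (fun x => f x * ψ (x - c)) c]
    simp only [add_sub_cancel_right]
  have hPe : ∫ x, P' x * u (x + c) * φ x = ∫ x, P x * u x * φ (x - c) := by
    rw [ht (fun x => P x * u x) φ]
    refine integral_congr_ae ?_
    filter_upwards [hP] with x hx
    by_cases hxO : x ∈ O'
    · rw [hx hxO]
    · rw [image_eq_zero_of_notMem_tsupport fun h => hxO (h3 h)]; ring
  simp only [ht] at h0
  rw [hPe]
  simp only [ht]
  exact h0

lemma MemLp.translate {f : Pt m → ℂ} (hf : MemLp f 2 volume) (c : Pt m) :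
    MemLp (fun x => f (x + c)) 2 volume :=
  hf.comp_measurePreserving (measurePreserving_add_right volume c)

lemma setIntegral_translate {K : Set (Pt m)} (hK : MeasurableSet K) (f : Pt m → ℝ) (c : Pt m) :
    ∫ x in K, f (x + c) = ∫ x, {x | x - c ∈ K}.indicator f x := by
  rw [← integral_indicator hK,
    ← integral_add_right_eq_self (fun x => {x | x - c ∈ K}.indicator f x) c]
  refine integral_congr_ae (Eventually.of_forall fun x => ?_)
  by_cases hx : x ∈ K <;> simp [indicator, hx]

/-- Translates of a bounded set by the periods overlap finitely often. -/
lemma exists_overlap {K : Set (Pt m)} (hK : IsCompact K) :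
    ∃ n : ℕ, ∀ f : Pt m → ℝ, Integrable f → (∀ x, 0 ≤ f x) → ∀ L : Finset (Fin m → ℤ),
      ∑ l ∈ L, ∫ x in K, f (x + period l) ≤ n * ∫ x, f x := by
  obtain ⟨r, hr⟩ := hK.isBounded.exists_norm_le
  obtain ⟨J, hJ⟩ := exists_nat_ge (r / (2 * Real.pi))
  have hpi := Real.pi_pos
  have hKJ : ∀ x ∈ K, ∀ i, |x.1 i| ≤ 2 * Real.pi * J := by
    intro x hx i
    have h1 : |x.1 i| ≤ ‖x.1‖ := PiLp.norm_apply_le x.1 i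
    have h2 : ‖x.1‖ ≤ r := (norm_fst_le x).trans (hr x hx)
    rw [div_le_iff₀ (by positivity)] at hJ
    linarith
  refine ⟨(2 * J + 1) ^ m, fun f hf hf0 L => ?_⟩
  classical
  have hcard : ∀ x : Pt m, (L.filter fun l => x - period l ∈ K).card ≤ (2 * J + 1) ^ m := by
    intro x
    set T : Finset (Fin m → ℤ) := Fintype.piFinset fun i =>
      Finset.Icc (⌈x.1 i / (2 * Real.pi)⌉ - J) (⌊x.1 i / (2 * Real.pi)⌋ + J) with hT
    have hsub : (L.filter fun l => x - period l ∈ K) ⊆ T := by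
      intro l hl
      rw [Finset.mem_filter] at hl
      rw [hT, Fintype.mem_piFinset]
      intro i
      have h1 := abs_le.1 (hKJ _ hl.2 i)
      have e : (x - period l).1 i = x.1 i - 2 * Real.pi * (l i : ℝ) := rfl
      rw [e] at h1
      have a1 : ⌈x.1 i / (2 * Real.pi)⌉ ≤ l i + J := by
        rw [Int.ceil_le, div_le_iff₀ (by positivity)]
        push_cast
        linarith [h1.2]
      have a2 : l i - J ≤ ⌊x.1 i / (2 * Real.pi)⌋ := by
        rw [Int.le_floor, le_div_iff₀ (by positivity)]
        push_cast
        linarith [h1.1]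
      rw [Finset.mem_Icc]
      omega
    refine (Finset.card_le_card hsub).trans ?_
    rw [hT, Fintype.card_piFinset]
    refine (Finset.prod_le_pow_card _ _ (2 * J + 1) fun i _ => ?_).trans (by simp)
    rw [Int.card_Icc]
    have := Int.floor_le_ceil (x.1 i / (2 * Real.pi))
    omega
  have hms : ∀ l : Fin m → ℤ, MeasurableSet {x : Pt m | x - period l ∈ K} := fun l =>
    hK.measurableSet.preimage (measurable_sub_const _)
  simp_rw [setIntegral_translate hK.measurableSet]
  rw [← integral_finsetSum _ fun l _ => hf.indicator (hms l), ← integral_const_mul]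
  refine integral_mono (integrable_finsetSum _ fun l _ => hf.indicator (hms l))
    (hf.const_mul _) fun x => ?_
  have e : ∑ l ∈ L, {x : Pt m | x - period l ∈ K}.indicator f x
      = (L.filter fun l => x - period l ∈ K).card * f x := by
    simp only [indicator, Set.mem_ofPred_eq]
    rw [← Finset.sum_filter, Finset.sum_const, nsmul_eq_mul]
  change ∑ l ∈ L, {x : Pt m | x - period l ∈ K}.indicator f x ≤ _
  rw [e]
  refine mul_le_mul_of_nonneg_right ?_ (hf0 x)
  exact_mod_cast hcard x

lemma ae_exists_mem_cell : ∀ᵐ x : Pt m, x.2 ∈ Ioo 0 R → ∃ l, x - period l ∈ cell m R := by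
  have hpi := Real.pi_pos
  have h1 : ∀ (i : Fin m) (c : ℝ), ∀ᵐ y : Hor m, y i ≠ c := by
    intro i c
    have h := (EuclideanSpace.volume_preserving_symm_measurableEquiv_toLp (Fin m)).symm
    have h2 : ∀ᵐ z : Fin m → ℝ, z i ≠ c := by
      rw [ae_iff]
      have := Measure.pi_hyperplane (fun _ : Fin m => (volume : Measure ℝ)) i c
      rw [← volume_pi] at this
      simpa using this
    exact h.symm.quasiMeasurePreserving.ae h2
  have h3 : ∀ᵐ y : Hor m, ∀ (i : Fin m) (n : ℤ), y i ≠ 2 * Real.pi * n - Real.pi :=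
    ae_all_iff.2 fun i => ae_all_iff.2 fun n => h1 i _
  have h4 : ∀ᵐ x : Pt m, ∀ (i : Fin m) (n : ℤ), x.1 i ≠ 2 * Real.pi * n - Real.pi := by
    rw [Measure.volume_eq_prod]
    exact Measure.quasiMeasurePreserving_fst.ae h3
  filter_upwards [h4] with x hx hx2
  refine ⟨fun i => ⌊(x.1 i + Real.pi) / (2 * Real.pi)⌋, sub_mem_cell_iff.2 ⟨fun i => ?_, hx2⟩⟩
  have a1 := Int.floor_le ((x.1 i + Real.pi) / (2 * Real.pi))
  have a2 := Int.lt_floor_add_one ((x.1 i + Real.pi) / (2 * Real.pi))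
  have a3 := hx i ⌊(x.1 i + Real.pi) / (2 * Real.pi)⌋
  rw [le_div_iff₀ (by positivity)] at a1
  rw [div_lt_iff₀ (by positivity)] at a2
  refine ⟨lt_of_le_of_ne (by linarith) fun h => a3 (by linarith), by linarith⟩

lemma eq_of_sub_mem_cell {x : Pt m} {l l' : Fin m → ℤ} (h : x - period l ∈ cell m R)
    (h' : x - period l' ∈ cell m R) : l = l' := by
  have hpi := Real.pi_pos
  funext i
  have a := (sub_mem_cell_iff.1 h).1 i
  have b := (sub_mem_cell_iff.1 h').1 i
  have h1 : (l i : ℝ) - l' i < 1 := by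
    by_contra hc
    rw [not_lt] at hc
    nlinarith [a.1, a.2, b.1, b.2]
  have h2 : (l' i : ℝ) - l i < 1 := by
    by_contra hc
    rw [not_lt] at hc
    nlinarith [a.1, a.2, b.1, b.2]
  have h3 : l i - l' i < 1 := by exact_mod_cast h1
  have h4 : l' i - l i < 1 := by exact_mod_cast h2
  omega

/-- An integral over the layer is the sum of the integrals over the cells. -/
lemma hasSum_cells {f : Pt m → ℝ} (hf : Integrable f) :
    HasSum (fun l : Fin m → ℤ => ∫ x in cell m R, f (x + period l)) (∫ x in slab m R, f x) := by
  have hms : ∀ l : Fin m → ℤ, MeasurableSet {x : Pt m | x - period l ∈ cell m R} := fun l =>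
    measurableSet_cell.preimage (measurable_sub_const _)
  have h := hasSum_integral_iUnion hms (fun l l' hl => by
    rw [Function.onFun, Set.disjoint_left]
    intro x hx hx'
    exact hl (eq_of_sub_mem_cell hx hx')) hf.integrableOn
  have e : (⋃ l : Fin m → ℤ, {x : Pt m | x - period l ∈ cell m R}) =ᵐ[volume] slab m R := by
    filter_upwards [ae_exists_mem_cell (m := m) (R := R)] with x hx
    refine propext ⟨fun h => ?_, fun h => ?_⟩
    · obtain ⟨l, hl⟩ := mem_iUnion.1 h
      exact ⟨mem_univ _, (sub_mem_cell_iff.1 hl).2⟩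
    · obtain ⟨l, hl⟩ := hx h.2
      exact mem_iUnion.2 ⟨l, hl⟩
  rw [setIntegral_congr_set e] at h
  refine h.congr_fun fun l => ?_
  rw [setIntegral_translate measurableSet_cell, integral_indicator (hms l)]

end Periods

/-! ### Summation over the cells -/

section SlabBound

variable {m : ℕ} {R₀ R k : ℝ} {np2 : Pt m → ℂ}

/-- The zeroth order coefficient `k² n²` of the equation in the layer, extended by zero. -/
def potential (k R : ℝ) (np2 : Pt m → ℂ) (q : L2Cell m R₀) : Pt m → ℂ :=
  (slab m R).indicator fun x => (k : ℂ) ^ 2 * perturbedIndex np2 q x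

lemma potential_im {q : L2Cell m R₀} {x : Pt m} (hx : x ∈ slab m R) :
    (potential k R np2 q x).im = k ^ 2 * ((np2 x).im + ((cell m R₀).indicator q x).im) := by
  rw [potential, indicator_of_mem hx, ← Complex.ofReal_pow, Complex.im_ofReal_mul, perturbedIndex,
    Complex.add_im]

lemma aestronglyMeasurable_potential (hn : IsLayerIndex R₀ np2) (q : L2Cell m R₀) :
    AEStronglyMeasurable (potential k R np2 q) volume := by
  refine (aestronglyMeasurable_indicator_iff measurableSet_slab).2 ?_
  refine AEStronglyMeasurable.const_mul ?_ _
  refine (hn.bounded.1.mono_measure restrict_slab_le_halfSpace).add ?_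
  exact ((aestronglyMeasurable_indicator_iff measurableSet_cell).2
    (Lp.aestronglyMeasurable q)).restrict

lemma isOpen_halfSpace : IsOpen (halfSpace m) := isOpen_Ioi.preimage continuous_snd

lemma ae_halfSpace {p : Pt m → Prop} : (∀ᵐ x ∂(volume.restrict (halfSpace m)), p x) ↔
    ∀ᵐ x, x ∈ halfSpace m → p x := ae_restrict_iff' isOpen_halfSpace.measurableSet

lemma exists_bound_potential (hn : IsLayerIndex R₀ np2) {q : L2Cell m R₀}
    (hq : q ∈ boundedPerturbations m R₀) :
    ∃ M : ℝ, 0 ≤ M ∧ ∀ᵐ x, ‖potential k R np2 q x‖ ≤ M := by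
  obtain ⟨M, hM0, hM⟩ := hn.exists_bound
  have hqM : ∀ᵐ x ∂(volume.restrict (cell m R₀)),
      ‖q x‖ ≤ (eLpNorm q ⊤ (volume.restrict (cell m R₀))).toReal := by
    filter_upwards [enorm_ae_le_eLpNormEssSup q (volume.restrict (cell m R₀))] with x hx
    rw [← eLpNorm_exponent_top] at hx
    simpa using ENNReal.toReal_mono hq.1.2.ne hx
  set M' := (eLpNorm q ⊤ (volume.restrict (cell m R₀))).toReal
  have hM'0 : 0 ≤ M' := ENNReal.toReal_nonneg
  refine ⟨k ^ 2 * (M + M'), by positivity, ?_⟩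
  filter_upwards [ae_halfSpace.1 hM, (ae_restrict_iff' measurableSet_cell).1 hqM] with x h1 h2
  by_cases hx : x ∈ slab m R
  · rw [potential, indicator_of_mem hx, norm_mul, perturbedIndex, norm_pow, Complex.norm_real,
      Real.norm_eq_abs, sq_abs]
    refine mul_le_mul_of_nonneg_left ((norm_add_le _ _).trans (add_le_add
      (h1 (slab_subset_halfSpace hx)) ?_)) (by positivity)
    by_cases hc : x ∈ cell m R₀
    · rw [indicator_of_mem hc]; exact h2 hc
    · rw [indicator_of_notMem hc]; simpa using hM'0
  · rw [potential, indicator_of_notMem hx]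
    simpa using by positivity

lemma indicator_im_nonneg {q : L2Cell m R₀} (hq : q ∈ boundedPerturbations m R₀) :
    ∀ᵐ x, 0 ≤ ((cell m R₀).indicator q x).im := by
  filter_upwards [(ae_restrict_iff' measurableSet_cell).1 hq.2] with x h2
  by_cases hc : x ∈ cell m R₀
  · rw [indicator_of_mem hc]; exact h2 hc
  · rw [indicator_of_notMem hc]; simp

lemma potential_im_nonneg (hn : IsLayerIndex R₀ np2) {q : L2Cell m R₀}
    (hq : q ∈ boundedPerturbations m R₀) : ∀ᵐ x, 0 ≤ (potential k R np2 q x).im := by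
  filter_upwards [ae_halfSpace.1 hn.im_nonneg, indicator_im_nonneg hq] with x h1 h2
  by_cases hx : x ∈ slab m R
  · rw [potential_im hx]
    have := h1 (slab_subset_halfSpace hx)
    positivity
  · rw [potential, indicator_of_notMem hx]; simp

lemma zero_mem_boundedPerturbations : (0 : L2Cell m R₀) ∈ boundedPerturbations m R₀ := by
  have h : ((0 : L2Cell m R₀) : Pt m → ℂ) =ᵐ[volume.restrict (cell m R₀)] 0 := Lp.coeFn_zero _ _ _
  refine ⟨(memLp_congr_ae h).2 MemLp.zero', ?_⟩
  filter_upwards [h] with x hx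
  rw [hx]; simp

lemma add_period (x : Pt m) (l : Fin m → ℤ) :
    x + period l = (x.1 + WithLp.toLp 2 (fun i => 2 * Real.pi * (l i : ℝ)), x.2) :=
  Prod.ext rfl (add_zero _)

lemma IsLayerIndex.add_period (hn : IsLayerIndex R₀ np2) (l : Fin m → ℤ) :
    ∀ᵐ x, x ∈ halfSpace m → np2 (x + period l) = np2 x := by
  filter_upwards [ae_halfSpace.1 (hn.periodic l)] with x hx hx2
  rw [PerturbedLayer.add_period]
  exact hx hx2

/-- By periodicity the absorbing set may be taken in the cell. -/
lemma exists_absorbing_subset_cell (hk : 0 < k) (hR : R₀ < R) (hn : IsLayerIndex R₀ np2) :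
    ∃ V : Set (Pt m), IsOpen V ∧ V.Nonempty ∧ V ⊆ cell m R ∧
      ∀ q ∈ boundedPerturbations m R₀, ∀ᵐ x, x ∈ V → 0 < (potential k R np2 q x).im := by
  obtain ⟨V, hV, hVn, hVh, hVp⟩ := hn.absorbing
  rw [ae_restrict_iff' hV.measurableSet] at hVp
  obtain ⟨x, hxV, l, hl⟩ : ∃ x ∈ V, ∃ l, x - period l ∈ cell m R := by
    by_contra! hcon
    have h0 : ∀ᵐ x : Pt m, x ∉ V := by
      filter_upwards [hVp, ae_halfSpace.1 hn.eq_one, ae_exists_mem_cell (m := m) (R := R)]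
        with x h1 h2 h3 hx
      have hx2 : x.2 < R := by
        by_contra hc
        have := h2 (hVh hx) (by linarith)
        have h4 := h1 hx
        rw [this] at h4
        simp at h4
      obtain ⟨l, hl⟩ := h3 ⟨hVh hx, hx2⟩
      exact hcon x hx l hl
    have : volume V = 0 := by simpa [ae_iff] using h0
    exact (hV.measure_pos volume hVn).ne' this
  refine ⟨cell m R ∩ (fun y => y + period l) ⁻¹' V,
    isOpen_cell.inter (hV.preimage (by fun_prop)), ⟨x - period l, hl, ?_⟩, inter_subset_left,
    fun q hq => ?_⟩
  · simpa using hxV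
  · have hshift : ∀ᵐ y : Pt m, y + period l ∈ V → 0 < (np2 (y + period l)).im :=
      (measurePreserving_add_right volume (period l)).quasiMeasurePreserving.ae hVp
    filter_upwards [hshift, hn.add_period l, indicator_im_nonneg hq] with y h1 h2 h3 hy
    have hys := cell_subset_slab hy.1
    rw [potential_im hys]
    have h4 := h1 hy.2
    rw [h2 (slab_subset_halfSpace hys)] at h4
    positivity

/-- In all cells except the base cell the potential is that of the periodic layer. -/
lemma potential_add_period (hR : R₀ ≤ R) (hn : IsLayerIndex R₀ np2) (q : L2Cell m R₀)
    {l : Fin m → ℤ} (hl : l ≠ 0) :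
    ∀ᵐ x, x ∈ cell m R → potential k R np2 q (x + period l)
      = potential k R np2 (0 : L2Cell m R₀) x := by
  have h : ((0 : L2Cell m R₀) : Pt m → ℂ) =ᵐ[volume.restrict (cell m R₀)] 0 := Lp.coeFn_zero _ _ _
  filter_upwards [hn.add_period l, (ae_restrict_iff' measurableSet_cell).1 h] with x h1 h2 hx
  have hxs := cell_subset_slab hx
  have hnot : x + period l ∉ cell m R₀ := by
    intro hc
    refine hl (eq_of_sub_mem_cell (R := R) (x := x + period l) (l := l) (l' := 0) ?_ ?_)
    · simpa using hx
    · have : period (0 : Fin m → ℤ) = 0 := by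
        ext i <;> simp [period]
      rw [this, sub_zero]
      exact cell_subset_cell hR hc
  rw [potential, potential, indicator_of_mem hxs, indicator_of_mem (add_period_mem_slab.2 hxs),
    perturbedIndex, perturbedIndex, indicator_of_notMem hnot, h1 (slab_subset_halfSpace hxs)]
  by_cases hc : x ∈ cell m R₀
  · rw [indicator_of_mem hc, h2 hc]; rfl
  · rw [indicator_of_notMem hc]

/-- Summation of the local estimate over all cells. Only two potentials occur, so that the constant
does not depend on the cell. -/
lemma exists_slab_bound (hk : 0 < k) (hR₀ : 0 < R₀) (hR : R₀ < R) (hn : IsLayerIndex R₀ np2)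
    {q : L2Cell m R₀} (hq : q ∈ boundedPerturbations m R₀) {ε : ℝ} (hε : 0 < ε) :
    ∃ C : ℝ, 0 ≤ C ∧ ∀ (u : Pt m → ℂ) (g : Dir m → Pt m → ℂ) (F : Option (Dir m) → Pt m → ℂ),
      MemLp u 2 volume → (∀ j, MemLp (g j) 2 volume) → (∀ o, MemLp (F o) 2 volume) →
      (∀ j, HasWeakDerivOn volume (slab m R) (dirVec m j) u (g j)) →
      SolvesSourceOn (slab m R) u g (potential k R np2 q) F →
      ∫ x in slab m R, ‖u x‖ ^ 2 ≤
        C * ((∫ x in slab m R, (potential k R np2 q x).im * ‖u x‖ ^ 2)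
          + ∑ o, ∫ x in slab m R, ‖F o x‖ ^ 2)
        + ε * ((∫ x, ‖u x‖ ^ 2) + ∑ j, ∫ x, ‖g j x‖ ^ 2) := by
  obtain ⟨χ, hχ, hχc, -, hχ1⟩ := exists_cellCutoff (m := m) (hR₀.trans hR)
  -- the neighbourhoods of the cells overlap at most `n` times, so that `ε / (n + 1)` per cell suffices
  obtain ⟨n, hov⟩ := exists_overlap (K := tsupport χ) hχc
  obtain ⟨V, hV, hVn, hVc, hVp⟩ := exists_absorbing_subset_cell hk hR hn
  choose! Mb hMb0 hMb using fun (p : L2Cell m R₀) (hp : p ∈ boundedPerturbations m R₀) =>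
    exists_bound_potential (k := k) (R := R) hn hp
  have hloc := fun (p : L2Cell m R₀) (hp : p ∈ boundedPerturbations m R₀) =>
    exists_cell_bound (hR₀.trans hR) hχ hχc hχ1 (aestronglyMeasurable_potential hn p) (hMb p hp)
      (ae_restrict_of_ae (potential_im_nonneg hn hp)) hV hVn hVc (hVp p hp)
      (ε := ε / (n + 1)) (by positivity)
  -- the base cell has the potential with `q`, all other cells the potential with `0`
  obtain ⟨C₁, hC₁0, hC₁⟩ := hloc q hq
  obtain ⟨C₂, hC₂0, hC₂⟩ := hloc 0 zero_mem_boundedPerturbations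
  refine ⟨C₁ + C₂, by positivity, fun u g F hu hg hF hw hs => ?_⟩
  set P := potential k R np2 q with hPdef
  have hPm : AEStronglyMeasurable P volume := aestronglyMeasurable_potential hn q
  have hP0 : ∀ᵐ x, 0 ≤ (P x).im := potential_im_nonneg hn hq
  have iu : ∀ {f : Pt m → ℂ}, MemLp f 2 volume → Integrable fun x => ‖f x‖ ^ 2 := fun hf =>
    hf.integrable_norm_pow (by norm_num)
  have iP : Integrable fun x => (P x).im * ‖u x‖ ^ 2 :=
    (iu hu).bdd_mul (c := Mb q) (Complex.continuous_im.comp_aestronglyMeasurable hPm)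
      ((hMb q hq).mono fun x hx => (Complex.abs_im_le_norm _).trans hx)
  set c₀ : (Fin m → ℤ) → ℝ := fun l => ∫ x in cell m R, ‖u (x + period l)‖ ^ 2 with hc₀
  set b : (Fin m → ℤ) → ℝ := fun l => ∫ x in cell m R, (P (x + period l)).im * ‖u (x + period l)‖ ^ 2
    with hb
  set c : (Fin m → ℤ) → ℝ := fun l => ∑ o, ∫ x in cell m R, ‖F o (x + period l)‖ ^ 2 with hc
  set d : (Fin m → ℤ) → ℝ := fun l => (∫ x in tsupport χ, ‖u (x + period l)‖ ^ 2)
    + ∑ j, ∫ x in tsupport χ, ‖g j (x + period l)‖ ^ 2 with hd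
  have hshift : ∀ l : Fin m → ℤ, ∀ᵐ x, 0 ≤ (P (x + period l)).im := fun l =>
    (measurePreserving_add_right volume (period l)).quasiMeasurePreserving.ae hP0
  have hb0 : ∀ l, 0 ≤ b l := fun l =>
    integral_nonneg_of_ae (ae_restrict_of_ae ((hshift l).mono fun x hx => by positivity))
  have hc0 : ∀ l, 0 ≤ c l := fun l => Finset.sum_nonneg fun o _ =>
    integral_nonneg fun x => by positivity
  have hcell : ∀ l, c₀ l ≤ (C₁ + C₂) * (b l + c l) + ε / (n + 1) * d l := by
    intro l
    have hadd : ∀ x ∈ slab m R, x + period l ∈ slab m R := fun x hx => add_period_mem_slab.2 hx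
    have hadd' : ∀ x ∈ cell m R, x + period l ∈ slab m R := fun x hx =>
      hadd x (cell_subset_slab hx)
    have hbc := add_nonneg (hb0 l) (hc0 l)
    have key : ∀ {p : L2Cell m R₀} {C : ℝ}, 0 ≤ C → C ≤ C₁ + C₂ →
        (∀ᵐ x, x ∈ cell m R → P (x + period l) = potential k R np2 p x) →
        (∀ (u : Pt m → ℂ) (g : Dir m → Pt m → ℂ) (F : Option (Dir m) → Pt m → ℂ),
          MemLp u 2 volume → (∀ j, MemLp (g j) 2 volume) → (∀ o, MemLp (F o) 2 volume) →
          (∀ j, HasWeakDerivOn volume (slab m R) (dirVec m j) u (g j)) →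
          SolvesSourceOn (cell m R) u g (potential k R np2 p) F →
          ∫ x in cell m R, ‖u x‖ ^ 2 ≤
            C * ((∫ x in cell m R, (potential k R np2 p x).im * ‖u x‖ ^ 2)
              + ∑ o, ∫ x in cell m R, ‖F o x‖ ^ 2)
            + ε / (n + 1) * ((∫ x in tsupport χ, ‖u x‖ ^ 2)
              + ∑ j, ∫ x in tsupport χ, ‖g j x‖ ^ 2)) →
        c₀ l ≤ (C₁ + C₂) * (b l + c l) + ε / (n + 1) * d l := by
      intro p C hC0 hCC hper hbound
      have h := hbound (fun x => u (x + period l)) (fun j x => g j (x + period l))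
        (fun o x => F o (x + period l)) (MemLp.translate hu _) (fun j => MemLp.translate (hg j) _)
        (fun o => MemLp.translate (hF o) _) (fun j => (hw j).translate hadd)
        (hs.translate hadd' hper)
      have e : ∫ x in cell m R, (potential k R np2 p x).im * ‖u (x + period l)‖ ^ 2 = b l := by
        refine integral_congr_ae ?_
        filter_upwards [(ae_restrict_iff' measurableSet_cell).2 hper] with x hx
        rw [hx]
      rw [e] at h
      exact h.trans (by gcongr)
    by_cases hl : l = 0
    · refine key hC₁0 (by linarith) (Eventually.of_forall fun x _ => ?_) hC₁
      have : period l = 0 := by rw [hl]; ext i <;> simp [period]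
      rw [this, add_zero]
    · exact key hC₂0 (by linarith) (potential_add_period hR.le hn q hl) hC₂
  refine hasSum_le_of_sum_le (hasSum_cells (R := R) (iu hu)) fun L => ?_
  have h1 : ∑ l ∈ L, b l ≤ ∫ x in slab m R, (P x).im * ‖u x‖ ^ 2 :=
    sum_le_hasSum L (fun l _ => hb0 l) (hasSum_cells iP)
  have h2 : ∑ l ∈ L, c l ≤ ∑ o, ∫ x in slab m R, ‖F o x‖ ^ 2 := by
    rw [hc, Finset.sum_comm]
    refine Finset.sum_le_sum fun o _ => ?_
    exact sum_le_hasSum L (fun l _ => integral_nonneg fun x => by positivity)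
      (hasSum_cells (iu (hF o)))
  have h3 : ∑ l ∈ L, d l ≤ n * ((∫ x, ‖u x‖ ^ 2) + ∑ j, ∫ x, ‖g j x‖ ^ 2) := by
    rw [hd, Finset.sum_add_distrib, Finset.sum_comm, mul_add, Finset.mul_sum]
    exact add_le_add (hov _ (iu hu) (fun x => by positivity) L)
      (Finset.sum_le_sum fun j _ => hov _ (iu (hg j)) (fun x => by positivity) L)
  have h4 : (0 : ℝ) ≤ (∫ x, ‖u x‖ ^ 2) + ∑ j, ∫ x, ‖g j x‖ ^ 2 :=
    add_nonneg (integral_nonneg fun x => by positivity)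
      (Finset.sum_nonneg fun j _ => integral_nonneg fun x => by positivity)
  calc ∑ l ∈ L, c₀ l ≤ ∑ l ∈ L, ((C₁ + C₂) * (b l + c l) + ε / (n + 1) * d l) :=
        Finset.sum_le_sum fun l _ => hcell l
    _ = (C₁ + C₂) * (∑ l ∈ L, b l + ∑ l ∈ L, c l) + ε / (n + 1) * ∑ l ∈ L, d l := by
        rw [Finset.sum_add_distrib, ← Finset.mul_sum, ← Finset.mul_sum, Finset.sum_add_distrib]
    _ ≤ (C₁ + C₂) * ((∫ x in slab m R, (P x).im * ‖u x‖ ^ 2)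
          + ∑ o, ∫ x in slab m R, ‖F o x‖ ^ 2)
        + ε / (n + 1) * (n * ((∫ x, ‖u x‖ ^ 2) + ∑ j, ∫ x, ‖g j x‖ ^ 2)) := by
        gcongr
    _ ≤ _ := by
        refine add_le_add le_rfl ?_
        rw [← mul_assoc]
        refine mul_le_mul_of_nonneg_right ?_ h4
        rw [div_mul_eq_mul_div, div_le_iff₀ (by positivity)]
        nlinarith

end SlabBound

/-! ### Invertibility and differentiation -/

section Inverse

variable {L H G : Type*} [NormedAddCommGroup L] [NormedSpace ℂ L] [NormedAddCommGroup H]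
  [NormedSpace ℂ H] [CompleteSpace H] [NormedAddCommGroup G] [NormedSpace ℂ G]

lemma isOpen_setOf_isUnit_sub (A : H →L[ℂ] H) (B : L →L[ℂ] H →L[ℂ] H) :
    IsOpen {q | IsUnit (A - B q)} :=
  (Units.isOpen (R := H →L[ℂ] H)).preimage (by fun_prop : Continuous fun q => A - B q)

/-- The derivative of `q ↦ γ (A - B(q))⁻¹ J` in direction `h` is
`γ (A - B(q))⁻¹ B(h) (A - B(q))⁻¹ J`. -/
lemma exists_hasFDerivAt_inverse (A : H →L[ℂ] H) (B : L →L[ℂ] H →L[ℂ] H) (J : L →L[ℂ] H)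
    (γ : H →L[ℂ] G) {q : L} (hq : IsUnit (A - B q)) :
    ∃ W : L →L[ℂ] L →L[ℂ] H,
      (∀ h f, (A - B q) (W h f) = B h (Ring.inverse (A - B q) (J f))) ∧
      HasFDerivAt (fun p => γ.comp ((Ring.inverse (A - B p)).comp J))
        ((ContinuousLinearMap.compL ℂ L H G γ).comp W) q := by
  obtain ⟨x, hx⟩ := hq
  let K : (H →L[ℂ] H) →L[ℂ] L →L[ℂ] H := (ContinuousLinearMap.compL ℂ L H H).flip J
  let D : L →L[ℂ] H →L[ℂ] H :=
    (ContinuousLinearMap.mulLeftRight ℂ (H →L[ℂ] H) (↑x⁻¹ : H →L[ℂ] H) (↑x⁻¹ : H →L[ℂ] H)).comp B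
  refine ⟨K.comp D, fun h f => ?_, ?_⟩
  · rw [← hx, Ring.inverse_unit]
    exact congrArg (fun T : H →L[ℂ] H => T (B h ((↑x⁻¹ : H →L[ℂ] H) (J f)))) x.mul_inv
  · have hd : HasFDerivAt (fun p => A - B p) (-B) q := (B.hasFDerivAt (x := q)).const_sub A
    have hr := hasFDerivAt_ringInverse (𝕜 := ℂ) x
    rw [hx] at hr
    have h2 := ((ContinuousLinearMap.compL ℂ L H G γ).comp K).hasFDerivAt.comp q (hr.comp q hd)
    have e : (ContinuousLinearMap.compL ℂ L H G γ).comp (K.comp D)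
        = ((ContinuousLinearMap.compL ℂ L H G γ).comp K).comp
          ((-ContinuousLinearMap.mulLeftRight ℂ (H →L[ℂ] H) (↑x⁻¹ : H →L[ℂ] H)
            (↑x⁻¹ : H →L[ℂ] H)).comp (-B)) := by
      have : (-ContinuousLinearMap.mulLeftRight ℂ (H →L[ℂ] H) (↑x⁻¹ : H →L[ℂ] H)
            (↑x⁻¹ : H →L[ℂ] H)).comp (-B) = D := by
        rw [ContinuousLinearMap.neg_comp, ContinuousLinearMap.comp_neg, neg_neg]
      rw [this]
      rfl
    rw [e]
    exact h2

end Inverse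

section Solvability

variable {m : ℕ} {R₀ R : ℝ}

/-- The functional `v ↦ ∫ f v̄` on `H̃¹` is represented by an element `J f` of `H̃¹`, and `J` is bounded
and linear. -/
lemma exists_source_operator (hR : R₀ ≤ R) :
    ∃ J : L2Cell m R₀ →L[ℂ] HTilde m R, ∀ (f : L2Cell m R₀) (v : HTilde m R),
      inner ℂ v (J f) = ∫ x in cell m R₀, f x * conj (v.1 none x) := by
  have hsub : cell m R₀ ⊆ slab m R := (cell_subset_cell hR).trans cell_subset_slab
  have hr : ((volume : Measure (Pt m)).restrict (slab m R)).restrict (cell m R₀)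
      = volume.restrict (cell m R₀) := Measure.restrict_restrict_of_subset hsub
  have hae : ∀ {p : Pt m → Prop}, (∀ᵐ x ∂(volume : Measure (Pt m)).restrict (cell m R₀), p x) →
      ∀ᵐ x ∂((volume : Measure (Pt m)).restrict (slab m R)).restrict (cell m R₀), p x := by
    intro p hp
    rwa [hr]
  have hmem : ∀ f : L2Cell m R₀, MemLp ((cell m R₀).indicator f) 2 (volume.restrict (slab m R)) := by
    intro f
    rw [memLp_indicator_iff_restrict measurableSet_cell, hr]
    exact Lp.memLp f
  let E : L2Cell m R₀ →L[ℂ] L2Slab m R :=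
    LinearMap.mkContinuous
      { toFun := fun f => (hmem f).toLp _
        map_add' := by
          intro f g
          rw [← MemLp.toLp_add]
          refine MemLp.toLp_congr _ _ ?_
          filter_upwards [(ae_restrict_iff' measurableSet_cell).1 (hae (Lp.coeFn_add f g))] with x hx
          rw [Pi.add_apply]
          by_cases hc : x ∈ cell m R₀
          · rw [indicator_of_mem hc, indicator_of_mem hc, indicator_of_mem hc]
            exact hx hc
          · simp [hc]
        map_smul' := by
          intro c f
          rw [RingHom.id_apply, ← MemLp.toLp_const_smul]
          refine MemLp.toLp_congr _ _ ?_
          filter_upwards [(ae_restrict_iff' measurableSet_cell).1 (hae (Lp.coeFn_smul c f))] with x hx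
          rw [Pi.smul_apply]
          by_cases hc : x ∈ cell m R₀
          · simp [hc, hx hc]
          · simp [hc] }
      1 (by
        intro f
        rw [one_mul, LinearMap.coe_mk, AddHom.coe_mk, Lp.norm_toLp,
          eLpNorm_indicator_eq_eLpNorm_restrict measurableSet_cell, hr, Lp.norm_def])
  let P : HTilde m R →L[ℂ] L2Slab m R :=
    (PiLp.proj 2 (fun _ : Option (Dir m) => L2Slab m R) none).comp (HTilde m R).subtypeL
  refine ⟨(ContinuousLinearMap.adjoint P).comp E, fun f v => ?_⟩
  rw [ContinuousLinearMap.comp_apply, ContinuousLinearMap.adjoint_inner_right, L2.inner_def]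
  have hint : ∀ F : Pt m → ℂ, ∫ x in cell m R₀, F x
      = ∫ x in slab m R, (cell m R₀).indicator F x := fun F => by
    rw [integral_indicator measurableSet_cell, hr]
  rw [hint]
  refine integral_congr_ae ?_
  filter_upwards [MemLp.coeFn_toLp (hmem f)] with x hx
  have e : E f x = (cell m R₀).indicator f x := hx
  rw [e, RCLike.inner_apply]
  change (cell m R₀).indicator f x * conj (v.1 none x) = _
  by_cases hc : x ∈ cell m R₀ <;> simp [hc]

/-- Unique solvability of the variational problem is bijectivity of the operator of the form. -/
lemma isUniquelySolvable_iff {k : ℝ} {np2 : Pt m → ℂ} {q : L2Cell m R₀}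
    {A : HTilde m R →L[ℂ] HTilde m R} (hA : ∀ u v, inner ℂ v (A u) = form k np2 q u v) :
    IsUniquelySolvable k R np2 q ↔ IsUnit A := by
  rw [ContinuousLinearMap.isUnit_iff_bijective]
  have key : ∀ u f : HTilde m R, (∀ v, form k np2 q u v = inner ℂ v f) ↔ A u = f := by
    intro u f
    simp only [← hA]
    exact ⟨fun h => ext_inner_left ℂ h, fun h v => by rw [h]⟩
  constructor
  · intro h
    have h' : ∀ f : HTilde m R, ∃! u, A u = f := by
      intro f
      have := h ((innerSL ℂ (E := HTilde m R)).flip f)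
      simpa only [ContinuousLinearMap.flip_apply, innerSL_apply_apply, key] using this
    exact Function.bijective_iff_existsUnique _ |>.2 h'
  · intro h F
    obtain ⟨f, hf⟩ : ∃ f : HTilde m R, ∀ v, F v = inner ℂ v f := by
      refine ⟨(InnerProductSpace.toDual ℂ (HTilde m R)).symm
        ((starL ℂ : ℂ ≃L⋆[ℂ] ℂ).toContinuousLinearMap.comp F), fun v => ?_⟩
      refine (star_star (F v)).symm.trans ?_
      refine Eq.trans ?_ (inner_conj_symm v _)
      rw [InnerProductSpace.toDual_symm_apply]
      rfl
    simp only [hf, key]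
    exact Function.bijective_iff_existsUnique _ |>.1 h f

/-- If the operator `A` of the form is invertible, the chosen solution operator is `A⁻¹ J`. -/
lemma solutionOperator_eq {k : ℝ} {np2 : Pt m → ℂ} {q : L2Cell m R₀}
    {A : HTilde m R →L[ℂ] HTilde m R} (hA : ∀ u v, inner ℂ v (A u) = form k np2 q u v)
    (hu : IsUnit A) {J : L2Cell m R₀ →L[ℂ] HTilde m R}
    (hJ : ∀ (f : L2Cell m R₀) (v : HTilde m R),
      inner ℂ v (J f) = ∫ x in cell m R₀, f x * conj (v.1 none x)) :
    IsSolutionOperator k np2 q (solutionOperator k R np2 q) ∧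
      solutionOperator k R np2 q = (Ring.inverse A).comp J := by
  have hex : IsSolutionOperator k np2 q ((Ring.inverse A).comp J) := by
    intro f v
    have e : A (Ring.inverse A (J f)) = J f := by
      have := Ring.mul_inverse_cancel A hu
      exact congrArg (fun T : HTilde m R →L[ℂ] HTilde m R => T (J f)) this
    rw [← hA, ContinuousLinearMap.comp_apply, e, hJ]
  have h : ∃ Λ : L2Cell m R₀ →L[ℂ] HTilde m R, IsSolutionOperator k np2 q Λ := ⟨_, hex⟩
  have h2 : IsSolutionOperator k np2 q (solutionOperator k R np2 q) := by
    rw [solutionOperator, dif_pos h]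
    exact h.choose_spec
  refine ⟨h2, ?_⟩
  ext1 f
  have hinj : Function.Injective A := ((ContinuousLinearMap.isUnit_iff_bijective).1 hu).1
  refine hinj (ext_inner_left ℂ fun v => ?_)
  rw [hA, hA, h2, hex]

lemma IsAdmissibleRadius.isUniquelySolvable {k : ℝ} {np2 : Pt m → ℂ} {δ : L2Cell m R₀ → ℝ}
    (hδ : IsAdmissibleRadius k R np2 δ) {q : L2Cell m R₀} (hq : q ∈ parameterSet δ) :
    IsUniquelySolvable k R np2 q := by
  obtain ⟨q₀, h0, h1⟩ := mem_iUnion₂.1 hq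
  exact (hδ q₀ h0).2 q h1

lemma isOpen_parameterSet (δ : L2Cell m R₀ → ℝ) : IsOpen (parameterSet δ) :=
  isOpen_biUnion fun _ _ => Metric.isOpen_ball

/-- Since invertible operators form an open set, unique solvability for bounded perturbations
extends to small `L²` balls around them. -/
lemma exists_isAdmissibleRadius (hm : m = 1 ∨ m = 2) (hR₀ : 0 < R₀) (hR : R₀ < R) {k : ℝ}
    (hk : 0 < k) {np2 : Pt m → ℂ} (hn : IsLayerIndex R₀ np2)
    (hs : ∀ q₀ ∈ boundedPerturbations m R₀, IsUniquelySolvable k R np2 q₀) :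
    ∃ δ : L2Cell m R₀ → ℝ, IsAdmissibleRadius k R np2 δ := by
  obtain ⟨A, B, hA, -⟩ := exists_form_operator hm hR₀ hR hk hn
  have hopen : IsOpen {q : L2Cell m R₀ | IsUniquelySolvable k R np2 q} := by
    have : {q : L2Cell m R₀ | IsUniquelySolvable k R np2 q}
        = {q | IsUnit (A - ((k : ℂ) ^ 2 • B) q)} := by
      ext q
      exact isUniquelySolvable_iff (hA q)
    rw [this]
    exact isOpen_setOf_isUnit_sub A ((k : ℂ) ^ 2 • B)
  have h : ∀ q₀ : L2Cell m R₀, ∃ δ : ℝ, q₀ ∈ boundedPerturbations m R₀ → 0 < δ ∧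
      ∀ q ∈ Metric.ball q₀ δ, IsUniquelySolvable k R np2 q := by
    intro q₀
    by_cases h0 : q₀ ∈ boundedPerturbations m R₀
    · obtain ⟨δ, h1, h2⟩ := Metric.isOpen_iff.1 hopen q₀ (hs q₀ h0)
      exact ⟨δ, fun _ => ⟨h1, fun q hq => h2 hq⟩⟩
    · exact ⟨0, fun h => (h0 h).elim⟩
  choose δ hδ using h
  exact ⟨δ, hδ⟩

/-- The measurement operator is `q ↦ γ (A₀ - k² B(q))⁻¹ J`; its derivative in direction `h` is
`γ W_h` with `W_h = (A₀ - k² B(q))⁻¹ k² B(h) (A₀ - k² B(q))⁻¹ J`. -/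
lemma hasFDerivAt_measurement (hm : m = 1 ∨ m = 2) (hR₀ : 0 < R₀) (hR : R₀ < R) {k : ℝ}
    (hk : 0 < k) {np2 : Pt m → ℂ} (hn : IsLayerIndex R₀ np2) {q : L2Cell m R₀}
    {O : Set (L2Cell m R₀)} (hO : IsOpen O) (hq : q ∈ O)
    (hs : ∀ p ∈ O, IsUniquelySolvable k R np2 p) :
    IsSolutionOperator k np2 q (solutionOperator k R np2 q) ∧
    ∃ W : L2Cell m R₀ →L[ℂ] L2Cell m R₀ →L[ℂ] HTilde m R, IsLinearizedOperator k np2 q W ∧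
      HasFDerivAt (fun p => measurement k R np2 p)
        ((ContinuousLinearMap.compL ℂ (L2Cell m R₀) (HTilde m R) (L2Cube m)
          (traceCell m R)).comp W) q := by
  obtain ⟨A, B, hA, hB⟩ := exists_form_operator hm hR₀ hR hk hn
  obtain ⟨J, hJ⟩ := exists_source_operator (m := m) hR.le
  have hunit : ∀ p ∈ O, IsUnit (A - (k : ℂ) ^ 2 • B p) := fun p hp =>
    (isUniquelySolvable_iff (hA p)).1 (hs p hp)
  obtain ⟨W, hW, hd⟩ := exists_hasFDerivAt_inverse A ((k : ℂ) ^ 2 • B) J (traceCell m R) (hunit q hq)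
  have hsol : ∀ p ∈ O, IsSolutionOperator k np2 p (solutionOperator k R np2 p) ∧
      solutionOperator k R np2 p = (Ring.inverse (A - (k : ℂ) ^ 2 • B p)).comp J := fun p hp =>
    solutionOperator_eq (hA p) (hunit p hp) hJ
  refine ⟨(hsol q hq).1, W, fun h f v => ?_, hd.congr_of_eventuallyEq ?_⟩
  · have e1 : (A - (k : ℂ) ^ 2 • B q) (W h f)
        = ((k : ℂ) ^ 2 • B h) (solutionOperator k R np2 q f) := by
      rw [(hsol q hq).2]
      exact hW h f
    rw [← hA, e1, _root_.smul_apply, inner_smul_right, hB, ← integral_const_mul]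
    refine integral_congr_ae (Eventually.of_forall fun y => ?_)
    ring_nf
  · filter_upwards [hO.mem_nhds hq] with p hp
    exact congrArg (fun T : L2Cell m R₀ →L[ℂ] HTilde m R => (traceCell m R).comp T) (hsol p hp).2

end Solvability

/-! ### Solvability for bounded perturbations -/

section Solvability

variable {m : ℕ} {R₀ R k : ℝ} {np2 : Pt m → ℂ}

/-- The form in terms of the whole zeroth order coefficient `k² (n² + q)`. -/
lemma form_eq_potential (hm : m = 1 ∨ m = 2) (hR₀ : 0 < R₀) (hR : R₀ < R)
    (hn : IsLayerIndex R₀ np2) (q : L2Cell m R₀) (u v : HTilde m R) :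
    form k np2 q u v = gradForm u v - weightForm (potential k R np2 q) u v
      - dtnPairing k (traceTop m R u.1) (traceTop m R v.1) := by
  obtain ⟨M, hM0, hM⟩ := hn.exists_bound
  rw [form_eq hm hR₀ hR hn]
  have i2 : Integrable (fun x => np2 x * u.1 none x * conj (v.1 none x))
      (volume.restrict (slab m R)) :=
    integrableOn_weight_of_bdd (hn.bounded.1.mono_measure restrict_slab_le_halfSpace)
      (ae_mono restrict_slab_le_halfSpace hM) _ _
  have i3 : Integrable (fun x => (cell m R₀).indicator q x * u.1 none x * conj (v.1 none x))
      (volume.restrict (slab m R)) :=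
    integrableOn_indicator_weight hm hR.le (hR₀.trans hR) q u v
  have e : weightForm (potential k R np2 q) u v = (k : ℂ) ^ 2 * weightForm np2 u v
      + (k : ℂ) ^ 2 * weightForm ((cell m R₀).indicator q) u v := by
    rw [← mul_add, weightForm, weightForm, weightForm, ← integral_add i2 i3, ← integral_const_mul]
    refine setIntegral_congr_fun measurableSet_slab fun x hx => ?_
    simp only [potential, indicator_of_mem hx, perturbedIndex]
    ring
  rw [e]; ring

/-- The boundary term has a sign: outgoing waves carry energy out of the layer. -/
lemma dtn_self (hR : 0 < R) (hk : 0 < k) (u : HTilde m R) :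
    (dtnPairing k (traceTop m R u.1) (traceTop m R u.1)).re ≤ 0 ∧
      0 ≤ (dtnPairing k (traceTop m R u.1) (traceTop m R u.1)).im := by
  have hi := (integrable_dtn hR hk u u).1
  have key : ∀ (t : ℝ) (z : ℂ), (Complex.I * branchSqrt t * z * conj z).re ≤ 0 ∧
      0 ≤ (Complex.I * branchSqrt t * z * conj z).im := by
    intro t z
    rw [mul_assoc, Complex.mul_conj, branchSqrt]
    have h0 := Complex.normSq_nonneg z
    split_ifs
    · have h1 := mul_nonneg (Real.sqrt_nonneg t) h0
      simp [h1]
    · have h1 := mul_nonneg (Real.sqrt_nonneg (-t)) h0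
      simp only [← mul_assoc, Complex.I_mul_I]
      simp [h1]
  constructor
  · have h := integral_re hi
    refine le_trans (le_of_eq h.symm) (integral_nonpos fun η => (key _ _).1)
  · have h := integral_im hi
    refine le_trans (integral_nonneg fun η => (key _ _).2) (le_of_eq h)

lemma gradForm_self (u : HTilde m R) : gradForm u u = ((∑ j, ‖u.1 (some j)‖ ^ 2 : ℝ) : ℂ) := by
  rw [gradForm, Complex.ofReal_sum]
  refine Finset.sum_congr rfl fun j _ => ?_
  rw [inner_self_eq_norm_sq_to_K]
  push_cast; rfl

lemma HTilde.norm_sq_eq (u : HTilde m R) :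
    ‖u‖ ^ 2 = ‖u.1 none‖ ^ 2 + ∑ j, ‖u.1 (some j)‖ ^ 2 := by
  refine (PiLp.norm_sq_eq_of_L2 _ u.1).trans ?_
  rw [Fintype.sum_option]

lemma integral_zext_sq (f : L2Slab m R) : ∫ x, ‖zext f x‖ ^ 2 = ‖f‖ ^ 2 := by
  rw [← norm_sq_toLp_eq (memLp_zext f), Lp.norm_toLp, eLpNorm_zext_two,
    ENNReal.toReal_ofReal (norm_nonneg _)]

lemma setIntegral_zext_sq (f : L2Slab m R) : ∫ x in slab m R, ‖zext f x‖ ^ 2 = ‖f‖ ^ 2 := by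
  rw [← integral_zext_sq]
  exact setIntegral_eq_integral_of_forall_compl_eq_zero fun x hx => by
    rw [zext_eq_zero f hx]; simp

/-- The energy estimates, from the real and the imaginary part of the form. -/
lemma energy_estimates (hm : m = 1 ∨ m = 2) (hR₀ : 0 < R₀) (hR : R₀ < R) (hk : 0 < k)
    (hn : IsLayerIndex R₀ np2) (q : L2Cell m R₀) {M : ℝ}
    (hM : ∀ᵐ x, ‖potential k R np2 q x‖ ≤ M) (u : HTilde m R) :
    ‖u‖ ^ 2 ≤ (1 + M) * ‖u.1 none‖ ^ 2 + (form k np2 q u u).re ∧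
      ∫ x in slab m R, (potential k R np2 q x).im * ‖zext (u.1 none) x‖ ^ 2
        ≤ -(form k np2 q u u).im := by
  obtain ⟨d1, d2⟩ := dtn_self (hR₀.trans hR) hk u
  set P := potential k R np2 q with hP
  have hPm : AEStronglyMeasurable P volume := aestronglyMeasurable_potential hn q
  have hi : Integrable (fun x => P x * u.1 none x * conj (u.1 none x))
      (volume.restrict (slab m R)) :=
    integrableOn_weight_of_bdd hPm.restrict (ae_restrict_of_ae hM) _ _
  have hre := integral_re hi
  have him := integral_im hi
  have e : ∀ x, P x * u.1 none x * conj (u.1 none x) = P x * ((‖u.1 none x‖ ^ 2 : ℝ) : ℂ) :=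
    fun x => by rw [mul_assoc, Complex.mul_conj, Complex.normSq_eq_norm_sq]
  have hf := form_eq_potential (k := k) hm hR₀ hR hn q u u
  rw [gradForm_self] at hf
  constructor
  · have h1 := congrArg Complex.re hf
    rw [Complex.sub_re, Complex.sub_re, Complex.ofReal_re] at h1
    have h2 : (weightForm P u u).re ≤ M * ‖u.1 none‖ ^ 2 := by
      have e3 : (weightForm P u u).re
          = ∫ x in slab m R, (P x * u.1 none x * conj (u.1 none x)).re := hre.symm
      rw [e3, ← setIntegral_zext_sq, ← integral_const_mul]
      refine integral_mono_ae hi.re (((memLp_zext _).integrable_norm_pow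
        (by norm_num)).restrict.const_mul _) ?_
      filter_upwards [ae_restrict_of_ae hM, ae_restrict_mem measurableSet_slab] with x hx hxs
      change (P x * u.1 none x * conj (u.1 none x)).re ≤ _
      rw [e, Complex.re_mul_ofReal, zext, indicator_of_mem hxs]
      exact mul_le_mul_of_nonneg_right ((Complex.re_le_norm _).trans hx) (by positivity)
    rw [HTilde.norm_sq_eq]
    linarith
  · have h1 := congrArg Complex.im hf
    rw [Complex.sub_im, Complex.sub_im, Complex.ofReal_im] at h1
    have e3 : (weightForm P u u).im
        = ∫ x in slab m R, (P x).im * ‖zext (u.1 none) x‖ ^ 2 := by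
      refine him.symm.trans ?_
      refine setIntegral_congr_fun measurableSet_slab fun x hx => ?_
      change (P x * u.1 none x * conj (u.1 none x)).im = _
      rw [e, Complex.im_mul_ofReal, zext, indicator_of_mem hx]
    rw [← e3]
    linarith

/-- Test functions in the layer are elements of `H̃¹` with vanishing traces. -/
lemma exists_test_jet (hR : 0 < R) {φ : Pt m → ℂ} (hφ : ContDiff ℝ ∞ φ) (hφc : HasCompactSupport φ)
    (hφs : tsupport φ ⊆ slab m R) :
    ∃ v : HTilde m R, (v.1 none : Pt m → ℂ) =ᵐ[volume.restrict (slab m R)] φ ∧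
      (∀ j, (v.1 (some j) : Pt m → ℂ) =ᵐ[volume.restrict (slab m R)] pd j φ) ∧
      traceTop m R v.1 = 0 := by
  have h0 : MemLp φ 2 (volume.restrict (slab m R)) := memLp_test R hφ.continuous hφc
  have hj : ∀ j, MemLp (pd j φ) 2 (volume.restrict (slab m R)) := fun j =>
    memLp_test_deriv R hφ hφc _
  let U : Jet m R := WithLp.toLp 2 fun o => match o with
    | none => h0.toLp _
    | some j => (hj j).toLp _
  have e0 : (U none : Pt m → ℂ) =ᵐ[volume.restrict (slab m R)] φ := h0.coeFn_toLp
  have ej : ∀ j, (U (some j) : Pt m → ℂ) =ᵐ[volume.restrict (slab m R)] pd j φ := fun j =>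
    (hj j).coeFn_toLp
  have hout : ∀ x, x ∉ slab m R → φ x = 0 := fun x hx =>
    image_eq_zero_of_notMem_tsupport fun h => hx (hφs h)
  have hU : U ∈ H1 m R := by
    intro j ψ h1 h2 h3
    have c1 : ∫ x in slab m R, U none x * fderiv ℝ ψ x (dirVec m j)
        = ∫ x, φ x * fderiv ℝ ψ x (dirVec m j) := by
      refine Eq.trans ?_ (setIntegral_eq_integral_of_forall_compl_eq_zero (s := slab m R)
        fun x hx => by rw [hout x hx, zero_mul])
      refine integral_congr_ae ?_
      filter_upwards [e0] with x hx
      rw [hx]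
    have c2 : ∫ x in slab m R, U (some j) x * ψ x = ∫ x, fderiv ℝ φ x (dirVec m j) * ψ x := by
      refine Eq.trans ?_ (setIntegral_eq_integral_of_forall_compl_eq_zero (s := slab m R)
        fun x hx => by
          change pd j φ x * ψ x = 0
          rw [pd_eq_zero_of_notMem hφs hx, zero_mul])
      refine integral_congr_ae ?_
      filter_upwards [ej j] with x hx
      rw [hx]; rfl
    rw [c1, c2]
    have hd1 : Continuous fun x => fderiv ℝ φ x (dirVec m j) :=
      (hφ.continuous_fderiv (by simp)).clm_apply continuous_const
    have hd2 : Continuous fun x => fderiv ℝ ψ x (dirVec m j) :=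
      (h1.continuous_fderiv (by simp)).clm_apply continuous_const
    exact integral_mul_fderiv_eq_neg_fderiv_mul_of_integrable
      ((hd1.mul h1.continuous).integrable_of_hasCompactSupport h2.mul_left)
      ((hφ.continuous.mul hd2).integrable_of_hasCompactSupport hφc.mul_right)
      ((hφ.continuous.mul h1.continuous).integrable_of_hasCompactSupport hφc.mul_right)
      (fun x _ => hφ.differentiable (by simp) x) (fun x _ => h1.differentiable (by simp) x)
  have htop : traceTop m R U = 0 := by
    refine Lp.ext ?_
    filter_upwards [traceTop_smooth hR hφ hφc U e0 (ej (Sum.inr ())),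
      Lp.coeFn_zero ℂ 2 (volume : Measure (Hor m))] with y hy hy0
    rw [hy, hy0, hout _ fun h => lt_irrefl R h.2.2]; rfl
  have hbot : traceBot m R U = 0 := by
    refine Lp.ext ?_
    filter_upwards [traceBot_smooth hR hφ hφc U e0 (ej (Sum.inr ())),
      Lp.coeFn_zero ℂ 2 (volume : Measure (Hor m))] with y hy hy0
    rw [hy, hy0, hout _ fun h => lt_irrefl (0 : ℝ) h.2.1]; rfl
  exact ⟨⟨U, hU, hbot⟩, e0, ej, htop⟩

lemma contDiff_conj_test {φ : Pt m → ℂ} (hφ : ContDiff ℝ ∞ φ) (hφc : HasCompactSupport φ) :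
    ContDiff ℝ ∞ (fun x => conj (φ x)) ∧ HasCompactSupport (fun x => conj (φ x)) ∧
      tsupport (fun x => conj (φ x)) = tsupport φ ∧
      ∀ x v, fderiv ℝ (fun x => conj (φ x)) x v = conj (fderiv ℝ φ x v) := by
  refine ⟨Complex.conjCLE.contDiff.comp hφ, hφc.comp_left (g := conj) (map_zero _), ?_,
    fun x v => ?_⟩
  · rw [tsupport, tsupport]
    congr 1
    ext x
    simp
  · have := (Complex.conjCLE.toContinuousLinearMap.hasFDerivAt.comp x
      (hφ.differentiable (by simp) x).hasFDerivAt).fderiv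
    have e : fderiv ℝ (fun x => conj (φ x)) x
        = Complex.conjCLE.toContinuousLinearMap.comp (fderiv ℝ φ x) := this
    rw [e]; rfl

lemma dtnPairing_zero_left (φ : L2Hor m) : dtnPairing k 0 φ = 0 := by
  rw [dtnPairing]
  refine integral_eq_zero_of_ae ?_
  have e : (𝓕 (0 : L2Hor m) : L2Hor m) = 0 := FourierTransform.fourier_zero ..
  rw [e]
  filter_upwards [Lp.coeFn_zero ℂ 2 (volume : Measure (Hor m))] with y hy
  rw [hy]; simp

lemma dtnPairing_zero_right (φ : L2Hor m) : dtnPairing k φ 0 = 0 := by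
  rw [dtnPairing]
  refine integral_eq_zero_of_ae ?_
  have e : (𝓕 (0 : L2Hor m) : L2Hor m) = 0 := FourierTransform.fourier_zero ..
  rw [e]
  filter_upwards [Lp.coeFn_zero ℂ 2 (volume : Measure (Hor m))] with y hy
  rw [hy]; simp

/-- The weak equation in the layer which a variational solution satisfies. -/
lemma solvesSourceOn_of_form (hm : m = 1 ∨ m = 2) (hR₀ : 0 < R₀) (hR : R₀ < R)
    (hn : IsLayerIndex R₀ np2) (q : L2Cell m R₀) {u f : HTilde m R}
    (hf : ∀ v, form k np2 q u v = inner ℂ v f) :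
    SolvesSourceOn (slab m R) (zext (u.1 none)) (fun j => zext (u.1 (some j)))
      (potential k R np2 q) (fun o => zext (f.1 o)) := by
  intro φ h1 h2 h3
  obtain ⟨k1, k2, k3, k4⟩ := contDiff_conj_test h1 h2
  obtain ⟨v, hv0, hvj, hvt⟩ := exists_test_jet (hR₀.trans hR) k1 k2 (k3.trans_subset h3)
  have hpd : ∀ j x, pd j (fun x => conj (φ x)) x = conj (pd j φ x) := fun j x => k4 x _
  have h := hf v
  rw [form_eq_potential hm hR₀ hR hn, hvt, dtnPairing_zero_right, sub_zero] at h
  have hin : ∀ (a : L2Slab m R) (b : L2Slab m R) (ψ : Pt m → ℂ),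
      (b : Pt m → ℂ) =ᵐ[volume.restrict (slab m R)] (fun x => conj (ψ x)) →
      inner ℂ b a = ∫ x, zext a x * ψ x := by
    intro a b ψ hb
    rw [L2.inner_def, integral_zext_mul]
    refine integral_congr_ae ?_
    filter_upwards [hb] with x hx
    rw [hx, RCLike.inner_apply, Complex.conj_conj]
  have hvj' : ∀ j, (v.1 (some j) : Pt m → ℂ) =ᵐ[volume.restrict (slab m R)]
      fun x => conj (pd j φ x) := fun j => (hvj j).trans (Eventually.of_forall fun x => hpd j x)
  have e1 : inner ℂ v f = (∫ x, zext (f.1 none) x * φ x)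
      + ∑ j, ∫ x, zext (f.1 (some j)) x * pd j φ x := by
    rw [Submodule.coe_inner, PiLp.inner_apply, Fintype.sum_option, hin _ _ _ hv0]
    congr 1
    exact Finset.sum_congr rfl fun j _ => hin _ _ _ (hvj' j)
  have e2 : gradForm u v = ∑ j, ∫ x, zext (u.1 (some j)) x * pd j φ x :=
    Finset.sum_congr rfl fun j _ => hin _ _ _ (hvj' j)
  have e3 : weightForm (potential k R np2 q) u v
      = ∫ x, potential k R np2 q x * zext (u.1 none) x * φ x := by
    rw [weightForm, ← integral_indicator measurableSet_slab]
    refine integral_congr_ae ?_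
    filter_upwards [(ae_restrict_iff' measurableSet_slab).1 hv0] with x hx
    by_cases hxs : x ∈ slab m R
    · rw [indicator_of_mem hxs, hx hxs, zext, indicator_of_mem hxs, Complex.conj_conj]
    · rw [indicator_of_notMem hxs, zext_eq_zero _ hxs]; ring
  rw [e1, e2, e3] at h
  exact h

/-- The absorption argument behind the a priori bound: `X` stands for the norm of the solution, `Y` for
that of the source and `N` for the square of the `L²` norm of the solution. The factor `1 / (2 (1 + M))`
lets half of `X ^ 2` be absorbed. -/
lemma le_of_energy_estimates {X Y N M C : ℝ} (hX : 0 ≤ X) (hY : 0 ≤ Y) (hM : 0 ≤ M) (hC : 0 ≤ C)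
    (h1 : X ^ 2 ≤ (1 + M) * N + X * Y)
    (h2 : N ≤ C * (X * Y + Y ^ 2) + 1 / (2 * (1 + M)) * X ^ 2) :
    X ≤ 4 * (1 + (1 + M) * C) * Y := by
  obtain ⟨D, hD⟩ : ∃ D : ℝ, D = 1 + (1 + M) * C := ⟨_, rfl⟩
  have hD1 : 1 ≤ D := by
    have : 0 ≤ (1 + M) * C := by positivity
    linarith
  rw [← hD]
  have h3 := mul_le_mul_of_nonneg_left h2 (by positivity : 0 ≤ 1 + M)
  have e : (1 + M) * (1 / (2 * (1 + M)) * X ^ 2) = X ^ 2 / 2 := by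
    have : (1 + M) ≠ 0 := by positivity
    field_simp
  rw [mul_add, e] at h3
  have h8 : X ^ 2 / 2 ≤ D * (X * Y) + D * Y ^ 2 := by
    have : 0 ≤ Y ^ 2 := by positivity
    have e2 : D * (X * Y) + D * Y ^ 2
        = X * Y + Y ^ 2 + (1 + M) * (C * (X * Y + Y ^ 2)) := by rw [hD]; ring
    linarith
  by_contra hcon
  rw [not_le] at hcon
  have h9 : D * (X * Y) ≤ X ^ 2 / 4 := by
    have := mul_le_mul_of_nonneg_left hcon.le hX
    have e2 : X * (4 * D * Y) = 4 * (D * (X * Y)) := by ring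
    rw [e2, ← pow_two] at this
    linarith
  have h10 : D * Y ^ 2 ≤ X ^ 2 / 16 := by
    have a1 : D * Y ^ 2 ≤ D * (D * Y ^ 2) :=
      le_mul_of_one_le_left (by positivity) hD1
    have a2 : (4 * D * Y) ^ 2 ≤ X ^ 2 := pow_le_pow_left₀ (by positivity) hcon.le 2
    have e2 : (4 * D * Y) ^ 2 = 16 * (D * (D * Y ^ 2)) := by ring
    linarith
  have hX0 : 0 < X := lt_of_le_of_lt (by positivity) hcon
  have : 0 < X ^ 2 := by positivity
  linarith

/-- The a priori bound: the energy estimates reduce it to the `L²` norm, which the absorption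
controls. -/
lemma exists_norm_le (hm : m = 1 ∨ m = 2) (hR₀ : 0 < R₀) (hR : R₀ < R) (hk : 0 < k)
    (hn : IsLayerIndex R₀ np2) {q : L2Cell m R₀} (hq : q ∈ boundedPerturbations m R₀) :
    ∃ K : ℝ, 0 ≤ K ∧ ∀ u f : HTilde m R, (∀ v, form k np2 q u v = inner ℂ v f) →
      ‖u‖ ≤ K * ‖f‖ := by
  obtain ⟨M, hM0, hM⟩ := exists_bound_potential (k := k) (R := R) hn hq
  obtain ⟨C, hC0, hC⟩ := exists_slab_bound hk hR₀ hR hn hq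
    (ε := 1 / (2 * (1 + M))) (by positivity)
  refine ⟨4 * (1 + (1 + M) * C), by positivity, fun u f hf => ?_⟩
  obtain ⟨h1, h2⟩ := energy_estimates hm hR₀ hR hk hn q hM u
  have h3 := hC (zext (u.1 none)) (fun j => zext (u.1 (some j))) (fun o => zext (f.1 o))
    (memLp_zext _) (fun j => memLp_zext _) (fun o => memLp_zext _)
    (fun j => isWeakDeriv_iff.1 (HTilde.mem_H1 u j)) (solvesSourceOn_of_form hm hR₀ hR hn q hf)
  have hff : ∑ o, ‖f.1 o‖ ^ 2 = ‖f‖ ^ 2 := by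
    rw [HTilde.norm_sq_eq, Fintype.sum_option]
  simp only [integral_zext_sq, setIntegral_zext_sq, ← HTilde.norm_sq_eq, hff] at h3
  have hb : ‖form k np2 q u u‖ ≤ ‖u‖ * ‖f‖ := by
    rw [hf]; exact norm_inner_le_norm (𝕜 := ℂ) u f
  have h4 := (Complex.re_le_norm _).trans hb
  have h5 : -(form k np2 q u u).im ≤ ‖u‖ * ‖f‖ :=
    (neg_le_abs _).trans ((Complex.abs_im_le_norm _).trans hb)
  have h6 : ‖u.1 none‖ ^ 2 ≤ C * (‖u‖ * ‖f‖ + ‖f‖ ^ 2) + 1 / (2 * (1 + M)) * ‖u‖ ^ 2 := by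
    refine h3.trans ?_
    gcongr
    exact h2.trans h5
  exact le_of_energy_estimates (norm_nonneg u) (norm_nonneg f) hM0 hC0
    (h1.trans (add_le_add le_rfl h4)) h6

/-- The adjoint problem has only the trivial solution, by absorption and unique continuation. -/
lemma eq_zero_of_form_eq_zero (hm : m = 1 ∨ m = 2) (hR₀ : 0 < R₀) (hR : R₀ < R) (hk : 0 < k)
    (hn : IsLayerIndex R₀ np2) {q : L2Cell m R₀} (hq : q ∈ boundedPerturbations m R₀)
    {v : HTilde m R} (hv : ∀ u, form k np2 q u v = 0) : v = 0 := by
  obtain ⟨M, hM0, hM⟩ := exists_bound_potential (k := k) (R := R) hn hq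
  obtain ⟨h1, h2⟩ := energy_estimates hm hR₀ hR hk hn q hM v
  rw [hv] at h1 h2
  obtain ⟨V, hV, hVn, hVc, hVp⟩ := exists_absorbing_subset_cell hk hR hn
  have hVp := hVp q hq
  have hP0 := potential_im_nonneg (k := k) (R := R) hn hq
  have hPm : AEStronglyMeasurable (potential k R np2 q) volume := aestronglyMeasurable_potential hn q
  set P := potential k R np2 q with hP
  have hVs : V ⊆ slab m R := hVc.trans cell_subset_slab
  have hint : Integrable (fun x => (P x).im * ‖zext (v.1 none) x‖ ^ 2)
      (volume.restrict (slab m R)) :=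
    (((memLp_zext (v.1 none)).integrable_norm_pow (by norm_num)).bdd_mul (c := M)
      (Complex.continuous_im.comp_aestronglyMeasurable hPm)
      (hM.mono fun x hx => (Complex.abs_im_le_norm _).trans hx)).restrict
  have hnn : 0 ≤ᵐ[volume.restrict (slab m R)] fun x => (P x).im * ‖zext (v.1 none) x‖ ^ 2 :=
    ae_restrict_of_ae (hP0.mono fun x hx => by
      have : 0 ≤ (P x).im := hx
      change 0 ≤ (P x).im * ‖zext (v.1 none) x‖ ^ 2
      positivity)
  have hz : ∫ x in slab m R, (P x).im * ‖zext (v.1 none) x‖ ^ 2 = 0 :=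
    le_antisymm (by simpa using h2) (integral_nonneg_of_ae hnn)
  rw [integral_eq_zero_iff_of_nonneg_ae hnn hint] at hz
  -- the imaginary part shows that there is no absorption, so that `v` vanishes on the absorbing set
  have hv0 : ∀ᵐ x, x ∈ V → conj (zext (v.1 none) x) = 0 := by
    filter_upwards [(ae_restrict_iff' measurableSet_slab).1 hz, hVp] with x hx hp hxV
    have := hx (hVs hxV)
    have hp' := (hp hxV).ne'
    simpa [hp'] using this
  have hstar : ∀ f : L2Slab m R, MemLp (fun x => conj (zext f x)) 2 volume := fun f =>
    (memLp_zext f).star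
  have hwd : ∀ j, HasWeakDerivOn volume (slab m R) (dirVec m j) (fun x => conj (zext (v.1 none) x))
      (fun x => conj (zext (v.1 (some j)) x)) := by
    intro j φ k1 k2 k3
    obtain ⟨l1, l2, l3, l4⟩ := contDiff_conj_test k1 k2
    have h := isWeakDeriv_iff.1 (HTilde.mem_H1 v j) _ l1 l2 (l3.trans_subset k3)
    have h' := congrArg conj h
    rw [map_neg, ← integral_conj, ← integral_conj] at h'
    simpa only [l4, map_mul, Complex.conj_conj] using h'
  -- the conjugate of `v` solves the homogeneous equation
  have hsol : SolvesOn (slab m R) (fun x => conj (zext (v.1 none) x))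
      (fun j x => conj (zext (v.1 (some j)) x)) P := by
    intro φ k1 k2 k3
    obtain ⟨w, hw0, hwj, hwt⟩ := exists_test_jet (hR₀.trans hR) k1 k2 k3
    have h := hv w
    rw [form_eq_potential hm hR₀ hR hn, hwt, dtnPairing_zero_left, sub_zero, sub_eq_zero] at h
    have hi : ∀ j ∈ Finset.univ, Integrable fun x => conj (zext (v.1 (some j)) x) * pd j φ x :=
      fun j _ => by
        have hp : MemLp (pd j φ) 2 volume :=
          (contDiff_pd k1 j).continuous.memLp_of_hasCompactSupport (hasCompactSupport_pd k2 j)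
        exact (hstar _).integrable_mul hp
    rw [integral_finsetSum _ hi]
    have e1 : gradForm w v = ∑ j, ∫ x, conj (zext (v.1 (some j)) x) * pd j φ x := by
      refine Finset.sum_congr rfl fun j _ => ?_
      rw [L2.inner_def, ← integral_indicator measurableSet_slab]
      refine integral_congr_ae ?_
      filter_upwards [(ae_restrict_iff' measurableSet_slab).1 (hwj j)] with x hx
      by_cases hxs : x ∈ slab m R
      · rw [indicator_of_mem hxs, hx hxs, zext, indicator_of_mem hxs, RCLike.inner_apply, mul_comm]
      · rw [indicator_of_notMem hxs, zext_eq_zero _ hxs]; simp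
    have e2 : weightForm P w v = ∫ x, P x * conj (zext (v.1 none) x) * φ x := by
      rw [weightForm, ← integral_indicator measurableSet_slab]
      refine integral_congr_ae ?_
      filter_upwards [(ae_restrict_iff' measurableSet_slab).1 hw0] with x hx
      by_cases hxs : x ∈ slab m R
      · rw [indicator_of_mem hxs, hx hxs, zext, indicator_of_mem hxs]; ring
      · rw [indicator_of_notMem hxs, zext_eq_zero _ hxs]; simp
    rw [← e1, ← e2]
    exact h
  have hall := eq_zero_of_eq_zero_on_open isOpen_slab
    (convex_univ.prod (convex_Ioo _ _)).isPreconnected hV hVn hVs hsol hwd (hstar _)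
    (fun j => hstar _) hPm hM hv0
  have hnorm : ‖v.1 none‖ ^ 2 = 0 := by
    rw [← setIntegral_zext_sq]
    refine integral_eq_zero_of_ae ?_
    filter_upwards [(ae_restrict_iff' measurableSet_slab).2 hall] with x hx
    have : zext (v.1 none) x = 0 := by simpa using hx
    rw [this]; simp
  rw [hnorm] at h1
  have : ‖v‖ ^ 2 = 0 := le_antisymm (by simpa using h1) (by positivity)
  simpa using this

/-- An operator on a Hilbert space that is bounded below and has dense range is invertible. -/
lemma isUnit_of_bound_of_dense {H : Type*} [NormedAddCommGroup H] [InnerProductSpace ℂ H]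
    [CompleteSpace H] {A : H →L[ℂ] H} {K : ℝ} (hK : 0 ≤ K) (hA : ∀ u, ‖u‖ ≤ K * ‖A u‖)
    (hd : ∀ v, (∀ u, inner ℂ v (A u) = 0) → v = 0) : IsUnit A := by
  rw [ContinuousLinearMap.isUnit_iff_bijective]
  have hanti : AntilipschitzWith ⟨K, hK⟩ A := A.antilipschitz_of_bound hA
  refine ⟨hanti.injective, ?_⟩
  have hcl : IsClosed (A.range : Set H) := hanti.isClosed_range A.uniformContinuous
  have := hcl.completeSpace_coe
  have hbot : A.rangeᗮ = ⊥ := by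
    rw [Submodule.eq_bot_iff]
    intro v hv
    exact hd v fun u => (Submodule.mem_orthogonal' _ _).1 hv _ ⟨u, rfl⟩
  have htop : A.range = ⊤ := (Submodule.orthogonal_eq_bot_iff).1 hbot
  intro y
  have : y ∈ A.range := htop ▸ Submodule.mem_top
  exact this

/-- For bounded perturbations the variational problem is uniquely solvable. -/
theorem isUniquelySolvable_of_mem_boundedPerturbations (hm : m = 1 ∨ m = 2) (hR₀ : 0 < R₀)
    (hR : R₀ < R) (hk : 0 < k) (hn : IsLayerIndex R₀ np2) {q : L2Cell m R₀}
    (hq : q ∈ boundedPerturbations m R₀) : IsUniquelySolvable k R np2 q := by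
  obtain ⟨A, B, hA, -⟩ := exists_form_operator hm hR₀ hR hk hn
  obtain ⟨K, hK0, hK⟩ := exists_norm_le hm hR₀ hR hk hn hq
  rw [isUniquelySolvable_iff (hA q)]
  refine isUnit_of_bound_of_dense hK0 (fun u => hK u _ fun v => (hA q u v).symm) fun v hv => ?_
  exact eq_zero_of_form_eq_zero hm hR₀ hR hk hn hq fun u => by rw [← hA, hv]

end Solvability

end PerturbedLayer

end

theorem mainTheorem9 (m : ℕ) (hm : m = 1 ∨ m = 2) (k R₀ R : ℝ) (hk : 0 < k) (hR₀ : 0 < R₀)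
    (hR : R₀ < R) (np2 : PerturbedLayer.Pt m → ℂ) (hn : PerturbedLayer.IsLayerIndex R₀ np2) :
    (∃ δ : PerturbedLayer.L2Cell m R₀ → ℝ, PerturbedLayer.IsAdmissibleRadius k R np2 δ) ∧
    ∀ δ : PerturbedLayer.L2Cell m R₀ → ℝ, PerturbedLayer.IsAdmissibleRadius k R np2 δ →
      IsOpen (PerturbedLayer.parameterSet δ) ∧
      ∀ q ∈ PerturbedLayer.parameterSet δ,
        PerturbedLayer.IsSolutionOperator k np2 q (PerturbedLayer.solutionOperator k R np2 q) ∧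
        ∃ W : PerturbedLayer.L2Cell m R₀ →L[ℂ]
            PerturbedLayer.L2Cell m R₀ →L[ℂ] PerturbedLayer.HTilde m R,
          PerturbedLayer.IsLinearizedOperator k np2 q W ∧
          HasFDerivAt (fun p => PerturbedLayer.measurement k R np2 p)
            ((ContinuousLinearMap.compL ℂ (PerturbedLayer.L2Cell m R₀)
              (PerturbedLayer.HTilde m R) (PerturbedLayer.L2Cube m)
              (PerturbedLayer.traceCell m R)).comp W) q := by
  have hs := fun q hq =>
    PerturbedLayer.isUniquelySolvable_of_mem_boundedPerturbations hm hR₀ hR hk hn (q := q) hq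
  refine ⟨PerturbedLayer.exists_isAdmissibleRadius hm hR₀ hR hk hn hs, fun δ hδ =>
    ⟨PerturbedLayer.isOpen_parameterSet δ, fun q hq => ?_⟩⟩
  exact PerturbedLayer.hasFDerivAt_measurement hm hR₀ hR hk hn
    (PerturbedLayer.isOpen_parameterSet δ) hq fun p hp => hδ.isUniquelySolvable hp
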